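/- **Setting.** Let $n\ge 2$. A *perturbation scheme of class $C^{n+1}$* consists of: an open interval $I_0\ni 0$; $k$-dimensional $C^{n+2}$ manifolds $M_\varepsilon$ (Hausdorff, second countable) with Lorentzian metrics $\hat g_\varepsilon$ of class $C^{n+1}$ ($\varepsilon\in I_0$), with background $(M,g):=(M_0,\hat g_0)$; and a set of gauges $\{\psi_\varepsilon\}$, each gauge being a family of $C^{n+2}$ diffeomorphisms $\psi_\varepsilon:M\to M_\varepsilon$ with $\psi_0=\mathrm{id}$, such that $g_\varepsilon:=\psi_\varepsilon^*\hat g_\varepsilon$ is $C^2$ in $\varepsilon$ (at each point of $M$) and the perturbation tensors $$K_1:=\frac{d g_\varepsilon}{d\varepsilon}\Big|_{\varepsilon=0},\qquad K_2:=\frac{d^2 g_\varepsilon}{d\varepsilon^2}\Big|_{\varepsilon=0}$$ are of class $C^n$ and $C^{n-1}$ on $M$, respectively. Vector fields $\xi,\eta$ of class $C^{n+1}$ *generate a stationary and axisymmetric isometry group acting orthogonally transitively* on a $C^{n+1}$ Lorentzian manifold if they are commuting Killing vectors; $\xi$ is timelike everywhere; $\eta$ is the generator (with $2\pi$-periodic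 parameter) of an effective action of the circle by $C^{n+2}$ isometries with at least one fixed point; $\eta$ is spacelike off the axis $\mathcal A:=\{\eta=0\}$; and, except possibly on a set with empty interior, the orbits are two-dimensional and non-null and the spaces orthogonal to $\xi$ and $\eta$ form an integrable distribution (through each point passes an immersed integral manifold). The scheme *inherits* such a group if $\xi,\eta$ generate such a group on the background $(M,g)$, and for every $\varepsilon\in I_0$ and every gauge the push-forwards $d\psi_\varepsilon(\xi)$, $d\psi_\varepsilon(\eta)$ generate such a group on $(M_\varepsilon,\hat g_\varepsilon)$. For vector fields $V_1,V_2$ on $M$ (*first and second order gauge vectors*) the transformed perturbation tensors are $$K_1^g:=K_1+\mathcal L_{V_1}g,\qquad K_2^g:=K_2+\mathcal L_{V_2}g+2\mathcal L_{V_1}K_1^g-\mathcal L_{V_1}\mathcal L_{V_1}g .$$ **Proposition 4.2 (Block).** Let a perturbation scheme of class $C^{n+1}$ $(n\ge 2)$ inherit a stationary and axisymmetric isometry group, generated on the background by $\xi_1=\xi$ and $\xi_2=\eta$, that acts orthogonally transitively. Assume that $M$ is simply connected. Then for each gauge, with perturbation tensors $K_1,K_2$ as above, there exist gauge vectors $V_1$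 of class $C^{n+1}$ and $V_2$ of class $C^{n}$ on all of $M$ such that $K_1^g$ is of class $C^n$ and $K_2^g$ is of class $C^{n-1}$ on all of $M$, including the axis $\mathcal A$, and both are block diagonal: in every local coordinate system $\{x^i,x^c\}$ ($i=1,2$) of $M\setminus\mathcal A$, belonging to the $C^{n+2}$ atlas, in which $$g=\gamma_{ij}(x^c)\,dx^i dx^j+h_{cd}(x^c)\,dx^c dx^d,\qquad \xi_i=\partial_{x^i},$$ they take the form $$K_1^g=(K_1^g)_{ij}(x^c)\,dx^idx^j+(K_1^g)_{cd}(x^c)\,dx^cdx^d,\qquad K_2^g=(K_2^g)_{ij}(x^c)\,dx^idx^j+(K_2^g)_{cd}(x^c)\,dx^cdx^d .$$ (That components are functions of the $x^c$ only means, here and for $g$, that they are constant along each segment, contained in the coordinate domain, on which all $x^c$ are constant.) -/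

import Mathlib

open Set Bundle Manifold
open scoped Manifold ContDiff Topology

universe u

noncomputable section

/-- The model space `ℝᵏ`. -/
abbrev ModelSp (k : ℕ) : Type := EuclideanSpace ℝ (Fin k)

/-- Bilinear forms on the model space. -/
abbrev ModelForm (k : ℕ) : Type := ModelSp k →L[ℝ] ModelSp k →L[ℝ] ℝ

/-- Vector fields on a `k`-dimensional manifold, with no regularity imposed. -/
abbrev VecField (k : ℕ) (M : Type u) [TopologicalSpace M] [ChartedSpace (ModelSp k) M] : Type u :=
  ∀ p : M, TangentSpace (𝓡 k) p

/-- Two-covariant tensor fields on a `k`-dimensional manifold, with no regularity imposed. -/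
abbrev CovTensor (k : ℕ) (M : Type u) [TopologicalSpace M] [ChartedSpace (ModelSp k) M] :
    Type u :=
  ∀ p : M, TangentSpace (𝓡 k) p →L[ℝ] TangentSpace (𝓡 k) p →L[ℝ] ℝ

/-- The bilinear form `(u, v) ↦ B (L u) (L v)`. -/
def ModelForm.comp {k : ℕ} (B : ModelForm k) (L : ModelSp k →L[ℝ] ModelSp k) : ModelForm k :=
  B.bilinearComp L L

section OneManifold

variable {k : ℕ} {M : Type u} [TopologicalSpace M] [ChartedSpace (ModelSp k) M]

/-- The vector field `V` is of class `C^m` on all of `M`. -/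
def VecField.IsOfClass [IsManifold (𝓡 k) 1 M] (m : ℕ) (V : VecField k M) : Prop :=
  ContMDiff (𝓡 k) (𝓡 k).tangent (m : WithTop ℕ∞) (fun p => (⟨p, V p⟩ : TangentBundle (𝓡 k) M))

/-- The tensor field `T` is of class `C^m` on all of `M`, as a section of the bundle of bilinear
forms on the tangent spaces. -/
def CovTensor.IsOfClass [IsManifold (𝓡 k) 1 M] (m : ℕ) (T : CovTensor k M) : Prop :=
  ContMDiff (𝓡 k) ((𝓡 k).prod 𝓘(ℝ, ModelForm k)) (m : WithTop ℕ∞)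
    (fun p => (TotalSpace.mk' (ModelForm k) p (T p) :
      TotalSpace (ModelForm k)
        (fun p : M => TangentSpace (𝓡 k) p →L[ℝ] TangentSpace (𝓡 k) p →L[ℝ] ℝ)))

/-- The pullback `f^* T` of a two-covariant tensor field:
`(f^* T)_q(u, v) = T_{f q}(df u, df v)`. -/
def CovTensor.pullback {N : Type*} [TopologicalSpace N] [ChartedSpace (ModelSp k) N]
    (f : N → M) (T : CovTensor k M) : CovTensor k N := fun q =>
  ModelForm.comp (T (f q)) (mfderiv (𝓡 k) (𝓡 k) f q)

/-- The Lie derivative `L_V T` on `ℝᵏ`: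
`V^γ ∂_γ T_{αβ} + T_{γβ} ∂_α V^γ + T_{αγ} ∂_β V^γ`. -/
def lieDerivModel (V : ModelSp k → ModelSp k) (T : ModelSp k → ModelForm k) (x : ModelSp k) :
    ModelForm k :=
  fderiv ℝ T x (V x)
    + (T x).bilinearComp (fderiv ℝ V x) (ContinuousLinearMap.id ℝ (ModelSp k))
    + (T x).bilinearComp (ContinuousLinearMap.id ℝ (ModelSp k)) (fderiv ℝ V x)

/-- The Lie derivative `L_V T` of a two-covariant tensor field on a manifold, computed at `p` in the
chart at `p`. -/
def lieDeriv (V : VecField k M) (T : CovTensor k M) : CovTensor k M := fun p =>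
  ModelForm.comp
    (lieDerivModel
      (VectorField.mpullback (𝓡 k) (𝓡 k) (chartAt (ModelSp k) p).symm V)
      (CovTensor.pullback (chartAt (ModelSp k) p).symm T)
      (chartAt (ModelSp k) p p))
    (mfderiv (𝓡 k) (𝓡 k) (chartAt (ModelSp k) p) p)

/-- `g` is a Lorentzian metric: symmetric, and at each point of signature `(-, +, …, +)`. -/
def IsLorentzian (g : CovTensor k M) : Prop :=
  ∀ p : M, (∀ v w : TangentSpace (𝓡 k) p, g p v w = g p w v) ∧
    ∃ v : TangentSpace (𝓡 k) p, g p v v < 0 ∧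
      ∀ w : TangentSpace (𝓡 k) p, g p v w = 0 → w ≠ 0 → 0 < g p w w

/-- `ξ` is a Killing vector field of `g`. -/
def IsKilling (g : CovTensor k M) (ξ : VecField k M) : Prop :=
  ∀ p : M, lieDeriv ξ g p = 0

/-- The axis of an axial Killing vector: its zero set. -/
def axis (η : VecField k M) : Set M := {p | η p = 0}

/-- `(M, g)`, a manifold of class `C^{n+2}` with a metric, is axially symmetric with axial vector
`η`: an effective action of the circle by `C^{n+2}` isometries which has a fixed point and, in the
standard `2π`-periodic parametrization, is generated by `η`. -/
def IsAxial (n : ℕ) (g : CovTensor k M) (η : VecField k M) : Prop :=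
  ∃ θ : Circle →* Equiv.Perm M,
    Function.Injective θ ∧
    (∀ z : Circle, ContMDiff (𝓡 k) (𝓡 k) ((n + 2 : ℕ) : WithTop ℕ∞) (θ z)) ∧
    (∀ z : Circle, CovTensor.pullback (θ z) g = g) ∧
    (∀ p : M, IsMIntegralCurve (fun s : ℝ => θ (Circle.exp s) p) η) ∧
    (∃ p : M, ∀ z : Circle, θ z p = p)

/-- The subspaces orthogonal to `ξ` and `η` have an integral manifold through `p`: an immersed
submanifold through `p` (of any dimension `m`, the image of a neighbourhood of the origin of `ℝᵐ`)
whose tangent space at each of its points is the space orthogonal to `ξ` and `η` there. -/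
def HasOrthogonalLeafThrough (g : CovTensor k M) (ξ η : VecField k M) (p : M) : Prop :=
  ∃ (m : ℕ) (U : Set (ModelSp m)) (f : ModelSp m → M),
    IsOpen U ∧ (0 : ModelSp m) ∈ U ∧ f 0 = p ∧ ContMDiffOn (𝓡 m) (𝓡 k) 2 f U ∧
    ∀ x ∈ U, Function.Injective (mfderiv (𝓡 m) (𝓡 k) f x) ∧
      ∀ v : TangentSpace (𝓡 k) (f x),
        (v ∈ Set.range (mfderiv (𝓡 m) (𝓡 k) f x) ↔
          g (f x) (ξ (f x)) v = 0 ∧ g (f x) (η (f x)) v = 0)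

/-- The (local) action generated by `ξ` and `η` is orthogonally transitive: except possibly on a set
with empty interior, its orbits are two-dimensional and non-null, and the spaces orthogonal to them
form an integrable distribution. -/
def IsOrthogonallyTransitive (g : CovTensor k M) (ξ η : VecField k M) : Prop :=
  ∃ N : Set M, interior N = ∅ ∧ ∀ p ∉ N,
    LinearIndependent ℝ ![ξ p, η p] ∧
    g p (ξ p) (ξ p) * g p (η p) (η p) - g p (ξ p) (η p) ^ 2 ≠ 0 ∧
    HasOrthogonalLeafThrough g ξ η p

/-- `ξ` and `η` generate an Abelian stationary and axisymmetric isometry group of `g` that acts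
orthogonally transitively. The Killing vectors, like the metric, are of class `C^{n+1}`. -/
structure IsStationaryAxisymmetricOT [IsManifold (𝓡 k) 1 M] (n : ℕ) (g : CovTensor k M)
    (ξ η : VecField k M) : Prop where
  class_xi : ξ.IsOfClass (n + 1)
  class_eta : η.IsOfClass (n + 1)
  killing_xi : IsKilling g ξ
  killing_eta : IsKilling g η
  commute : ∀ p : M, VectorField.mlieBracket (𝓡 k) ξ η p = 0
  timelike : ∀ p : M, g p (ξ p) (ξ p) < 0
  axial : IsAxial n g η
  spacelike : ∀ p ∉ axis η, 0 < g p (η p) (η p)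
  orthogonallyTransitive : IsOrthogonallyTransitive g ξ η

/-- The component `T_{αβ}` of `T` in the chart `e`, as a function of the coordinates. -/
def component (e : OpenPartialHomeomorph M (ModelSp k)) (T : CovTensor k M) (α β : Fin k)
    (x : ModelSp k) : ℝ :=
  T (e.symm x) (mfderiv (𝓡 k) (𝓡 k) e.symm x (EuclideanSpace.single α (1 : ℝ)))
    (mfderiv (𝓡 k) (𝓡 k) e.symm x (EuclideanSpace.single β (1 : ℝ)))

/-- In the chart `e`, whose coordinates are split into the two coordinates with indices `a`, `b` and
the remaining ones `x^c`, the tensor `T` takes the form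
`T_{ij}(x^c) dx^i dx^j + T_{cd}(x^c) dx^c dx^d` with `i, j ∈ {a, b}` and `c, d ∉ {a, b}`.
Being a function of the `x^c` is understood along segments contained in the coordinate domain (so,
on all of the domain when it is convex). -/
structure HasBlockForm (e : OpenPartialHomeomorph M (ModelSp k)) (a b : Fin k)
    (T : CovTensor k M) : Prop where
  cross : ∀ x ∈ e.target, ∀ i c : Fin k, (i = a ∨ i = b) → c ≠ a → c ≠ b →
    component e T i c x = 0 ∧ component e T c i x = 0
  transversal : ∀ x y : ModelSp k, segment ℝ x y ⊆ e.target →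
    (∀ c : Fin k, c ≠ a → c ≠ b → x c = y c) →
    ∀ α β : Fin k, component e T α β x = component e T α β y

/-- The chart `e` of the `C^{n+2}` manifold `M` is a local coordinate system off the axis of `η`
that is adapted to `ξ`, `η` and to the orthogonal transitivity of `g`:
`ξ = ∂_{x^a}`, `η = ∂_{x^b}` and `g` has block form. -/
structure IsAdaptedChart (n : ℕ) (g : CovTensor k M) (ξ η : VecField k M)
    (e : OpenPartialHomeomorph M (ModelSp k)) (a b : Fin k) : Prop where
  mem_atlas : e ∈ IsManifold.maximalAtlas (𝓡 k) ((n + 2 : ℕ) : WithTop ℕ∞) M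
  off_axis : e.source ⊆ (axis η)ᶜ
  ne : a ≠ b
  xi_eq : ∀ x ∈ e.target,
    ξ (e.symm x) = mfderiv (𝓡 k) (𝓡 k) e.symm x (EuclideanSpace.single a (1 : ℝ))
  eta_eq : ∀ x ∈ e.target,
    η (e.symm x) = mfderiv (𝓡 k) (𝓡 k) e.symm x (EuclideanSpace.single b (1 : ℝ))
  metric_block : HasBlockForm e a b g

/-- The `j`-th derivative at `ε = 0` of a family of tensor fields. The derivative is taken at a fixed
point, in the space of bilinear forms on the tangent space there. -/
def epsDeriv (j : ℕ) (G : ℝ → CovTensor k M) : CovTensor k M := fun p =>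
  iteratedDeriv (F := ModelForm k) j (fun ε => G ε p) 0

/-- The first order perturbation tensor after the gauge transformation with first order gauge vector
`V₁`. -/
def gaugeFirst (g K₁ : CovTensor k M) (V₁ : VecField k M) : CovTensor k M := fun p =>
  K₁ p + lieDeriv V₁ g p

/-- The second order perturbation tensor after the gauge transformation with gauge vectors
`V₁`, `V₂`. -/
def gaugeSecond (g K₁ K₂ : CovTensor k M) (V₁ V₂ : VecField k M) : CovTensor k M := fun p =>
  K₂ p + lieDeriv V₂ g p + (2 : ℝ) • lieDeriv V₁ (gaugeFirst g K₁ V₁) p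
    - lieDeriv V₁ (lieDeriv V₁ g) p

end OneManifold

/-- A perturbation scheme of class `C^{n+1}` on the family of `C^{n+2}` manifolds `M ε`, with
background manifold `M 0`: Lorentzian metrics of class `C^{n+1}` for `ε` in an open interval `I₀`
around `0`, and a set of gauges, each of them consisting of `C^{n+2}` diffeomorphisms
`ψ ε : M 0 → M ε` with `ψ 0` the identity, such that `g_ε = (ψ ε)^* (metric ε)` is `C^2` in `ε` and
the first and second order perturbation tensors are of class `C^n` and `C^{n-1}`.
Nothing is asked for `ε` outside `I₀`, where `M ε` and `ψ ε` only serve as default values. -/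
structure PerturbationScheme (k n : ℕ) (M : ℝ → Type u) [∀ ε, TopologicalSpace (M ε)]
    [∀ ε, ChartedSpace (ModelSp k) (M ε)] [∀ ε, IsManifold (𝓡 k) 1 (M ε)] where
  I₀ : Set ℝ
  isOpen_I₀ : IsOpen I₀
  ordConnected_I₀ : I₀.OrdConnected
  zero_mem_I₀ : (0 : ℝ) ∈ I₀
  metric : ∀ ε, CovTensor k (M ε)
  lorentzian : ∀ ε ∈ I₀, IsLorentzian (metric ε)
  class_metric : ∀ ε ∈ I₀, (metric ε).IsOfClass (n + 1)
  gauges : Set (∀ ε, Diffeomorph (𝓡 k) (𝓡 k) (M 0) (M ε) ((n + 2 : ℕ) : WithTop ℕ∞))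
  gauge_zero : ∀ ψ ∈ gauges, ∀ p : M 0, ψ 0 p = p
  contDiff_eps : ∀ ψ ∈ gauges, ∀ p : M 0,
    ContDiffOn ℝ 2 (F := ModelForm k) (fun ε => CovTensor.pullback (ψ ε) (metric ε) p) I₀
  class_first : ∀ ψ ∈ gauges,
    (epsDeriv 1 (fun ε => CovTensor.pullback (ψ ε) (metric ε))).IsOfClass n
  class_second : ∀ ψ ∈ gauges,
    (epsDeriv 2 (fun ε => CovTensor.pullback (ψ ε) (metric ε))).IsOfClass (n - 1)

section Scheme

variable {k n : ℕ} {M : ℝ → Type u} [∀ ε, TopologicalSpace (M ε)]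
  [∀ ε, ChartedSpace (ModelSp k) (M ε)] [∀ ε, IsManifold (𝓡 k) 1 (M ε)]

/-- The metrics `g_ε = (ψ ε)^* (metric ε)` on the background manifold, in the gauge `ψ`. -/
def PerturbationScheme.pulledMetric (S : PerturbationScheme k n M)
    (ψ : ∀ ε, Diffeomorph (𝓡 k) (𝓡 k) (M 0) (M ε) ((n + 2 : ℕ) : WithTop ℕ∞)) :
    ℝ → CovTensor k (M 0) := fun ε => CovTensor.pullback (ψ ε) (S.metric ε)

/-- The scheme inherits the stationary and axisymmetric, orthogonally transitive isometry group
generated on the background by `ξ` and `η`: for all `ε` and all gauges, the push-forwards of `ξ` and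
`η` generate such a group on `(M ε, metric ε)`. (The push-forward by `ψ ε` is the pullback by its
inverse.) -/
def PerturbationScheme.InheritsStationaryAxisymmetricOT (S : PerturbationScheme k n M)
    (ξ η : VecField k (M 0)) : Prop :=
  IsStationaryAxisymmetricOT n (S.metric 0) ξ η ∧
  ∀ ψ ∈ S.gauges, ∀ ε ∈ S.I₀,
    IsStationaryAxisymmetricOT n (S.metric ε)
      (VectorField.mpullback (𝓡 k) (𝓡 k) (ψ ε).symm ξ)
      (VectorField.mpullback (𝓡 k) (𝓡 k) (ψ ε).symm η)

end Scheme

end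

/-! For each metric of the family, let σ¹, σ² (`coFst`, `coSnd`) be the covectors dual to ξ, η that
vanish on the orthogonal complement of the orbits; in adapted coordinates they are the differentials
of the two orbit coordinates. Off the axis they are closed (`fderiv_coframe_symm`): invariance under
the commuting Killing vectors handles the orbit directions, and integrability of the complement
handles the others. Since ξ and η do not depend on ε, the ε-derivatives of σ at 0 are limits of
closed forms. `deriv_coframe` computes them: the first is the shift of K₁, which encodes the
off-diagonal part of K₁, and the second is the shift of K₂ with a quadratic correction. The
ε-regularity holds only pointwise on the manifold, so closedness passes to the limit by a Baire
argument (`fderiv_symm_of_tendsto`), and invariance under ξ, η by Gronwall's inequality along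
integral curves (`fderiv_apply_eq_of_tendsto`).

Choose local functions S₁, S₂ whose differentials are minus the shifts of a symmetric source k, and
put X = S₁ ξ + S₂ η (`IsGaugeAt`). Let R be the reflection equal to -1 on the orbits and +1 on their
complement. Then L_X g = ½ (R^*k - k) (`lieForm_gauge_metric`), so k + L_X g = ½ (k + R^*k) has no
cross components. The first order takes k = K₁. The second order takes the part of the transformed
K₂ that does not involve V₂; its shift is exactly the second ε-derivative of σ (`second_source`),
hence closed again.

The difficulty is the axis, where R is singular and the primitives may be multivalued. (1) R^*k
extends across the axis with the regularity of k (`exists_contDiffOn_extension`). Since ∇(R^*k) =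
R^*(∇k), induction on the order reduces this to continuity; there, limits of R along different
directions differ by a rotation, which an invariant tensor does not see (`IsAxisDir.pull_eq`). (2)
Once L_X g is known, the second derivative of X is an affine function of its 1-jet
(`fderiv_fderiv_eq`). By Gronwall the 1-jet is Lipschitz near the axis, hence extends to it. (3) The
period of the primitives around the axis is a combination a ξ + b η whose 1-jet vanishes at an axis
point. There ξ ≠ 0, η = 0 and Dη ≠ 0, so a = b = 0 (`orbitJet_injective`,
`exists_primitive_off_codim_two`). The second order system then gives the full regularity of X.

Globally, two gauge fields for the same source differ locally by a constant combination of ξ and η,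
because Killing fields are determined by their germs (`exists_gauge_sub_eq`). The differences form a
locally constant cocycle with values in ℝ², which is a coboundary on a simply connected manifold
(`exists_locally_constant_coboundary`). The block form then follows from the absence of cross
components together with invariance under ξ and η. -/

section

open Filter MeasureTheory
open scoped Interval

set_option maxSynthPendingDepth 3
set_option synthInstance.maxHeartbeats 400000
set_option maxHeartbeats 800000

/-! ### Locally constant cocycles and covering spaces. -/

/-- Locally constant cocycles on a simply connected space are coboundaries. -/
theorem exists_locally_constant_coboundary {X ι : Type*} {A : Type*} [TopologicalSpace X]
    [SimplyConnectedSpace X] [LocallyPathConnectedSpace X] [AddCommGroup A] (U : ι → Set X)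
    (hU : ∀ i, IsOpen (U i)) (cover : ∀ x, ∃ i, x ∈ U i) (a : ι → ι → X → A)
    (cocycle : ∀ i j l x, x ∈ U i → x ∈ U j → x ∈ U l → a i j x + a j l x = a i l x)
    (locconst : ∀ i j x, x ∈ U i → x ∈ U j → ∀ᶠ y in 𝓝 x, a i j y = a i j x) :
    ∃ s : ι → X → A, (∀ i x, x ∈ U i → ∀ᶠ y in 𝓝 x, s i y = s i x) ∧
      ∀ i j x, x ∈ U i → x ∈ U j → s j x = s i x + a i j x := by
  classical
  -- With discrete fibres, translation by a locally constant function is a continuous transition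
  -- map, and the glued bundle is a covering.
  let _ : TopologicalSpace A := ⊥
  have : DiscreteTopology A := ⟨rfl⟩
  choose ix hix using cover
  have aself : ∀ i x, x ∈ U i → a i i x = 0 := fun i x hx => by
    simpa using cocycle i i i x hx hx hx
  let Z : FiberBundleCore ι X A :=
    { baseSet := U
      isOpen_baseSet := hU
      indexAt := ix
      mem_baseSet_at := hix
      coordChange := fun i j x v => v + a i j x
      coordChange_self := fun i x hx v => by simp [aself i x hx]
      continuousOn_coordChange := by
        intro i j
        rintro ⟨x, v⟩ ⟨⟨hxi, hxj⟩, -⟩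
        refine ContinuousAt.continuousWithinAt ?_
        refine continuousAt_const (y := v + a i j x) |>.congr ?_
        have h1 : ∀ᶠ p : X × A in 𝓝 (x, v), a i j p.1 = a i j x :=
          ((continuous_fst.tendsto (x, v)).eventually (p := fun y => a i j y = a i j x)
            (locconst i j x hxi hxj))
        have h2 : ∀ᶠ p : X × A in 𝓝 (x, v), p.2 = v :=
          continuous_snd.continuousAt.eventually (p := fun w => w = v)
            (by simp [nhds_discrete])
        filter_upwards [h1, h2] with p h1 h2
        rw [h1, h2]
      coordChange_comp := fun i j l x hx v => by
        rw [add_assoc, cocycle i j l x hx.1.1 hx.1.2 hx.2] }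
  have cov : IsCoveringMap Z.proj := IsCoveringMap.mk _ (fun _ => A) (fun x => Z.localTriv (ix x))
    (fun x => hix x)
  obtain ⟨x₀⟩ : Nonempty X := inferInstance
  -- The identity of the simply connected base lifts to a global section of the covering. Its
  -- coordinate in the i-th trivialization is the cochain `s i`; changing trivialization adds the
  -- cocycle.
  obtain ⟨σ, ⟨-, hσ⟩, -⟩ := cov.existsUnique_continuousMap_lifts (ContinuousMap.id X) x₀
    (⟨x₀, (0 : A)⟩ : Z.TotalSpace) rfl
  have hσ' : ∀ x, (σ x).1 = x := fun x => congrFun hσ x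
  refine ⟨fun i x => (Z.localTriv i (σ x)).2, ?_, ?_⟩
  · intro i x hx
    have hc : ContinuousAt (fun y => (Z.localTriv i (σ y)).2) x := by
      have h1 : ContinuousAt (Z.localTriv i) (σ x) := by
        refine (Z.localTriv i).continuousAt ?_
        rw [Z.mem_localTriv_source, ← Z.baseSet_at, hσ']; exact hx
      exact continuous_snd.continuousAt.comp (h1.comp σ.continuous.continuousAt)
    exact hc.eventually (p := fun w => w = (Z.localTriv i (σ x)).2) (by simp [nhds_discrete])
  · intro i j x hxi hxj
    simp only [FiberBundleCore.localTriv_apply]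
    have key : ∀ (w : A) (y : X), y = x →
        w + a (ix y) j y = w + a (ix y) i y + a i j x := by
      rintro w y rfl
      rw [add_assoc, cocycle _ i j y (hix y) hxi hxj]
    exact key (σ x).2 (σ x).1 (hσ' x)

/-! ### Removability of a hyperplane for continuously differentiable functions. -/

section Removable

variable {E F : Type*} [NormedAddCommGroup E] [NormedSpace ℝ E] [NormedAddCommGroup F]
  [NormedSpace ℝ F]

/-- A continuous function that is differentiable off a hyperplane, with a derivative that extends
continuously, is differentiable. -/
theorem hasFDerivAt_of_off_hyperplane {U : Set E} (hU : IsOpen U) (l : E →L[ℝ] ℝ)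
    (hl : l ≠ 0) {f : E → F}
    {g : E → E →L[ℝ] F} (hf : ContinuousOn f U) (hg : ContinuousOn g U)
    (hfg : ∀ x ∈ U, l x ≠ 0 → HasFDerivAt f (g x) x) {x : E} (hx : x ∈ U) :
    HasFDerivAt f (g x) x := by
  by_cases hlx : l x = 0
  swap
  · exact hfg x hx hlx
  rw [hasFDerivAt_iff_isLittleO_nhds_zero, Asymptotics.isLittleO_iff]
  intro c hc
  have h1 : ∀ᶠ y in 𝓝 x, y ∈ U ∧ ‖g y - g x‖ < c := by
    refine (hU.eventually_mem hx).and ?_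
    have := tendsto_iff_norm_sub_tendsto_zero.1 (hg.continuousAt (hU.mem_nhds hx)).tendsto
    have h2 := this.eventually (p := fun t => t < c) (Iio_mem_nhds hc)
    exact h2
  obtain ⟨r, hr, hball⟩ := Metric.eventually_nhds_iff_ball.1 h1
  obtain ⟨v, hv⟩ : ∃ v, 0 < l v := by
    obtain ⟨v, hv⟩ : ∃ v, l v ≠ 0 := by
      by_contra! h
      exact hl (ContinuousLinearMap.ext h)
    rcases lt_or_gt_of_ne hv with h | h
    · exact ⟨-v, by simpa using h⟩
    · exact ⟨v, h⟩
  -- The sign `s` selects a side of the hyperplane. The mean value inequality for `f - g x` holds on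
  -- the open half ball, which is convex and avoids the hyperplane, and extends to the closed half
  -- by continuity; `x` itself lies on the boundary.
  have key : ∀ s : ℝ, (s = 1 ∨ s = -1) → ∀ y ∈ Metric.ball x r, 0 ≤ s * l y →
      ‖f y - f x - g x (y - x)‖ ≤ c * ‖y - x‖ := by
    intro s hs y hy hsy
    have hss : s * s = 1 := by rcases hs with rfl | rfl <;> norm_num
    set C : Set E := Metric.ball x r ∩ {z | 0 < s * l z} with hC
    have hCconv : Convex ℝ C := by
      refine (convex_ball x r).inter ?_
      have : {z | 0 < s * l z} = (s • l) ⁻¹' (Ioi 0) := by ext z; simp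
      rw [this]
      exact (convex_Ioi 0).is_linear_preimage (s • l).toLinearMap.isLinear
    have hlip : ∀ a ∈ C, ∀ b ∈ C, ‖(f b - g x b) - (f a - g x a)‖ ≤ c * ‖b - a‖ := by
      intro a ha b hb
      refine hCconv.norm_image_sub_le_of_norm_hasFDerivWithin_le
        (f := fun z => f z - g x z) (f' := fun z => g z - g x) (fun z hz => ?_) (fun z hz => ?_)
        ha hb
      · have hz0 : l z ≠ 0 := by
          intro h0
          have := hz.2
          simp [h0] at this
        exact ((hfg z (hball z hz.1).1 hz0).sub (g x).hasFDerivAt).hasFDerivWithinAt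
      · exact (hball z hz.1).2.le
    -- Points of the closed half ball are pushed into the open one by small multiples of the
    -- transversal vector `v`.
    have happ : ∀ z ∈ Metric.ball x r, 0 ≤ s * l z → ∀ᶠ t in 𝓝[>] (0 : ℝ), z + (t * s) • v ∈ C := by
      intro z hz hzl
      have h1 : ∀ᶠ t in 𝓝[>] (0 : ℝ), z + (t * s) • v ∈ Metric.ball x r := by
        refine nhdsWithin_le_nhds ?_
        have hcont : ContinuousAt (fun t : ℝ => z + (t * s) • v) 0 := by fun_prop
        refine hcont.eventually (p := fun w => w ∈ Metric.ball x r) ?_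
        simp only [zero_mul, zero_smul, add_zero]
        exact Metric.isOpen_ball.mem_nhds hz
      filter_upwards [h1, self_mem_nhdsWithin] with t h1 ht
      refine ⟨h1, ?_⟩
      have ht : 0 < t := ht
      simp only [mem_ofPred_eq, map_add, map_smul, smul_eq_mul]
      have : s * (l z + t * s * l v) = s * l z + t * l v * (s * s) := by ring
      rw [this, hss]
      have := mul_pos ht hv
      linarith
    have hlim : ∀ z ∈ Metric.ball x r, Tendsto (fun t : ℝ => f (z + (t * s) • v) -
        g x (z + (t * s) • v)) (𝓝[>] 0) (𝓝 (f z - g x z)) := by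
      intro z hz
      have hcf : ContinuousAt f z := hf.continuousAt (hU.mem_nhds (hball z hz).1)
      have hcont : ContinuousAt (fun t : ℝ => z + (t * s) • v) 0 := by fun_prop
      have h0 : (fun t : ℝ => z + (t * s) • v) 0 = z := by simp
      have h1 : ContinuousAt (fun w => f w - g x w) z := hcf.sub (g x).continuous.continuousAt
      have h2 := ContinuousAt.comp_of_eq h1 hcont h0
      have h3 := h2.tendsto
      simp only [Function.comp_def, zero_mul, zero_smul, add_zero] at h3
      exact h3.mono_left nhdsWithin_le_nhds
    have hxb : x ∈ Metric.ball x r := Metric.mem_ball_self hr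
    have hx0 : 0 ≤ s * l x := by simp [hlx]
    have hfin := le_of_tendsto ((hlim y hy).sub (hlim x hxb)).norm
      (b := c * ‖y - x‖) (by
        filter_upwards [happ y hy hsy, happ x hxb hx0] with t h1 h2
        have := hlip _ h2 _ h1
        simpa using this)
    calc ‖f y - f x - g x (y - x)‖ = ‖f y - g x y - (f x - g x x)‖ := by
          congr 1; rw [map_sub]; abel
      _ ≤ _ := hfin
  rw [Metric.eventually_nhds_iff_ball]
  refine ⟨r, hr, fun h hh => ?_⟩
  have hy : x + h ∈ Metric.ball x r := by simpa using hh
  rcases le_total 0 (l (x + h)) with h0 | h0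
  · simpa using key 1 (Or.inl rfl) (x + h) hy (by simpa using h0)
  · simpa using key (-1) (Or.inr rfl) (x + h) hy (by linarith)

end Removable

/-! ### Pointwise limits of closed one-forms. -/

section Closed

variable {E : Type*} [NormedAddCommGroup E] [NormedSpace ℝ E] [CompleteSpace E]

/-- A `C^1` one-form that is a pointwise limit of closed one-forms is closed. -/
theorem fderiv_symm_of_tendsto {U : Set E} (hU : IsOpen U) {h : ℕ → E → E →L[ℝ] ℝ}
    {W : E → E →L[ℝ] ℝ} (hd : ∀ N, DifferentiableOn ℝ (h N) U)
    (hs : ∀ N, ∀ x ∈ U, ∀ X Y, fderiv ℝ (h N) x X Y = fderiv ℝ (h N) x Y X)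
    (hlim : ∀ x ∈ U, Tendsto (fun N => h N x) atTop (𝓝 (W x)))
    (hW : ContDiffOn ℝ 1 W U) {x : E} (hx : x ∈ U) (X Y : E) :
    fderiv ℝ W x X Y = fderiv ℝ W x Y X := by
  have hWc : ContinuousOn (fderiv ℝ W) U := hW.continuousOn_fderiv_of_isOpen hU le_rfl
  have hWd : DifferentiableOn ℝ W U := hW.differentiableOn one_ne_zero
  -- points near which the sequence is bounded
  have step : ∀ y ∈ U, ∀ r > 0, Metric.ball y r ⊆ U → (∃ m : ℕ, ∀ N, ∀ z ∈ Metric.ball y r,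
      ‖h N z‖ ≤ m) → ∀ X Y, fderiv ℝ W y X Y = fderiv ℝ W y Y X := by
    rintro y hy r hr hball ⟨m, hm⟩ X Y
    -- The uniform bound on the ball allows dominated convergence of the integrals along segments.
    have hseg : ∀ a ∈ Metric.ball y r, ∀ b ∈ Metric.ball y r,
        Tendsto (fun N => ∫ᶜ z in Path.segment a b, h N z) atTop
          (𝓝 (∫ᶜ z in Path.segment a b, W z)) := by
      intro a ha b hb
      simp only [curveIntegral_segment]
      have hmem : ∀ t ∈ Icc (0 : ℝ) 1, AffineMap.lineMap a b t ∈ Metric.ball y r := fun t ht =>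
        (convex_ball y r).lineMap_mem ha hb ht
      have hI : Ι (0 : ℝ) 1 ⊆ Icc 0 1 := by
        rw [uIoc_of_le zero_le_one]; exact Ioc_subset_Icc_self
      refine intervalIntegral.tendsto_integral_filter_of_dominated_convergence
        (fun _ => m * ‖b - a‖) ?_ ?_ ?_ ?_
      · refine Eventually.of_forall fun N => ?_
        refine ContinuousOn.aestronglyMeasurable ?_ measurableSet_uIoc
        have : ContinuousOn (fun t : ℝ => h N (AffineMap.lineMap a b t)) (Icc 0 1) :=
          (hd N).continuousOn.comp (by fun_prop) (fun t ht => hball (hmem t ht))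
        exact (this.mono hI).clm_apply continuousOn_const
      · refine Eventually.of_forall fun N => Eventually.of_forall fun t ht => ?_
        exact (ContinuousLinearMap.le_opNorm _ _).trans
          (mul_le_mul_of_nonneg_right (hm N _ (hmem t (hI ht))) (norm_nonneg _))
      · exact intervalIntegrable_const
      · refine Eventually.of_forall fun t ht => ?_
        exact ((ContinuousLinearMap.apply ℝ ℝ (b - a)).continuous.tendsto _).comp
          (hlim _ (hball (hmem t (hI ht))))
    -- The integral of a closed form over a triangle vanishes. This property survives the pointwise
    -- limit, whereas the derivatives of the forms need not converge.
    have hcoc : ∀ a ∈ Metric.ball y r, ∀ b ∈ Metric.ball y r, ∀ c ∈ Metric.ball y r,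
        (∫ᶜ z in Path.segment a b, W z) + (∫ᶜ z in Path.segment b c, W z) =
          ∫ᶜ z in Path.segment a c, W z := by
      intro a ha b hb c hc
      refine tendsto_nhds_unique ((hseg a ha b hb).add (hseg b hb c hc)) ?_
      refine (hseg a ha c hc).congr fun N => ?_
      refine ((convex_ball y r).curveIntegral_segment_add_eq_of_hasFDerivWithinAt_symmetric
        (dω := fderiv ℝ (h N)) (fun z hz => ?_) (fun z hz X _ Y _ => ?_) ha hb hc).symm
      · exact ((hd N).differentiableAt (hU.mem_nhds (hball hz))).hasFDerivAt.hasFDerivWithinAt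
      · exact hs N z (hball hz) X Y
    have hyb : y ∈ Metric.ball y r := Metric.mem_ball_self hr
    -- Hence integration from the centre is a primitive of `W`, and the derivative of `W` is a
    -- second derivative.
    have hF : ∀ b ∈ Metric.ball y r,
        HasFDerivAt (fun b => ∫ᶜ z in Path.segment y b, W z) (W b) b := by
      intro b hb
      suffices HasFDerivWithinAt (fun c => ∫ᶜ x in .segment y b, W x + ∫ᶜ x in .segment b c, W x)
          (W b) (Metric.ball y r) b from
        (this.congr' (fun c hc => (hcoc y hyb b hb c hc).symm) hb).hasFDerivAt
          (Metric.isOpen_ball.mem_nhds hb)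
      refine .const_add _ <| ?_
      exact HasFDerivWithinAt.curveIntegral_segment_source (convex_ball y r)
        (hWd.continuousOn.mono hball) hb
    refine second_derivative_symmetric_of_eventually (𝕜 := ℝ)
      (f := fun b => ∫ᶜ z in Path.segment y b, W z) (f' := W) (x := y)
      ?_ (hWd.differentiableAt (hU.mem_nhds hy)).hasFDerivAt X Y
    filter_upwards [Metric.isOpen_ball.mem_nhds hyb] with b hb using hF b hb
  -- the set of such points is dense
  have hdense : ∀ V ⊆ U, IsOpen V → V.Nonempty → ∃ y ∈ V, ∃ r > 0, Metric.ball y r ⊆ U ∧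
      ∃ m : ℕ, ∀ N, ∀ z ∈ Metric.ball y r, ‖h N z‖ ≤ m := by
    intro V hVU hV hVne
    have : BaireSpace V := hV.baireSpace
    have : Nonempty V := hVne.to_subtype
    -- Convergent sequences are bounded, so the closed sets on which all `h N` are bounded by `m`
    -- cover `V`; by Baire's theorem one of them has interior.
    obtain ⟨m, hm⟩ := nonempty_interior_of_iUnion_of_closed
      (f := fun m : ℕ => {z : V | ∀ N, ‖h N z‖ ≤ m}) (fun m => by
        simp only [ofPred_forall]
        refine isClosed_iInter fun N => ?_
        refine isClosed_le ?_ continuous_const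
        exact (((hd N).continuousOn.mono hVU).domRestrict).norm) (by
        refine eq_univ_of_forall fun z => ?_
        obtain ⟨C, hC⟩ := (hlim z (hVU z.2)).norm.bddAbove_range
        obtain ⟨m, hm⟩ := exists_nat_ge C
        exact mem_iUnion.2 ⟨m, fun N => (hC (mem_range_self N)).trans hm⟩)
    obtain ⟨z, hz⟩ := hm
    have h1 : (Subtype.val '' interior {z : V | ∀ N, ‖h N z‖ ≤ (m : ℝ)}) ∈ 𝓝 (z : E) :=
      (hV.isOpenMap_subtype_val _ isOpen_interior).mem_nhds ⟨z, hz, rfl⟩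
    obtain ⟨r, hr, hsub⟩ := Metric.mem_nhds_iff.1 (Filter.inter_mem h1 (hV.mem_nhds z.2))
    refine ⟨z, z.2, r, hr, fun w hw => hVU (hsub hw).2, m, fun N w hw => ?_⟩
    obtain ⟨w', hw', rfl⟩ := (hsub hw).1
    exact interior_subset hw' N
  -- conclusion by continuity
  by_contra hne
  have hcont : ContinuousOn (fun y => fderiv ℝ W y X Y - fderiv ℝ W y Y X) U :=
    ((hWc.clm_apply continuousOn_const).clm_apply continuousOn_const).sub
      ((hWc.clm_apply continuousOn_const).clm_apply continuousOn_const)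
  have hVo : IsOpen (U ∩ (fun y => fderiv ℝ W y X Y - fderiv ℝ W y Y X) ⁻¹' {0}ᶜ) :=
    hcont.isOpen_inter_preimage hU isOpen_compl_singleton
  obtain ⟨y, hy, r, hr, hb, hm⟩ := hdense _ inter_subset_left hVo
    ⟨x, hx, by simpa [sub_eq_zero] using hne⟩
  exact hy.2 (by simpa [sub_eq_zero] using step y hy.1 r hr hb hm X Y)

end Closed

/-! ### Pointwise limits of solutions of a transport equation. -/

section LimitODE

variable {E F : Type*} [NormedAddCommGroup E] [NormedSpace ℝ E] [CompleteSpace E]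
  [NormedAddCommGroup F] [NormedSpace ℝ F] [CompleteSpace F]

/-- A linear first order equation along a vector field passes to pointwise limits. -/
theorem fderiv_apply_eq_of_tendsto {U : Set E} (hU : IsOpen U) {ξ : E → E}
    (hξ : ContDiffOn ℝ 1 ξ U) {B : E → F →L[ℝ] F} (hB : ContinuousOn B U) {T : ℕ → E → F}
    (hT : ∀ N, ContDiffOn ℝ 1 (T N) U)
    (heq : ∀ N, ∀ x ∈ U, fderiv ℝ (T N) x (ξ x) = B x (T N x)) {T' : E → F}
    (hlim : ∀ x ∈ U, Tendsto (fun N => T N x) atTop (𝓝 (T' x)))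
    (hT' : ContDiffOn ℝ 1 T' U) {x : E} (hx : x ∈ U) :
    fderiv ℝ T' x (ξ x) = B x (T' x) := by
  have hdiff : ∀ {S : E → F}, ContDiffOn ℝ 1 S U → ∀ y ∈ U, HasFDerivAt S (fderiv ℝ S y) y :=
    fun hS y hy => ((hS.differentiableOn one_ne_zero).differentiableAt (hU.mem_nhds hy)).hasFDerivAt
  -- Along an integral curve `c` of `ξ` through `x` the equation becomes a linear ordinary
  -- differential equation.
  obtain ⟨c, hc0, ε, hε, hc⟩ :=
    (hξ.contDiffAt (hU.mem_nhds hx)).exists_forall_mem_closedBall_exists_eq_forall_mem_Ioo_hasDerivAt₀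
      0
  simp only [zero_sub, zero_add] at hc
  have hc_at : ContinuousAt c 0 := (hc 0 ⟨by linarith, hε⟩).continuousAt
  have h1 : ∀ᶠ t in 𝓝 (0 : ℝ), c t ∈ U ∧ ‖B (c t)‖ < ‖B x‖ + 1 := by
    have h2 : ContinuousAt (fun y => ‖B y‖) (c 0) := by
      rw [hc0]; exact (hB.continuousAt (hU.mem_nhds hx)).norm
    refine (hc_at.eventually (p := fun y => y ∈ U) (by rw [hc0]; exact hU.mem_nhds hx)).and ?_
    refine (ContinuousAt.comp (f := c) (x := (0 : ℝ)) h2 hc_at).eventually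
      (p := fun t => t < ‖B x‖ + 1) ?_
    simp only [Function.comp, hc0]
    exact Iio_mem_nhds (by linarith)
  obtain ⟨r, hr, hball⟩ := Metric.eventually_nhds_iff.1 h1
  set δ := min ε r / 2 with hδ
  have hδ0 : 0 < δ := by positivity
  have hδε : δ < ε := by
    have := min_le_left ε r
    have : 0 < min ε r := by positivity
    linarith
  have hδr : δ < r := by
    have := min_le_right ε r
    have : 0 < min ε r := by positivity
    linarith
  have hcU : ∀ t ∈ Icc (-δ) δ, c t ∈ U ∧ ‖B (c t)‖ ≤ ‖B x‖ + 1 := fun t ht => by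
    have := hball (y := t) (by rw [Real.dist_0_eq_abs, abs_lt]; constructor <;> linarith [ht.1, ht.2])
    exact ⟨this.1, this.2.le⟩
  have hcd : ∀ t ∈ Icc (-δ) δ, HasDerivAt c (ξ (c t)) t := fun t ht =>
    hc t ⟨by linarith [ht.1], by linarith [ht.2]⟩
  have hcc : ContinuousOn c (Icc (-δ) δ) := HasDerivAt.continuousOn hcd
  have hBc : ContinuousOn (fun t => B (c t)) (Icc (-δ) δ) := hB.comp hcc fun t ht => (hcU t ht).1
  have hSc : ∀ {S : E → F}, ContDiffOn ℝ 1 S U → ∀ t ∈ Icc (-δ) δ,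
      HasDerivAt (fun t => S (c t)) (fderiv ℝ S (c t) (ξ (c t))) t := fun hS t ht =>
    (hdiff hS (c t) (hcU t ht).1).comp_hasDerivAt t (hcd t ht)
  have hsub : ∀ {s : ℝ}, s ∈ Icc 0 δ → Icc 0 s ⊆ Icc (-δ) δ := fun hs =>
    Icc_subset_Icc (by linarith) hs.2
  obtain ⟨M, hM⟩ : ∃ M, ∀ N, ‖T N x‖ ≤ M := by
    obtain ⟨M, hM⟩ := (hlim x hx).norm.bddAbove_range
    exact ⟨M, fun N => hM (mem_range_self N)⟩
  have hM0 : 0 ≤ M := (norm_nonneg _).trans (hM 0)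
  -- Gronwall's inequality propagates the bound at the single point `x`, which comes from
  -- convergence there, to a bound along the curve that is uniform in `N`.
  have hbound : ∀ N, ∀ s ∈ Icc 0 δ, ‖T N (c s)‖ ≤ M * Real.exp ((‖B x‖ + 1) * δ) := by
    intro N s hs
    have := norm_le_gronwallBound_of_norm_deriv_right_le (f := fun t => T N (c t))
      (f' := fun t => fderiv ℝ (T N) (c t) (ξ (c t))) (δ := M) (K := ‖B x‖ + 1) (ε := 0)
      (a := 0) (b := δ)
      (fun t ht => (hSc (hT N) t (hsub ⟨hδ0.le, le_rfl⟩ ht)).continuousAt.continuousWithinAt)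
      (fun t ht => (hSc (hT N) t (hsub ⟨hδ0.le, le_rfl⟩ ⟨ht.1, ht.2.le⟩)).hasDerivWithinAt)
      (by simpa [hc0] using hM N) (fun t ht => by
        have htm := hcU t (hsub ⟨hδ0.le, le_rfl⟩ ⟨ht.1, ht.2.le⟩)
        rw [heq N _ htm.1, add_zero]
        exact ((B (c t)).le_opNorm _).trans (mul_le_mul_of_nonneg_right htm.2 (norm_nonneg _)))
      s hs
    rw [gronwallBound_ε0] at this
    refine this.trans ?_
    gcongr
    linarith [hs.2]
  -- The integrated equation passes to the limit by dominated convergence.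
  have hint : ∀ s ∈ Icc 0 δ, T' (c s) - T' x = ∫ t in (0 : ℝ)..s, B (c t) (T' (c t)) := by
    intro s hs
    have h1 : Tendsto (fun N => ∫ t in (0 : ℝ)..s, B (c t) (T N (c t))) atTop
        (𝓝 (∫ t in (0 : ℝ)..s, B (c t) (T' (c t)))) := by
      have hI : Ι (0 : ℝ) s ⊆ Icc 0 s := by
        rw [uIoc_of_le hs.1]; exact Ioc_subset_Icc_self
      refine intervalIntegral.tendsto_integral_filter_of_dominated_convergence
        (fun _ => (‖B x‖ + 1) * (M * Real.exp ((‖B x‖ + 1) * δ))) ?_ ?_ ?_ ?_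
      · refine Eventually.of_forall fun N => ?_
        refine ContinuousOn.aestronglyMeasurable ?_ measurableSet_uIoc
        refine ContinuousOn.mono ?_ (hI.trans (hsub hs))
        exact hBc.clm_apply (HasDerivAt.continuousOn (hSc (hT N)))
      · refine Eventually.of_forall fun N => Eventually.of_forall fun t ht => ?_
        have ht' := hI ht
        exact ((B (c t)).le_opNorm _).trans (mul_le_mul (hcU t (hsub hs ht')).2
          (hbound N t ⟨ht'.1, ht'.2.trans hs.2⟩) (norm_nonneg _) (by positivity))
      · exact intervalIntegrable_const
      · refine Eventually.of_forall fun t ht => ?_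
        exact ((B (c t)).continuous.tendsto _).comp (hlim _ (hcU t (hsub hs (hI ht))).1)
    have h2 : Tendsto (fun N => T N (c s) - T N x) atTop (𝓝 (T' (c s) - T' x)) :=
      (hlim _ (hcU s (hsub hs ⟨hs.1, le_rfl⟩)).1).sub (hlim _ hx)
    refine tendsto_nhds_unique h2 (h1.congr fun N => ?_)
    have hu : uIcc 0 s ⊆ Icc (-δ) δ := by rw [uIcc_of_le hs.1]; exact hsub hs
    have h3 := intervalIntegral.integral_eq_sub_of_hasDerivAt (f := fun t => T N (c t))
      (f' := fun t => B (c t) (T N (c t))) (a := 0) (b := s)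
      (fun t ht => by
        rw [← heq N _ (hcU t (hu ht)).1]
        exact hSc (hT N) t (hu ht))
      ((hBc.clm_apply (HasDerivAt.continuousOn (hSc (hT N)))).mono hu).intervalIntegrable
    rw [h3, hc0]
  have h0mem : Icc (-δ) δ ∈ 𝓝 (0 : ℝ) := Icc_mem_nhds (by linarith) hδ0
  have h0 : (0 : ℝ) ∈ Icc (-δ) δ := mem_of_mem_nhds h0mem
  -- The integral equation is known for nonnegative times only, and comparing right derivatives at 0
  -- is enough.
  have hd1 := (hSc hT' 0 h0).hasDerivWithinAt (s := Ici 0)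
  have hcont : ContinuousOn (fun t => B (c t) (T' (c t))) (Icc (-δ) δ) :=
    hBc.clm_apply (HasDerivAt.continuousOn (hSc hT'))
  have hd2 : HasDerivAt (fun s => (∫ t in (0 : ℝ)..s, B (c t) (T' (c t)))) (B (c 0) (T' (c 0))) 0 :=
    intervalIntegral.integral_hasDerivAt_right (by simp)
      (hcont.stronglyMeasurableAtFilter_nhdsWithin measurableSet_Icc 0 |>.filter_mono
        (by rw [nhdsWithin_eq_nhds.2 h0mem]))
      (hcont.continuousAt h0mem)
  have hd3 := (hd2.const_add (T' x)).hasDerivWithinAt (s := Ici 0)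
  have hd4 : HasDerivWithinAt (fun t => T' (c t)) (B (c 0) (T' (c 0))) (Ici 0) 0 := by
    refine hd3.congr_of_eventuallyEq ?_ (by simp [hc0])
    have : Icc 0 δ ∈ 𝓝[≥] (0 : ℝ) := Icc_mem_nhdsGE hδ0
    filter_upwards [this] with s hs
    rw [← hint s hs]; abel
  have := (uniqueDiffOn_Ici (0 : ℝ) 0 self_mem_Ici).eq_deriv _ hd1 hd4
  simpa [hc0] using this

end LimitODE

/-! ### Covariant tensors of arbitrary rank and their covariant derivatives. -/

/-- A pullback action of the endomorphisms of `E` on a space `F` of covariant tensors, with the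
corresponding action by derivations. -/
structure TensorAction (E F : Type) [NormedAddCommGroup E] [NormedSpace ℝ E]
    [NormedAddCommGroup F] [NormedSpace ℝ F] where
  pull : (E →L[ℝ] E) → (F →L[ℝ] F)
  der : (E →L[ℝ] E) →L[ℝ] (F →L[ℝ] F)
  differentiable_pull : Differentiable ℝ pull
  -- Differentiated form of the contravariance of the pullback, pull (B R) = pull R ∘ pull B.
  fderiv_pull : ∀ R B k, fderiv ℝ pull R (B ∘L R) k = pull R (der B k)
  pull_der : ∀ R A, R ∘L R = ContinuousLinearMap.id ℝ E →
    ∀ k, pull R (der A k) = der (R ∘L A ∘L R) (pull R k)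
  -- The commutator is reversed because the slots are covariant.
  der_comm : ∀ A B k, der A (der B k) - der B (der A k) = der (B ∘L A - A ∘L B) k

namespace TensorAction

variable {E F : Type} [NormedAddCommGroup E] [NormedSpace ℝ E]
    [NormedAddCommGroup F] [NormedSpace ℝ F]

/-- The trivial action on scalars. -/
noncomputable def scalar (E : Type) [NormedAddCommGroup E] [NormedSpace ℝ E] :
    TensorAction E ℝ where
  pull := fun _ => ContinuousLinearMap.id ℝ ℝ
  der := 0
  differentiable_pull := differentiable_const _
  fderiv_pull := by simp
  pull_der := by simp
  der_comm := by simp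

open ContinuousLinearMap in
/-- The action on tensors with one more covariant slot. -/
noncomputable def succ (a : TensorAction E F) : TensorAction E (E →L[ℝ] F) where
  pull := fun R => (compL ℝ E F F (a.pull R)) ∘L ((compL ℝ E E F).flip R)
  der := (compL ℝ E F F) ∘L a.der + (compL ℝ E E F).flip
  differentiable_pull := by
    have := a.differentiable_pull
    fun_prop
  fderiv_pull := by
    intro R B κ
    have h1 : HasFDerivAt a.pull (fderiv ℝ a.pull R) R := (a.differentiable_pull R).hasFDerivAt
    have h2 : HasFDerivAt (fun R => compL ℝ E F F (a.pull R)) _ R :=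
      HasFDerivAt.comp (g := fun T => compL ℝ E F F T) R (compL ℝ E F F).hasFDerivAt h1
    have h3 := h2.clm_comp ((compL ℝ E E F).flip.hasFDerivAt (x := R))
    rw [HasFDerivAt.fderiv (f := fun R => (compL ℝ E F F (a.pull R)) ∘L ((compL ℝ E E F).flip R)) h3]
    ext X
    have := a.fderiv_pull R B (κ (R X))
    simp [this, add_comm]
  pull_der := by
    intro R A hR κ
    ext X
    have h1 := a.pull_der R A hR (κ (R X))
    have h2 : ∀ Y, R (R Y) = Y := fun Y => congrArg (fun T : E →L[ℝ] E => T Y) hR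
    simp only [compL_apply, comp_apply, add_apply, flip_apply, h1, h2, map_add]
  der_comm := by
    intro A B κ
    ext X
    have h1 := a.der_comm A B (κ X)
    simp only [compL_apply, comp_apply, add_apply, flip_apply, sub_apply, map_add, map_sub] at h1 ⊢
    linear_combination (norm := module) (1 : ℝ) • h1

@[simp] theorem succ_pull_apply (a : TensorAction E F) (R : E →L[ℝ] E) (κ : E →L[ℝ] F) (X : E) :
    a.succ.pull R κ X = a.pull R (κ (R X)) := rfl

@[simp] theorem succ_der_apply (a : TensorAction E F) (A : E →L[ℝ] E) (κ : E →L[ℝ] F) (X : E) :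
    a.succ.der A κ X = a.der A (κ X) + κ (A X) := rfl

/-- The zeroth order part of a connection with coefficients `Γ`. -/
noncomputable def conn (a : TensorAction E F) (T : E →L[ℝ] E →L[ℝ] E) (k : F) : E →L[ℝ] F :=
  ContinuousLinearMap.apply ℝ F k ∘L (a.der ∘L T)

@[simp] theorem conn_apply (a : TensorAction E F) (T : E →L[ℝ] E →L[ℝ] E) (k : F) (X : E) :
    a.conn T k X = a.der (T X) k := rfl

/-- The covariant derivative with respect to the connection with coefficients `Γ`. -/
noncomputable def nabla (a : TensorAction E F) (Γ : E → E →L[ℝ] E →L[ℝ] E) (k : E → F) (x : E) :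
    E →L[ℝ] F :=
  fderiv ℝ k x - a.conn (Γ x) (k x)

theorem nabla_apply (a : TensorAction E F) (Γ : E → E →L[ℝ] E →L[ℝ] E) (k : E → F) (x X : E) :
    a.nabla Γ k x X = fderiv ℝ k x X - a.der (Γ x X) (k x) := rfl

theorem contDiffOn_conn (a : TensorAction E F) {U : Set E} {m : WithTop ℕ∞}
    {Γ : E → E →L[ℝ] E →L[ℝ] E} {k : E → F} (hΓ : ContDiffOn ℝ m Γ U) (hk : ContDiffOn ℝ m k U) :
    ContDiffOn ℝ m (fun x => a.conn (Γ x) (k x)) U := by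
  have h1 : ContDiffOn ℝ m (fun x => ContinuousLinearMap.apply ℝ F (k x)) U :=
    contDiffOn_const.clm_apply hk
  have h2 : ContDiffOn ℝ m (fun x => a.der ∘L Γ x) U := contDiffOn_const.clm_comp hΓ
  exact h1.clm_comp h2

theorem contDiffOn_nabla (a : TensorAction E F) {U : Set E} (hU : IsOpen U) {m : ℕ}
    {Γ : E → E →L[ℝ] E →L[ℝ] E} {k : E → F} (hΓ : ContDiffOn ℝ m Γ U)
    (hk : ContDiffOn ℝ (m + 1) k U) : ContDiffOn ℝ m (a.nabla Γ k) U :=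
  (hk.fderiv_of_isOpen hU le_rfl).sub
    (a.contDiffOn_conn (m := m) hΓ (hk.of_le (by norm_cast; omega)))

theorem hasFDerivAt_conn (a : TensorAction E F) {Γ : E → E →L[ℝ] E →L[ℝ] E} {k : E → F} {x : E}
    {Γ' : E →L[ℝ] E →L[ℝ] E →L[ℝ] E} {k' : E →L[ℝ] F} (hΓ : HasFDerivAt Γ Γ' x)
    (hk : HasFDerivAt k k' x) : ∃ L : E →L[ℝ] E →L[ℝ] F,
      HasFDerivAt (fun y => a.conn (Γ y) (k y)) L x ∧
      ∀ X Y, L X Y = a.der (Γ' X Y) (k x) + a.der (Γ x Y) (k' X) := by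
  have h1 : HasFDerivAt (fun y => ContinuousLinearMap.apply ℝ F (k y)) _ x :=
    HasFDerivAt.comp (g := fun v => ContinuousLinearMap.apply ℝ F v) x
      (ContinuousLinearMap.apply ℝ F).hasFDerivAt hk
  have h2 : HasFDerivAt (fun y => a.der ∘L Γ y) _ x := (hasFDerivAt_const a.der x).clm_comp hΓ
  refine ⟨_, h1.clm_comp h2, fun X Y => ?_⟩
  simp

/-- The tensor field `k` is invariant under the local flow of `ξ`. -/
def Invariant (a : TensorAction E F) (U : Set E) (ξ : E → E) (k : E → F) : Prop :=
  ∀ x ∈ U, fderiv ℝ k x (ξ x) + a.der (fderiv ℝ ξ x) (k x) = 0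

end TensorAction

/-- The set `N` is removable in `U` for continuously differentiable functions. -/
def IsC1Removable {E : Type} [NormedAddCommGroup E] [NormedSpace ℝ E] (U N : Set E) : Prop :=
  ∀ (F : Type) [NormedAddCommGroup F] [NormedSpace ℝ F] (f : E → F) (g : E → E →L[ℝ] F),
    ContinuousOn f U → ContinuousOn g U → (∀ x ∈ U \ N, HasFDerivAt f (g x) x) →
    ∀ x ∈ U, HasFDerivAt f (g x) x

/-! ### Reflections along orbits and the regularity of reflected tensors. -/

/-- The geometry of reflections `R` along the orbits of two vector fields `ξ`, `η`, off the set
where `η` vanishes. -/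
structure ReflectionGeometry {E : Type} [NormedAddCommGroup E] [NormedSpace ℝ E] (U : Set E)
    (ξ η : E → E) (Γ : E → E →L[ℝ] E →L[ℝ] E) (R : E → E →L[ℝ] E) : Prop where
  isOpen : IsOpen U
  xi_class : ContDiffOn ℝ 2 ξ U
  eta_class : ContDiffOn ℝ 2 η U
  symm : ∀ x ∈ U, ∀ X Y, Γ x X Y = Γ x Y X
  diffR : ∀ x ∈ U, η x ≠ 0 → DifferentiableAt ℝ R x
  invol : ∀ x ∈ U, η x ≠ 0 → R x ∘L R x = ContinuousLinearMap.id ℝ E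
  R_xi : ∀ x ∈ U, η x ≠ 0 → R x (ξ x) = - ξ x
  R_eta : ∀ x ∈ U, η x ≠ 0 → R x (η x) = - η x
  split : ∀ x ∈ U, η x ≠ 0 → ∀ X, ∃ (a b : ℝ) (Y : E), R x Y = Y ∧ X = Y + a • ξ x + b • η x
  -- That is, ∇_Y R = 0 for directions Y orthogonal to the orbits.
  parallel : ∀ x ∈ U, η x ≠ 0 → ∀ Y, R x Y = Y →
    fderiv ℝ R x Y = R x ∘L Γ x Y - Γ x Y ∘L R x
  R_inv_xi : ∀ x ∈ U, η x ≠ 0 →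
    fderiv ℝ R x (ξ x) = fderiv ℝ ξ x ∘L R x - R x ∘L fderiv ℝ ξ x
  R_inv_eta : ∀ x ∈ U, η x ≠ 0 →
    fderiv ℝ R x (η x) = fderiv ℝ η x ∘L R x - R x ∘L fderiv ℝ η x
  -- By symmetry of Γ the endomorphism in the middle is ∇ξ: it exchanges the orbit plane and its
  -- complement.
  anti_xi : ∀ x ∈ U, η x ≠ 0 →
    R x ∘L (fderiv ℝ ξ x + Γ x (ξ x)) ∘L R x = - (fderiv ℝ ξ x + Γ x (ξ x))
  anti_eta : ∀ x ∈ U, η x ≠ 0 →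
    R x ∘L (fderiv ℝ η x + Γ x (η x)) ∘L R x = - (fderiv ℝ η x + Γ x (η x))
  -- The Lie derivative of the connection along ξ vanishes.
  gamma_xi : ∀ x ∈ U, ∀ X, fderiv ℝ (fderiv ℝ ξ) x X + fderiv ℝ Γ x (ξ x) X
    - fderiv ℝ ξ x ∘L Γ x X + Γ x (fderiv ℝ ξ x X) + Γ x X ∘L fderiv ℝ ξ x = 0
  gamma_eta : ∀ x ∈ U, ∀ X, fderiv ℝ (fderiv ℝ η) x X + fderiv ℝ Γ x (η x) X
    - fderiv ℝ η x ∘L Γ x X + Γ x (fderiv ℝ η x X) + Γ x X ∘L fderiv ℝ η x = 0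
  bounded : ∀ p ∈ U, η p = 0 → ∃ C, ∀ᶠ x in 𝓝[{x | η x ≠ 0}] p, ‖R x‖ ≤ C
  -- No limit of `R` itself is required, only of its action on tensors annihilated by the
  -- infinitesimal rotation at the axis point.
  limit : ∀ p ∈ U, η p = 0 → ∀ (F : Type) [NormedAddCommGroup F] [NormedSpace ℝ F]
    (a : TensorAction E F) (k : F), a.der (fderiv ℝ η p) k = 0 →
    ∃ L, Tendsto (fun x => a.pull (R x) k) (𝓝[{x | η x ≠ 0}] p) (𝓝 L)
  removable : IsC1Removable U {x | η x = 0}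
  axis_thin : ∀ p ∈ U, (𝓝[{x | η x ≠ 0}] p).NeBot

namespace ReflectionGeometry

variable {E : Type} [NormedAddCommGroup E] [NormedSpace ℝ E]
  {U : Set E} {ξ η : E → E} {Γ : E → E →L[ℝ] E →L[ℝ] E} {R : E → E →L[ℝ] E}

/-- Amounts to ∇(R^*k) = R^*(∇k). Orthogonally to the orbits this is the parallelism of R. In an
orbit direction ζ the reflection reverses ζ, and the sign is compensated: k and R are invariant
under ζ, so ∇_ζ acts algebraically through ∇ζ, and conjugation by R reverses ∇ζ. -/
theorem fderiv_pull_reflection {F : Type} [NormedAddCommGroup F] [NormedSpace ℝ F]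
    (G : ReflectionGeometry U ξ η Γ R) (a : TensorAction E F) {k : E → F} {x : E} (hx : x ∈ U)
    (hη : η x ≠ 0) (hk : DifferentiableAt ℝ k x) (hξk : a.Invariant U ξ k)
    (hηk : a.Invariant U η k) :
    HasFDerivAt (fun y => a.pull (R y) (k y))
      (a.succ.pull (R x) (a.nabla Γ k x) + a.conn (Γ x) (a.pull (R x) (k x))) x := by
  have hpR : HasFDerivAt (fun y => a.pull (R y)) (fderiv ℝ a.pull (R x) ∘L fderiv ℝ R x) x :=
    (a.differentiable_pull (R x)).hasFDerivAt.comp x (G.diffR x hx hη).hasFDerivAt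
  have hd := hpR.clm_apply hk.hasFDerivAt
  refine hd.congr_fderiv ?_
  have hinv := G.invol x hx hη
  have hRR : ∀ Y, R x (R x Y) = Y := fun Y => congrArg (fun T : E →L[ℝ] E => T Y) hinv
  have hRTR : ∀ T : E →L[ℝ] E, R x ∘L (R x ∘L T ∘L R x) ∘L R x = T := fun T => by
    ext Y; simp [hRR]
  -- the direction of an orbit
  have orbit : ∀ ζ : E → E, R x (ζ x) = - ζ x → a.Invariant U ζ k →
      fderiv ℝ R x (ζ x) = fderiv ℝ ζ x ∘L R x - R x ∘L fderiv ℝ ζ x →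
      R x ∘L (fderiv ℝ ζ x + Γ x (ζ x)) ∘L R x = - (fderiv ℝ ζ x + Γ x (ζ x)) →
      fderiv ℝ a.pull (R x) (fderiv ℝ R x (ζ x)) (k x) + a.pull (R x) (fderiv ℝ k x (ζ x)) =
      a.pull (R x) (a.nabla Γ k x (R x (ζ x))) + a.der (Γ x (ζ x)) (a.pull (R x) (k x)) := by
    intro ζ hRζ hinvk hRinv hanti
    have e1 : fderiv ℝ R x (ζ x) = (fderiv ℝ ζ x - R x ∘L fderiv ℝ ζ x ∘L R x) ∘L R x := by
      rw [hRinv]; ext Y; simp [hRR]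
    have hk0 := hinvk x hx
    have e2 : fderiv ℝ k x (ζ x) = - a.der (fderiv ℝ ζ x) (k x) := eq_neg_of_add_eq_zero_left hk0
    rw [e1, a.fderiv_pull, hRζ, map_neg, TensorAction.nabla_apply, e2]
    have e3 := a.pull_der (R x) (fderiv ℝ ζ x + Γ x (ζ x)) hinv (k x)
    rw [hanti] at e3
    have e4 := a.pull_der (R x) (R x ∘L fderiv ℝ ζ x ∘L R x) hinv (k x)
    rw [hRTR] at e4
    simp only [map_add, map_sub, map_neg, sub_apply,
      add_apply, neg_apply] at e3 ⊢
    rw [e4]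
    linear_combination (norm := module) (-1 : ℝ) • e3
  ext X
  obtain ⟨s, t, Y, hY, rfl⟩ := G.split x hx hη X
  have hYeq : fderiv ℝ a.pull (R x) (fderiv ℝ R x Y) (k x) + a.pull (R x) (fderiv ℝ k x Y) =
      a.pull (R x) (a.nabla Γ k x (R x Y)) + a.der (Γ x Y) (a.pull (R x) (k x)) := by
    have e1 : fderiv ℝ R x Y = (R x ∘L Γ x Y ∘L R x - Γ x Y) ∘L R x := by
      rw [G.parallel x hx hη Y hY]; ext Z; simp [hRR]
    have e4 := a.pull_der (R x) (R x ∘L Γ x Y ∘L R x) hinv (k x)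
    rw [hRTR] at e4
    rw [e1, a.fderiv_pull, hY, TensorAction.nabla_apply]
    simp only [map_sub, sub_apply]
    rw [e4]; abel
  have h1 := orbit ξ (G.R_xi x hx hη) hξk (G.R_inv_xi x hx hη) (G.anti_xi x hx hη)
  have h2 := orbit η (G.R_eta x hx hη) hηk (G.R_inv_eta x hx hη) (G.anti_eta x hx hη)
  have expand : ∀ Z, (a.pull (R x) ∘L fderiv ℝ k x +
      (fderiv ℝ a.pull (R x) ∘L fderiv ℝ R x).flip (k x)) Z =
      fderiv ℝ a.pull (R x) (fderiv ℝ R x Z) (k x) + a.pull (R x) (fderiv ℝ k x Z) := fun Z => by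
    simp [add_comm]
  have expand' : ∀ Z, (a.succ.pull (R x) (a.nabla Γ k x) +
      a.conn (Γ x) (a.pull (R x) (k x))) Z =
      a.pull (R x) (a.nabla Γ k x (R x Z)) + a.der (Γ x Z) (a.pull (R x) (k x)) := fun Z => by
    simp
  rw [map_add, map_add, map_smul, map_smul, map_add, map_add, map_smul, map_smul]
  rw [expand, expand, expand, expand', expand', expand', hYeq, h1, h2]

/-- The Lie derivative along ζ commutes with ∇ when ζ preserves the connection; the invariance
equation is differentiated and the commutator of the two algebraic actions is rearranged. -/
theorem invariant_nabla {F : Type} [NormedAddCommGroup F] [NormedSpace ℝ F] (hU : IsOpen U)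
    {ζ : E → E} (hζ : ContDiffOn ℝ 2 ζ U) (hΓ : ContDiffOn ℝ 1 Γ U)
    (hΓζ : ∀ x ∈ U, ∀ X, fderiv ℝ (fderiv ℝ ζ) x X + fderiv ℝ Γ x (ζ x) X
      - fderiv ℝ ζ x ∘L Γ x X + Γ x (fderiv ℝ ζ x X) + Γ x X ∘L fderiv ℝ ζ x = 0)
    (a : TensorAction E F) {k : E → F} (hk : ContDiffOn ℝ 2 k U) (hinv : a.Invariant U ζ k) :
    a.succ.Invariant U ζ (a.nabla Γ k) := by
  intro x hx
  have hUx := hU.mem_nhds hx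
  have hkx : ContDiffAt ℝ 2 k x := hk.contDiffAt hUx
  have dk : HasFDerivAt k (fderiv ℝ k x) x := (hkx.differentiableAt two_ne_zero).hasFDerivAt
  have dk2 : HasFDerivAt (fderiv ℝ k) (fderiv ℝ (fderiv ℝ k) x) x :=
    ((hkx.fderiv_right (m := 1) (by norm_num)).differentiableAt one_ne_zero).hasFDerivAt
  have hζx : ContDiffAt ℝ 2 ζ x := hζ.contDiffAt hUx
  have dζ : HasFDerivAt ζ (fderiv ℝ ζ x) x := (hζx.differentiableAt two_ne_zero).hasFDerivAt
  have dζ2 : HasFDerivAt (fderiv ℝ ζ) (fderiv ℝ (fderiv ℝ ζ) x) x :=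
    ((hζx.fderiv_right (m := 1) (by norm_num)).differentiableAt one_ne_zero).hasFDerivAt
  have dΓ : HasFDerivAt Γ (fderiv ℝ Γ x) x :=
    ((hΓ.contDiffAt hUx).differentiableAt one_ne_zero).hasFDerivAt
  -- derivative of the invariance equation
  have h0 : HasFDerivAt (fun y => fderiv ℝ k y (ζ y) + a.der (fderiv ℝ ζ y) (k y)) (0 : E →L[ℝ] F) x := by
    refine (hasFDerivAt_const (0 : F) x).congr_of_eventuallyEq ?_
    filter_upwards [hUx] with y hy using hinv y hy
  have hcd : HasFDerivAt (fun y => a.der (fderiv ℝ ζ y)) (a.der ∘L fderiv ℝ (fderiv ℝ ζ) x) x :=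
    HasFDerivAt.comp (g := fun T => a.der T) x a.der.hasFDerivAt dζ2
  have h1 := (dk2.clm_apply dζ).add (hcd.clm_apply dk)
  have h2 := h1.unique h0
  obtain ⟨L, hL, hLa⟩ := a.hasFDerivAt_conn dΓ dk
  have dn : HasFDerivAt (a.nabla Γ k) (fderiv ℝ (fderiv ℝ k) x - L) x := dk2.sub hL
  rw [dn.fderiv]
  ext X
  have h3 := congrArg (fun T : E →L[ℝ] F => T X) h2
  have hsymm : fderiv ℝ (fderiv ℝ k) x (ζ x) X = fderiv ℝ (fderiv ℝ k) x X (ζ x) :=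
    (hkx.isSymmSndFDerivAt (by simp)) _ _
  have h4 := congrArg (fun T : E →L[ℝ] E => a.der T (k x)) (hΓζ x hx X)
  have h5 := a.der_comm (Γ x X) (fderiv ℝ ζ x) (k x)
  have h6 := hinv x hx
  have h7 := congrArg (a.der (Γ x X)) h6
  simp [TensorAction.nabla_apply, hLa] at h3 h4 h5 h7 ⊢
  rw [hsymm]
  linear_combination (norm := module) (1 : ℝ) • h3 - (1 : ℝ) • h4 + (1 : ℝ) • h5 - (1 : ℝ) • h7

/-- At a zero of ζ the factor g only needs to be continuous, since the error (g y - g p)(ζ y) is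
o(1) times O(|y - p|). -/
theorem hasFDerivAt_clm_apply_of_eq_zero {F : Type} [NormedAddCommGroup F] [NormedSpace ℝ F]
    {g : E → E →L[ℝ] F} {ζ : E → E} {ζ' : E →L[ℝ] E} {p : E} (hg : ContinuousAt g p)
    (hζ : HasFDerivAt ζ ζ' p) (h0 : ζ p = 0) :
    HasFDerivAt (fun y => g y (ζ y)) (g p ∘L ζ') p := by
  have h1 : HasFDerivAt (fun y => g p (ζ y)) (g p ∘L ζ') p :=
    HasFDerivAt.comp (g := fun v => g p v) p (g p).hasFDerivAt hζ
  have h2 : HasFDerivAt (fun y => (g y - g p) (ζ y)) (0 : E →L[ℝ] F) p := by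
    rw [hasFDerivAt_iff_isLittleO]
    simp only [h0, map_zero, sub_zero, zero_apply]
    have hO : (fun y => ζ y) =O[𝓝 p] fun y => y - p := by
      have := hζ.isBigO_sub
      simpa [h0] using this
    have ho : (fun y => ‖g y - g p‖) =o[𝓝 p] fun _ => (1 : ℝ) :=
      (Asymptotics.isLittleO_one_iff ℝ).2 (tendsto_iff_norm_sub_tendsto_zero.1 hg.tendsto)
    have h3 := ho.mul_isBigO hO.norm_norm
    refine (Asymptotics.IsBigO.of_bound 1 ?_).trans_isLittleO (h3.trans_isBigO ?_)
    · refine Eventually.of_forall fun y => ?_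
      simpa using (g y - g p).le_opNorm (ζ y)
    · simpa using (Asymptotics.isBigO_refl (fun y => y - p) (𝓝 p)).norm_left
  have h3 := h1.add h2
  simp only [add_zero] at h3
  refine h3.congr_of_eventuallyEq (Eventually.of_forall fun y => ?_)
  simp

/-- Invariance of ∇k evaluated at a zero of ζ. A tensor of class C¹ suffices there, because the
second derivative of k would be contracted with ζ p = 0. -/
theorem der_nabla_eq_zero {F : Type} [NormedAddCommGroup F] [NormedSpace ℝ F] (hU : IsOpen U)
    {ζ : E → E} (hζ : ContDiffOn ℝ 2 ζ U) {p : E} (hp : p ∈ U) (h0 : ζ p = 0)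
    (hΓζ : ∀ x ∈ U, ∀ X, fderiv ℝ (fderiv ℝ ζ) x X + fderiv ℝ Γ x (ζ x) X
      - fderiv ℝ ζ x ∘L Γ x X + Γ x (fderiv ℝ ζ x X) + Γ x X ∘L fderiv ℝ ζ x = 0)
    (a : TensorAction E F) {k : E → F} (hk : ContDiffOn ℝ 1 k U) (hinv : a.Invariant U ζ k) :
    a.succ.der (fderiv ℝ ζ p) (a.nabla Γ k p) = 0 := by
  have hUx := hU.mem_nhds hp
  have hkx : ContDiffAt ℝ 1 k p := hk.contDiffAt hUx
  have dk : HasFDerivAt k (fderiv ℝ k p) p := (hkx.differentiableAt one_ne_zero).hasFDerivAt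
  have ck : ContinuousAt (fderiv ℝ k) p :=
    (hk.continuousOn_fderiv_of_isOpen hU le_rfl).continuousAt hUx
  have hζx : ContDiffAt ℝ 2 ζ p := hζ.contDiffAt hUx
  have dζ : HasFDerivAt ζ (fderiv ℝ ζ p) p := (hζx.differentiableAt two_ne_zero).hasFDerivAt
  have dζ2 : HasFDerivAt (fderiv ℝ ζ) (fderiv ℝ (fderiv ℝ ζ) p) p :=
    ((hζx.fderiv_right (m := 1) (by norm_num)).differentiableAt one_ne_zero).hasFDerivAt
  have hz : HasFDerivAt (fun y => fderiv ℝ k y (ζ y) + a.der (fderiv ℝ ζ y) (k y)) (0 : E →L[ℝ] F) p := by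
    refine (hasFDerivAt_const (0 : F) p).congr_of_eventuallyEq ?_
    filter_upwards [hUx] with y hy using hinv y hy
  have hcd : HasFDerivAt (fun y => a.der (fderiv ℝ ζ y)) (a.der ∘L fderiv ℝ (fderiv ℝ ζ) p) p :=
    HasFDerivAt.comp (g := fun T => a.der T) p a.der.hasFDerivAt dζ2
  have h1 := (hasFDerivAt_clm_apply_of_eq_zero ck dζ h0).add (hcd.clm_apply dk)
  have h2 := h1.unique hz
  ext X
  have h3 := congrArg (fun T : E →L[ℝ] F => T X) h2
  have h4 := congrArg (fun T : E →L[ℝ] E => a.der T (k p)) (hΓζ p hp X)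
  have h5 := a.der_comm (Γ p X) (fderiv ℝ ζ p) (k p)
  have h6 := hinv p hp
  rw [h0, map_zero, zero_add] at h6
  have h7 := congrArg (a.der (Γ p X)) h6
  simp [TensorAction.nabla_apply, h0] at h3 h4 h5 h7 ⊢
  linear_combination (norm := module) (1 : ℝ) • h3 - (1 : ℝ) • h4 + (1 : ℝ) • h5 - (1 : ℝ) • h7

/-- Reflecting an invariant tensor field of class `C^m` along the orbits gives a tensor field that
extends to one of class `C^m`. -/
theorem exists_contDiffOn_extension [FiniteDimensional ℝ E] (G : ReflectionGeometry U ξ η Γ R)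
    (m : ℕ) : ∀ {F : Type} [NormedAddCommGroup F] [NormedSpace ℝ F]
      (a : TensorAction E F) {k : E → F},
      ContDiffOn ℝ m Γ U → ContDiffOn ℝ m k U → (m ≠ 0 → a.Invariant U ξ k ∧ a.Invariant U η k) →
      (∀ p ∈ U, η p = 0 → a.der (fderiv ℝ η p) (k p) = 0) →
      ∃ f : E → F, ContDiffOn ℝ m f U ∧ ∀ x ∈ U, η x ≠ 0 → f x = a.pull (R x) (k x) := by
  -- Continuity at the axis: `R` is bounded near p, so replacing `k x` by `k p` costs nothing in the
  -- limit, and the reflections of the rotation-invariant tensor `k p` converge.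
  have base : ∀ {F : Type} [NormedAddCommGroup F] [NormedSpace ℝ F]
      (a : TensorAction E F) {k : E → F}, ContinuousOn k U →
      (∀ p ∈ U, η p = 0 → a.der (fderiv ℝ η p) (k p) = 0) →
      ∃ f : E → F, ContinuousOn f U ∧ ∀ x ∈ U, η x ≠ 0 → f x = a.pull (R x) (k x) := by
    intro F _ _ a k hk hder
    have hcont : ∀ x ∈ U, η x ≠ 0 → ContinuousAt (fun y => a.pull (R y) (k y)) x := by
      intro x hx hηx
      have h1 : ContinuousAt (fun y => a.pull (R y)) x :=
        (a.differentiable_pull.continuous.continuousAt (x := R x)).comp (G.diffR x hx hηx).continuousAt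
      exact h1.clm_apply (hk.continuousAt (G.isOpen.mem_nhds hx))
    have hηo : ∀ x ∈ U, η x ≠ 0 → {y | η y ≠ 0} ∈ 𝓝 x := by
      intro x hx hηx
      exact (G.eta_class.continuousOn.continuousAt (G.isOpen.mem_nhds hx)).eventually_ne hηx
    have hdense : U ⊆ closure {y | η y ≠ 0} := fun p hp =>
      mem_closure_iff_nhdsWithin_neBot.2 (G.axis_thin p hp)
    refine ⟨extendFrom {y | η y ≠ 0} (fun y => a.pull (R y) (k y)), ?_, ?_⟩
    · refine continuousOn_extendFrom hdense fun p hp => ?_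
      by_cases hηp : η p = 0
      · obtain ⟨L, hL⟩ := G.limit p hp hηp F a (k p) (hder p hp hηp)
        refine ⟨L, ?_⟩
        obtain ⟨C, hC⟩ := G.bounded p hp hηp
        obtain ⟨K, hK⟩ := (isCompact_closedBall (0 : E →L[ℝ] E) C).exists_bound_of_continuousOn
          (f := a.pull) a.differentiable_pull.continuous.continuousOn
        have h0 : Tendsto (fun x => a.pull (R x) (k x - k p)) (𝓝[{y | η y ≠ 0}] p) (𝓝 0) := by
          have hk0 : Tendsto (fun x => K * ‖k x - k p‖) (𝓝[{y | η y ≠ 0}] p) (𝓝 0) := by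
            have := tendsto_iff_norm_sub_tendsto_zero.1
              (hk.continuousAt (G.isOpen.mem_nhds hp)).tendsto
            have := this.const_mul K
            rw [mul_zero] at this
            exact this.mono_left nhdsWithin_le_nhds
          refine squeeze_zero_norm' ?_ hk0
          filter_upwards [hC] with x hx
          exact (ContinuousLinearMap.le_opNorm _ _).trans
            (mul_le_mul_of_nonneg_right (hK _ (by simpa using hx)) (norm_nonneg _))
        have h1 := h0.add hL
        rw [zero_add] at h1
        refine h1.congr fun x => ?_
        rw [← map_add]; simp
      · exact ⟨_, (hcont p hp hηp).tendsto.mono_left nhdsWithin_le_nhds⟩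
    · intro x hx hηx
      have := G.axis_thin x hx
      exact extendFrom_eq (hdense hx) ((hcont x hx hηx).tendsto.mono_left nhdsWithin_le_nhds)
  -- The tensor space stays general in the induction because each step passes to the covariant
  -- derivative, which has one more slot.
  induction m with
  | zero =>
    intro F _ _ a k _ hk _ hder
    obtain ⟨f, hf, hfe⟩ := base a hk.continuousOn hder
    exact ⟨f, contDiffOn_zero.2 hf, hfe⟩
  | succ m ih =>
    intro F _ _ a k hΓ hk hinv hder
    obtain ⟨hξk, hηk⟩ := hinv (Nat.succ_ne_zero m)
    have hk1 : ContDiffOn ℝ 1 k U := hk.of_le (by norm_cast; omega)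
    have hΓ1 : ContDiffOn ℝ 1 Γ U := hΓ.of_le (by norm_cast; omega)
    have hΓm : ContDiffOn ℝ m Γ U := hΓ.of_le (by norm_cast; omega)
    obtain ⟨f₁, hf₁, hfe₁⟩ := ih a.succ hΓm
      (a.contDiffOn_nabla G.isOpen hΓm (by exact_mod_cast hk))
      (fun hm => ⟨invariant_nabla G.isOpen G.xi_class hΓ1 G.gamma_xi a
          (hk.of_le (by norm_cast; omega)) hξk,
        invariant_nabla G.isOpen G.eta_class hΓ1 G.gamma_eta a
          (hk.of_le (by norm_cast; omega)) hηk⟩)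
      (fun p hp h0 => der_nabla_eq_zero G.isOpen G.eta_class hp h0 G.gamma_eta a hk1 hηk)
    obtain ⟨f, hf, hfe⟩ := base a hk.continuousOn hder
    -- Off the axis the derivative of the reflected tensor is the reflection of ∇k plus a connection
    -- term. Both extend continuously, and the axis is removable.
    have hfd : ∀ x ∈ U, HasFDerivAt f (f₁ x + a.conn (Γ x) (f x)) x := by
      refine G.removable F f _ hf ?_ ?_
      · refine hf₁.continuousOn.add ?_
        have := a.contDiffOn_conn (m := 0) (hΓ.of_le (by simp)) (contDiffOn_zero.2 hf)
        exact this.continuousOn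
      · rintro x ⟨hx, hηx⟩
        have hηx : η x ≠ 0 := hηx
        have h1 := G.fderiv_pull_reflection a hx hηx
          ((hk1.differentiableOn one_ne_zero).differentiableAt (G.isOpen.mem_nhds hx)) hξk hηk
        rw [hfe₁ x hx hηx, hfe x hx hηx]
        refine h1.congr_of_eventuallyEq ?_
        filter_upwards [G.isOpen.mem_nhds hx,
          (G.eta_class.continuousOn.continuousAt (G.isOpen.mem_nhds hx)).eventually_ne hηx]
          with y hy hy0 using hfe y hy hy0
    refine ⟨f, ?_, hfe⟩
    -- The formula for the derivative contains `f` itself through the connection term, so regularity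
    -- is gained one order at a time.
    have hboot : ∀ j : ℕ, j ≤ m + 1 → ContDiffOn ℝ j f U := by
      intro j
      induction j with
      | zero => exact fun _ => contDiffOn_zero.2 hf
      | succ j ihj =>
        intro hj
        have hfj := ihj (by omega)
        have : ContDiffOn ℝ (j + 1) f U := by
          rw [contDiffOn_succ_iff_fderiv_of_isOpen G.isOpen]
          refine ⟨fun x hx => (hfd x hx).differentiableAt.differentiableWithinAt, by simp, ?_⟩
          have h2 : ContDiffOn ℝ j (fun x => f₁ x + a.conn (Γ x) (f x)) U :=
            (hf₁.of_le (by norm_cast; omega)).add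
              (a.contDiffOn_conn (hΓ.of_le (by norm_cast; omega)) hfj)
          exact h2.congr fun x hx => (hfd x hx).fderiv
        exact_mod_cast this
    exact hboot (m + 1) le_rfl

end ReflectionGeometry

/-! ### Linear algebra of the orbit plane: dual covectors, projection, reflection. -/

section OrbitAlgebra

variable {E : Type} [NormedAddCommGroup E] [NormedSpace ℝ E]

/-- The Gram determinant of two vectors. -/
noncomputable def gramDet (G : E →L[ℝ] E →L[ℝ] ℝ) (u v : E) : ℝ := G u u * G v v - G u v ^ 2

/-- The covector dual to `u` in the plane spanned by `u`, `v`, vanishing on its complement. -/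
noncomputable def coFst (G : E →L[ℝ] E →L[ℝ] ℝ) (u v : E) : E →L[ℝ] ℝ :=
  (gramDet G u v)⁻¹ • (G v v • G u - G u v • G v)

/-- The covector dual to `v` in the plane spanned by `u`, `v`, vanishing on its complement. -/
noncomputable def coSnd (G : E →L[ℝ] E →L[ℝ] ℝ) (u v : E) : E →L[ℝ] ℝ :=
  (gramDet G u v)⁻¹ • (G u u • G v - G u v • G u)

/-- The orthogonal projection onto the plane spanned by `u`, `v`. -/
noncomputable def orbitProj (G : E →L[ℝ] E →L[ℝ] ℝ) (u v : E) : E →L[ℝ] E :=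
  (coFst G u v).smulRight u + (coSnd G u v).smulRight v

/-- The reflection along the plane spanned by `u`, `v`. -/
noncomputable def orbitRefl (G : E →L[ℝ] E →L[ℝ] ℝ) (u v : E) : E →L[ℝ] E :=
  ContinuousLinearMap.id ℝ E - (2 : ℝ) • orbitProj G u v

variable {G : E →L[ℝ] E →L[ℝ] ℝ} {u v : E}

theorem coFst_apply (X : E) : coFst G u v X = (gramDet G u v)⁻¹ * (G v v * G u X - G u v * G v X) :=
  rfl

theorem coSnd_apply (X : E) : coSnd G u v X = (gramDet G u v)⁻¹ * (G u u * G v X - G u v * G u X) :=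
  rfl

theorem orbitProj_apply (X : E) : orbitProj G u v X = coFst G u v X • u + coSnd G u v X • v := rfl

theorem orbitRefl_apply (X : E) :
    orbitRefl G u v X = X - (2 : ℝ) • (coFst G u v X • u + coSnd G u v X • v) := rfl

theorem coFst_fst (hs : ∀ X Y, G X Y = G Y X)
     (hd : gramDet G u v ≠ 0) : coFst G u v u = 1 := by
  rw [coFst_apply, hs v u, inv_mul_eq_one₀ hd, gramDet]; ring

theorem coSnd_snd (hd : gramDet G u v ≠ 0) : coSnd G u v v = 1 := by
  rw [coSnd_apply, inv_mul_eq_one₀ hd, gramDet]; ring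

theorem coSnd_fst (hs : ∀ X Y, G X Y = G Y X) : coSnd G u v u = 0 := by
  rw [coSnd_apply, hs v u]; ring

theorem coFst_snd : coFst G u v v = 0 := by
  rw [coFst_apply]; ring

/-- This relation and the next determine the coframe. Differentiating them replaces differentiating
the quotients that define it. -/
theorem metric_fst_eq (hd : gramDet G u v ≠ 0) (X : E) : G u X = G u u * coFst G u v X + G u v * coSnd G u v X := by
  rw [coFst_apply, coSnd_apply]
  have h : gramDet G u v * (gramDet G u v)⁻¹ = 1 := mul_inv_cancel₀ hd
  have : G u u * ((gramDet G u v)⁻¹ * (G v v * G u X - G u v * G v X)) +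
      G u v * ((gramDet G u v)⁻¹ * (G u u * G v X - G u v * G u X)) =
      (gramDet G u v * (gramDet G u v)⁻¹) * G u X := by
    rw [gramDet]; ring
  rw [this, h, one_mul]

theorem metric_snd_eq (hd : gramDet G u v ≠ 0) (X : E) : G v X = G u v * coFst G u v X + G v v * coSnd G u v X := by
  rw [coFst_apply, coSnd_apply]
  have h : gramDet G u v * (gramDet G u v)⁻¹ = 1 := mul_inv_cancel₀ hd
  have : G u v * ((gramDet G u v)⁻¹ * (G v v * G u X - G u v * G v X)) +
      G v v * ((gramDet G u v)⁻¹ * (G u u * G v X - G u v * G u X)) =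
      (gramDet G u v * (gramDet G u v)⁻¹) * G v X := by
    rw [gramDet]; ring
  rw [this, h, one_mul]

theorem orbitRefl_fst (hs : ∀ X Y, G X Y = G Y X)
     (hd : gramDet G u v ≠ 0) : orbitRefl G u v u = - u := by
  rw [orbitRefl_apply, coFst_fst hs hd, coSnd_fst hs]; module

theorem orbitRefl_snd (_hs : ∀ X Y, G X Y = G Y X)
     (hd : gramDet G u v ≠ 0) : orbitRefl G u v v = - v := by
  rw [orbitRefl_apply, coFst_snd, coSnd_snd hd]; module

theorem orbitRefl_orbitRefl (hs : ∀ X Y, G X Y = G Y X)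
     (hd : gramDet G u v ≠ 0) (X : E) : orbitRefl G u v (orbitRefl G u v X) = X := by
  rw [orbitRefl_apply X, map_sub, map_smul, map_add, map_smul, map_smul, orbitRefl_fst hs hd,
    orbitRefl_snd hs hd, orbitRefl_apply X]
  module

theorem orbitRefl_symm (hs : ∀ X Y, G X Y = G Y X) (X Y : E) : G (orbitRefl G u v X) Y = G X (orbitRefl G u v Y) := by
  rw [orbitRefl_apply, orbitRefl_apply]
  simp only [map_sub, map_add, map_smul, sub_apply, add_apply, smul_apply, smul_eq_mul]
  rw [hs X u, hs X v, coFst_apply, coSnd_apply, coFst_apply, coSnd_apply]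
  ring

theorem orbitRefl_eq_self_iff (hs : ∀ X Y, G X Y = G Y X)
     (hd : gramDet G u v ≠ 0) (X : E) : orbitRefl G u v X = X ↔ G u X = 0 ∧ G v X = 0 := by
  constructor
  · intro h
    constructor
    · have h1 := orbitRefl_symm (u := u) (v := v) hs u X
      rw [h, orbitRefl_fst hs hd, map_neg, neg_apply] at h1
      linarith
    · have h1 := orbitRefl_symm (u := u) (v := v) hs v X
      rw [h, orbitRefl_snd hs hd, map_neg, neg_apply] at h1
      linarith
  · rintro ⟨h1, h2⟩
    rw [orbitRefl_apply, coFst_apply, coSnd_apply, h1, h2]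
    simp

theorem exists_orbit_split (hs : ∀ X Y, G X Y = G Y X)
     (hd : gramDet G u v ≠ 0) (X : E) : ∃ (a b : ℝ) (Y : E), orbitRefl G u v Y = Y ∧
    X = Y + a • u + b • v := by
  refine ⟨coFst G u v X, coSnd G u v X, X - (coFst G u v X • u + coSnd G u v X • v), ?_, by module⟩
  rw [map_sub, map_add, map_smul, map_smul, orbitRefl_fst hs hd, orbitRefl_snd hs hd,
    orbitRefl_apply]
  module

/-- Anticommutation sends the fixed space of the reflection into the orbit plane, while
self-adjointness and the vanishing on u, v make the image orthogonal to that plane; the plane is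
nondegenerate. -/
theorem eq_zero_of_anticommute (hs : ∀ X Y, G X Y = G Y X)
     (hd : gramDet G u v ≠ 0) {S : E →L[ℝ] E} (hu : S u = 0) (hv : S v = 0)
    (hS : ∀ X Y, G (S X) Y = G X (S Y))
    (hSR : ∀ X, S (orbitRefl G u v X) + orbitRefl G u v (S X) = 0) : S = 0 := by
  ext X
  obtain ⟨a, b, Y, hY, rfl⟩ := exists_orbit_split hs hd X
  have h1 := hSR Y
  rw [hY, orbitRefl_apply] at h1
  have h2 : S Y = coFst G u v (S Y) • u + coSnd G u v (S Y) • v := by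
    linear_combination (norm := module) (1 / 2 : ℝ) • h1
  have h3 : G u (S Y) = 0 := by rw [← hS, hu]; simp
  have h4 : G v (S Y) = 0 := by rw [← hS, hv]; simp
  rw [coFst_apply, coSnd_apply, h3, h4] at h2
  simp only [map_add, map_smul, hu, hv]
  rw [h2]; simp

theorem contDiffOn_gramDet {D : Type*} [NormedAddCommGroup D]
    [NormedSpace ℝ D] {m : WithTop ℕ∞} {U : Set D} {G : D → E →L[ℝ] E →L[ℝ] ℝ} {u v : D → E}
    (hG : ContDiffOn ℝ m G U) (hu : ContDiffOn ℝ m u U) (hv : ContDiffOn ℝ m v U) :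
    ContDiffOn ℝ m (fun x => gramDet (G x) (u x) (v x)) U :=
  (((hG.clm_apply hu).clm_apply hu).mul ((hG.clm_apply hv).clm_apply hv)).sub
    (((hG.clm_apply hu).clm_apply hv).pow 2)

theorem contDiffOn_coFst {D : Type*} [NormedAddCommGroup D]
    [NormedSpace ℝ D] {m : WithTop ℕ∞} {U : Set D} {G : D → E →L[ℝ] E →L[ℝ] ℝ} {u v : D → E}
    (hG : ContDiffOn ℝ m G U) (hu : ContDiffOn ℝ m u U) (hv : ContDiffOn ℝ m v U)
    (h0 : ∀ x ∈ U, gramDet (G x) (u x) (v x) ≠ 0) :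
    ContDiffOn ℝ m (fun x => coFst (G x) (u x) (v x)) U :=
  ((contDiffOn_gramDet hG hu hv).inv h0).smul
    ((((hG.clm_apply hv).clm_apply hv).smul (hG.clm_apply hu)).sub
      (((hG.clm_apply hu).clm_apply hv).smul (hG.clm_apply hv)))

theorem contDiffOn_coSnd {D : Type*} [NormedAddCommGroup D]
    [NormedSpace ℝ D] {m : WithTop ℕ∞} {U : Set D} {G : D → E →L[ℝ] E →L[ℝ] ℝ} {u v : D → E}
    (hG : ContDiffOn ℝ m G U) (hu : ContDiffOn ℝ m u U) (hv : ContDiffOn ℝ m v U)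
    (h0 : ∀ x ∈ U, gramDet (G x) (u x) (v x) ≠ 0) :
    ContDiffOn ℝ m (fun x => coSnd (G x) (u x) (v x)) U :=
  ((contDiffOn_gramDet hG hu hv).inv h0).smul
    ((((hG.clm_apply hu).clm_apply hu).smul (hG.clm_apply hv)).sub
      (((hG.clm_apply hu).clm_apply hv).smul (hG.clm_apply hu)))

theorem contDiffOn_orbitProj {D : Type*} [NormedAddCommGroup D]
    [NormedSpace ℝ D] {m : WithTop ℕ∞} {U : Set D} {G : D → E →L[ℝ] E →L[ℝ] ℝ} {u v : D → E}
    (hG : ContDiffOn ℝ m G U) (hu : ContDiffOn ℝ m u U) (hv : ContDiffOn ℝ m v U)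
    (h0 : ∀ x ∈ U, gramDet (G x) (u x) (v x) ≠ 0) :
    ContDiffOn ℝ m (fun x => orbitProj (G x) (u x) (v x)) U :=
  ((contDiffOn_coFst hG hu hv h0).smulRight hu).add ((contDiffOn_coSnd hG hu hv h0).smulRight hv)

theorem contDiffOn_orbitRefl {D : Type*} [NormedAddCommGroup D]
    [NormedSpace ℝ D] {m : WithTop ℕ∞} {U : Set D} {G : D → E →L[ℝ] E →L[ℝ] ℝ} {u v : D → E}
    (hG : ContDiffOn ℝ m G U) (hu : ContDiffOn ℝ m u U) (hv : ContDiffOn ℝ m v U)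
    (h0 : ∀ x ∈ U, gramDet (G x) (u x) (v x) ≠ 0) :
    ContDiffOn ℝ m (fun x => orbitRefl (G x) (u x) (v x)) U :=
  contDiffOn_const.sub ((contDiffOn_orbitProj hG hu hv h0).const_smul (2 : ℝ))

end OrbitAlgebra

/-! ### The Levi-Civita connection in coordinates. -/

section LeviCivita

variable {E : Type} [NormedAddCommGroup E] [NormedSpace ℝ E]

/-- Exchanging the arguments of bilinear forms. -/
noncomputable def flipForm : (E →L[ℝ] E →L[ℝ] ℝ) →L[ℝ] (E →L[ℝ] E →L[ℝ] ℝ) :=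
  ((ContinuousLinearMap.flipₗᵢ ℝ E E ℝ).toContinuousLinearEquiv :
    (E →L[ℝ] E →L[ℝ] ℝ) →L[ℝ] (E →L[ℝ] E →L[ℝ] ℝ))

/-- The Christoffel symbols of the first kind (twice) of a metric with first derivative `T`. -/
noncomputable def christoffelFirst (T : E →L[ℝ] E →L[ℝ] E →L[ℝ] ℝ) :
    E →L[ℝ] E →L[ℝ] E →L[ℝ] ℝ :=
  let T₁ : E →L[ℝ] E →L[ℝ] E →L[ℝ] ℝ := T.flip
  let T₂ : E →L[ℝ] E →L[ℝ] E →L[ℝ] ℝ := flipForm ∘L T₁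
  T + T₁ - T₂

theorem christoffelFirst_apply (T : E →L[ℝ] E →L[ℝ] E →L[ℝ] ℝ) (X Y Z : E) :
    christoffelFirst T X Y Z = T X Y Z + T Y X Z - T Z X Y := rfl

/-- The coefficients of the Levi-Civita connection of `G`. -/
noncomputable def leviCivita (G : E → E →L[ℝ] E →L[ℝ] ℝ) (x : E) : E →L[ℝ] E →L[ℝ] E :=
  (ContinuousLinearMap.compL ℝ E (E →L[ℝ] ℝ) E ((1 / 2 : ℝ) • ContinuousLinearMap.inverse (G x))) ∘L
    christoffelFirst (fderiv ℝ G x)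

theorem leviCivita_apply (G : E → E →L[ℝ] E →L[ℝ] ℝ) (x X Y : E) :
    leviCivita G x X Y =
      (1 / 2 : ℝ) • ContinuousLinearMap.inverse (G x) (christoffelFirst (fderiv ℝ G x) X Y) := rfl

end LeviCivita

/-! ### Stationary and axisymmetric geometries on open sets of a vector space. -/

/-- A stationary and axisymmetric geometry on an open set of a vector space: a metric `G` of class
`C^{n+1}` with commuting Killing vectors `ξ`, `η` whose orthogonal distribution is integrable off
the axis. -/
structure AxialGeometry {E : Type} [NormedAddCommGroup E] [NormedSpace ℝ E] (n : ℕ) (U : Set E)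
    (G : E → E →L[ℝ] E →L[ℝ] ℝ) (ξ η : E → E) : Prop where
  two_le : 2 ≤ n
  isOpen : IsOpen U
  metric_class : ContDiffOn ℝ (n + 1 : ℕ) G U
  xi_class : ContDiffOn ℝ (n + 1 : ℕ) ξ U
  eta_class : ContDiffOn ℝ (n + 1 : ℕ) η U
  symm : ∀ x ∈ U, ∀ X Y, G x X Y = G x Y X
  spatial : ∀ x ∈ U, ∀ w, G x (ξ x) w = 0 → w ≠ 0 → 0 < G x w w
  timelike : ∀ x ∈ U, G x (ξ x) (ξ x) < 0
  spacelike : ∀ x ∈ U, η x ≠ 0 → 0 < G x (η x) (η x)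
  killing_xi : ∀ x ∈ U, ∀ X Y, fderiv ℝ G x (ξ x) X Y + G x (fderiv ℝ ξ x X) Y
    + G x X (fderiv ℝ ξ x Y) = 0
  killing_eta : ∀ x ∈ U, ∀ X Y, fderiv ℝ G x (η x) X Y + G x (fderiv ℝ η x X) Y
    + G x X (fderiv ℝ η x Y) = 0
  commute : ∀ x ∈ U, fderiv ℝ ξ x (η x) = fderiv ℝ η x (ξ x)
  -- Frobenius condition: the exterior derivative of the metric dual of ξ vanishes on the complement
  -- of the orbits.
  ot_xi : ∀ x ∈ U, η x ≠ 0 → ∀ X Y, G x (ξ x) X = 0 → G x (η x) X = 0 → G x (ξ x) Y = 0 →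
    G x (η x) Y = 0 → fderiv ℝ (fun y => G y (ξ y)) x X Y = fderiv ℝ (fun y => G y (ξ y)) x Y X
  ot_eta : ∀ x ∈ U, η x ≠ 0 → ∀ X Y, G x (ξ x) X = 0 → G x (η x) X = 0 → G x (ξ x) Y = 0 →
    G x (η x) Y = 0 → fderiv ℝ (fun y => G y (η y)) x X Y = fderiv ℝ (fun y => G y (η y)) x Y X
  axis_thin : ∀ p ∈ U, (𝓝[{x | η x ≠ 0}] p).NeBot

namespace AxialGeometry

variable {E : Type} [NormedAddCommGroup E] [NormedSpace ℝ E] {n : ℕ} {U : Set E}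
  {G : E → E →L[ℝ] E →L[ℝ] ℝ} {ξ η : E → E}

theorem mono (A : AxialGeometry n U G ξ η) {V : Set E} (hV : IsOpen V) (h : V ⊆ U) :
    AxialGeometry n V G ξ η where
  two_le := A.two_le
  isOpen := hV
  metric_class := A.metric_class.mono h
  xi_class := A.xi_class.mono h
  eta_class := A.eta_class.mono h
  symm x hx := A.symm x (h hx)
  spatial x hx := A.spatial x (h hx)
  timelike x hx := A.timelike x (h hx)
  spacelike x hx := A.spacelike x (h hx)
  killing_xi x hx := A.killing_xi x (h hx)
  killing_eta x hx := A.killing_eta x (h hx)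
  commute x hx := A.commute x (h hx)
  ot_xi x hx := A.ot_xi x (h hx)
  ot_eta x hx := A.ot_eta x (h hx)
  axis_thin x hx := A.axis_thin x (h hx)

variable (A : AxialGeometry n U G ξ η) {x : E}
include A

theorem gramDet_ne (hx : x ∈ U) (hη : η x ≠ 0) : gramDet (G x) (ξ x) (η x) ≠ 0 := by
  have h1 := A.timelike x hx
  have h2 := A.spacelike x hx hη
  have : gramDet (G x) (ξ x) (η x) < 0 := by
    unfold gramDet
    nlinarith [mul_neg_of_neg_of_pos h1 h2, sq_nonneg (G x (ξ x) (η x))]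
  exact this.ne

theorem nondeg (hx : x ∈ U) {X : E} (h : ∀ Y, G x X Y = 0) : X = 0 := by
  by_contra hX
  have h1 : G x (ξ x) X = 0 := by rw [A.symm x hx, h]
  exact (A.spatial x hx X h1 hX).ne' (h X)

theorem ext_metric (hx : x ∈ U) {X Y : E} (h : ∀ Z, G x X Z = G x Y Z) : X = Y := by
  rw [← sub_eq_zero]
  exact A.nondeg hx fun Z => by rw [map_sub, sub_apply, h, sub_self]

theorem contDiffAt_metric (hx : x ∈ U) : ContDiffAt ℝ (n + 1 : ℕ) G x :=
  A.metric_class.contDiffAt (A.isOpen.mem_nhds hx)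

theorem metric_two : ContDiffOn ℝ 2 G U :=
  A.metric_class.of_le (by have := A.two_le; norm_cast; omega)

theorem xi_two : ContDiffOn ℝ 2 ξ U :=
  A.xi_class.of_le (by have := A.two_le; norm_cast; omega)

theorem eta_two : ContDiffOn ℝ 2 η U :=
  A.eta_class.of_le (by have := A.two_le; norm_cast; omega)

theorem hasFDerivAt_metric (hx : x ∈ U) : HasFDerivAt G (fderiv ℝ G x) x :=
  ((A.metric_two.contDiffAt (A.isOpen.mem_nhds hx)).differentiableAt two_ne_zero).hasFDerivAt

theorem hasFDerivAt_xi (hx : x ∈ U) : HasFDerivAt ξ (fderiv ℝ ξ x) x :=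
  ((A.xi_two.contDiffAt (A.isOpen.mem_nhds hx)).differentiableAt two_ne_zero).hasFDerivAt

theorem hasFDerivAt_eta (hx : x ∈ U) : HasFDerivAt η (fderiv ℝ η x) x :=
  ((A.eta_two.contDiffAt (A.isOpen.mem_nhds hx)).differentiableAt two_ne_zero).hasFDerivAt

theorem fderiv_metric_symm (hx : x ∈ U) (W X Y : E) :
    fderiv ℝ G x W X Y = fderiv ℝ G x W Y X := by
  have h1 : HasFDerivAt (fun y => G y X Y) _ x :=
    ((A.hasFDerivAt_metric hx).clm_apply (hasFDerivAt_const X x)).clm_apply (hasFDerivAt_const Y x)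
  have h2 : HasFDerivAt (fun y => G y Y X) _ x :=
    ((A.hasFDerivAt_metric hx).clm_apply (hasFDerivAt_const Y x)).clm_apply (hasFDerivAt_const X x)
  have h3 := h1.unique (h2.congr_of_eventuallyEq (by
    filter_upwards [A.isOpen.mem_nhds hx] with y hy using A.symm y hy X Y))
  have := congrArg (fun T : E →L[ℝ] ℝ => T W) h3
  simpa using this

theorem isOpen_off_axis : IsOpen (U ∩ {x | η x ≠ 0}) :=
  A.eta_class.continuousOn.isOpen_inter_preimage A.isOpen isOpen_compl_singleton

/-- The metric as an isomorphism onto the dual space. -/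
noncomputable def flatEquiv [FiniteDimensional ℝ E] (hx : x ∈ U) : E ≃L[ℝ] (E →L[ℝ] ℝ) :=
  LinearEquiv.toContinuousLinearEquiv (LinearEquiv.ofInjectiveOfFinrankEq (G x : E →ₗ[ℝ] (E →L[ℝ] ℝ))
    (by
      rw [← LinearMap.ker_eq_bot, LinearMap.ker_eq_bot']
      intro X hX
      exact A.nondeg hx fun Y => congrArg (fun T : E →L[ℝ] ℝ => T Y) hX)
    (by
      rw [LinearEquiv.finrank_eq (LinearMap.toContinuousLinearMap (E := E) (F' := ℝ) (𝕜 := ℝ)).symm]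
      exact (Subspace.dual_finrank_eq (K := ℝ) (V := E)).symm))

theorem coe_flatEquiv [FiniteDimensional ℝ E] (hx : x ∈ U) :
    (A.flatEquiv hx : E →L[ℝ] (E →L[ℝ] ℝ)) = G x := by
  ext X Y; rfl

theorem metric_inverse [FiniteDimensional ℝ E] (hx : x ∈ U) (α : E →L[ℝ] ℝ) :
    G x (ContinuousLinearMap.inverse (G x) α) = α := by
  have h := A.coe_flatEquiv hx
  have h2 : ContinuousLinearMap.inverse (G x) = ((A.flatEquiv hx).symm : (E →L[ℝ] ℝ) →L[ℝ] E) := by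
    rw [← h, ContinuousLinearMap.inverse_equiv]
  rw [h2]
  conv_lhs => rw [← h]
  simp

theorem contDiffOn_inverse [FiniteDimensional ℝ E] :
    ContDiffOn ℝ (n + 1 : ℕ) (fun x => ContinuousLinearMap.inverse (G x)) U := by
  intro x hx
  have h := A.coe_flatEquiv hx
  have h1 : ContDiffAt ℝ (n + 1 : ℕ) ContinuousLinearMap.inverse (G x) := by
    rw [← h]; exact contDiffAt_map_inverse _
  exact (h1.comp x (A.contDiffAt_metric hx)).contDiffWithinAt

theorem metric_leviCivita [FiniteDimensional ℝ E] (hx : x ∈ U) (X Y Z : E) :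
    G x (leviCivita G x X Y) Z =
      (1 / 2) * (fderiv ℝ G x X Y Z + fderiv ℝ G x Y X Z - fderiv ℝ G x Z X Y) := by
  rw [leviCivita_apply, map_smul, A.metric_inverse hx, smul_apply, christoffelFirst_apply,
    smul_eq_mul]

theorem leviCivita_symm [FiniteDimensional ℝ E] (hx : x ∈ U) (X Y : E) :
    leviCivita G x X Y = leviCivita G x Y X := by
  refine A.ext_metric hx fun Z => ?_
  rw [A.metric_leviCivita hx, A.metric_leviCivita hx, A.fderiv_metric_symm hx Z X Y]
  ring

theorem leviCivita_metric [FiniteDimensional ℝ E] (hx : x ∈ U) (X Y Z : E) :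
    fderiv ℝ G x X Y Z = G x (leviCivita G x X Y) Z + G x Y (leviCivita G x X Z) := by
  rw [A.symm x hx Y, A.metric_leviCivita hx, A.metric_leviCivita hx, A.fderiv_metric_symm hx X Z Y]
  ring

theorem contDiffOn_leviCivita [FiniteDimensional ℝ E] : ContDiffOn ℝ n (leviCivita G) U := by
  rw [contDiffOn_clm_apply]
  intro X
  rw [contDiffOn_clm_apply]
  intro Y
  simp only [leviCivita_apply]
  refine contDiffOn_const.smul (ContDiffOn.clm_apply (A.contDiffOn_inverse.of_le ?_) ?_)
  · norm_cast; omega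
  rw [contDiffOn_clm_apply]
  intro Z
  simp only [christoffelFirst_apply]
  have h : ContDiffOn ℝ n (fderiv ℝ G) U :=
    A.metric_class.fderiv_of_isOpen A.isOpen (by norm_cast)
  exact ((((h.clm_apply contDiffOn_const).clm_apply contDiffOn_const).clm_apply
      contDiffOn_const).add (((h.clm_apply contDiffOn_const).clm_apply contDiffOn_const).clm_apply
      contDiffOn_const)).sub (((h.clm_apply contDiffOn_const).clm_apply contDiffOn_const).clm_apply
      contDiffOn_const)

/-- The Levi-Civita connection is invariant under Killing vectors. -/
theorem leviCivita_killing [FiniteDimensional ℝ E] {ζ : E → E} (hζ : ContDiffOn ℝ 2 ζ U)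
    (hk : ∀ x ∈ U, ∀ X Y, fderiv ℝ G x (ζ x) X Y + G x (fderiv ℝ ζ x X) Y
      + G x X (fderiv ℝ ζ x Y) = 0) (hx : x ∈ U) (X : E) :
    fderiv ℝ (fderiv ℝ ζ) x X + fderiv ℝ (leviCivita G) x (ζ x) X
      - fderiv ℝ ζ x ∘L leviCivita G x X + leviCivita G x (fderiv ℝ ζ x X)
      + leviCivita G x X ∘L fderiv ℝ ζ x = 0 := by
  have hUx := A.isOpen.mem_nhds hx
  have hζx : ContDiffAt ℝ 2 ζ x := hζ.contDiffAt hUx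
  have dζ : HasFDerivAt ζ (fderiv ℝ ζ x) x := (hζx.differentiableAt two_ne_zero).hasFDerivAt
  have dζ2 : HasFDerivAt (fderiv ℝ ζ) (fderiv ℝ (fderiv ℝ ζ) x) x :=
    ((hζx.fderiv_right (m := 1) (by norm_num)).differentiableAt one_ne_zero).hasFDerivAt
  have hGx : ContDiffAt ℝ 2 G x := A.metric_two.contDiffAt hUx
  have dG := A.hasFDerivAt_metric hx
  have dG2 : HasFDerivAt (fderiv ℝ G) (fderiv ℝ (fderiv ℝ G) x) x :=
    ((hGx.fderiv_right (m := 1) (by norm_num)).differentiableAt one_ne_zero).hasFDerivAt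
  have hn := A.two_le
  have dΓ : HasFDerivAt (leviCivita G) (fderiv ℝ (leviCivita G) x) x :=
    ((A.contDiffOn_leviCivita.contDiffAt hUx).differentiableAt (by norm_cast; omega)).hasFDerivAt
  have hsymG : ∀ V W, fderiv ℝ (fderiv ℝ G) x V W = fderiv ℝ (fderiv ℝ G) x W V := fun V W =>
    (hGx.isSymmSndFDerivAt (by simp)) V W
  have hsymζ : ∀ V W, fderiv ℝ (fderiv ℝ ζ) x V W = fderiv ℝ (fderiv ℝ ζ) x W V := fun V W =>
    (hζx.isSymmSndFDerivAt (by simp)) V W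
  -- the derivative of the Killing equation
  have key : ∀ W Y Z, fderiv ℝ (fderiv ℝ G) x (ζ x) W Y Z + fderiv ℝ G x (fderiv ℝ ζ x W) Y Z
      + fderiv ℝ G x W (fderiv ℝ ζ x Y) Z + G x (fderiv ℝ (fderiv ℝ ζ) x W Y) Z
      + fderiv ℝ G x W Y (fderiv ℝ ζ x Z) + G x Y (fderiv ℝ (fderiv ℝ ζ) x W Z) = 0 := by
    intro W Y Z
    have h0 : HasFDerivAt (fun y => fderiv ℝ G y (ζ y) Y Z + G y (fderiv ℝ ζ y Y) Z
        + G y Y (fderiv ℝ ζ y Z)) (0 : E →L[ℝ] ℝ) x := by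
      refine (hasFDerivAt_const (0 : ℝ) x).congr_of_eventuallyEq ?_
      filter_upwards [hUx] with y hy using hk y hy Y Z
    have cY := hasFDerivAt_const (𝕜 := ℝ) Y x
    have cZ := hasFDerivAt_const (𝕜 := ℝ) Z x
    have h1 := ((((dG2.clm_apply dζ).clm_apply cY).clm_apply cZ).add
      ((dG.clm_apply (dζ2.clm_apply cY)).clm_apply cZ)).add
      ((dG.clm_apply cY).clm_apply (dζ2.clm_apply cZ))
    have h2 := congrArg (fun T : E →L[ℝ] ℝ => T W) (h1.unique h0)
    simp at h2
    rw [hsymG (ζ x) W]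
    linarith
  ext Y
  refine A.nondeg hx fun Z => ?_
  -- the derivative of the Christoffel symbols of the first kind
  have hΓ : fderiv ℝ G x (ζ x) (leviCivita G x X Y) Z + G x (fderiv ℝ (leviCivita G) x (ζ x) X Y) Z
      = (1 / 2) * (fderiv ℝ (fderiv ℝ G) x (ζ x) X Y Z + fderiv ℝ (fderiv ℝ G) x (ζ x) Y X Z
        - fderiv ℝ (fderiv ℝ G) x (ζ x) Z X Y) := by
    have cX := hasFDerivAt_const (𝕜 := ℝ) X x
    have cY := hasFDerivAt_const (𝕜 := ℝ) Y x
    have cZ := hasFDerivAt_const (𝕜 := ℝ) Z x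
    have h1 := (dG.clm_apply ((dΓ.clm_apply cX).clm_apply cY)).clm_apply cZ
    have h2 := (((((dG2.clm_apply cX).clm_apply cY).clm_apply cZ).add
      (((dG2.clm_apply cY).clm_apply cX).clm_apply cZ)).sub
      (((dG2.clm_apply cZ).clm_apply cX).clm_apply cY)).const_mul (1 / 2 : ℝ)
    have h3 := h1.unique (h2.congr_of_eventuallyEq (by
      filter_upwards [hUx] with y hy using A.metric_leviCivita hy X Y Z))
    have h4 := congrArg (fun T : E →L[ℝ] ℝ => T (ζ x)) h3
    simp at h4
    linarith
  -- The differentiated Killing equation is used for three permutations of the arguments and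
  -- combined as in the Koszul formula.
  have k1 := key X Y Z
  have k2 := key Y X Z
  have k3 := key Z X Y
  have g1 := A.metric_leviCivita hx (fderiv ℝ ζ x X) Y Z
  have g2 := A.metric_leviCivita hx X (fderiv ℝ ζ x Y) Z
  have g3 := A.metric_leviCivita hx X Y (fderiv ℝ ζ x Z)
  have kk := hk x hx (leviCivita G x X Y) Z
  rw [hsymζ Y X, A.symm x hx X (fderiv ℝ (fderiv ℝ ζ) x Y Z)] at k2
  rw [hsymζ Z X, hsymζ Z Y, A.symm x hx X, A.fderiv_metric_symm hx Z X] at k3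
  rw [A.symm x hx Y (fderiv ℝ (fderiv ℝ ζ) x X Z)] at k1
  rw [A.fderiv_metric_symm hx Z X] at g2
  simp only [add_apply, sub_apply, ContinuousLinearMap.comp_apply, map_add, map_sub]
  linarith

/-- A Killing vector whose 1-jet vanishes at a point of a connected open set vanishes nearby; hence
the derivative of the axial vector does not vanish on the axis. -/
theorem axis_deriv [FiniteDimensional ℝ E] (p : E) (hp : p ∈ U) (h0 : η p = 0) :
    fderiv ℝ η p ≠ 0 := by
  intro hD
  obtain ⟨r, hr, hrU⟩ := Metric.isOpen_iff.1 A.isOpen p hp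
  have hn := A.two_le
  have dη2 : ∀ x ∈ U, HasFDerivAt (fderiv ℝ η) (fderiv ℝ (fderiv ℝ η) x) x := fun x hx =>
    (((A.eta_two.contDiffAt (A.isOpen.mem_nhds hx)).fderiv_right (m := 1) (by norm_num)
      ).differentiableAt one_ne_zero).hasFDerivAt
  -- The invariance of the connection expresses the second derivative of `η` linearly through its
  -- 1-jet `y`.
  set y : E → E × (E →L[ℝ] E) := fun x => (η x, fderiv ℝ η x) with hy
  have dy : ∀ x ∈ U, HasFDerivAt y ((fderiv ℝ η x).prod (fderiv ℝ (fderiv ℝ η) x)) x :=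
    fun x hx => (A.hasFDerivAt_eta hx).prodMk (dη2 x hx)
  have cΓ : ContinuousOn (leviCivita G) U := A.contDiffOn_leviCivita.continuousOn
  have cΓ' : ContinuousOn (fderiv ℝ (leviCivita G)) U :=
    A.contDiffOn_leviCivita.continuousOn_fderiv_of_isOpen A.isOpen (by norm_cast; omega)
  have b1 : ∀ᶠ x in 𝓝 p, ‖leviCivita G x‖ < ‖leviCivita G p‖ + 1 :=
    (cΓ.continuousAt (A.isOpen.mem_nhds hp)).norm.eventually (gt_mem_nhds (by linarith))
  have b2 : ∀ᶠ x in 𝓝 p, ‖fderiv ℝ (leviCivita G) x‖ < ‖fderiv ℝ (leviCivita G) p‖ + 1 :=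
    (cΓ'.continuousAt (A.isOpen.mem_nhds hp)).norm.eventually (gt_mem_nhds (by linarith))
  set a := ‖leviCivita G p‖ + 1
  set b := ‖fderiv ℝ (leviCivita G) p‖ + 1
  have ha : 0 ≤ a := by positivity
  have hb : 0 ≤ b := by positivity
  obtain ⟨s, hs, hball⟩ := Metric.eventually_nhds_iff_ball.1
    ((b1.and b2).and (A.isOpen.mem_nhds hp))
  -- The constant collects one term with the derivative of Γ (`b`), three terms with Γ (`a`), and 1
  -- for the first component of the jet.
  have hbound : ∀ x ∈ Metric.ball p s,
      ‖(fderiv ℝ η x).prod (fderiv ℝ (fderiv ℝ η) x)‖ ≤ (1 + b + 3 * a) * ‖y x‖ := by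
    intro x hx
    obtain ⟨⟨h1, h2⟩, hxU⟩ := hball x hx
    have n1 : ‖η x‖ ≤ ‖y x‖ := norm_fst_le (y x)
    have n2 : ‖fderiv ℝ η x‖ ≤ ‖y x‖ := norm_snd_le (y x)
    have ny := norm_nonneg (y x)
    have hsecond : ‖fderiv ℝ (fderiv ℝ η) x‖ ≤ (1 + b + 3 * a) * ‖y x‖ := by
      refine ContinuousLinearMap.opNorm_le_bound _ (by positivity) fun X => ?_
      have hk := A.leviCivita_killing A.eta_two A.killing_eta hxU X
      have e1 : fderiv ℝ (fderiv ℝ η) x X = - fderiv ℝ (leviCivita G) x (η x) X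
          + fderiv ℝ η x ∘L leviCivita G x X - leviCivita G x (fderiv ℝ η x X)
          - leviCivita G x X ∘L fderiv ℝ η x := by
        linear_combination (norm := module) (1 : ℝ) • hk
      have m1 : ‖fderiv ℝ (leviCivita G) x (η x) X‖ ≤ b * ‖y x‖ * ‖X‖ := by
        refine (ContinuousLinearMap.le_opNorm₂ _ _ _).trans ?_
        gcongr
      have m0 : ‖leviCivita G x X‖ ≤ a * ‖X‖ :=
        (ContinuousLinearMap.le_opNorm _ _).trans (by gcongr)
      have m2 : ‖fderiv ℝ η x ∘L leviCivita G x X‖ ≤ ‖y x‖ * (a * ‖X‖) :=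
        (ContinuousLinearMap.opNorm_comp_le _ _).trans (by gcongr)
      have m3 : ‖leviCivita G x (fderiv ℝ η x X)‖ ≤ a * (‖y x‖ * ‖X‖) := by
        refine (ContinuousLinearMap.le_opNorm _ _).trans ?_
        have := (fderiv ℝ η x).le_opNorm X
        gcongr
        exact this.trans (by gcongr)
      have m4 : ‖leviCivita G x X ∘L fderiv ℝ η x‖ ≤ a * ‖X‖ * ‖y x‖ :=
        (ContinuousLinearMap.opNorm_comp_le _ _).trans (by gcongr)
      rw [e1]
      refine (norm_sub_le _ _).trans ?_
      refine (add_le_add_left (norm_sub_le _ _) _).trans ?_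
      refine (add_le_add_left (add_le_add_left (norm_add_le _ _) _) _).trans ?_
      rw [norm_neg]
      nlinarith [mul_nonneg ny (norm_nonneg X)]
    refine ContinuousLinearMap.opNorm_le_bound _ (by positivity) fun X => ?_
    rw [ContinuousLinearMap.prod_apply, Prod.norm_def]
    refine max_le ?_ ((ContinuousLinearMap.le_opNorm _ _).trans (by gcongr))
    refine (ContinuousLinearMap.le_opNorm _ _).trans ?_
    have : ‖fderiv ℝ η x‖ ≤ (1 + b + 3 * a) * ‖y x‖ := by
      nlinarith [mul_nonneg hb ny, mul_nonneg ha ny]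
    gcongr
  have hzero : ∀ x ∈ Metric.ball p s, y x = 0 := by
    intro x hx
    have hseg : ∀ t ∈ Icc (0 : ℝ) 1, p + t • (x - p) ∈ Metric.ball p s := by
      intro t ht
      have := (convex_ball p s).add_smul_sub_mem (Metric.mem_ball_self hs) hx ht
      exact this
    have hd : ∀ t ∈ Icc (0 : ℝ) 1, HasDerivAt (fun t : ℝ => y (p + t • (x - p)))
        (((fderiv ℝ η (p + t • (x - p))).prod (fderiv ℝ (fderiv ℝ η) (p + t • (x - p)))) (x - p))
        t := by
      intro t ht
      have h1 : HasDerivAt (fun t : ℝ => p + t • (x - p)) (x - p) t := by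
        simpa using ((hasDerivAt_id t).smul_const (x - p)).const_add p
      exact (dy _ (hball _ (hseg t ht)).2).comp_hasDerivAt t h1
    have hg := norm_le_gronwallBound_of_norm_deriv_right_le (δ := 0)
      (K := (1 + b + 3 * a) * ‖x - p‖) (ε := 0) (a := 0) (b := 1)
      (fun t ht => (hd t ht).continuousAt.continuousWithinAt)
      (fun t ht => (hd t ⟨ht.1, ht.2.le⟩).hasDerivWithinAt)
      (by simp [hy, h0, hD]) (fun t ht => by
        have := hbound _ (hseg t ⟨ht.1, ht.2.le⟩)
        rw [add_zero]
        refine (ContinuousLinearMap.le_opNorm _ _).trans ?_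
        nlinarith [norm_nonneg (x - p)]) 1 (right_mem_Icc.2 zero_le_one)
    rw [gronwallBound_ε0_δ0] at hg
    simpa using hg
  -- A vanishing 1-jet thus forces `η` to vanish on a ball, but the axis has no interior.
  have hne := A.axis_thin p hp
  obtain ⟨x, hx1, hx2⟩ := (hne.nonempty_of_mem (inter_mem self_mem_nhdsWithin
    (mem_nhdsWithin_of_mem_nhds (Metric.ball_mem_nhds p hs))))
  exact hx1 (congrArg Prod.fst (hzero x hx2))

end AxialGeometry

/-! ### Derivatives of the orbit reflection. -/

section OrbitDerivative

variable {E : Type} [NormedAddCommGroup E] [NormedSpace ℝ E]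

/-- An antisymmetric endomorphism that is block off-diagonal with respect to the orbits
anticommutes with the reflection. -/
theorem orbitRefl_conj_eq_neg {G : E →L[ℝ] E →L[ℝ] ℝ} {u v : E} (hs : ∀ X Y, G X Y = G Y X)
    (hd : gramDet G u v ≠ 0) (hn : ∀ X, (∀ Y, G X Y = 0) → X = 0) {A : E →L[ℝ] E}
    (hA : ∀ X Y, G (A X) Y = - G X (A Y)) (huv : G (A u) v = 0)
    (hot : ∀ X Y, orbitRefl G u v X = X → orbitRefl G u v Y = Y → G (A X) Y = 0) :
    orbitRefl G u v ∘L A ∘L orbitRefl G u v = - A := by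
  have e1 : G (A u) u = 0 := by have := hA u u; rw [hs u] at this; linarith
  have e2 : G (A v) v = 0 := by have := hA v v; rw [hs v] at this; linarith
  have e3 : G (A v) u = 0 := by rw [hA, hs, huv, neg_zero]
  ext X
  rw [← sub_eq_zero]
  refine hn _ fun Z => ?_
  rw [map_sub, sub_apply, sub_eq_zero]
  simp only [ContinuousLinearMap.comp_apply, neg_apply, map_neg]
  rw [orbitRefl_symm hs]
  obtain ⟨a, b, Y, hY, rfl⟩ := exists_orbit_split hs hd X
  obtain ⟨c, d, W, hW, rfl⟩ := exists_orbit_split hs hd Z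
  have e4 := hot Y W hY hW
  simp only [map_add, map_smul, hY, hW, orbitRefl_fst hs hd, orbitRefl_snd hs hd, map_neg,
    add_apply, smul_apply, neg_apply, smul_eq_mul, e1, e2, e3, e4, huv]
  ring

/-- The covariant derivative of the orbit reflection vanishes if those of the metric and of the
orbits do. -/
theorem fderiv_orbitRefl_eq {G : E → E →L[ℝ] E →L[ℝ] ℝ} {ξ η : E → E} {x : E}
    {G' : E →L[ℝ] E →L[ℝ] E →L[ℝ] ℝ} {ξ' η' : E →L[ℝ] E} (hG : HasFDerivAt G G' x)
    (hξ : HasFDerivAt ξ ξ' x) (hη : HasFDerivAt η η' x)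
    (hs : ∀ᶠ y in 𝓝 x, ∀ X Y, G y X Y = G y Y X)
    (hd : ∀ᶠ y in 𝓝 x, gramDet (G y) (ξ y) (η y) ≠ 0)
    (hR : DifferentiableAt ℝ (fun y => orbitRefl (G y) (ξ y) (η y)) x)
    (Y : E) (T : E →L[ℝ] E) (hT : ∀ a b, G' Y a b = G x (T a) b + G x a (T b))
    (hξT : orbitRefl (G x) (ξ x) (η x) (ξ' Y + T (ξ x)) = - (ξ' Y + T (ξ x)))
    (hηT : orbitRefl (G x) (ξ x) (η x) (η' Y + T (η x)) = - (η' Y + T (η x))) :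
    fderiv ℝ (fun y => orbitRefl (G y) (ξ y) (η y)) x Y =
      orbitRefl (G x) (ξ x) (η x) ∘L T - T ∘L orbitRefl (G x) (ξ x) (η x) := by
  set R := fun y => orbitRefl (G y) (ξ y) (η y) with hRdef
  have hRx : orbitRefl (G x) (ξ x) (η x) = R x := rfl
  have hs' := hs.self_of_nhds
  have hd' := hd.self_of_nhds
  have dR := hR.hasFDerivAt
  -- With T in the role of a connection matrix, the left side is the covariant derivative of R.
  -- Differentiating Rξ = -ξ, Rη = -η, the self-adjointness of R and R² = 1 gives the hypotheses of
  -- `eq_zero_of_anticommute`.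
  have key : fderiv ℝ R x Y + T ∘L R x - R x ∘L T = 0 := by
    refine eq_zero_of_anticommute hs' hd' ?_ ?_ ?_ ?_
    · have h1 := (dR.clm_apply hξ).unique (hξ.neg.congr_of_eventuallyEq (by
        filter_upwards [hs, hd] with y h1 h2 using orbitRefl_fst h1 h2))
      have h2 := congrArg (fun L : E →L[ℝ] E => L Y) h1
      simp at h2
      have h3 : R x (ξ x) = - ξ x := orbitRefl_fst hs' hd'
      rw [hRx, map_add] at hξT
      simp only [add_apply, sub_apply, ContinuousLinearMap.comp_apply, h3, map_neg]
      linear_combination (norm := module) (1 : ℝ) • h2 - (1 : ℝ) • hξT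
    · have h1 := (dR.clm_apply hη).unique (hη.neg.congr_of_eventuallyEq (by
        filter_upwards [hs, hd] with y h1 h2 using orbitRefl_snd h1 h2))
      have h2 := congrArg (fun L : E →L[ℝ] E => L Y) h1
      simp at h2
      have h3 : R x (η x) = - η x := orbitRefl_snd hs' hd'
      rw [hRx, map_add] at hηT
      simp only [add_apply, sub_apply, ContinuousLinearMap.comp_apply, h3, map_neg]
      linear_combination (norm := module) (1 : ℝ) • h2 - (1 : ℝ) • hηT
    · intro X Z
      have h1 : HasFDerivAt (fun y => G y (R y X) Z) _ x :=
        (hG.clm_apply (dR.clm_apply (hasFDerivAt_const X x))).clm_apply (hasFDerivAt_const Z x)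
      have h2 : HasFDerivAt (fun y => G y X (R y Z)) _ x :=
        (hG.clm_apply (hasFDerivAt_const X x)).clm_apply (dR.clm_apply (hasFDerivAt_const Z x))
      have h3 := h1.unique (h2.congr_of_eventuallyEq (by
        filter_upwards [hs] with y hy using orbitRefl_symm hy X Z))
      have h4 := congrArg (fun L : E →L[ℝ] ℝ => L Y) h3
      simp [hT] at h4
      simp only [add_apply, sub_apply, ContinuousLinearMap.comp_apply, map_add, map_sub]
      have h5 : G x (R x (T X)) Z = G x (T X) (R x Z) := orbitRefl_symm hs' _ _
      have h6 : G x (R x X) (T Z) = G x X (R x (T Z)) := orbitRefl_symm hs' _ _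
      linarith
    · intro X
      have h1 : HasFDerivAt (fun y => R y (R y X)) _ x :=
        dR.clm_apply (dR.clm_apply (hasFDerivAt_const X x))
      have h3 := h1.unique ((hasFDerivAt_const X x).congr_of_eventuallyEq (by
        filter_upwards [hs, hd] with y h1 h2 using orbitRefl_orbitRefl h1 h2 X))
      have h4 := congrArg (fun L : E →L[ℝ] E => L Y) h3
      simp at h4
      have h5 : ∀ W, R x (R x W) = W := orbitRefl_orbitRefl hs' hd'
      rw [hRx]
      simp only [add_apply, sub_apply, ContinuousLinearMap.comp_apply, map_add, map_sub, h5]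
      linear_combination (norm := module) (1 : ℝ) • h4
  rw [hRx]
  linear_combination (norm := module) (1 : ℝ) • key

end OrbitDerivative

namespace AxialGeometry

variable {E : Type} [NormedAddCommGroup E] [NormedSpace ℝ E] [FiniteDimensional ℝ E] {n : ℕ}
  {U : Set E} {G : E → E →L[ℝ] E →L[ℝ] ℝ} {ξ η : E → E}

theorem metric_killing_antisymm (A : AxialGeometry n U G ξ η) {x : E} (hx : x ∈ U) {z : E}
    {ζ' : E →L[ℝ] E}
    (hk : ∀ X Y, fderiv ℝ G x z X Y + G x (ζ' X) Y + G x X (ζ' Y) = 0) (X Y : E) :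
    G x ((ζ' + leviCivita G x z) X) Y = - G x X ((ζ' + leviCivita G x z) Y) := by
  have h1 := hk X Y
  have h2 := A.leviCivita_metric hx z X Y
  simp only [add_apply, map_add]
  linarith

/-- The antisymmetric part of the derivative of the dual form is that of ∇ζ, since the Christoffel
terms are symmetric; ∇ζ is itself antisymmetric by the Killing equation, so it vanishes wherever
this antisymmetric part does. -/
theorem metric_killing_eq_zero (A : AxialGeometry n U G ξ η) {x : E} (hx : x ∈ U) {ζ : E → E}
    {ζ' : E →L[ℝ] E} (hζ : HasFDerivAt ζ ζ' x)
    (hk : ∀ X Y, fderiv ℝ G x (ζ x) X Y + G x (ζ' X) Y + G x X (ζ' Y) = 0)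
    {X Y : E} (hX : G x (ζ x) X = 0) (hY : G x (ζ x) Y = 0)
    (h : fderiv ℝ (fun y => G y (ζ y)) x X Y = fderiv ℝ (fun y => G y (ζ y)) x Y X) :
    G x ((ζ' + leviCivita G x (ζ x)) X) Y = 0 := by
  have hD : ∀ V W, fderiv ℝ (fun y => G y (ζ y)) x V W =
      G x ((ζ' + leviCivita G x (ζ x)) V) W + G x (ζ x) (leviCivita G x V W) := by
    intro V W
    rw [((A.hasFDerivAt_metric hx).clm_apply hζ).fderiv]
    have := A.leviCivita_metric hx V (ζ x) W
    simp [this, A.leviCivita_symm hx (ζ x) V]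
    ring
  rw [hD, hD, A.leviCivita_symm hx Y X] at h
  have h2 := A.metric_killing_antisymm hx hk X Y
  rw [A.symm x hx X] at h2
  linarith

/-- Both diagonal blocks of ∇ξ and ∇η vanish. On the complement this is the Frobenius condition. On
the orbit plane it follows from antisymmetry together with ∇_ξ η = ∇_η ξ, which holds because the
fields commute. -/
theorem anti (A : AxialGeometry n U G ξ η) {x : E} (hx : x ∈ U) (hη : η x ≠ 0) :
    orbitRefl (G x) (ξ x) (η x) ∘L (fderiv ℝ ξ x + leviCivita G x (ξ x)) ∘L
      orbitRefl (G x) (ξ x) (η x) = - (fderiv ℝ ξ x + leviCivita G x (ξ x)) ∧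
    orbitRefl (G x) (ξ x) (η x) ∘L (fderiv ℝ η x + leviCivita G x (η x)) ∘L
      orbitRefl (G x) (ξ x) (η x) = - (fderiv ℝ η x + leviCivita G x (η x)) := by
  have hs := A.symm x hx
  have hd := A.gramDet_ne hx hη
  have aξ := A.metric_killing_antisymm hx (A.killing_xi x hx)
  have aη := A.metric_killing_antisymm hx (A.killing_eta x hx)
  have hc : (fderiv ℝ ξ x + leviCivita G x (ξ x)) (η x) =
      (fderiv ℝ η x + leviCivita G x (η x)) (ξ x) := by
    simp only [add_apply]
    rw [A.commute x hx, A.leviCivita_symm hx]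
  have aξξ := aξ (ξ x) (η x)
  have aηη := aη (ξ x) (η x)
  constructor
  · refine orbitRefl_conj_eq_neg hs hd (fun X => A.nondeg hx) aξ ?_ ?_
    · rw [aξ, hc, hs]
      have := aη (ξ x) (ξ x)
      rw [hs (ξ x)] at this
      linarith
    · intro X Y hX hY
      rw [orbitRefl_eq_self_iff hs hd] at hX hY
      exact A.metric_killing_eq_zero hx (A.hasFDerivAt_xi hx) (A.killing_xi x hx) hX.1 hY.1
        (A.ot_xi x hx hη X Y hX.1 hX.2 hY.1 hY.2)
  · refine orbitRefl_conj_eq_neg hs hd (fun X => A.nondeg hx) aη ?_ ?_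
    · rw [← hc]
      have := aξ (η x) (η x)
      rw [hs (η x)] at this
      linarith
    · intro X Y hX hY
      rw [orbitRefl_eq_self_iff hs hd] at hX hY
      exact A.metric_killing_eq_zero hx (A.hasFDerivAt_eta hx) (A.killing_eta x hx) hX.2 hY.2
        (A.ot_eta x hx hη X Y hX.1 hX.2 hY.1 hY.2)

theorem contDiffOn_orbitRefl (A : AxialGeometry n U G ξ η) :
    ContDiffOn ℝ (n + 1 : ℕ) (fun y => orbitRefl (G y) (ξ y) (η y)) (U ∩ {x | η x ≠ 0}) :=
  _root_.contDiffOn_orbitRefl (A.metric_class.mono inter_subset_left)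
    (A.xi_class.mono inter_subset_left) (A.eta_class.mono inter_subset_left)
    fun _ hx => A.gramDet_ne hx.1 hx.2

theorem differentiableAt_orbitRefl (A : AxialGeometry n U G ξ η) {x : E} (hx : x ∈ U)
    (hη : η x ≠ 0) : DifferentiableAt ℝ (fun y => orbitRefl (G y) (ξ y) (η y)) x :=
  (A.contDiffOn_orbitRefl.contDiffAt (A.isOpen_off_axis.mem_nhds ⟨hx, hη⟩)).differentiableAt
    (by norm_cast)

/-- Serves for T = Γ(Y), where it expresses parallelism, and for T minus the derivative of a Killing
vector, where it expresses invariance. -/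
theorem fderiv_orbitRefl (A : AxialGeometry n U G ξ η) {x : E} (hx : x ∈ U) (hη : η x ≠ 0)
    (Y : E) (T : E →L[ℝ] E) (hT : ∀ a b, fderiv ℝ G x Y a b = G x (T a) b + G x a (T b))
    (hξT : orbitRefl (G x) (ξ x) (η x) (fderiv ℝ ξ x Y + T (ξ x)) =
      - (fderiv ℝ ξ x Y + T (ξ x)))
    (hηT : orbitRefl (G x) (ξ x) (η x) (fderiv ℝ η x Y + T (η x)) =
      - (fderiv ℝ η x Y + T (η x))) :
    fderiv ℝ (fun y => orbitRefl (G y) (ξ y) (η y)) x Y =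
      orbitRefl (G x) (ξ x) (η x) ∘L T - T ∘L orbitRefl (G x) (ξ x) (η x) := by
  have hU := A.isOpen_off_axis.mem_nhds ⟨hx, hη⟩
  exact fderiv_orbitRefl_eq (A.hasFDerivAt_metric hx) (A.hasFDerivAt_xi hx) (A.hasFDerivAt_eta hx)
    (by filter_upwards [hU] with y hy using A.symm y hy.1)
    (by filter_upwards [hU] with y hy using A.gramDet_ne hy.1 hy.2)
    (A.differentiableAt_orbitRefl hx hη) Y T hT hξT hηT

end AxialGeometry

/-! ### Limits of the orbit reflections at the axis. -/

section AxisDirections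

variable {E : Type} [NormedAddCommGroup E] [NormedSpace ℝ E]

/-- The reflection along the plane spanned by `u` and an orthogonal unit vector `e`. -/
noncomputable def axisRefl (G : E →L[ℝ] E →L[ℝ] ℝ) (u e : E) : E →L[ℝ] E :=
  ContinuousLinearMap.id ℝ E - ((2 : ℝ) * (G u u)⁻¹) • (G u).smulRight u
    - (2 : ℝ) • (G e).smulRight e

theorem axisRefl_apply (G : E →L[ℝ] E →L[ℝ] ℝ) (u e X : E) :
    axisRefl G u e X = X - ((2 : ℝ) * (G u u)⁻¹) • G u X • u - (2 : ℝ) • G e X • e := rfl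

/-- `e` is a unit vector orthogonal to `u` in the rotation plane of `A`. -/
structure IsAxisDir (G : E →L[ℝ] E →L[ℝ] ℝ) (A : E →L[ℝ] E) (u e : E) : Prop where
  unit : G e e = 1
  orth : G u e = 0
  plane : ∀ X, A X = G e X • A e - G (A e) X • e

/-- Two unit vectors in the rotation plane are joined by a path of rotations. Along it the
derivative of the reflection is a multiple of A composed with the reflection, so the pullback of a
tensor killed by A is constant. -/
theorem IsAxisDir.pull_eq {G : E →L[ℝ] E →L[ℝ] ℝ} {A : E →L[ℝ] E} {u e e' : E}
    (he : IsAxisDir G A u e) (he' : IsAxisDir G A u e') (hs : ∀ X Y, G X Y = G Y X)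
    (hA : ∀ X Y, G (A X) Y = - G X (A Y)) (hu : A u = 0)
    (hpos : ∀ w, G u w = 0 → w ≠ 0 → 0 < G w w) (h0 : A ≠ 0)
    {F : Type} [NormedAddCommGroup F] [NormedSpace ℝ F] (a : TensorAction E F) {k : F}
    (hk : a.der A k = 0) : a.pull (axisRefl G u e) k = a.pull (axisRefl G u e') k := by
  have prop : ∀ d, IsAxisDir G A u d → 0 < G (A d) (A d) ∧ G d (A d) = 0 ∧ G u (A d) = 0 := by
    intro d hd
    have h1 : G u (A d) = 0 := by rw [hs, hA, hs, hu]; simp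
    refine ⟨hpos _ h1 fun h => h0 ?_, ?_, h1⟩
    · ext X; rw [hd.plane X, h]; simp
    · have := hA d d; rw [hs] at this; linarith
  obtain ⟨q1, q2, q3⟩ := prop e he
  obtain ⟨q1', q2', q3'⟩ := prop e' he'
  set f := A e with hf
  set l := √(G f f) with hl
  have hl0 : 0 < l := Real.sqrt_pos.2 q1
  have hll : l * l = G f f := Real.mul_self_sqrt q1.le
  -- the second direction lies in the same plane
  have hee : ∃ α β : ℝ, e' = α • e + β • f := by
    have h1 : A (A e') = - G (A e') (A e') • e' := by
      rw [he'.plane (A e'), q2']; simp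
    rw [he.plane (A e')] at h1
    refine ⟨(G (A e') (A e'))⁻¹ * G f (A e'), - ((G (A e') (A e'))⁻¹ * G e (A e')), ?_⟩
    have h2 : e' = (-(G (A e') (A e'))⁻¹) • (-G (A e') (A e') • e') := by
      rw [smul_smul, neg_mul_neg, inv_mul_cancel₀ q1'.ne', one_smul]
    refine h2.trans ?_
    rw [← h1]
    module
  obtain ⟨α, β, rfl⟩ := hee
  have hunit : α ^ 2 + (β * l) ^ 2 = 1 := by
    have := he'.unit
    simp only [map_add, map_smul, add_apply, smul_apply, smul_eq_mul, he.unit, q2, hs f e,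
      ← hll] at this
    linarith
  -- The coordinates of `e'` with respect to `e` and `f` normalized by its length `l` form a unit
  -- complex number; θ is its argument.
  obtain ⟨θ, hc, hsn⟩ : ∃ θ : ℝ, Real.cos θ = α ∧ Real.sin θ = β * l := by
    have hn : ‖(⟨α, β * l⟩ : ℂ)‖ = 1 := by
      rw [Complex.norm_def, Complex.normSq_mk, Real.sqrt_eq_one]; linarith
    have hne : (⟨α, β * l⟩ : ℂ) ≠ 0 := by rw [← norm_ne_zero_iff, hn]; exact one_ne_zero
    refine ⟨Complex.arg ⟨α, β * l⟩, ?_, ?_⟩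
    · rw [Complex.cos_arg hne, hn, div_one]
    · rw [Complex.sin_arg, hn, div_one]
  set d : ℝ → E := fun t => Real.cos t • e + (Real.sin t * l⁻¹) • f with hd
  set R : ℝ → E →L[ℝ] E := fun t => axisRefl G u (d t) with hR
  have hAf : A f = (- (l * l)) • e := by
    rw [he.plane f, q2, hll]; simp [hf]
  have hdd : ∀ t, HasDerivAt d (l⁻¹ • A (d t)) t := by
    intro t
    have h1 := ((Real.hasDerivAt_cos t).smul_const e).add
      (((Real.hasDerivAt_sin t).mul_const l⁻¹).smul_const f)
    refine h1.congr_deriv ?_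
    simp only [hd, map_add, map_smul, hAf, ← hf, smul_add, smul_smul]
    have : l⁻¹ * (Real.sin t * l⁻¹ * -(l * l)) = - Real.sin t := by field_simp
    rw [this, mul_comm l⁻¹]
    module
  have hdu : ∀ t, G u (d t) = 0 := by
    intro t; simp [hd, he.orth, q3]
  have hplane : ∀ t X, A X = G (d t) X • A (d t) - G (A (d t)) X • d t := by
    intro t X
    have hcs := Real.cos_sq_add_sin_sq t
    rw [he.plane X]
    simp only [hd, map_add, map_smul, hAf, ← hf, add_apply, smul_apply, smul_eq_mul, neg_apply]
    match_scalars
    · field_simp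
      linear_combination (-G e X * l) * hcs
    · field_simp
      linear_combination (G f X) * hcs
  -- The factor is 2 because a reflection turns at twice the speed of its normal; `l⁻¹` normalizes A
  -- to unit angular speed.
  have hRd : ∀ t, HasDerivAt R (((2 * l⁻¹) • A) ∘L R t) t := by
    intro t
    have h1 : HasDerivAt (fun t => (G (d t)).smulRight (d t))
        ((G (d t)).smulRight (l⁻¹ • A (d t)) + (G (l⁻¹ • A (d t))).smulRight (d t)) t := by
      have hb := (ContinuousLinearMap.smulRightL ℝ E E).isBoundedBilinearMap.hasFDerivAt
        (G (d t), d t)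
      have := hb.comp_hasDerivAt t ((G.hasFDerivAt.comp_hasDerivAt t (hdd t)).prodMk (hdd t))
      refine this.congr_deriv ?_
      ext X
      simp [IsBoundedBilinearMap.deriv, smul_smul, mul_comm]
    have h2 := (h1.const_smul (2 : ℝ)).const_sub
      (ContinuousLinearMap.id ℝ E - ((2 : ℝ) * (G u u)⁻¹) • (G u).smulRight u)
    refine h2.congr_deriv (ContinuousLinearMap.ext fun X => ?_)
    have h3 := hplane t X
    simp only [ContinuousLinearMap.comp_apply, hR, axisRefl_apply, map_sub, map_smul, hu, smul_zero,
      sub_zero, smul_apply, neg_apply, add_apply, ContinuousLinearMap.smulRight_apply, smul_eq_mul]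
    rw [h3]
    module
  have hconst : ∀ t, HasDerivAt (fun t => a.pull (R t) k) 0 t := by
    intro t
    have h1 := ((a.differentiable_pull (R t)).hasFDerivAt.comp_hasDerivAt t (hRd t)).clm_apply
      (hasDerivAt_const t k)
    have h2 := a.fderiv_pull (R t) ((2 * l⁻¹) • A) k
    rw [map_smul, smul_apply, hk, smul_zero, map_zero] at h2
    refine h1.congr_deriv ?_
    simpa using h2
  have hfin := is_const_of_deriv_eq_zero (fun t => (hconst t).differentiableAt)
    (fun t => (hconst t).deriv) 0 θ
  have d0 : d 0 = e := by simp [hd]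
  have dθ : d θ = α • e + β • f := by
    simp only [hd, hc, hsn]
    rw [mul_assoc, mul_inv_cancel₀ hl0.ne', mul_one]
  simpa only [hR, d0, dθ] using hfin

/-- Gram-Schmidt: removing from v its component along u leaves a spacelike vector, which is
normalized. The unit vector e stays bounded at the axis, whereas v tends to zero there. -/
theorem orbitRefl_eq_axisRefl {G : E →L[ℝ] E →L[ℝ] ℝ} {u v : E} (hs : ∀ X Y, G X Y = G Y X)
    (hu : G u u < 0) (hv : 0 < G v v) :
    ∃ e, G e e = 1 ∧ G u e = 0 ∧ orbitRefl G u v = axisRefl G u e := by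
  set c := G u v / G u u with hc
  set w := v - c • u with hw
  have huw : G u w = 0 := by
    simp only [hw, map_sub, map_smul, smul_eq_mul, hc]; rw [div_mul_cancel₀ _ hu.ne, sub_self]
  have hww : G w w = gramDet G u v / G u u := by
    have : G w w = G v w - c * G u w := by simp [hw]
    rw [this, huw, hw, map_sub, map_smul, hs v u, gramDet, hc]
    have hu' := hu.ne
    simp only [smul_eq_mul]; field_simp; ring
  have hd : gramDet G u v < 0 := by
    unfold gramDet; nlinarith [mul_neg_of_neg_of_pos hu hv, sq_nonneg (G u v)]
  have hpos : 0 < G w w := by rw [hww]; exact div_pos_of_neg_of_neg hd hu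
  set r := √(G w w) with hr
  have hr0 : 0 < r := Real.sqrt_pos.2 hpos
  have hrr : r * r = G w w := Real.mul_self_sqrt hpos.le
  refine ⟨r⁻¹ • w, ?_, ?_, ?_⟩
  · simp only [map_smul, smul_apply, smul_eq_mul, ← hrr]; field_simp
  · rw [map_smul, huw, smul_zero]
  · ext X
    rw [orbitRefl_apply, axisRefl_apply, coFst_apply, coSnd_apply]
    have h1 : G (r⁻¹ • w) X • r⁻¹ • w = ((G w w)⁻¹ * G w X) • w := by
      rw [← hrr, map_smul, smul_apply, smul_eq_mul, smul_smul]; congr 1; field_simp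
    rw [h1, hww]
    have h2 : G w X = G v X - c * G u X := by simp [hw]
    rw [h2, hw, hc]
    have hu' := hu.ne
    have hd' := hd.ne
    match_scalars
    · ring
    · have : gramDet G u v = G u u * G v v - G u v ^ 2 := rfl
      field_simp
      rw [this]; ring
    · field_simp

end AxisDirections

theorem tendsto_clm_apply {α E F : Type*} [NormedAddCommGroup E] [NormedSpace ℝ E]
    [NormedAddCommGroup F] [NormedSpace ℝ F] {l : Filter α} {T : α → E →L[ℝ] F} {T₀ : E →L[ℝ] F}
    {v : α → E} {v₀ : E} (hT : Tendsto T l (𝓝 T₀)) (hv : Tendsto v l (𝓝 v₀)) :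
    Tendsto (fun a => T a (v a)) l (𝓝 (T₀ v₀)) :=
  (isBoundedBilinearMap_apply.continuous.tendsto (T₀, v₀)).comp (hT.prodMk_nhds hv)

theorem tendsto_clm_comp {α E F H : Type*} [NormedAddCommGroup E] [NormedSpace ℝ E]
    [NormedAddCommGroup F] [NormedSpace ℝ F] [NormedAddCommGroup H] [NormedSpace ℝ H]
    {l : Filter α} {T : α → F →L[ℝ] H} {T₀ : F →L[ℝ] H}
    {S : α → E →L[ℝ] F} {S₀ : E →L[ℝ] F} (hT : Tendsto T l (𝓝 T₀)) (hS : Tendsto S l (𝓝 S₀)) :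
    Tendsto (fun a => T a ∘L S a) l (𝓝 (T₀ ∘L S₀)) :=
  (isBoundedBilinearMap_comp.continuous.tendsto (T₀, S₀)).comp (hT.prodMk_nhds hS)

theorem tendsto_smulRight {α E F : Type*} [NormedAddCommGroup E] [NormedSpace ℝ E]
    [NormedAddCommGroup F] [NormedSpace ℝ F] {l : Filter α} {T : α → E →L[ℝ] ℝ} {T₀ : E →L[ℝ] ℝ}
    {v : α → F} {v₀ : F} (hT : Tendsto T l (𝓝 T₀)) (hv : Tendsto v l (𝓝 v₀)) :
    Tendsto (fun a => (T a).smulRight (v a)) l (𝓝 (T₀.smulRight v₀)) :=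
  tendsto_clm_apply (((ContinuousLinearMap.smulRightL ℝ E F).continuous.tendsto _).comp hT) hv

namespace AxialGeometry

variable {E : Type} [NormedAddCommGroup E] [NormedSpace ℝ E] [FiniteDimensional ℝ E] {n : ℕ}
  {U : Set E} {G : E → E →L[ℝ] E →L[ℝ] ℝ} {ξ η : E → E}

/-- Reversing the sign of the metric along ξ gives a positive definite form H. On the compact unit
sphere it has a positive lower bound, uniform near p, and on the vectors in question it equals 1. -/
theorem exists_bound_unit (A : AxialGeometry n U G ξ η) {p : E} (hp : p ∈ U) :
    ∃ C, ∀ᶠ x in 𝓝 p, ∀ e, G x e e = 1 → G x (ξ x) e = 0 → ‖e‖ ≤ C := by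
  set H : E → E → ℝ := fun x X => G x X X - 2 * (G x (ξ x) (ξ x))⁻¹ * (G x (ξ x) X) ^ 2 with hH
  have hpos : ∀ X, X ≠ 0 → 0 < H p X := by
    intro X hX
    have h1 := A.timelike p hp
    set t := (G p (ξ p) (ξ p))⁻¹ * G p (ξ p) X with ht
    have h2 : G p (ξ p) X = G p (ξ p) (ξ p) * t := by
      rw [ht, ← mul_assoc, mul_inv_cancel₀ h1.ne, one_mul]
    have h3 : G p (ξ p) (X - t • ξ p) = 0 := by
      rw [map_sub, map_smul, smul_eq_mul, h2]; ring
    have h4 : G p (X - t • ξ p) (X - t • ξ p) = G p X X - t ^ 2 * G p (ξ p) (ξ p) := by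
      simp only [map_sub, map_smul, sub_apply, smul_apply, smul_eq_mul, A.symm p hp X (ξ p), h2]
      ring
    have h5 : H p X = G p (X - t • ξ p) (X - t • ξ p) - t ^ 2 * G p (ξ p) (ξ p) := by
      rw [h4, hH]; simp only [h2]; field_simp [h1.ne]; ring
    by_cases hw : X - t • ξ p = 0
    · have ht0 : t ≠ 0 := by
        rintro h; rw [h, zero_smul, sub_zero] at hw; exact hX hw
      rw [h5, hw, map_zero]
      have := mul_neg_of_pos_of_neg (by positivity : 0 < t ^ 2) h1
      linarith
    · have := A.spatial p hp _ h3 hw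
      nlinarith [sq_nonneg t]
  have hξ : ξ p ≠ 0 := fun h => by have := A.timelike p hp; simp [h] at this
  have : Nontrivial E := nontrivial_of_ne _ _ hξ
  have hcG := A.metric_class.continuousOn.continuousAt (A.isOpen.mem_nhds hp)
  have hcξ := A.xi_class.continuousOn.continuousAt (A.isOpen.mem_nhds hp)
  have hcont : ∀ X, ContinuousAt (fun z : E × E => H z.1 z.2) (p, X) := by
    intro X
    have hG : ContinuousAt (fun z : E × E => G z.1) (p, X) :=
      ContinuousAt.comp (f := Prod.fst) (g := G) hcG continuousAt_fst
    have hx : ContinuousAt (fun z : E × E => ξ z.1) (p, X) :=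
      ContinuousAt.comp (f := Prod.fst) (g := ξ) hcξ continuousAt_fst
    exact ((hG.clm_apply continuousAt_snd).clm_apply continuousAt_snd).sub
      ((continuousAt_const.mul (((hG.clm_apply hx).clm_apply hx).inv₀ (A.timelike p hp).ne)).mul
        (((hG.clm_apply hx).clm_apply continuousAt_snd).pow 2))
  have hK : IsCompact (Metric.sphere (0 : E) 1) := isCompact_sphere 0 1
  obtain ⟨X₀, hX₀, hmin⟩ := hK.exists_isMinOn (f := H p) (NormedSpace.sphere_nonempty.2 zero_le_one)
    (fun X _ => (((hcont X).comp (f := fun X : E => (p, X)) (x := X)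
      (by fun_prop)).continuousWithinAt : _))
  have hc : 0 < H p X₀ := hpos _ (by rintro rfl; simp at hX₀)
  set c := H p X₀ / 2 with hcdef
  have hc2 : 0 < c := by positivity
  have hev : ∀ᶠ x in 𝓝 p, ∀ X ∈ Metric.sphere (0 : E) 1, c < H x X := by
    refine hK.eventually_forall_of_forall_eventually fun X hX => ?_
    have h1 : c < H p X := by have : H p X₀ ≤ H p X := hmin hX; linarith
    have := (hcont X).eventually (lt_mem_nhds h1)
    exact this
  refine ⟨√(1 / c), ?_⟩
  filter_upwards [hev] with x hx e he1 he2
  have he0 : e ≠ 0 := by rintro rfl; simp at he1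
  have hn : 0 < ‖e‖ := norm_pos_iff.2 he0
  have h1 := hx (‖e‖⁻¹ • e) (by rw [mem_sphere_zero_iff_norm, norm_smul, norm_inv, norm_norm,
    inv_mul_cancel₀ hn.ne'])
  simp only [hH, map_smul, smul_apply, smul_eq_mul, he1, he2, mul_one, mul_zero] at h1
  apply Real.le_sqrt_of_sq_le
  rw [le_div_iff₀ hc2]
  have h2 : ‖e‖ ^ 2 * (‖e‖⁻¹ * ‖e‖⁻¹) = 1 := by field_simp
  nlinarith [mul_lt_mul_of_pos_left h1 (by positivity : 0 < ‖e‖ ^ 2)]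

theorem orbitRefl_bounded (A : AxialGeometry n U G ξ η) {p : E} (hp : p ∈ U) :
    ∃ C, ∀ᶠ x in 𝓝[{x | η x ≠ 0}] p, ‖orbitRefl (G x) (ξ x) (η x)‖ ≤ C := by
  obtain ⟨C, hC⟩ := A.exists_bound_unit hp
  have hcG := A.metric_class.continuousOn.continuousAt (A.isOpen.mem_nhds hp)
  have hcξ := A.xi_class.continuousOn.continuousAt (A.isOpen.mem_nhds hp)
  set T : E → E →L[ℝ] E := fun x => ContinuousLinearMap.id ℝ E
    - ((2 : ℝ) * (G x (ξ x) (ξ x))⁻¹) • (G x (ξ x)).smulRight (ξ x) with hT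
  have hTc : ContinuousAt T p :=
    continuousAt_const.sub ((continuousAt_const.mul (((hcG.clm_apply hcξ).clm_apply hcξ).inv₀
      (A.timelike p hp).ne)).smul (tendsto_smulRight (hcG.clm_apply hcξ) hcξ))
  have h1 : ∀ᶠ x in 𝓝 p, ‖T x‖ < ‖T p‖ + 1 := hTc.norm.eventually (gt_mem_nhds (by linarith))
  have h2 : ∀ᶠ x in 𝓝 p, ‖G x‖ < ‖G p‖ + 1 := hcG.norm.eventually (gt_mem_nhds (by linarith))
  refine ⟨‖T p‖ + 1 + 2 * ((‖G p‖ + 1) * C * C), ?_⟩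
  filter_upwards [nhdsWithin_le_nhds hC, nhdsWithin_le_nhds h1, nhdsWithin_le_nhds h2,
    self_mem_nhdsWithin, nhdsWithin_le_nhds (A.isOpen.mem_nhds hp)] with x hx1 hx2 hx3 hx4 hxU
  obtain ⟨e, he1, he2, he3⟩ := orbitRefl_eq_axisRefl (A.symm x hxU) (A.timelike x hxU)
    (A.spacelike x hxU hx4)
  have hb := hx1 e he1 he2
  rw [he3]
  have h3 : axisRefl (G x) (ξ x) e = T x - (2 : ℝ) • (G x e).smulRight e := rfl
  rw [h3]
  refine (norm_sub_le _ _).trans (add_le_add hx2.le ?_)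
  rw [norm_smul, ContinuousLinearMap.norm_smulRight_apply, Real.norm_two]
  have hC0 : 0 ≤ C := (norm_nonneg _).trans hb
  have : ‖G x e‖ ≤ (‖G p‖ + 1) * C :=
    ((G x).le_opNorm e).trans (mul_le_mul hx3.le hb (norm_nonneg _) (by positivity))
  gcongr

/-- Conjugation by the reflection reverses A, so A maps the complement of the plane of u and e into
that plane; since A u = 0 the image is orthogonal to u, hence a multiple of e. -/
theorem isAxisDir_of_conj {G : E →L[ℝ] E →L[ℝ] ℝ} {A : E →L[ℝ] E} {u e : E}
    (hs : ∀ X Y, G X Y = G Y X) (hA : ∀ X Y, G (A X) Y = - G X (A Y)) (hu : A u = 0)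
    (hneg : G u u < 0) (h1 : G e e = 1) (h2 : G u e = 0)
    (hc : axisRefl G u e ∘L A ∘L axisRefl G u e = - A) : IsAxisDir G A u e := by
  have key : ∀ X, G u X = 0 → G e X = 0 → A X = - G (A e) X • e := by
    intro X hX hX'
    have h3 := congrArg (fun T : E →L[ℝ] E => T X) hc
    simp only [ContinuousLinearMap.comp_apply, neg_apply] at h3
    have h4 : axisRefl G u e X = X := by rw [axisRefl_apply, hX, hX']; simp
    have h5 : G u (A X) = 0 := by rw [hs, hA, hs, hu]; simp
    have h6 : G e (A X) = - G (A e) X := by rw [hA]; simp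
    rw [h4, axisRefl_apply, h5, h6] at h3
    have h7 : (2 : ℝ) • A X = (2 : ℝ) • (- G (A e) X • e) := by
      linear_combination (norm := module) (1 : ℝ) • h3
    exact smul_right_injective E two_ne_zero h7
  refine ⟨h1, h2, fun X => ?_⟩
  set s := (G u u)⁻¹ * G u X with hsdef
  have hus : G u u * s = G u X := by rw [hsdef, ← mul_assoc, mul_inv_cancel₀ hneg.ne, one_mul]
  have hfe : G (A e) e = 0 := by have := hA e e; rw [hs e] at this; linarith
  have hfu : G (A e) u = 0 := by rw [hA, hu]; simp
  have heu : G e u = 0 := by rw [hs, h2]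
  have := key (X - s • u - G e X • e) (by
      simp only [map_sub, map_smul, h2, smul_eq_mul]; linarith) (by
      simp only [map_sub, map_smul, h1, heu, smul_eq_mul]; ring)
  simp only [map_sub, map_smul, hu, hfu, hfe, smul_zero, sub_zero] at this
  linear_combination (norm := module) (1 : ℝ) • this

theorem fderiv_eta_xi_eq_zero (A : AxialGeometry n U G ξ η) {p : E} (hp : p ∈ U) (h0 : η p = 0) :
    fderiv ℝ η p (ξ p) = 0 := by
  rw [← A.commute p hp, h0, map_zero]

theorem fderiv_eta_antisymm (A : AxialGeometry n U G ξ η) {p : E} (hp : p ∈ U) (h0 : η p = 0)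
    (X Y : E) : G p (fderiv ℝ η p X) Y = - G p X (fderiv ℝ η p Y) := by
  have := A.killing_eta p hp X Y
  rw [h0, map_zero] at this
  simp at this
  linarith

/-- The unit directions lie in a compact ball, so they converge along an ultrafilter. The limit is
an axis direction because the anticommutation of ∇η with the reflection passes to the limit. -/
theorem exists_tendsto_orbitRefl (A : AxialGeometry n U G ξ η) {p : E} (hp : p ∈ U)
    (h0 : η p = 0) (l : Ultrafilter E) (hl : ↑l ≤ 𝓝[{x | η x ≠ 0}] p) :
    ∃ e, IsAxisDir (G p) (fderiv ℝ η p) (ξ p) e ∧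
      Tendsto (fun x => orbitRefl (G x) (ξ x) (η x)) l (𝓝 (axisRefl (G p) (ξ p) e)) := by
  obtain ⟨C, hC⟩ := A.exists_bound_unit hp
  have hl' : (l : Filter E) ≤ 𝓝 p := hl.trans nhdsWithin_le_nhds
  have hev : ∀ᶠ x in (l : Filter E), x ∈ U ∧ η x ≠ 0 :=
    Filter.Eventually.and (p := fun x => x ∈ U) (hl' (A.isOpen.mem_nhds hp))
      (hl self_mem_nhdsWithin)
  have hch : ∀ x, ∃ e, x ∈ U ∧ η x ≠ 0 → G x e e = 1 ∧ G x (ξ x) e = 0 ∧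
      orbitRefl (G x) (ξ x) (η x) = axisRefl (G x) (ξ x) e := by
    intro x
    by_cases hx : x ∈ U ∧ η x ≠ 0
    · obtain ⟨e, he⟩ := orbitRefl_eq_axisRefl (A.symm x hx.1) (A.timelike x hx.1)
        (A.spacelike x hx.1 hx.2)
      exact ⟨e, fun _ => he⟩
    · exact ⟨0, fun h => absurd h hx⟩
  choose d hd using hch
  have hball : ∀ᶠ x in (l : Filter E), d x ∈ Metric.closedBall (0 : E) C := by
    filter_upwards [hev, hl' hC] with x hx hx2
    rw [mem_closedBall_zero_iff]
    exact hx2 _ (hd x hx).1 (hd x hx).2.1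
  obtain ⟨e, -, he⟩ := (isCompact_closedBall (0 : E) C).ultrafilter_le_nhds (l.map d)
    (Filter.le_principal_iff.2 hball)
  have hde : Tendsto d l (𝓝 e) := he
  have tG : Tendsto G l (𝓝 (G p)) :=
    (A.metric_class.continuousOn.continuousAt (A.isOpen.mem_nhds hp)).tendsto.mono_left hl'
  have tξ : Tendsto ξ l (𝓝 (ξ p)) :=
    (A.xi_class.continuousOn.continuousAt (A.isOpen.mem_nhds hp)).tendsto.mono_left hl'
  have e1 : G p e e = 1 := by
    refine tendsto_nhds_unique (tendsto_clm_apply (tendsto_clm_apply tG hde) hde) ?_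
    exact tendsto_const_nhds.congr' (by filter_upwards [hev] with x hx using (hd x hx).1.symm)
  have e2 : G p (ξ p) e = 0 := by
    refine tendsto_nhds_unique (tendsto_clm_apply (tendsto_clm_apply tG tξ) hde) ?_
    exact tendsto_const_nhds.congr' (by filter_upwards [hev] with x hx using (hd x hx).2.1.symm)
  have tR : Tendsto (fun x => axisRefl (G x) (ξ x) (d x)) l (𝓝 (axisRefl (G p) (ξ p) e)) := by
    have i1 : Tendsto (fun x => (G x (ξ x)).smulRight (ξ x)) l (𝓝 ((G p (ξ p)).smulRight (ξ p))) :=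
      tendsto_smulRight (tendsto_clm_apply tG tξ) tξ
    have i2 : Tendsto (fun x => (G x (d x)).smulRight (d x)) l (𝓝 ((G p e).smulRight e)) :=
      tendsto_smulRight (tendsto_clm_apply tG hde) hde
    exact (tendsto_const_nhds.sub ((((tendsto_clm_apply (tendsto_clm_apply tG tξ) tξ).inv₀
      (A.timelike p hp).ne).const_mul 2).smul i1)).sub (i2.const_smul (2 : ℝ))
  have tR' := tR.congr' (f₂ := fun x => orbitRefl (G x) (ξ x) (η x))
    (by filter_upwards [hev] with x hx using (hd x hx).2.2.symm)
  refine ⟨e, ?_, tR'⟩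
  -- Since η tends to 0, the Christoffel term disappears and ∇η tends to the plain derivative at p.
  have tη : Tendsto (fun x => fderiv ℝ η x + leviCivita G x (η x)) l (𝓝 (fderiv ℝ η p)) := by
    have hη0 : Tendsto η l (𝓝 0) := by
      rw [← h0]
      exact (A.eta_class.continuousOn.continuousAt (A.isOpen.mem_nhds hp)).tendsto.mono_left hl'
    have hdη : Tendsto (fderiv ℝ η) l (𝓝 (fderiv ℝ η p)) :=
      ((A.eta_class.continuousOn_fderiv_of_isOpen A.isOpen (by norm_cast; omega)).continuousAt
        (A.isOpen.mem_nhds hp)).tendsto.mono_left hl'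
    have hΓ : Tendsto (leviCivita G) l (𝓝 (leviCivita G p)) :=
      (A.contDiffOn_leviCivita.continuousOn.continuousAt
        (A.isOpen.mem_nhds hp)).tendsto.mono_left hl'
    simpa using hdη.add (tendsto_clm_apply hΓ hη0)
  refine isAxisDir_of_conj (A.symm p hp) (A.fderiv_eta_antisymm hp h0)
    (A.fderiv_eta_xi_eq_zero hp h0) (A.timelike p hp) e1 e2 ?_
  refine tendsto_nhds_unique (tendsto_clm_comp tR' (tendsto_clm_comp tη tR')) ?_
  exact tη.neg.congr' (by filter_upwards [hev] with x hx using (A.anti hx.1 hx.2).2.symm)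

/-- Tensors at an axis point that are invariant under the rotation have well-defined limits of
reflections. -/
theorem exists_limit_pull (A : AxialGeometry n U G ξ η) {p : E} (hp : p ∈ U) (h0 : η p = 0)
    (F : Type) [NormedAddCommGroup F] [NormedSpace ℝ F] (a : TensorAction E F) (k : F)
    (hk : a.der (fderiv ℝ η p) k = 0) :
    ∃ L, Tendsto (fun x => a.pull (orbitRefl (G x) (ξ x) (η x)) k) (𝓝[{x | η x ≠ 0}] p) (𝓝 L) := by
  have := A.axis_thin p hp
  obtain ⟨e, he, -⟩ := A.exists_tendsto_orbitRefl hp h0 (Ultrafilter.of (𝓝[{x | η x ≠ 0}] p))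
    (Ultrafilter.of_le _)
  refine ⟨a.pull (axisRefl (G p) (ξ p) e) k, ?_⟩
  -- The limiting direction may depend on the ultrafilter, but by `IsAxisDir.pull_eq` the reflected
  -- tensor does not.
  rw [tendsto_iff_ultrafilter]
  intro l hl
  obtain ⟨e', he', ht⟩ := A.exists_tendsto_orbitRefl hp h0 l hl
  rw [he.pull_eq he' (A.symm p hp) (A.fderiv_eta_antisymm hp h0) (A.fderiv_eta_xi_eq_zero hp h0)
    (A.spatial p hp) (A.axis_deriv p hp h0) a hk]
  exact tendsto_clm_apply ((a.differentiable_pull.continuous.tendsto _).comp ht) tendsto_const_nhds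

theorem reflectionGeometry (A : AxialGeometry n U G ξ η)
    (hrem : IsC1Removable U {x | η x = 0}) :
    ReflectionGeometry U ξ η (leviCivita G) (fun x => orbitRefl (G x) (ξ x) (η x)) where
  isOpen := A.isOpen
  xi_class := A.xi_two
  eta_class := A.eta_two
  symm x hx := A.leviCivita_symm hx
  diffR x hx hη := A.differentiableAt_orbitRefl hx hη
  invol x hx hη := ContinuousLinearMap.ext
    (orbitRefl_orbitRefl (A.symm x hx) (A.gramDet_ne hx hη))
  R_xi x hx hη := orbitRefl_fst (A.symm x hx) (A.gramDet_ne hx hη)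
  R_eta x hx hη := orbitRefl_snd (A.symm x hx) (A.gramDet_ne hx hη)
  split x hx hη := exists_orbit_split (A.symm x hx) (A.gramDet_ne hx hη)
  parallel x hx hη Y hY := by
    refine A.fderiv_orbitRefl hx hη Y _ (A.leviCivita_metric hx Y) ?_ ?_
    · have := congrArg (fun T : E →L[ℝ] E => T Y) (A.anti hx hη).1
      simpa only [ContinuousLinearMap.comp_apply, hY, neg_apply, add_apply,
        A.leviCivita_symm hx (ξ x) Y] using this
    · have := congrArg (fun T : E →L[ℝ] E => T Y) (A.anti hx hη).2
      simpa only [ContinuousLinearMap.comp_apply, hY, neg_apply, add_apply,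
        A.leviCivita_symm hx (η x) Y] using this
  R_inv_xi x hx hη := by
    -- For T = -Dξ the compatibility with the metric is the Killing equation, and the conditions on
    -- the orbit vectors hold because the fields commute.
    rw [A.fderiv_orbitRefl hx hη (ξ x) (- fderiv ℝ ξ x)]
    · ext X; simp; abel
    · intro a b
      have := A.killing_xi x hx a b
      simp only [neg_apply, map_neg]; linarith
    · simp
    · simp [A.commute x hx]
  R_inv_eta x hx hη := by
    rw [A.fderiv_orbitRefl hx hη (η x) (- fderiv ℝ η x)]
    · ext X; simp; abel
    · intro a b
      have := A.killing_eta x hx a b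
      simp only [neg_apply, map_neg]; linarith
    · simp [A.commute x hx]
    · simp
  anti_xi x hx hη := (A.anti hx hη).1
  anti_eta x hx hη := (A.anti hx hη).2
  gamma_xi x hx := A.leviCivita_killing A.xi_two A.killing_xi hx
  gamma_eta x hx := A.leviCivita_killing A.eta_two A.killing_eta hx
  bounded p hp _ := A.orbitRefl_bounded hp
  limit p hp h0 F _ _ a k hk := A.exists_limit_pull hp h0 F a k hk
  removable := hrem
  axis_thin := A.axis_thin

end AxialGeometry

/-! ### The orbit coframe is invariant and closed. -/

section OrbitCoframe

variable {E : Type} [NormedAddCommGroup E] [NormedSpace ℝ E]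

theorem eq_zero_of_symm_system {F : Type*} [AddCommGroup F] [Module ℝ F] {a b c : ℝ} {p q : F}
    (hd : a * c - b ^ 2 ≠ 0) (h1 : a • p + b • q = 0) (h2 : b • p + c • q = 0) :
    p = 0 ∧ q = 0 := by
  constructor
  · have : (a * c - b ^ 2) • p = 0 := by
      linear_combination (norm := module) c • h1 - b • h2
    exact (smul_eq_zero.1 this).resolve_left hd
  · have : (a * c - b ^ 2) • q = 0 := by
      linear_combination (norm := module) a • h2 - b • h1
    exact (smul_eq_zero.1 this).resolve_left hd

end OrbitCoframe

namespace AxialGeometry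

variable {E : Type} [NormedAddCommGroup E] [NormedSpace ℝ E] {n : ℕ}
  {U : Set E} {G : E → E →L[ℝ] E →L[ℝ] ℝ} {ξ η : E → E}

theorem contDiffOn_coFst (A : AxialGeometry n U G ξ η) :
    ContDiffOn ℝ (n + 1 : ℕ) (fun y => coFst (G y) (ξ y) (η y)) (U ∩ {x | η x ≠ 0}) :=
  _root_.contDiffOn_coFst (A.metric_class.mono inter_subset_left)
    (A.xi_class.mono inter_subset_left) (A.eta_class.mono inter_subset_left)
    fun _ hx => A.gramDet_ne hx.1 hx.2

theorem contDiffOn_coSnd (A : AxialGeometry n U G ξ η) :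
    ContDiffOn ℝ (n + 1 : ℕ) (fun y => coSnd (G y) (ξ y) (η y)) (U ∩ {x | η x ≠ 0}) :=
  _root_.contDiffOn_coSnd (A.metric_class.mono inter_subset_left)
    (A.xi_class.mono inter_subset_left) (A.eta_class.mono inter_subset_left)
    fun _ hx => A.gramDet_ne hx.1 hx.2

theorem hasFDerivAt_coFst (A : AxialGeometry n U G ξ η) {x : E} (hx : x ∈ U) (hη : η x ≠ 0) :
    HasFDerivAt (fun y => coFst (G y) (ξ y) (η y))
      (fderiv ℝ (fun y => coFst (G y) (ξ y) (η y)) x) x :=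
  ((A.contDiffOn_coFst.contDiffAt (A.isOpen_off_axis.mem_nhds ⟨hx, hη⟩)).differentiableAt
    (by norm_cast)).hasFDerivAt

theorem hasFDerivAt_coSnd (A : AxialGeometry n U G ξ η) {x : E} (hx : x ∈ U) (hη : η x ≠ 0) :
    HasFDerivAt (fun y => coSnd (G y) (ξ y) (η y))
      (fderiv ℝ (fun y => coSnd (G y) (ξ y) (η y)) x) x :=
  ((A.contDiffOn_coSnd.contDiffAt (A.isOpen_off_axis.mem_nhds ⟨hx, hη⟩)).differentiableAt
    (by norm_cast)).hasFDerivAt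

/-- The metric duals of the Killing vectors are invariant. -/
theorem invariant_flat (A : AxialGeometry n U G ξ η) {x : E} (hx : x ∈ U) {ζ ζ' : E → E}
    (hζ' : HasFDerivAt ζ' (fderiv ℝ ζ' x) x)
    (hk : ∀ X Y, fderiv ℝ G x (ζ x) X Y + G x (fderiv ℝ ζ x X) Y + G x X (fderiv ℝ ζ x Y) = 0)
    (hc : fderiv ℝ ζ' x (ζ x) = fderiv ℝ ζ x (ζ' x)) (Y : E) :
    fderiv ℝ (fun y => G y (ζ' y)) x (ζ x) Y + G x (ζ' x) (fderiv ℝ ζ x Y) = 0 := by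
  rw [((A.hasFDerivAt_metric hx).clm_apply hζ').fderiv]
  have := hk (ζ' x) Y
  simp [hc]
  linarith

/-- The orbit coframe is invariant under the Killing vectors. -/
theorem invariant_coframe (A : AxialGeometry n U G ξ η) {x : E} (hx : x ∈ U) (hη : η x ≠ 0)
    {ζ : E → E} (hζ : HasFDerivAt ζ (fderiv ℝ ζ x) x)
    (hk : ∀ X Y, fderiv ℝ G x (ζ x) X Y + G x (fderiv ℝ ζ x X) Y + G x X (fderiv ℝ ζ x Y) = 0)
    (hc1 : fderiv ℝ ξ x (ζ x) = fderiv ℝ ζ x (ξ x))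
    (hc2 : fderiv ℝ η x (ζ x) = fderiv ℝ ζ x (η x)) (Y : E) :
    fderiv ℝ (fun y => coFst (G y) (ξ y) (η y)) x (ζ x) Y
        + coFst (G x) (ξ x) (η x) (fderiv ℝ ζ x Y) = 0 ∧
      fderiv ℝ (fun y => coSnd (G y) (ξ y) (η y)) x (ζ x) Y
        + coSnd (G x) (ξ x) (η x) (fderiv ℝ ζ x Y) = 0 := by
  have d1 := A.hasFDerivAt_coFst hx hη
  have d2 := A.hasFDerivAt_coSnd hx hη
  have e1 : HasFDerivAt (fun y => G y (ξ y)) (fderiv ℝ (fun y => G y (ξ y)) x) x :=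
    (((A.hasFDerivAt_metric hx).clm_apply (A.hasFDerivAt_xi hx)).differentiableAt).hasFDerivAt
  have e2 : HasFDerivAt (fun y => G y (η y)) (fderiv ℝ (fun y => G y (η y)) x) x :=
    (((A.hasFDerivAt_metric hx).clm_apply (A.hasFDerivAt_eta hx)).differentiableAt).hasFDerivAt
  have i1 := A.invariant_flat hx (A.hasFDerivAt_xi hx) hk hc1
  have i2 := A.invariant_flat hx (A.hasFDerivAt_eta hx) hk hc2
  have cY := hasFDerivAt_const (𝕜 := ℝ) Y x
  have hev : ∀ᶠ y in 𝓝 x, gramDet (G y) (ξ y) (η y) ≠ 0 := by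
    filter_upwards [A.isOpen_off_axis.mem_nhds ⟨hx, hη⟩] with y hy using A.gramDet_ne hy.1 hy.2
  have hs := A.symm x hx
  -- the derivative of the defining equations of the coframe
  have k1 := ((e1.clm_apply cY).unique (HasFDerivAt.congr_of_eventuallyEq
    ((((e1.clm_apply (A.hasFDerivAt_xi hx)).mul (d1.clm_apply cY)).add
      ((e1.clm_apply (A.hasFDerivAt_eta hx)).mul (d2.clm_apply cY))))
      (by filter_upwards [hev] with y hy using metric_fst_eq hy Y)))
  have k2 := ((e2.clm_apply cY).unique (HasFDerivAt.congr_of_eventuallyEq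
    ((((e1.clm_apply (A.hasFDerivAt_eta hx)).mul (d1.clm_apply cY)).add
      ((e2.clm_apply (A.hasFDerivAt_eta hx)).mul (d2.clm_apply cY))))
      (by filter_upwards [hev] with y hy using metric_snd_eq hy Y)))
  have l1 := congrArg (fun T : E →L[ℝ] ℝ => T (ζ x)) k1
  have l2 := congrArg (fun T : E →L[ℝ] ℝ => T (ζ x)) k2
  simp [hc1, hc2] at l1 l2
  have hd := A.gramDet_ne hx hη
  have f1 := metric_fst_eq hd (fderiv ℝ ζ x Y)
  have f2 := metric_snd_eq hd (fderiv ℝ ζ x Y)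
  -- The metric duals of ξ and η are invariant, so the Lie derivatives of the two coframe covectors
  -- solve the homogeneous Gram system.
  refine eq_zero_of_symm_system (F := ℝ) (a := G x (ξ x) (ξ x)) (b := G x (ξ x) (η x))
    (c := G x (η x) (η x)) hd ?_ ?_
  · simp only [smul_eq_mul]
    have := i1 Y
    have j1 := i1 (ξ x)
    have j2 := i1 (η x)
    linear_combination this - f1 - l1 - coFst (G x) (ξ x) (η x) Y * j1
      - coSnd (G x) (ξ x) (η x) Y * j2
  · simp only [smul_eq_mul]
    have := i2 Y
    have j1 := i1 (η x)
    have j2 := i2 (η x)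
    linear_combination this - f2 - l2 - coFst (G x) (ξ x) (η x) Y * j1
      - coSnd (G x) (ξ x) (η x) Y * j2

theorem fderiv_symm_of_split {α : E →L[ℝ] E →L[ℝ] ℝ} {G : E →L[ℝ] E →L[ℝ] ℝ} {u v : E}
    (hs : ∀ X Y, G X Y = G Y X) (hd : gramDet G u v ≠ 0)
    (hu : ∀ Y, α u Y = α Y u) (hv : ∀ Y, α v Y = α Y v)
    (h : ∀ X Y, G u X = 0 → G v X = 0 → G u Y = 0 → G v Y = 0 → α X Y = α Y X) (X Y : E) :
    α X Y = α Y X := by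
  obtain ⟨a, b, X', hX, rfl⟩ := exists_orbit_split hs hd X
  obtain ⟨c, d, Y', hY, rfl⟩ := exists_orbit_split hs hd Y
  rw [orbitRefl_eq_self_iff hs hd] at hX hY
  have := h X' Y' hX.1 hX.2 hY.1 hY.2
  simp only [map_add, map_smul, add_apply, smul_apply, smul_eq_mul]
  linear_combination this - c * hu X' - d * hv X' + a * hu Y' + b * hv Y' + (a * d - b * c) * hu v

/-- The orbit coframe is closed. -/
theorem fderiv_coframe_symm (A : AxialGeometry n U G ξ η) {x : E} (hx : x ∈ U) (hη : η x ≠ 0)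
    (X Y : E) :
    fderiv ℝ (fun y => coFst (G y) (ξ y) (η y)) x X Y =
        fderiv ℝ (fun y => coFst (G y) (ξ y) (η y)) x Y X ∧
      fderiv ℝ (fun y => coSnd (G y) (ξ y) (η y)) x X Y =
        fderiv ℝ (fun y => coSnd (G y) (ξ y) (η y)) x Y X := by
  have d1 := A.hasFDerivAt_coFst hx hη
  have d2 := A.hasFDerivAt_coSnd hx hη
  have hd := A.gramDet_ne hx hη
  have hs := A.symm x hx
  have hev : ∀ᶠ y in 𝓝 x, (∀ X Y, G y X Y = G y Y X) ∧ gramDet (G y) (ξ y) (η y) ≠ 0 := by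
    filter_upwards [A.isOpen_off_axis.mem_nhds ⟨hx, hη⟩] with y hy
      using ⟨A.symm y hy.1, A.gramDet_ne hy.1 hy.2⟩
  have i1 := A.invariant_coframe hx hη (A.hasFDerivAt_xi hx) (A.killing_xi x hx) rfl
    (A.commute x hx).symm
  have i2 := A.invariant_coframe hx hη (A.hasFDerivAt_eta hx) (A.killing_eta x hx)
    (A.commute x hx) rfl
  -- Constancy of σ(ζ) turns the invariance of σ into the vanishing of dσ(ζ, ·), as in Cartan's
  -- formula.
  have cst : ∀ {σ : E → E →L[ℝ] ℝ} {ζ : E → E} {c : ℝ}, HasFDerivAt σ (fderiv ℝ σ x) x →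
      HasFDerivAt ζ (fderiv ℝ ζ x) x → (∀ᶠ y in 𝓝 x, σ y (ζ y) = c) → ∀ Y,
      fderiv ℝ σ x Y (ζ x) = - σ x (fderiv ℝ ζ x Y) := by
    intro σ ζ c h1 h2 h3 Y
    have := congrArg (fun T : E →L[ℝ] ℝ => T Y) ((h1.clm_apply h2).unique
      ((hasFDerivAt_const c x).congr_of_eventuallyEq h3))
    simp at this
    linarith
  have hξd := A.hasFDerivAt_xi hx
  have hηd := A.hasFDerivAt_eta hx
  have k1 := cst d1 hξd (c := 1) (by filter_upwards [hev] with y hy using coFst_fst hy.1 hy.2)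
  have k2 := cst d1 hηd (c := 0) (by filter_upwards [hev] with y hy using coFst_snd)
  have k3 := cst d2 hξd (c := 0) (by filter_upwards [hev] with y hy using coSnd_fst hy.1)
  have k4 := cst d2 hηd (c := 1) (by filter_upwards [hev] with y hy using coSnd_snd hy.2)
  -- on the orthogonal complement
  have perp : ∀ X Y, G x (ξ x) X = 0 → G x (η x) X = 0 → G x (ξ x) Y = 0 → G x (η x) Y = 0 →
      fderiv ℝ (fun y => coFst (G y) (ξ y) (η y)) x X Y -
        fderiv ℝ (fun y => coFst (G y) (ξ y) (η y)) x Y X = 0 ∧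
      fderiv ℝ (fun y => coSnd (G y) (ξ y) (η y)) x X Y -
        fderiv ℝ (fun y => coSnd (G y) (ξ y) (η y)) x Y X = 0 := by
    intro X Y hX1 hX2 hY1 hY2
    have o1 := A.ot_xi x hx hη X Y hX1 hX2 hY1 hY2
    have o2 := A.ot_eta x hx hη X Y hX1 hX2 hY1 hY2
    have e1 : HasFDerivAt (fun y => G y (ξ y)) (fderiv ℝ (fun y => G y (ξ y)) x) x :=
      (((A.hasFDerivAt_metric hx).clm_apply (A.hasFDerivAt_xi hx)).differentiableAt).hasFDerivAt
    have e2 : HasFDerivAt (fun y => G y (η y)) (fderiv ℝ (fun y => G y (η y)) x) x :=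
      (((A.hasFDerivAt_metric hx).clm_apply (A.hasFDerivAt_eta hx)).differentiableAt).hasFDerivAt
    have z : ∀ Z, G x (ξ x) Z = 0 → G x (η x) Z = 0 →
        coFst (G x) (ξ x) (η x) Z = 0 ∧ coSnd (G x) (ξ x) (η x) Z = 0 := by
      intro Z h1 h2
      rw [coFst_apply, coSnd_apply, h1, h2]; simp
    -- On the complement the coframe vanishes, so the derivatives of the Gram coefficients drop out
    -- and the Frobenius condition becomes a Gram system for the exterior derivatives of the
    -- coframe.
    have r1 : ∀ Z W, G x (ξ x) W = 0 → G x (η x) W = 0 →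
        fderiv ℝ (fun y => G y (ξ y)) x Z W =
        G x (ξ x) (ξ x) * fderiv ℝ (fun y => coFst (G y) (ξ y) (η y)) x Z W +
        G x (ξ x) (η x) * fderiv ℝ (fun y => coSnd (G y) (ξ y) (η y)) x Z W := by
      intro Z W hW1 hW2
      have cW := hasFDerivAt_const (𝕜 := ℝ) W x
      have := congrArg (fun T : E →L[ℝ] ℝ => T Z)
        ((e1.clm_apply cW).unique (HasFDerivAt.congr_of_eventuallyEq
        ((((e1.clm_apply (A.hasFDerivAt_xi hx)).mul (d1.clm_apply cW)).add
          ((e1.clm_apply (A.hasFDerivAt_eta hx)).mul (d2.clm_apply cW))))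
          (by filter_upwards [hev] with y hy using metric_fst_eq hy.2 W)))
      simpa [(z W hW1 hW2).1, (z W hW1 hW2).2] using this
    have r2 : ∀ Z W, G x (ξ x) W = 0 → G x (η x) W = 0 →
        fderiv ℝ (fun y => G y (η y)) x Z W =
        G x (ξ x) (η x) * fderiv ℝ (fun y => coFst (G y) (ξ y) (η y)) x Z W +
        G x (η x) (η x) * fderiv ℝ (fun y => coSnd (G y) (ξ y) (η y)) x Z W := by
      intro Z W hW1 hW2
      have cW := hasFDerivAt_const (𝕜 := ℝ) W x
      have := congrArg (fun T : E →L[ℝ] ℝ => T Z)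
        ((e2.clm_apply cW).unique (HasFDerivAt.congr_of_eventuallyEq
        ((((e1.clm_apply (A.hasFDerivAt_eta hx)).mul (d1.clm_apply cW)).add
          ((e2.clm_apply (A.hasFDerivAt_eta hx)).mul (d2.clm_apply cW))))
          (by filter_upwards [hev] with y hy using metric_snd_eq hy.2 W)))
      simpa [(z W hW1 hW2).1, (z W hW1 hW2).2] using this
    rw [r1 X Y hY1 hY2, r1 Y X hX1 hX2] at o1
    rw [r2 X Y hY1 hY2, r2 Y X hX1 hX2] at o2
    refine eq_zero_of_symm_system (F := ℝ) (a := G x (ξ x) (ξ x)) (b := G x (ξ x) (η x))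
      (c := G x (η x) (η x)) hd ?_ ?_
    · simp only [smul_eq_mul]; linarith
    · simp only [smul_eq_mul]; linarith
  constructor
  · refine fderiv_symm_of_split hs hd (fun Z => ?_) (fun Z => ?_)
      (fun Z W h1 h2 h3 h4 => sub_eq_zero.1 (perp Z W h1 h2 h3 h4).1) X Y
    · rw [k1]; linarith [(i1 Z).1]
    · rw [k2]; linarith [(i2 Z).1]
  · refine fderiv_symm_of_split hs hd (fun Z => ?_) (fun Z => ?_)
      (fun Z W h1 h2 h3 h4 => sub_eq_zero.1 (perp Z W h1 h2 h3 h4).2) X Y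
    · rw [k3]; linarith [(i1 Z).2]
    · rw [k4]; linarith [(i2 Z).2]

end AxialGeometry

/-! ### First and second difference quotients in the parameter. -/

section DifferenceQuotients

variable {F : Type*} [NormedAddCommGroup F] [NormedSpace ℝ F]

theorem ContDiffAt.hasDerivAt_deriv {f : ℝ → F} {x : ℝ} (hf : ContDiffAt ℝ 2 f x) :
    HasDerivAt (deriv f) (deriv (deriv f) x) x := by
  have h : DifferentiableAt ℝ (fderiv ℝ f) x :=
    (hf.fderiv_right (m := 1) (by norm_num)).differentiableAt one_ne_zero
  have h2 : deriv f = fun y => fderiv ℝ f y 1 := funext fun y => fderiv_apply_one_eq_deriv.symm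
  have h3 : DifferentiableAt ℝ (deriv f) x := by
    rw [h2]; exact h.clm_apply (differentiableAt_const _)
  exact h3.hasDerivAt

theorem tendsto_first_difference {f : ℝ → F} (hf : DifferentiableAt ℝ f 0) {t : ℕ → ℝ}
    (ht : Tendsto t atTop (𝓝 0)) (ht0 : ∀ N, t N ≠ 0) :
    Tendsto (fun N => (t N)⁻¹ • (f (t N) - f 0)) atTop (𝓝 (deriv f 0)) := by
  have h := hf.hasDerivAt.tendsto_slope
  have h2 := h.comp (tendsto_nhdsWithin_iff.2 ⟨ht, Eventually.of_forall fun N => ht0 N⟩)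
  refine h2.congr fun N => ?_
  simp [slope_def_module]

/-- After subtraction of s² L the symmetric sum has derivative o(s), so the mean value inequality
bounds its increment by o(t²). -/
theorem tendsto_second_difference {f : ℝ → F} (hf : ContDiffAt ℝ 2 f 0) {t : ℕ → ℝ}
    (ht : Tendsto t atTop (𝓝 0)) (ht0 : ∀ N, t N ≠ 0) :
    Tendsto (fun N => ((t N) ^ 2)⁻¹ • (f (t N) + f (-t N) - (2 : ℝ) • f 0)) atTop
      (𝓝 (deriv (deriv f) 0)) := by
  set L := deriv (deriv f) 0 with hL
  have hev : ∀ᶠ s in 𝓝 (0 : ℝ), HasDerivAt f (deriv f s) s := by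
    filter_upwards [hf.eventually (by simp)] with s hs
      using (hs.differentiableAt two_ne_zero).hasDerivAt
  have hd : HasDerivAt (deriv f) L 0 :=
    hf.hasDerivAt_deriv
  set φ : ℝ → F := fun s => f s + f (-s) - s ^ 2 • L with hφ
  have hlit : (fun s => deriv f s - deriv f (-s) - (2 * s) • L) =o[𝓝 0] fun s : ℝ => s := by
    have h1 := (hasDerivAt_iff_isLittleO_nhds_zero.1 hd)
    have hneg : Tendsto (fun s : ℝ => -s) (𝓝 0) (𝓝 0) := by simpa using (continuous_neg.tendsto (0 : ℝ))
    have h2 := (h1.comp_tendsto hneg).neg_right.congr_right (g₂ := fun s : ℝ => s) (by intro x; simp)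
    refine (h1.sub h2).congr_left fun s => ?_
    simp only [Function.comp, zero_add]
    module
  rw [Metric.tendsto_nhds]
  intro c hc
  have h3 := hlit.bound (c := c / 2) (by positivity)
  have hnegev : ∀ᶠ s in 𝓝 (0 : ℝ), HasDerivAt f (deriv f (-s)) (-s) := by
    have hneg : Tendsto (fun s : ℝ => -s) (𝓝 0) (𝓝 0) := by simpa using (continuous_neg.tendsto (0 : ℝ))
    exact hneg.eventually hev
  obtain ⟨r, hr, hball⟩ := Metric.eventually_nhds_iff_ball.1 ((hev.and hnegev).and h3)
  have htr : ∀ᶠ N in atTop, t N ∈ Metric.ball (0 : ℝ) r :=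
    ht.eventually (Metric.ball_mem_nhds _ hr)
  filter_upwards [htr] with N hN
  have hφd : ∀ s ∈ Metric.ball (0 : ℝ) r, HasDerivAt φ (deriv f s - deriv f (-s) - (2 * s) • L) s := by
    intro s hs
    have a1 := (hball s hs).1.1
    have a2 : HasDerivAt (fun s => f (-s)) (-deriv f (-s)) s := by
      have := HasDerivAt.scomp s (hball s hs).1.2 (hasDerivAt_neg s)
      simpa [Function.comp_def] using this
    have a3 : HasDerivAt (fun s : ℝ => s ^ 2 • L) ((2 * s) • L) s := by
      simpa using (hasDerivAt_pow 2 s).smul_const L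
    refine ((a1.add a2).sub a3).congr_deriv ?_
    module
  have hsub : segment ℝ 0 (t N) ⊆ Metric.ball (0 : ℝ) r :=
    (convex_ball _ _).segment_subset (Metric.mem_ball_self hr) hN
  have hnorm : ∀ s ∈ segment ℝ 0 (t N), ‖s‖ ≤ ‖t N‖ := by
    rintro s ⟨a, b, ha, hb, hab, rfl⟩
    rw [smul_zero, zero_add, norm_smul, Real.norm_of_nonneg hb]
    nlinarith [norm_nonneg (t N)]
  have hmv := (convex_segment (0 : ℝ) (t N)).norm_image_sub_le_of_norm_hasDerivWithin_le
    (f := φ) (C := c / 2 * ‖t N‖) (fun s hs => (hφd s (hsub hs)).hasDerivWithinAt)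
    (fun s hs => ((hball s (hsub hs)).2).trans (by gcongr; exact hnorm s hs))
    (left_mem_segment ℝ _ _) (right_mem_segment ℝ _ _)
  have hφ0 : φ 0 = (2 : ℝ) • f 0 := by simp [hφ, two_smul]
  rw [dist_eq_norm]
  have hpos : 0 < ‖t N‖ := norm_pos_iff.2 (ht0 N)
  have heq : ((t N) ^ 2)⁻¹ • (f (t N) + f (-t N) - (2 : ℝ) • f 0) - L =
      ((t N) ^ 2)⁻¹ • (φ (t N) - φ 0) := by
    rw [hφ0, hφ]
    have : L = ((t N) ^ 2)⁻¹ • (t N) ^ 2 • L := by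
      rw [smul_smul, inv_mul_cancel₀ (pow_ne_zero 2 (ht0 N)), one_smul]
    conv_lhs => rw [this]
    module
  rw [heq, norm_smul, norm_inv, norm_pow]
  rw [sub_zero] at hmv
  calc (‖t N‖ ^ 2)⁻¹ * ‖φ (t N) - φ 0‖ ≤ (‖t N‖ ^ 2)⁻¹ * (c / 2 * ‖t N‖ * ‖t N‖) := by gcongr
    _ = c / 2 := by field_simp
    _ < c := by linarith

end DifferenceQuotients

/-! ### Shift covectors and parameter derivatives of the coframe. -/

section Shift

variable {E : Type} [NormedAddCommGroup E] [NormedSpace ℝ E]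

/-- The first shift covector of `k`: the `u`-component of the off-diagonal part of `k`. -/
noncomputable def shiftFst (G : E →L[ℝ] E →L[ℝ] ℝ) (u v : E) (k : E →L[ℝ] E →L[ℝ] ℝ) : E →L[ℝ] ℝ :=
  ((gramDet G u v)⁻¹ • (G v v • k u - G u v • k v)) ∘L
    (ContinuousLinearMap.id ℝ E - orbitProj G u v)

/-- The second shift covector of `k`: the `v`-component of the off-diagonal part of `k`. -/
noncomputable def shiftSnd (G : E →L[ℝ] E →L[ℝ] ℝ) (u v : E) (k : E →L[ℝ] E →L[ℝ] ℝ) : E →L[ℝ] ℝ :=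
  ((gramDet G u v)⁻¹ • (G u u • k v - G u v • k u)) ∘L
    (ContinuousLinearMap.id ℝ E - orbitProj G u v)

variable {G : E →L[ℝ] E →L[ℝ] ℝ} {u v : E} {k : E →L[ℝ] E →L[ℝ] ℝ}

theorem orbitProj_fst (hs : ∀ X Y, G X Y = G Y X) (hd : gramDet G u v ≠ 0) :
    orbitProj G u v u = u := by
  rw [orbitProj_apply, coFst_fst hs hd, coSnd_fst hs]; module

theorem orbitProj_snd (hd : gramDet G u v ≠ 0) : orbitProj G u v v = v := by
  rw [orbitProj_apply, coFst_snd, coSnd_snd hd]; module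

theorem orbitProj_eq_zero {X : E} (h1 : G u X = 0) (h2 : G v X = 0) : orbitProj G u v X = 0 := by
  rw [orbitProj_apply, coFst_apply, coSnd_apply, h1, h2]; simp

theorem shiftFst_apply (X : E) : shiftFst G u v k X = (gramDet G u v)⁻¹ *
    (G v v * k u (X - orbitProj G u v X) - G u v * k v (X - orbitProj G u v X)) := rfl

theorem shiftSnd_apply (X : E) : shiftSnd G u v k X = (gramDet G u v)⁻¹ *
    (G u u * k v (X - orbitProj G u v X) - G u v * k u (X - orbitProj G u v X)) := rfl

theorem shift_fst (hs : ∀ X Y, G X Y = G Y X) (hd : gramDet G u v ≠ 0) :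
    shiftFst G u v k u = 0 ∧ shiftSnd G u v k u = 0 := by
  rw [shiftFst_apply, shiftSnd_apply, orbitProj_fst hs hd]; simp

theorem shift_snd (hd : gramDet G u v ≠ 0) :
    shiftFst G u v k v = 0 ∧ shiftSnd G u v k v = 0 := by
  rw [shiftFst_apply, shiftSnd_apply, orbitProj_snd hd]; simp

theorem metric_shift (hd : gramDet G u v ≠ 0) {X : E} (h1 : G u X = 0) (h2 : G v X = 0) :
    G u u * shiftFst G u v k X + G u v * shiftSnd G u v k X = k u X ∧
    G u v * shiftFst G u v k X + G v v * shiftSnd G u v k X = k v X := by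
  rw [shiftFst_apply, shiftSnd_apply, orbitProj_eq_zero h1 h2, sub_zero]
  have hd' : G u u * G v v - G u v ^ 2 ≠ 0 := hd
  rw [gramDet]
  constructor <;> field_simp <;> ring

/-- Uniqueness for the Gram system on the complement, together with the values on the orbit plane.
This identifies parameter derivatives of the coframe without differentiating its explicit formula.
-/
theorem eq_shift (hs : ∀ X Y, G X Y = G Y X) (hd : gramDet G u v ≠ 0) {α β : E →L[ℝ] ℝ}
    (hα : α u = 0 ∧ α v = 0) (hβ : β u = 0 ∧ β v = 0)
    (h : ∀ X, G u X = 0 → G v X = 0 → G u u * α X + G u v * β X = k u X ∧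
      G u v * α X + G v v * β X = k v X) :
    α = shiftFst G u v k ∧ β = shiftSnd G u v k := by
  have key : ∀ X, α X - shiftFst G u v k X = 0 ∧ β X - shiftSnd G u v k X = 0 := by
    intro X
    obtain ⟨a, b, Y, hY, rfl⟩ := exists_orbit_split hs hd X
    rw [orbitRefl_eq_self_iff hs hd] at hY
    have h1 := h Y hY.1 hY.2
    have h2 := metric_shift (k := k) hd hY.1 hY.2
    have h3 := eq_zero_of_symm_system (F := ℝ) (a := G u u) (b := G u v) (c := G v v)
      (p := α Y - shiftFst G u v k Y) (q := β Y - shiftSnd G u v k Y) hd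
      (by simp only [smul_eq_mul]; linarith [h1.1, h2.1])
      (by simp only [smul_eq_mul]; linarith [h1.2, h2.2])
    simpa [hα, hβ, shift_fst (k := k) hs hd, shift_snd (k := k) hd] using h3
  exact ⟨ContinuousLinearMap.ext fun X => sub_eq_zero.1 (key X).1,
    ContinuousLinearMap.ext fun X => sub_eq_zero.1 (key X).2⟩

theorem contDiffOn_shift {D : Type*} [NormedAddCommGroup D] [NormedSpace ℝ D] {m : WithTop ℕ∞}
    {U : Set D} {G : D → E →L[ℝ] E →L[ℝ] ℝ} {u v : D → E} {k : D → E →L[ℝ] E →L[ℝ] ℝ}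
    (hG : ContDiffOn ℝ m G U) (hu : ContDiffOn ℝ m u U) (hv : ContDiffOn ℝ m v U)
    (hk : ContDiffOn ℝ m k U) (h0 : ∀ x ∈ U, gramDet (G x) (u x) (v x) ≠ 0) :
    ContDiffOn ℝ m (fun x => shiftFst (G x) (u x) (v x) (k x)) U ∧
    ContDiffOn ℝ m (fun x => shiftSnd (G x) (u x) (v x) (k x)) U := by
  have hp := contDiffOn_const (c := ContinuousLinearMap.id ℝ E) |>.sub
    (contDiffOn_orbitProj hG hu hv h0)
  have hi := (contDiffOn_gramDet hG hu hv).inv h0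
  exact ⟨(hi.smul ((((hG.clm_apply hv).clm_apply hv).smul (hk.clm_apply hu)).sub
      (((hG.clm_apply hu).clm_apply hv).smul (hk.clm_apply hv)))).clm_comp hp,
    (hi.smul ((((hG.clm_apply hu).clm_apply hu).smul (hk.clm_apply hv)).sub
      (((hG.clm_apply hu).clm_apply hv).smul (hk.clm_apply hu)))).clm_comp hp⟩

/-- The quadratic correction in the second order shift. -/
noncomputable def shiftCorrection (k : E →L[ℝ] E →L[ℝ] ℝ) (u v : E) (α β : E →L[ℝ] ℝ) :
    E →L[ℝ] E →L[ℝ] ℝ :=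
  (k.flip u).smulRight α + (k.flip v).smulRight β

theorem shiftCorrection_apply (k : E →L[ℝ] E →L[ℝ] ℝ) (u v : E) (α β : E →L[ℝ] ℝ) (X Y : E) :
    shiftCorrection k u v α β X Y = k X u * α Y + k X v * β Y := rfl

/-- The derivatives of the orbit coframe of a family of metrics. -/
theorem deriv_coframe {G : ℝ → E →L[ℝ] E →L[ℝ] ℝ} {u v : E} (hG : ContDiffAt ℝ 2 G 0)
    (hs : ∀ᶠ ε in 𝓝 0, ∀ X Y, G ε X Y = G ε Y X) (hd : gramDet (G 0) u v ≠ 0) :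
    ContDiffAt ℝ 2 (fun ε => coFst (G ε) u v) 0 ∧ ContDiffAt ℝ 2 (fun ε => coSnd (G ε) u v) 0 ∧
    deriv (fun ε => coFst (G ε) u v) 0 = shiftFst (G 0) u v (deriv G 0) ∧
    deriv (fun ε => coSnd (G ε) u v) 0 = shiftSnd (G 0) u v (deriv G 0) ∧
    deriv (deriv (fun ε => coFst (G ε) u v)) 0 = shiftFst (G 0) u v (deriv (deriv G) 0
      - (2 : ℝ) • shiftCorrection (deriv G 0) u v (shiftFst (G 0) u v (deriv G 0))
        (shiftSnd (G 0) u v (deriv G 0))) ∧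
    deriv (deriv (fun ε => coSnd (G ε) u v)) 0 = shiftSnd (G 0) u v (deriv (deriv G) 0
      - (2 : ℝ) • shiftCorrection (deriv G 0) u v (shiftFst (G 0) u v (deriv G 0))
        (shiftSnd (G 0) u v (deriv G 0))) := by
  have hcont : ContinuousAt (fun ε => gramDet (G ε) u v) 0 := by
    have h : ∀ a b, ContinuousAt (fun ε => G ε a b) 0 := fun a b =>
      (hG.continuousAt.clm_apply continuousAt_const).clm_apply continuousAt_const
    exact ((h u u).mul (h v v)).sub ((h u v).pow 2)
  have hdev : ∀ᶠ ε in 𝓝 0, gramDet (G ε) u v ≠ 0 := hcont.eventually_ne hd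
  obtain ⟨I, hI, hGI⟩ : ∃ I ∈ 𝓝 (0 : ℝ), ContDiffOn ℝ 2 G I := by
    obtain ⟨I, hI, h⟩ := hG.contDiffOn (m := 2) le_rfl (by simp)
    refine ⟨I, ?_, h⟩
    simpa using hI
  obtain ⟨J, hJsub, hJo, hJ0⟩ := mem_nhds_iff.1 (inter_mem hI hdev)
  have hJn := hJo.mem_nhds hJ0
  have hGJ := hGI.mono (hJsub.trans inter_subset_left)
  have hJd : ∀ ε ∈ J, gramDet (G ε) u v ≠ 0 := fun ε hε => (hJsub hε).2
  have c1 := (contDiffOn_coFst hGJ contDiffOn_const contDiffOn_const hJd).contDiffAt hJn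
  have c2 := (contDiffOn_coSnd hGJ contDiffOn_const contDiffOn_const hJd).contDiffAt hJn
  have two : ∀ {F : Type} [NormedAddCommGroup F] [NormedSpace ℝ F] {f : ℝ → F},
      ContDiffAt ℝ 2 f 0 → (∀ᶠ ε in 𝓝 0, HasDerivAt f (deriv f ε) ε) ∧
        HasDerivAt (deriv f) (deriv (deriv f) 0) 0 := by
    intro F _ _ f hf
    constructor
    · filter_upwards [hf.eventually (by simp)] with s hs
        using (hs.differentiableAt two_ne_zero).hasDerivAt
    · exact hf.hasDerivAt_deriv
  refine ⟨c1, c2, ?_⟩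
  set s1 := fun ε => coFst (G ε) u v with hs1
  set s2 := fun ε => coSnd (G ε) u v with hs2
  obtain ⟨g1, g2⟩ := two hG
  obtain ⟨p1, p2⟩ := two c1
  obtain ⟨q1, q2⟩ := two c2
  have hev := hs.and hdev
  -- evaluation on the orbits
  have const : ∀ {f : ℝ → E →L[ℝ] ℝ} {w : E} {c : ℝ}, ContDiffAt ℝ 2 f 0 →
      (∀ᶠ ε in 𝓝 0, f ε w = c) → deriv f 0 w = 0 ∧ deriv (deriv f) 0 w = 0 := by
    intro f w c hf hc
    obtain ⟨f1, f2⟩ := two hf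
    have h1 : ∀ᶠ ε in 𝓝 0, deriv f ε w = 0 := by
      filter_upwards [f1, hc.eventually_nhds] with ε h1 h2
      have := (h1.clm_apply (hasDerivAt_const ε w)).unique
        ((hasDerivAt_const ε c).congr_of_eventuallyEq h2)
      simpa using this
    refine ⟨h1.self_of_nhds, ?_⟩
    have := (f2.clm_apply (hasDerivAt_const 0 w)).unique
        ((hasDerivAt_const 0 (0 : ℝ)).congr_of_eventuallyEq h1)
    simpa using this
  have k1 := const c1 (w := u) (c := 1) (by filter_upwards [hev] with ε h using coFst_fst h.1 h.2)
  have k2 := const c1 (w := v) (c := 0) (by filter_upwards [hev] with ε h using coFst_snd)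
  have k3 := const c2 (w := u) (c := 0) (by filter_upwards [hev] with ε h using coSnd_fst h.1)
  have k4 := const c2 (w := v) (c := 1) (by filter_upwards [hev] with ε h using coSnd_snd h.2)
  -- evaluation on the complement
  have perp : ∀ {w a b c d X : E}, s1 0 X = 0 → s2 0 X = 0 →
      (∀ᶠ ε in 𝓝 0, G ε w X = G ε a b * s1 ε X + G ε c d * s2 ε X) →
      deriv G 0 w X = G 0 a b * deriv s1 0 X + G 0 c d * deriv s2 0 X ∧
      deriv (deriv G) 0 w X = 2 * (deriv G 0 a b * deriv s1 0 X + deriv G 0 c d * deriv s2 0 X) +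
        G 0 a b * deriv (deriv s1) 0 X + G 0 c d * deriv (deriv s2) 0 X := by
    intro w a b c d X z1 z2 hw
    have e1 : ∀ᶠ ε in 𝓝 0, deriv G ε w X = (deriv G ε a b * s1 ε X + G ε a b * deriv s1 ε X) +
        (deriv G ε c d * s2 ε X + G ε c d * deriv s2 ε X) := by
      filter_upwards [g1, p1, q1, hw.eventually_nhds] with ε hg hp hq h2
      have cst := fun Z : E => hasDerivAt_const (𝕜 := ℝ) ε Z
      have := ((hg.clm_apply (cst w)).clm_apply (cst X)).unique (HasDerivAt.congr_of_eventuallyEq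
        ((((hg.clm_apply (cst a)).clm_apply (cst b)).mul (hp.clm_apply (cst X))).add
        (((hg.clm_apply (cst c)).clm_apply (cst d)).mul (hq.clm_apply (cst X)))) h2)
      simpa using this
    refine ⟨by have := e1.self_of_nhds; rw [z1, z2] at this; linarith, ?_⟩
    have cst := fun Z : E => hasDerivAt_const (𝕜 := ℝ) (0 : ℝ) Z
    have g0 := g1.self_of_nhds
    have p0 := p1.self_of_nhds
    have q0 := q1.self_of_nhds
    have := ((g2.clm_apply (cst w)).clm_apply (cst X)).unique (HasDerivAt.congr_of_eventuallyEq
        (((((g2.clm_apply (cst a)).clm_apply (cst b)).mul (p0.clm_apply (cst X))).add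
        (((g0.clm_apply (cst a)).clm_apply (cst b)).mul (p2.clm_apply (cst X)))).add
        ((((g2.clm_apply (cst c)).clm_apply (cst d)).mul (q0.clm_apply (cst X))).add
        (((g0.clm_apply (cst c)).clm_apply (cst d)).mul (q2.clm_apply (cst X))))) e1)
    simp [z1, z2] at this
    linarith
  have zero : ∀ X, G 0 u X = 0 → G 0 v X = 0 → s1 0 X = 0 ∧ s2 0 X = 0 := by
    intro X h1 h2
    simp only [hs1, hs2]
    rw [coFst_apply, coSnd_apply, h1, h2]; simp
  have pu : ∀ X, ∀ᶠ ε in 𝓝 0, G ε u X = G ε u u * s1 ε X + G ε u v * s2 ε X := fun X => by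
    filter_upwards [hdev] with ε h using metric_fst_eq h X
  have pv : ∀ X, ∀ᶠ ε in 𝓝 0, G ε v X = G ε u v * s1 ε X + G ε v v * s2 ε X := fun X => by
    filter_upwards [hdev] with ε h using metric_snd_eq h X
  have hs0 := hs.self_of_nhds
  obtain ⟨r1, r2⟩ := eq_shift (k := deriv G 0) hs0 hd ⟨k1.1, k2.1⟩ ⟨k3.1, k4.1⟩ fun X h1 h2 =>
    ⟨((perp (zero X h1 h2).1 (zero X h1 h2).2 (pu X)).1).symm,
      ((perp (zero X h1 h2).1 (zero X h1 h2).2 (pv X)).1).symm⟩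
  -- Needed because `shiftCorrection` inserts u and v in the second slot.
  have hK : deriv G 0 u v = deriv G 0 v u := by
    have cst := fun Z : E => hasDerivAt_const (𝕜 := ℝ) (0 : ℝ) Z
    have g0 := g1.self_of_nhds
    have := ((g0.clm_apply (cst u)).clm_apply (cst v)).unique (HasDerivAt.congr_of_eventuallyEq
      ((g0.clm_apply (cst v)).clm_apply (cst u)) (by filter_upwards [hs] with ε h using h u v))
    simpa using this
  refine ⟨r1, r2, ?_⟩
  rw [← r1, ← r2]
  -- Differentiating the defining relations twice produces, besides the second derivative of the
  -- metric, twice the products of first derivatives; these form the quadratic correction.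
  refine eq_shift hs0 hd ⟨k1.2, k2.2⟩ ⟨k3.2, k4.2⟩ fun X h1 h2 => ?_
  have t1 := (perp (zero X h1 h2).1 (zero X h1 h2).2 (pu X)).2
  have t2 := (perp (zero X h1 h2).1 (zero X h1 h2).2 (pv X)).2
  simp only [sub_apply, smul_apply, shiftCorrection_apply, smul_eq_mul]
  constructor
  · linarith
  · rw [← hK]; linarith

end Shift

section FormAction

variable {E : Type} [NormedAddCommGroup E] [NormedSpace ℝ E]

/-- The action on bilinear forms. -/
noncomputable def formAction (E : Type) [NormedAddCommGroup E] [NormedSpace ℝ E] :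
    TensorAction E (E →L[ℝ] E →L[ℝ] ℝ) := (TensorAction.scalar E).succ.succ

theorem formAction_der_apply (A : E →L[ℝ] E) (T : E →L[ℝ] E →L[ℝ] ℝ) (X Y : E) :
    (formAction E).der A T X Y = T (A X) Y + T X (A Y) := by
  simp only [formAction, TensorAction.succ_der_apply, TensorAction.scalar, add_apply]
  simp; ring

theorem formAction_pull_apply (R : E →L[ℝ] E) (T : E →L[ℝ] E →L[ℝ] ℝ) (X Y : E) :
    (formAction E).pull R T X Y = T (R X) (R Y) := by
  simp [formAction, TensorAction.scalar]

end FormAction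

/-! ### Families of geometries sharing their Killing vectors. -/

/-- A family of stationary and axisymmetric geometries with common Killing vectors. -/
structure AxialFamily {E : Type} [NormedAddCommGroup E] [NormedSpace ℝ E] (n : ℕ) (I : Set ℝ)
    (U : Set E) (G : ℝ → E → E →L[ℝ] E →L[ℝ] ℝ) (ξ η : E → E) : Prop where
  isOpen_param : IsOpen I
  zero_mem : (0 : ℝ) ∈ I
  geometry : ∀ ε ∈ I, AxialGeometry n U (G ε) ξ η
  contDiff_param : ∀ x ∈ U, ContDiffOn ℝ 2 (fun ε => G ε x) I

namespace AxialFamily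

variable {E : Type} [NormedAddCommGroup E] [NormedSpace ℝ E] [CompleteSpace E] {n : ℕ} {I : Set ℝ}
  {U : Set E} {G : ℝ → E → E →L[ℝ] E →L[ℝ] ℝ} {ξ η : E → E}

theorem background (A : AxialFamily n I U G ξ η) : AxialGeometry n U (G 0) ξ η :=
  A.geometry 0 A.zero_mem

theorem contDiffAt_param (A : AxialFamily n I U G ξ η) {x : E} (hx : x ∈ U) :
    ContDiffAt ℝ 2 (fun ε => G ε x) 0 :=
  (A.contDiff_param x hx).contDiffAt (A.isOpen_param.mem_nhds A.zero_mem)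

theorem exists_params (A : AxialFamily n I U G ξ η) : ∃ t : ℕ → ℝ, Tendsto t atTop (𝓝 0) ∧
    (∀ N, t N ≠ 0) ∧ (∀ N, t N ∈ I) ∧ ∀ N, - t N ∈ I := by
  obtain ⟨r, hr, hball⟩ := Metric.isOpen_iff.1 A.isOpen_param 0 A.zero_mem
  have h2 : ∀ N : ℕ, (0 : ℝ) < r / (N + 2) ∧ r / (N + 2) < r := fun N => by
    have : (0 : ℝ) ≤ N := N.cast_nonneg
    refine ⟨by positivity, ?_⟩
    rw [div_lt_iff₀ (by positivity)]
    nlinarith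
  -- The offset 2 keeps every term strictly below `r`, so that both signs lie in the ball inside the
  -- parameter set.
  refine ⟨fun N => r / (N + 2), ?_, fun N => (h2 N).1.ne', fun N => hball ?_, fun N => hball ?_⟩
  · have h1 : Tendsto (fun N : ℕ => (N : ℝ) + 2) atTop atTop :=
      tendsto_atTop_add_const_right _ _ tendsto_natCast_atTop_atTop
    exact h1.const_div_atTop r
  · rw [mem_ball_zero_iff, Real.norm_of_nonneg (h2 N).1.le]; exact (h2 N).2
  · rw [mem_ball_zero_iff, norm_neg, Real.norm_of_nonneg (h2 N).1.le]; exact (h2 N).2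

/-- The source of the second order shift. -/
noncomputable def secondSource (G : ℝ → E → E →L[ℝ] E →L[ℝ] ℝ) (ξ η : E → E) (x : E) :
    E →L[ℝ] E →L[ℝ] ℝ :=
  deriv (deriv (fun ε => G ε x)) 0 - (2 : ℝ) • shiftCorrection (deriv (fun ε => G ε x) 0) (ξ x) (η x)
    (shiftFst (G 0 x) (ξ x) (η x) (deriv (fun ε => G ε x) 0))
    (shiftSnd (G 0 x) (ξ x) (η x) (deriv (fun ε => G ε x) 0))

theorem deriv_coframe (A : AxialFamily n I U G ξ η) {x : E} (hx : x ∈ U) (hη : η x ≠ 0) :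
    ContDiffAt ℝ 2 (fun ε => coFst (G ε x) (ξ x) (η x)) 0 ∧
    ContDiffAt ℝ 2 (fun ε => coSnd (G ε x) (ξ x) (η x)) 0 ∧
    deriv (fun ε => coFst (G ε x) (ξ x) (η x)) 0 =
      shiftFst (G 0 x) (ξ x) (η x) (deriv (fun ε => G ε x) 0) ∧
    deriv (fun ε => coSnd (G ε x) (ξ x) (η x)) 0 =
      shiftSnd (G 0 x) (ξ x) (η x) (deriv (fun ε => G ε x) 0) ∧
    deriv (deriv (fun ε => coFst (G ε x) (ξ x) (η x))) 0 =
      shiftFst (G 0 x) (ξ x) (η x) (secondSource G ξ η x) ∧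
    deriv (deriv (fun ε => coSnd (G ε x) (ξ x) (η x))) 0 =
      shiftSnd (G 0 x) (ξ x) (η x) (secondSource G ξ η x) :=
  _root_.deriv_coframe (G := fun ε => G ε x) (u := ξ x) (v := η x) (A.contDiffAt_param hx)
    (by filter_upwards [A.isOpen_param.mem_nhds A.zero_mem] with ε hε
          using (A.geometry ε hε).symm x hx) (A.background.gramDet_ne hx hη)

/-- The shifts of the first perturbation are limits of difference quotients of closed coframes. The
convergence is only pointwise in x, which is what `fderiv_symm_of_tendsto` handles. -/
theorem fderiv_symm_shift_first (A : AxialFamily n I U G ξ η)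
    (hK : ContDiffOn ℝ 1 (fun x => deriv (fun ε => G ε x) 0) U) {x : E} (hx : x ∈ U)
    (hη : η x ≠ 0) (X Y : E) :
    fderiv ℝ (fun y => shiftFst (G 0 y) (ξ y) (η y) (deriv (fun ε => G ε y) 0)) x X Y =
      fderiv ℝ (fun y => shiftFst (G 0 y) (ξ y) (η y) (deriv (fun ε => G ε y) 0)) x Y X ∧
    fderiv ℝ (fun y => shiftSnd (G 0 y) (ξ y) (η y) (deriv (fun ε => G ε y) 0)) x X Y =
      fderiv ℝ (fun y => shiftSnd (G 0 y) (ξ y) (η y) (deriv (fun ε => G ε y) 0)) x Y X := by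
  obtain ⟨t, ht, ht0, htI, -⟩ := A.exists_params
  have B := A.background
  have hle : (1 : WithTop ℕ∞) ≤ (n + 1 : ℕ) := by norm_cast; omega
  obtain ⟨s1, s2⟩ := contDiffOn_shift ((B.metric_class.of_le hle).mono inter_subset_left)
    ((B.xi_class.of_le hle).mono inter_subset_left) ((B.eta_class.of_le hle).mono inter_subset_left)
    (hK.mono inter_subset_left) (U := U ∩ {x | η x ≠ 0}) fun _ h => B.gramDet_ne h.1 h.2
  have hdiff : ∀ ε ∈ I, ∀ y ∈ U ∩ {x | η x ≠ 0},
      HasFDerivAt (fun y => coFst (G ε y) (ξ y) (η y)) _ y ∧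
      HasFDerivAt (fun y => coSnd (G ε y) (ξ y) (η y)) _ y := fun ε hε y hy =>
    ⟨(A.geometry ε hε).hasFDerivAt_coFst hy.1 hy.2, (A.geometry ε hε).hasFDerivAt_coSnd hy.1 hy.2⟩
  constructor
  · refine fderiv_symm_of_tendsto B.isOpen_off_axis (h := fun N y => (t N)⁻¹ •
      (coFst (G (t N) y) (ξ y) (η y) - coFst (G 0 y) (ξ y) (η y))) ?_ ?_ ?_ s1 ⟨hx, hη⟩ X Y
    · intro N y hy
      exact (((hdiff _ (htI N) y hy).1.sub (hdiff _ A.zero_mem y hy).1).const_smul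
        (t N)⁻¹).differentiableAt.differentiableWithinAt
    · intro N y hy X Y
      have hd := ((hdiff _ (htI N) y hy).1.sub (hdiff _ A.zero_mem y hy).1).const_smul (t N)⁻¹
      rw [HasFDerivAt.fderiv (f := fun y => (t N)⁻¹ •
        (coFst (G (t N) y) (ξ y) (η y) - coFst (G 0 y) (ξ y) (η y))) hd]
      simp only [smul_apply, sub_apply]
      rw [((A.geometry _ (htI N)).fderiv_coframe_symm hy.1 hy.2 X Y).1,
        (B.fderiv_coframe_symm hy.1 hy.2 X Y).1]
    · intro y hy
      obtain ⟨c1, -, r1, -⟩ := A.deriv_coframe hy.1 hy.2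
      rw [← r1]
      exact tendsto_first_difference (f := fun ε => coFst (G ε y) (ξ y) (η y))
        (c1.differentiableAt two_ne_zero) ht ht0
  · refine fderiv_symm_of_tendsto B.isOpen_off_axis (h := fun N y => (t N)⁻¹ •
      (coSnd (G (t N) y) (ξ y) (η y) - coSnd (G 0 y) (ξ y) (η y))) ?_ ?_ ?_ s2 ⟨hx, hη⟩ X Y
    · intro N y hy
      exact (((hdiff _ (htI N) y hy).2.sub (hdiff _ A.zero_mem y hy).2).const_smul
        (t N)⁻¹).differentiableAt.differentiableWithinAt
    · intro N y hy X Y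
      have hd := ((hdiff _ (htI N) y hy).2.sub (hdiff _ A.zero_mem y hy).2).const_smul (t N)⁻¹
      rw [HasFDerivAt.fderiv (f := fun y => (t N)⁻¹ •
        (coSnd (G (t N) y) (ξ y) (η y) - coSnd (G 0 y) (ξ y) (η y))) hd]
      simp only [smul_apply, sub_apply]
      rw [((A.geometry _ (htI N)).fderiv_coframe_symm hy.1 hy.2 X Y).2,
        (B.fderiv_coframe_symm hy.1 hy.2 X Y).2]
    · intro y hy
      obtain ⟨-, c2, -, r2, -⟩ := A.deriv_coframe hy.1 hy.2
      rw [← r2]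
      exact tendsto_first_difference (f := fun ε => coSnd (G ε y) (ξ y) (η y))
        (c2.differentiableAt two_ne_zero) ht ht0

/-- As at first order, with symmetric second differences of the coframe, whose limit is the shift of
`secondSource`. -/
theorem fderiv_symm_shift_second (A : AxialFamily n I U G ξ η)
    (hK : ContDiffOn ℝ 1 (fun x => deriv (fun ε => G ε x) 0) U)
    (hK2 : ContDiffOn ℝ 1 (fun x => deriv (deriv (fun ε => G ε x)) 0) U) {x : E} (hx : x ∈ U)
    (hη : η x ≠ 0) (X Y : E) :
    fderiv ℝ (fun y => shiftFst (G 0 y) (ξ y) (η y) (secondSource G ξ η y)) x X Y =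
      fderiv ℝ (fun y => shiftFst (G 0 y) (ξ y) (η y) (secondSource G ξ η y)) x Y X ∧
    fderiv ℝ (fun y => shiftSnd (G 0 y) (ξ y) (η y) (secondSource G ξ η y)) x X Y =
      fderiv ℝ (fun y => shiftSnd (G 0 y) (ξ y) (η y) (secondSource G ξ η y)) x Y X := by
  obtain ⟨t, ht, ht0, htI, htI'⟩ := A.exists_params
  have B := A.background
  have hle : (1 : WithTop ℕ∞) ≤ (n + 1 : ℕ) := by norm_cast; omega
  have hG1 := (B.metric_class.of_le hle).mono (inter_subset_left (t := {x | η x ≠ 0}))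
  have hξ1 := (B.xi_class.of_le hle).mono (inter_subset_left (t := {x | η x ≠ 0}))
  have hη1 := (B.eta_class.of_le hle).mono (inter_subset_left (t := {x | η x ≠ 0}))
  have hK' := hK.mono (inter_subset_left (t := {x | η x ≠ 0}))
  have hd0 : ∀ y ∈ U ∩ {x | η x ≠ 0}, gramDet (G 0 y) (ξ y) (η y) ≠ 0 :=
    fun _ h => B.gramDet_ne h.1 h.2
  obtain ⟨s1, s2⟩ := contDiffOn_shift hG1 hξ1 hη1 hK' hd0
  have hflip : ContDiffOn ℝ 1 (fun x => flipForm (deriv (fun ε => G ε x) 0)) (U ∩ {x | η x ≠ 0}) :=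
    flipForm.contDiff.comp_contDiffOn hK'
  have hsrc : ContDiffOn ℝ 1 (secondSource G ξ η) (U ∩ {x | η x ≠ 0}) :=
    (hK2.mono inter_subset_left).sub ((((hflip.clm_apply hξ1).smulRight s1).add
      ((hflip.clm_apply hη1).smulRight s2)).const_smul (2 : ℝ))
  obtain ⟨r1, r2⟩ := contDiffOn_shift hG1 hξ1 hη1 hsrc hd0
  have hdiff : ∀ ε ∈ I, ∀ y ∈ U ∩ {x | η x ≠ 0},
      HasFDerivAt (fun y => coFst (G ε y) (ξ y) (η y)) _ y ∧
      HasFDerivAt (fun y => coSnd (G ε y) (ξ y) (η y)) _ y := fun ε hε y hy =>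
    ⟨(A.geometry ε hε).hasFDerivAt_coFst hy.1 hy.2, (A.geometry ε hε).hasFDerivAt_coSnd hy.1 hy.2⟩
  constructor
  · refine fderiv_symm_of_tendsto B.isOpen_off_axis (h := fun N y => ((t N) ^ 2)⁻¹ •
      (coFst (G (t N) y) (ξ y) (η y) + coFst (G (- t N) y) (ξ y) (η y)
        - (2 : ℝ) • coFst (G 0 y) (ξ y) (η y))) ?_ ?_ ?_ r1 ⟨hx, hη⟩ X Y
    · intro N y hy
      exact ((((hdiff _ (htI N) y hy).1.add (hdiff _ (htI' N) y hy).1).sub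
        ((hdiff _ A.zero_mem y hy).1.const_smul (2 : ℝ))).const_smul
        ((t N) ^ 2)⁻¹).differentiableAt.differentiableWithinAt
    · intro N y hy X Y
      have hd := (((hdiff _ (htI N) y hy).1.add (hdiff _ (htI' N) y hy).1).sub
        ((hdiff _ A.zero_mem y hy).1.const_smul (2 : ℝ))).const_smul ((t N) ^ 2)⁻¹
      rw [HasFDerivAt.fderiv (f := fun y => ((t N) ^ 2)⁻¹ •
      (coFst (G (t N) y) (ξ y) (η y) + coFst (G (- t N) y) (ξ y) (η y)
        - (2 : ℝ) • coFst (G 0 y) (ξ y) (η y))) hd]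
      simp only [smul_apply, sub_apply, add_apply]
      rw [((A.geometry _ (htI N)).fderiv_coframe_symm hy.1 hy.2 X Y).1,
        ((A.geometry _ (htI' N)).fderiv_coframe_symm hy.1 hy.2 X Y).1,
        (B.fderiv_coframe_symm hy.1 hy.2 X Y).1]
    · intro y hy
      obtain ⟨c1, -, -, -, e1, -⟩ := A.deriv_coframe hy.1 hy.2
      rw [← e1]
      exact tendsto_second_difference (f := fun ε => coFst (G ε y) (ξ y) (η y)) c1 ht ht0
  · refine fderiv_symm_of_tendsto B.isOpen_off_axis (h := fun N y => ((t N) ^ 2)⁻¹ •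
      (coSnd (G (t N) y) (ξ y) (η y) + coSnd (G (- t N) y) (ξ y) (η y)
        - (2 : ℝ) • coSnd (G 0 y) (ξ y) (η y))) ?_ ?_ ?_ r2 ⟨hx, hη⟩ X Y
    · intro N y hy
      exact ((((hdiff _ (htI N) y hy).2.add (hdiff _ (htI' N) y hy).2).sub
        ((hdiff _ A.zero_mem y hy).2.const_smul (2 : ℝ))).const_smul
        ((t N) ^ 2)⁻¹).differentiableAt.differentiableWithinAt
    · intro N y hy X Y
      have hd := (((hdiff _ (htI N) y hy).2.add (hdiff _ (htI' N) y hy).2).sub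
        ((hdiff _ A.zero_mem y hy).2.const_smul (2 : ℝ))).const_smul ((t N) ^ 2)⁻¹
      rw [HasFDerivAt.fderiv (f := fun y => ((t N) ^ 2)⁻¹ •
      (coSnd (G (t N) y) (ξ y) (η y) + coSnd (G (- t N) y) (ξ y) (η y)
        - (2 : ℝ) • coSnd (G 0 y) (ξ y) (η y))) hd]
      simp only [smul_apply, sub_apply, add_apply]
      rw [((A.geometry _ (htI N)).fderiv_coframe_symm hy.1 hy.2 X Y).2,
        ((A.geometry _ (htI' N)).fderiv_coframe_symm hy.1 hy.2 X Y).2,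
        (B.fderiv_coframe_symm hy.1 hy.2 X Y).2]
    · intro y hy
      obtain ⟨-, c2, -, -, -, e2⟩ := A.deriv_coframe hy.1 hy.2
      rw [← e2]
      exact tendsto_second_difference (f := fun ε => coSnd (G ε y) (ξ y) (η y)) c2 ht ht0

/-- The Killing equation is linear in the metric, so the difference quotients in ε solve the same
transport equation along ζ, and it passes to their pointwise limits. -/
theorem invariant_of_killing (A : AxialFamily n I U G ξ η) {ζ : E → E} (hζ : ContDiffOn ℝ 1 ζ U)
    (hk : ∀ ε ∈ I, ∀ x ∈ U, ∀ X Y, fderiv ℝ (G ε) x (ζ x) X Y + G ε x (fderiv ℝ ζ x X) Y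
      + G ε x X (fderiv ℝ ζ x Y) = 0) :
    (ContDiffOn ℝ 1 (fun x => deriv (fun ε => G ε x) 0) U →
      (formAction E).Invariant U ζ (fun x => deriv (fun ε => G ε x) 0)) ∧
    (ContDiffOn ℝ 1 (fun x => deriv (deriv (fun ε => G ε x)) 0) U →
      (formAction E).Invariant U ζ (fun x => deriv (deriv (fun ε => G ε x)) 0)) := by
  obtain ⟨t, ht, ht0, htI, htI'⟩ := A.exists_params
  have hU := A.background.isOpen
  have hB : ContinuousOn (fun x => - (formAction E).der (fderiv ℝ ζ x)) U :=
    ((formAction E).der.continuous.comp_continuousOn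
      (hζ.continuousOn_fderiv_of_isOpen hU le_rfl)).neg
  have hC : ∀ ε ∈ I, ContDiffOn ℝ 1 (G ε) U := fun ε hε =>
    (A.geometry ε hε).metric_class.of_le (by norm_cast; omega)
  have hk' : ∀ ε ∈ I, ∀ x ∈ U, fderiv ℝ (G ε) x (ζ x) =
      - (formAction E).der (fderiv ℝ ζ x) (G ε x) := by
    intro ε hε x hx
    ext X Y
    have := hk ε hε x hx X Y
    rw [neg_apply, neg_apply, formAction_der_apply]
    linarith
  have hD : ∀ ε ∈ I, ∀ x ∈ U, HasFDerivAt (G ε) (fderiv ℝ (G ε) x) x := fun ε hε x hx =>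
    (A.geometry ε hε).hasFDerivAt_metric hx
  constructor
  · intro hK x hx
    have := fderiv_apply_eq_of_tendsto hU hζ hB
      (T := fun N y => (t N)⁻¹ • (G (t N) y - G 0 y)) (fun N => ((hC _ (htI N)).sub
      (hC _ A.zero_mem)).const_smul _) ?_ (fun y hy => tendsto_first_difference
        (f := fun ε => G ε y) ((A.contDiffAt_param hy).differentiableAt two_ne_zero) ht ht0) hK hx
    · rw [this, neg_apply, neg_add_cancel]
    · intro N y hy
      have hd := ((hD _ (htI N) y hy).sub (hD _ A.zero_mem y hy)).const_smul (t N)⁻¹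
      rw [HasFDerivAt.fderiv (f := fun y => (t N)⁻¹ • (G (t N) y - G 0 y)) hd]
      simp only [smul_apply, sub_apply, neg_apply, map_smul, map_sub]
      rw [hk' _ (htI N) y hy, hk' _ A.zero_mem y hy]
  · intro hK x hx
    have := fderiv_apply_eq_of_tendsto hU hζ hB
      (T := fun N y => ((t N) ^ 2)⁻¹ • (G (t N) y + G (- t N) y - (2 : ℝ) • G 0 y))
      (fun N => (((hC _ (htI N)).add (hC _ (htI' N))).sub
      ((hC _ A.zero_mem).const_smul (2 : ℝ))).const_smul _) ?_
      (fun y hy => tendsto_second_difference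
        (f := fun ε => G ε y) (A.contDiffAt_param hy) ht ht0) hK hx
    · rw [this, neg_apply, neg_add_cancel]
    · intro N y hy
      have hd := (((hD _ (htI N) y hy).add (hD _ (htI' N) y hy)).sub
        ((hD _ A.zero_mem y hy).const_smul (2 : ℝ))).const_smul ((t N) ^ 2)⁻¹
      rw [HasFDerivAt.fderiv (f := fun y => ((t N) ^ 2)⁻¹ •
        (G (t N) y + G (- t N) y - (2 : ℝ) • G 0 y)) hd]
      simp only [smul_apply, sub_apply, add_apply, neg_apply, map_smul, map_sub, map_add]
      rw [hk' _ (htI N) y hy, hk' _ (htI' N) y hy, hk' _ A.zero_mem y hy]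

end AxialFamily

theorem contDiffOn_compL {D E F₁ F₂ : Type*} [NormedAddCommGroup D] [NormedSpace ℝ D]
    [NormedAddCommGroup E] [NormedSpace ℝ E] [NormedAddCommGroup F₁] [NormedSpace ℝ F₁]
    [NormedAddCommGroup F₂] [NormedSpace ℝ F₂] {m : WithTop ℕ∞} {U : Set D} {T : D → F₁ →L[ℝ] F₂}
    (hT : ContDiffOn ℝ m T U) :
    ContDiffOn ℝ m (fun x => ContinuousLinearMap.compL ℝ E F₁ F₂ (T x)) U :=
  (ContinuousLinearMap.compL ℝ E F₁ F₂).contDiff.comp_contDiffOn hT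

theorem contDiffOn_compL_flip {D E F₁ F₂ : Type*} [NormedAddCommGroup D] [NormedSpace ℝ D]
    [NormedAddCommGroup E] [NormedSpace ℝ E] [NormedAddCommGroup F₁] [NormedSpace ℝ F₁]
    [NormedAddCommGroup F₂] [NormedSpace ℝ F₂] {m : WithTop ℕ∞} {U : Set D} {T : D → E →L[ℝ] F₁}
    (hT : ContDiffOn ℝ m T U) :
    ContDiffOn ℝ m (fun x => (ContinuousLinearMap.compL ℝ E F₁ F₂).flip (T x)) U :=
  (ContinuousLinearMap.compL ℝ E F₁ F₂).flip.contDiff.comp_contDiffOn hT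

/-! ### Second derivatives of a vector field from its Lie derivative of the metric. -/

section Koszul

variable {E : Type} [NormedAddCommGroup E] [NormedSpace ℝ E]

/-- `christoffelFirst` as a continuous linear map. -/
noncomputable def christoffelFirstL : (E →L[ℝ] E →L[ℝ] E →L[ℝ] ℝ) →L[ℝ] (E →L[ℝ] E →L[ℝ] E →L[ℝ] ℝ) :=
  let fl : (E →L[ℝ] E →L[ℝ] E →L[ℝ] ℝ) →L[ℝ] (E →L[ℝ] E →L[ℝ] E →L[ℝ] ℝ) :=
    ((ContinuousLinearMap.flipₗᵢ ℝ E E (E →L[ℝ] ℝ)).toContinuousLinearEquiv :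
      (E →L[ℝ] E →L[ℝ] E →L[ℝ] ℝ) →L[ℝ] (E →L[ℝ] E →L[ℝ] E →L[ℝ] ℝ))
  ContinuousLinearMap.id ℝ _ + fl - (ContinuousLinearMap.compL ℝ E _ _ flipForm) ∘L fl

theorem christoffelFirstL_apply (T : E →L[ℝ] E →L[ℝ] E →L[ℝ] ℝ) (X Y Z : E) :
    christoffelFirstL T X Y Z = T X Y Z + T Y X Z - T Z X Y := rfl

/-- The operator solving `H(X,Y,Z) + H(X,Z,Y) = T(X,Y,Z)`, with `H(X,Y,Z) = G(S(X,Y),Z)`, for a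
symmetric `S`. -/
noncomputable def koszul (G : E →L[ℝ] E →L[ℝ] ℝ) :
    (E →L[ℝ] E →L[ℝ] E →L[ℝ] ℝ) →L[ℝ] (E →L[ℝ] E →L[ℝ] E) :=
  (ContinuousLinearMap.compL ℝ E (E →L[ℝ] E →L[ℝ] ℝ) (E →L[ℝ] E)
    (ContinuousLinearMap.compL ℝ E (E →L[ℝ] ℝ) E ((1 / 2 : ℝ) • ContinuousLinearMap.inverse G))) ∘L
    christoffelFirstL

theorem koszul_apply (G : E →L[ℝ] E →L[ℝ] ℝ) (T : E →L[ℝ] E →L[ℝ] E →L[ℝ] ℝ) (X Y : E) :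
    koszul G T X Y = (1 / 2 : ℝ) • ContinuousLinearMap.inverse G (christoffelFirstL T X Y) := rfl

/-- The coefficients of the first order system satisfied by the 1-jet of a vector field with given
Lie derivative of the metric. -/
noncomputable def jetCoeff (G : E → E →L[ℝ] E →L[ℝ] ℝ) (x : E) :
    E × (E →L[ℝ] E) →L[ℝ] (E →L[ℝ] E →L[ℝ] E) :=
  koszul (G x) ∘L (- (fderiv ℝ (fderiv ℝ G) x ∘L ContinuousLinearMap.fst ℝ E (E →L[ℝ] E)) -
    (ContinuousLinearMap.compL ℝ E E (E →L[ℝ] E →L[ℝ] ℝ) (fderiv ℝ G x)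
      + ((ContinuousLinearMap.compL ℝ E (E →L[ℝ] E →L[ℝ] ℝ) (E →L[ℝ] E →L[ℝ] ℝ)).flip
        (fderiv ℝ G x)) ∘L (formAction E).der) ∘L ContinuousLinearMap.snd ℝ E (E →L[ℝ] E))

/-- The Lie derivative of a bilinear form along a vector field. -/
noncomputable def lieForm (V : E → E) (T : E → E →L[ℝ] E →L[ℝ] ℝ) (x : E) : E →L[ℝ] E →L[ℝ] ℝ :=
  fderiv ℝ T x (V x) + (formAction E).der (fderiv ℝ V x) (T x)

theorem lieForm_apply (V : E → E) (T : E → E →L[ℝ] E →L[ℝ] ℝ) (x X Y : E) :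
    lieForm V T x X Y = fderiv ℝ T x (V x) X Y + T x (fderiv ℝ V x X) Y
      + T x X (fderiv ℝ V x Y) := by
  simp only [lieForm, add_apply, formAction_der_apply, add_assoc]

end Koszul

namespace AxialGeometry

variable {E : Type} [NormedAddCommGroup E] [NormedSpace ℝ E] [FiniteDimensional ℝ E] {n : ℕ}
  {U : Set E} {G : E → E →L[ℝ] E →L[ℝ] ℝ} {ξ η : E → E}

/-- The second derivative of a vector field in terms of its 1-jet and of its Lie derivative of the
metric. -/
theorem fderiv_fderiv_eq (A : AxialGeometry n U G ξ η) {ζ : E → E} {c : E → E →L[ℝ] E →L[ℝ] ℝ}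
    {x : E} (hx : x ∈ U) (hζ : ContDiffAt ℝ 2 ζ x) (hc : DifferentiableAt ℝ c x)
    (h : ∀ᶠ y in 𝓝 x, lieForm ζ G y = c y) :
    fderiv ℝ (fderiv ℝ ζ) x = koszul (G x) (fderiv ℝ c x) + jetCoeff G x (ζ x, fderiv ℝ ζ x) := by
  have hUx := A.isOpen.mem_nhds hx
  have dζ : HasFDerivAt ζ (fderiv ℝ ζ x) x := (hζ.differentiableAt two_ne_zero).hasFDerivAt
  have dζ2 : HasFDerivAt (fderiv ℝ ζ) (fderiv ℝ (fderiv ℝ ζ) x) x :=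
    ((hζ.fderiv_right (m := 1) (by norm_num)).differentiableAt one_ne_zero).hasFDerivAt
  have hGx : ContDiffAt ℝ 2 G x := A.metric_two.contDiffAt hUx
  have dG := A.hasFDerivAt_metric hx
  have dG2 : HasFDerivAt (fderiv ℝ G) (fderiv ℝ (fderiv ℝ G) x) x :=
    ((hGx.fderiv_right (m := 1) (by norm_num)).differentiableAt one_ne_zero).hasFDerivAt
  have hsymG : ∀ V W, fderiv ℝ (fderiv ℝ G) x V W = fderiv ℝ (fderiv ℝ G) x W V := fun V W =>
    (hGx.isSymmSndFDerivAt (by simp)) V W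
  have hsymζ : ∀ V W, fderiv ℝ (fderiv ℝ ζ) x V W = fderiv ℝ (fderiv ℝ ζ) x W V := fun V W =>
    (hζ.isSymmSndFDerivAt (by simp)) V W
  set e : E →L[ℝ] E →L[ℝ] E →L[ℝ] ℝ := fderiv ℝ c x - fderiv ℝ (fderiv ℝ G) x (ζ x) -
    (fderiv ℝ G x ∘L fderiv ℝ ζ x + (formAction E).der (fderiv ℝ ζ x) ∘L fderiv ℝ G x) with he
  have he_apply : ∀ W Y Z, e W Y Z = fderiv ℝ c x W Y Z - fderiv ℝ (fderiv ℝ G) x (ζ x) W Y Z -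
      (fderiv ℝ G x (fderiv ℝ ζ x W) Y Z + (fderiv ℝ G x W (fderiv ℝ ζ x Y) Z +
        fderiv ℝ G x W Y (fderiv ℝ ζ x Z))) := by
    intro W Y Z
    simp only [he, sub_apply, add_apply, ContinuousLinearMap.comp_apply, formAction_der_apply]
  -- Derivative of the equation L_ζ G = c in the direction W. Since the second derivative of ζ is
  -- symmetric, the Koszul permutation trick solves for it.
  have key : ∀ W Y Z, G x (fderiv ℝ (fderiv ℝ ζ) x W Y) Z + G x Y (fderiv ℝ (fderiv ℝ ζ) x W Z)
      = e W Y Z := by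
    intro W Y Z
    have cY := hasFDerivAt_const (𝕜 := ℝ) Y x
    have cZ := hasFDerivAt_const (𝕜 := ℝ) Z x
    have h1 := ((((dG2.clm_apply dζ).clm_apply cY).clm_apply cZ).add
      ((dG.clm_apply (dζ2.clm_apply cY)).clm_apply cZ)).add
      ((dG.clm_apply cY).clm_apply (dζ2.clm_apply cZ))
    have h0 := (((hc.hasFDerivAt).clm_apply cY).clm_apply cZ).congr_of_eventuallyEq
      (f₁ := fun y => fderiv ℝ G y (ζ y) Y Z + G y (fderiv ℝ ζ y Y) Z
        + G y Y (fderiv ℝ ζ y Z)) (by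
        filter_upwards [h] with y hy
        rw [← hy, lieForm_apply])
    have h2 := congrArg (fun T : E →L[ℝ] ℝ => T W) (h1.unique h0)
    simp at h2
    rw [he_apply, hsymG (ζ x) W]
    linarith
  have hmain : fderiv ℝ (fderiv ℝ ζ) x = koszul (G x) e := by
    ext X Y
    refine A.ext_metric hx fun Z => ?_
    rw [koszul_apply, map_smul, A.metric_inverse hx, smul_apply, christoffelFirstL_apply,
      smul_eq_mul, ← key X Y Z, ← key Y X Z, ← key Z X Y, hsymζ Y X, hsymζ Z X, hsymζ Z Y,
      A.symm x hx X (fderiv ℝ (fderiv ℝ ζ) x Y Z), A.symm x hx Y (fderiv ℝ (fderiv ℝ ζ) x X Z)]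
    ring
  rw [hmain, jetCoeff, ContinuousLinearMap.comp_apply, ← map_add]
  congr 1
  ext W Y Z
  rw [he_apply]
  simp [formAction_der_apply]
  ring

theorem contDiffOn_koszul (A : AxialGeometry n U G ξ η) :
    ContDiffOn ℝ (n + 1 : ℕ) (fun x => koszul (G x)) U :=
  ContDiffOn.clm_comp (contDiffOn_compL (contDiffOn_compL
    (A.contDiffOn_inverse.const_smul (1 / 2 : ℝ)))) contDiffOn_const

theorem contDiffOn_jetCoeff (A : AxialGeometry n U G ξ η) :
    ContDiffOn ℝ (n - 1 : ℕ) (jetCoeff G) U := by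
  have hn := A.two_le
  have h1 : ContDiffOn ℝ n (fderiv ℝ G) U :=
    A.metric_class.fderiv_of_isOpen A.isOpen (by norm_cast)
  have h2 : ContDiffOn ℝ (n - 1 : ℕ) (fderiv ℝ (fderiv ℝ G)) U :=
    h1.fderiv_of_isOpen A.isOpen (by norm_cast; omega)
  have h1' : ContDiffOn ℝ (n - 1 : ℕ) (fderiv ℝ G) U := h1.of_le (by norm_cast; omega)
  refine (A.contDiffOn_koszul.of_le (by norm_cast; omega)).clm_comp (ContDiffOn.sub
    (h2.clm_comp contDiffOn_const).neg (ContDiffOn.clm_comp (ContDiffOn.add ?_ ?_)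
      contDiffOn_const))
  · exact contDiffOn_compL h1'
  · exact (contDiffOn_compL_flip h1').clm_comp contDiffOn_const

/-- A vector field of class `C^1` whose 1-jet satisfies the system with a source of class `C^m` is
of class `C^{m+1}`. -/
theorem contDiffOn_of_jet (A : AxialGeometry n U G ξ η) {V : Set E} (hV : IsOpen V) (hVU : V ⊆ U)
    {ζ : E → E} {b : E → E →L[ℝ] E →L[ℝ] E} {m : ℕ} (hmn : m + 1 ≤ n)
    (hb : ContDiffOn ℝ m b V) (hζ : ContDiffOn ℝ 1 ζ V)
    (h : ∀ x ∈ V, HasFDerivAt (fderiv ℝ ζ) (b x + jetCoeff G x (ζ x, fderiv ℝ ζ x)) x) :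
    ContDiffOn ℝ (m + 2 : ℕ) ζ V := by
  have hd : ∀ x ∈ V, DifferentiableAt ℝ ζ x := fun x hx =>
    (hζ.differentiableOn one_ne_zero).differentiableAt (hV.mem_nhds hx)
  -- Each round gains one derivative, limited by the source and by the coefficients, which are of
  -- class `n - 1` only because they contain second derivatives of the metric.
  have step : ∀ r : ℕ, r ≤ m → ContDiffOn ℝ (r + 1 : ℕ) ζ V → ContDiffOn ℝ (r + 2 : ℕ) ζ V := by
    intro r hr hζr
    have h1 : ContDiffOn ℝ r (fderiv ℝ ζ) V := hζr.fderiv_of_isOpen hV (by norm_cast)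
    have h2 : ContDiffOn ℝ (r + 1 : ℕ) (fderiv ℝ ζ) V := by
      push_cast
      rw [contDiffOn_succ_iff_fderiv_of_isOpen hV]
      refine ⟨fun x hx => (h x hx).differentiableAt.differentiableWithinAt, by simp, ?_⟩
      refine ContDiffOn.congr (f := fun x => b x + jetCoeff G x (ζ x, fderiv ℝ ζ x)) ?_
        fun x hx => (h x hx).fderiv
      exact (hb.of_le (by exact_mod_cast hr)).add
        (((A.contDiffOn_jetCoeff.mono hVU).of_le (by norm_cast; omega)).clm_apply
        ((hζr.of_le (by norm_cast; omega)).prodMk h1))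
    have : ((r + 2 : ℕ) : WithTop ℕ∞) = ((r + 1 : ℕ) : WithTop ℕ∞) + 1 := by push_cast; ring
    rw [this, contDiffOn_succ_iff_fderiv_of_isOpen hV]
    exact ⟨fun x hx => (hd x hx).differentiableWithinAt, by simp, h2⟩
  have all : ∀ r : ℕ, r ≤ m + 1 → ContDiffOn ℝ (r + 1 : ℕ) ζ V := by
    intro r
    induction r with
    | zero => intro _; simpa using hζ
    | succ r ih => intro hr; exact step r (by omega) (ih (by omega))
  exact all (m + 1) le_rfl

end AxialGeometry

/-! ### Gronwall estimates on convex sets. -/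

section Gronwall

variable {E F : Type*} [NormedAddCommGroup E] [NormedSpace ℝ E] [NormedAddCommGroup F]
  [NormedSpace ℝ F]

theorem norm_le_of_norm_fderiv_le_affine {H : Set E} (hH : Convex ℝ H) {y : E → F}
    {y' : E → E →L[ℝ] F} {K ε : ℝ} (hy : ∀ x ∈ H, HasFDerivAt y (y' x) x) (hK : 0 ≤ K)
    (hb : ∀ x ∈ H, ‖y' x‖ ≤ K * ‖y x‖ + ε) {q x : E} (hq : q ∈ H) (hx : x ∈ H) :
    ‖y x‖ ≤ gronwallBound ‖y q‖ (K * ‖x - q‖) (ε * ‖x - q‖) 1 := by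
  have hseg : ∀ t ∈ Icc (0 : ℝ) 1, q + t • (x - q) ∈ H := fun t ht =>
    hH.add_smul_sub_mem hq hx ht
  have hd : ∀ t ∈ Icc (0 : ℝ) 1, HasDerivAt (fun t : ℝ => y (q + t • (x - q)))
      (y' (q + t • (x - q)) (x - q)) t := by
    intro t ht
    have h1 : HasDerivAt (fun t : ℝ => q + t • (x - q)) (x - q) t := by
      simpa using ((hasDerivAt_id t).smul_const (x - q)).const_add q
    exact (hy _ (hseg t ht)).comp_hasDerivAt t h1
  have hg := norm_le_gronwallBound_of_norm_deriv_right_le (δ := ‖y q‖)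
    (K := K * ‖x - q‖) (ε := ε * ‖x - q‖) (a := 0) (b := 1)
    (fun t ht => (hd t ht).continuousAt.continuousWithinAt)
    (fun t ht => (hd t ⟨ht.1, ht.2.le⟩).hasDerivWithinAt)
    (by simp) (fun t ht => by
      have := hb _ (hseg t ⟨ht.1, ht.2.le⟩)
      refine (ContinuousLinearMap.le_opNorm _ _).trans ?_
      nlinarith [norm_nonneg (x - q)]) 1 (right_mem_Icc.2 zero_le_one)
  simpa using hg

theorem eq_zero_of_norm_fderiv_le {H : Set E} (hH : Convex ℝ H) {y : E → F}
    {y' : E → E →L[ℝ] F} {K : ℝ} (hy : ∀ x ∈ H, HasFDerivAt y (y' x) x) (hK : 0 ≤ K)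
    (hb : ∀ x ∈ H, ‖y' x‖ ≤ K * ‖y x‖) {q x : E} (hq : q ∈ H) (hx : x ∈ H) (h0 : y q = 0) :
    y x = 0 := by
  have := norm_le_of_norm_fderiv_le_affine hH hy hK (ε := 0) (by simpa using hb) hq hx
  rw [h0, norm_zero, zero_mul, gronwallBound_ε0_δ0] at this
  simpa using this

/-- Gronwall along segments bounds y on the bounded set; the inequality then bounds the derivative,
and convexity gives a Lipschitz constant. -/
theorem exists_lipschitzOnWith_of_norm_fderiv_le {H : Set E} (hH : Convex ℝ H)
    (hHb : Bornology.IsBounded H) {y : E → F} {y' : E → E →L[ℝ] F} {K : ℝ}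
    (hy : ∀ x ∈ H, HasFDerivAt y (y' x) x) (hK : 0 ≤ K)
    (hb : ∀ x ∈ H, ‖y' x‖ ≤ K * ‖y x‖ + K) : ∃ C, LipschitzOnWith C y H := by
  rcases H.eq_empty_or_nonempty with rfl | ⟨q, hq⟩
  · exact ⟨0, lipschitzOnWith_empty _ _⟩
  obtain ⟨r, hr⟩ := hHb.subset_closedBall q
  have hbd : ∀ x ∈ H, ‖y x‖ ≤ gronwallBound ‖y q‖ (K * r) (K * r) 1 := by
    intro x hx
    have hxr : ‖x - q‖ ≤ r := by rw [← dist_eq_norm]; exact hr hx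
    have hseg := norm_le_of_norm_fderiv_le_affine hH hy hK hb hq hx
    refine hseg.trans ?_
    have h0 := norm_nonneg (x - q)
    have hr0 := h0.trans hxr
    have hanti : ∀ k k' : ℝ, 0 ≤ k → k ≤ k' →
        gronwallBound ‖y q‖ k k 1 ≤ gronwallBound ‖y q‖ k' k' 1 := by
      intro k k' hk hkk
      have hform : ∀ c : ℝ, 0 ≤ c → gronwallBound ‖y q‖ c c 1 = ‖y q‖ * Real.exp c + (Real.exp c - 1) := by
        intro c hc
        rcases hc.eq_or_lt with rfl | hc
        · simp [gronwallBound_K0]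
        · rw [gronwallBound_of_K_ne_0 hc.ne']; simp [div_self hc.ne']
      rw [hform k hk, hform k' (hk.trans hkk)]
      have := Real.exp_le_exp.2 hkk
      nlinarith [norm_nonneg (y q)]
    exact hanti _ _ (by positivity) (by gcongr)
  set M := gronwallBound ‖y q‖ (K * r) (K * r) 1
  have hM : 0 ≤ M := (norm_nonneg _).trans (hbd q hq)
  have hKM : 0 ≤ K * M + K := by positivity
  refine ⟨Real.toNNReal (K * M + K), ?_⟩
  refine hH.lipschitzOnWith_of_nnnorm_hasFDerivWithin_le (f' := y')
    (fun x hx => (hy x hx).hasFDerivWithinAt) fun x hx => NNReal.coe_le_coe.1 ?_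
  rw [coe_nnnorm, Real.coe_toNNReal _ hKM]
  refine (hb x hx).trans ?_
  have := hbd x hx
  gcongr

end Gronwall

namespace AxialGeometry

variable {E : Type} [NormedAddCommGroup E] [NormedSpace ℝ E] [FiniteDimensional ℝ E] {n : ℕ}
  {U : Set E} {G : E → E →L[ℝ] E →L[ℝ] ℝ} {ξ η : E → E}

theorem norm_prod_le {D₁ : E →L[ℝ] E} {D₂ : E →L[ℝ] E →L[ℝ] E} {C : ℝ} (hC : 0 ≤ C)
    (h1 : ‖D₁‖ ≤ C) (h2 : ‖D₂‖ ≤ C) : ‖D₁.prod D₂‖ ≤ C := by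
  refine ContinuousLinearMap.opNorm_le_bound _ hC fun X => ?_
  rw [ContinuousLinearMap.prod_apply, Prod.norm_def]
  exact max_le ((ContinuousLinearMap.le_opNorm _ _).trans (by gcongr))
    ((ContinuousLinearMap.le_opNorm _ _).trans (by gcongr))

/-- Near every point, Killing vectors are determined by their germ at any other point. -/
theorem exists_ball_killing_eq_zero (A : AxialGeometry n U G ξ η) {p : E} (hp : p ∈ U) :
    ∃ r > 0, Metric.ball p r ⊆ U ∧ ∀ ζ : E → E, ContDiffOn ℝ 2 ζ (Metric.ball p r) →
      (∀ x ∈ Metric.ball p r, lieForm ζ G x = 0) → ∀ q ∈ Metric.ball p r, ζ =ᶠ[𝓝 q] 0 →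
      ∀ x ∈ Metric.ball p r, ζ x = 0 := by
  have hc : ContinuousAt (jetCoeff G) p :=
    A.contDiffOn_jetCoeff.continuousOn.continuousAt (A.isOpen.mem_nhds hp)
  -- The radius depends only on a bound for the coefficients, so a single ball serves all fields ζ
  -- and all points q.
  have hev : ∀ᶠ x in 𝓝 p, ‖jetCoeff G x‖ < ‖jetCoeff G p‖ + 1 :=
    hc.norm.eventually (gt_mem_nhds (by linarith))
  obtain ⟨r, hr, hball⟩ := Metric.eventually_nhds_iff_ball.1 (hev.and (A.isOpen.eventually_mem hp))
  refine ⟨r, hr, fun x hx => (hball x hx).2, fun ζ hζ hk q hq hζq x hx => ?_⟩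
  have hat : ∀ z ∈ Metric.ball p r, ContDiffAt ℝ 2 ζ z := fun z hz =>
    hζ.contDiffAt (Metric.isOpen_ball.mem_nhds hz)
  have hy : ∀ z ∈ Metric.ball p r, HasFDerivAt (fun z => (ζ z, fderiv ℝ ζ z))
      ((fderiv ℝ ζ z).prod (fderiv ℝ (fderiv ℝ ζ) z)) z := fun z hz =>
    (((hat z hz).differentiableAt two_ne_zero).hasFDerivAt).prodMk
      ((((hat z hz).fderiv_right (m := 1) (by norm_num)).differentiableAt one_ne_zero).hasFDerivAt)
  have h0 : (fun z => (ζ z, fderiv ℝ ζ z)) q = 0 := by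
    simp only [hζq.self_of_nhds, hζq.fderiv_eq]
    simp
  have := eq_zero_of_norm_fderiv_le (convex_ball p r) hy (K := 1 + (‖jetCoeff G p‖ + 1))
    (by positivity) (fun z hz => ?_) hq hx h0
  · exact congrArg Prod.fst this
  · have e := A.fderiv_fderiv_eq (c := fun _ => 0) (hball z hz).2 (hat z hz)
      (differentiableAt_const _) (by
        filter_upwards [Metric.isOpen_ball.mem_nhds hz] with w hw using hk w hw)
    rw [fderiv_fun_const, Pi.zero_apply, map_zero, zero_add] at e
    have n0 := norm_nonneg (ζ z, fderiv ℝ ζ z)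
    refine norm_prod_le (by positivity) ?_ ?_
    · have : ‖fderiv ℝ ζ z‖ ≤ ‖(ζ z, fderiv ℝ ζ z)‖ := norm_snd_le (ζ z, fderiv ℝ ζ z)
      nlinarith [mul_nonneg (by positivity : 0 ≤ ‖jetCoeff G p‖ + 1) n0]
    · rw [e]
      refine (ContinuousLinearMap.le_opNorm _ _).trans ?_
      have := (hball z hz).1.le
      nlinarith

end AxialGeometry

/-! ### Gauge fields: existence off the axis, uniqueness, regularity. -/

/-- `X` is, at `x`, a combination of `ξ`, `η` whose coefficients have the shifts of `k` as negative
differentials. -/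
structure IsGaugeAt {E : Type} [NormedAddCommGroup E] [NormedSpace ℝ E]
    (G : E → E →L[ℝ] E →L[ℝ] ℝ) (ξ η : E → E) (k : E → E →L[ℝ] E →L[ℝ] ℝ) (X : E → E) (x : E) :
    Prop where
  decomp : X x = coFst (G x) (ξ x) (η x) (X x) • ξ x + coSnd (G x) (ξ x) (η x) (X x) • η x
  fst : HasFDerivAt (fun y => coFst (G y) (ξ y) (η y) (X y))
    (- shiftFst (G x) (ξ x) (η x) (k x)) x
  snd : HasFDerivAt (fun y => coSnd (G y) (ξ y) (η y) (X y))
    (- shiftSnd (G x) (ξ x) (η x) (k x)) x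

/-- The shifts of `k` are closed off the axis. -/
structure HasClosedShift {E : Type} [NormedAddCommGroup E] [NormedSpace ℝ E] (U : Set E)
    (G : E → E →L[ℝ] E →L[ℝ] ℝ) (ξ η : E → E) (k : E → E →L[ℝ] E →L[ℝ] ℝ) : Prop where
  fst : ∀ x ∈ U, η x ≠ 0 → ∀ X Y, fderiv ℝ (fun y => shiftFst (G y) (ξ y) (η y) (k y)) x X Y =
    fderiv ℝ (fun y => shiftFst (G y) (ξ y) (η y) (k y)) x Y X
  snd : ∀ x ∈ U, η x ≠ 0 → ∀ X Y, fderiv ℝ (fun y => shiftSnd (G y) (ξ y) (η y) (k y)) x X Y =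
    fderiv ℝ (fun y => shiftSnd (G y) (ξ y) (η y) (k y)) x Y X

theorem lieForm_sub {E : Type} [NormedAddCommGroup E] [NormedSpace ℝ E] {X Y : E → E}
    {T : E → E →L[ℝ] E →L[ℝ] ℝ} {x : E} (hX : DifferentiableAt ℝ X x)
    (hY : DifferentiableAt ℝ Y x) :
    lieForm (fun y => X y - Y y) T x = lieForm X T x - lieForm Y T x := by
  rw [lieForm, lieForm, lieForm, fderiv_fun_sub hX hY]
  simp only [map_sub, sub_apply]
  abel

theorem lieForm_add {E : Type} [NormedAddCommGroup E] [NormedSpace ℝ E] {X Y : E → E}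
    {T : E → E →L[ℝ] E →L[ℝ] ℝ} {x : E} (hX : DifferentiableAt ℝ X x)
    (hY : DifferentiableAt ℝ Y x) :
    lieForm (fun y => X y + Y y) T x = lieForm X T x + lieForm Y T x := by
  rw [lieForm, lieForm, lieForm, fderiv_fun_add hX hY]
  simp only [map_add, add_apply]
  abel

theorem lieForm_const_smul {E : Type} [NormedAddCommGroup E] [NormedSpace ℝ E] {X : E → E}
    {T : E → E →L[ℝ] E →L[ℝ] ℝ} {x : E} (hX : DifferentiableAt ℝ X x) (a : ℝ) :
    lieForm (fun y => a • X y) T x = a • lieForm X T x := by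
  rw [lieForm, lieForm, fderiv_fun_const_smul hX]
  simp only [map_smul, smul_apply, smul_add]

theorem lieForm_congr {E : Type} [NormedAddCommGroup E] [NormedSpace ℝ E] {X Y : E → E}
    {T : E → E →L[ℝ] E →L[ℝ] ℝ} {x : E} (h : X =ᶠ[𝓝 x] Y) : lieForm X T x = lieForm Y T x := by
  rw [lieForm, lieForm, h.fderiv_eq, h.self_of_nhds]

namespace AxialGeometry

variable {E : Type} [NormedAddCommGroup E] [NormedSpace ℝ E] {n : ℕ}
  {U : Set E} {G : E → E →L[ℝ] E →L[ℝ] ℝ} {ξ η : E → E} {k : E → E →L[ℝ] E →L[ℝ] ℝ}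

theorem lieForm_xi (A : AxialGeometry n U G ξ η) {x : E} (hx : x ∈ U) : lieForm ξ G x = 0 := by
  ext X Y; rw [lieForm_apply, A.killing_xi x hx X Y]; rfl

theorem lieForm_eta (A : AxialGeometry n U G ξ η) {x : E} (hx : x ∈ U) : lieForm η G x = 0 := by
  ext X Y; rw [lieForm_apply, A.killing_eta x hx X Y]; rfl

theorem coframe_apply (A : AxialGeometry n U G ξ η) {x : E} (hx : x ∈ U) (hη : η x ≠ 0) (a b : ℝ) :
    coFst (G x) (ξ x) (η x) (a • ξ x + b • η x) = a ∧
    coSnd (G x) (ξ x) (η x) (a • ξ x + b • η x) = b := by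
  have hs := A.symm x hx
  have hd := A.gramDet_ne hx hη
  simp [coFst_fst hs hd, coFst_snd, coSnd_fst hs, coSnd_snd hd]

theorem isGaugeAt_of_eventuallyEq (A : AxialGeometry n U G ξ η) {x : E} (hx : x ∈ U)
    (hη : η x ≠ 0) {X : E → E} {S₁ S₂ : E → ℝ}
    (h1 : HasFDerivAt S₁ (- shiftFst (G x) (ξ x) (η x) (k x)) x)
    (h2 : HasFDerivAt S₂ (- shiftSnd (G x) (ξ x) (η x) (k x)) x)
    (hX : ∀ᶠ y in 𝓝 x, X y = S₁ y • ξ y + S₂ y • η y) : IsGaugeAt G ξ η k X x := by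
  have hev : ∀ᶠ y in 𝓝 x, coFst (G y) (ξ y) (η y) (X y) = S₁ y ∧
      coSnd (G y) (ξ y) (η y) (X y) = S₂ y := by
    filter_upwards [A.isOpen_off_axis.mem_nhds ⟨hx, hη⟩, hX] with y hy hy2
    rw [hy2]; exact A.coframe_apply hy.1 hy.2 _ _
  refine ⟨?_, h1.congr_of_eventuallyEq (hev.mono fun _ h => h.1),
    h2.congr_of_eventuallyEq (hev.mono fun _ h => h.2)⟩
  rw [hev.self_of_nhds.1, hev.self_of_nhds.2, hX.self_of_nhds]

theorem hasFDerivAt_gauge (A : AxialGeometry n U G ξ η) {X : E → E} {x : E} (hx : x ∈ U)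
    (hX : ∀ᶠ y in 𝓝 x, IsGaugeAt G ξ η k X y) :
    HasFDerivAt X ((coFst (G x) (ξ x) (η x) (X x)) • fderiv ℝ ξ x
      + (- shiftFst (G x) (ξ x) (η x) (k x)).smulRight (ξ x)
      + ((coSnd (G x) (ξ x) (η x) (X x)) • fderiv ℝ η x
      + (- shiftSnd (G x) (ξ x) (η x) (k x)).smulRight (η x))) x :=
  ((hX.self_of_nhds.fst.smul (A.hasFDerivAt_xi hx)).add
    (hX.self_of_nhds.snd.smul (A.hasFDerivAt_eta hx))).congr_of_eventuallyEq
    (hX.mono fun _ h => h.decomp)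

/-- The Lie derivative of an invariant tensor along a gauge field. -/
theorem lieForm_gauge (A : AxialGeometry n U G ξ η) {X : E → E} {x : E} (hx : x ∈ U)
    (hX : ∀ᶠ y in 𝓝 x, IsGaugeAt G ξ η k X y) {T : E → E →L[ℝ] E →L[ℝ] ℝ}
    (hξ : lieForm ξ T x = 0) (hη : lieForm η T x = 0) (Y Z : E) :
    lieForm X T x Y Z = -(shiftFst (G x) (ξ x) (η x) (k x) Y * T x (ξ x) Z
      + shiftFst (G x) (ξ x) (η x) (k x) Z * T x Y (ξ x)
      + shiftSnd (G x) (ξ x) (η x) (k x) Y * T x (η x) Z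
      + shiftSnd (G x) (ξ x) (η x) (k x) Z * T x Y (η x)) := by
  have h1 := congrArg (fun S : E →L[ℝ] E →L[ℝ] ℝ => S Y Z) hξ
  have h2 := congrArg (fun S : E →L[ℝ] E →L[ℝ] ℝ => S Y Z) hη
  simp only [lieForm_apply, zero_apply] at h1 h2
  have hd := hX.self_of_nhds.decomp
  rw [lieForm_apply, (A.hasFDerivAt_gauge hx hX).fderiv]
  conv_lhs => enter [1, 1, 1, 1]; rw [hd]
  simp only [map_add, map_smul, add_apply, smul_apply, ContinuousLinearMap.smulRight_apply,
    neg_apply, smul_eq_mul]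
  linear_combination (coFst (G x) (ξ x) (η x) (X x)) * h1 + (coSnd (G x) (ξ x) (η x) (X x)) * h2

/-- The reflection fixes both diagonal blocks of k and reverses the cross block, so the right side
is minus the cross part of k. In this form the source extends across the axis, unlike the shifts
from which it is built. -/
theorem lieForm_gauge_metric (A : AxialGeometry n U G ξ η) {X : E → E} {x : E} (hx : x ∈ U)
    (hη : η x ≠ 0) (hX : ∀ᶠ y in 𝓝 x, IsGaugeAt G ξ η k X y) (hk : ∀ Y Z, k x Y Z = k x Z Y) :
    lieForm X G x = (1 / 2 : ℝ) • ((formAction E).pull (orbitRefl (G x) (ξ x) (η x)) (k x) - k x) := by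
  have hs := A.symm x hx
  have hd := A.gramDet_ne hx hη
  ext Y Z
  rw [A.lieForm_gauge hx hX (A.lieForm_xi hx) (A.lieForm_eta hx)]
  rw [smul_apply, smul_apply, sub_apply, sub_apply, formAction_pull_apply, smul_eq_mul]
  obtain ⟨a, b, Y, hY, rfl⟩ := exists_orbit_split hs hd Y
  obtain ⟨c, d, Z, hZ, rfl⟩ := exists_orbit_split hs hd Z
  simp only [map_add, map_smul, orbitRefl_fst hs hd, orbitRefl_snd hs hd, hY, hZ]
  rw [orbitRefl_eq_self_iff hs hd] at hY hZ
  have m1 := metric_shift (k := k x) hd hY.1 hY.2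
  have m2 := metric_shift (k := k x) hd hZ.1 hZ.2
  simp only [map_add, map_smul, map_neg, add_apply, smul_apply, neg_apply, smul_eq_mul,
    shift_fst (k := k x) hs hd, shift_snd (k := k x) hd, hs Y, hY.1, hY.2, hZ.1, hZ.2, hk Y,
    hs (η x) (ξ x)]
  linear_combination (-c) * m1.1 - d * m1.2 - a * m2.1 - b * m2.2

theorem contDiffOn_shift (A : AxialGeometry n U G ξ η) {m : ℕ} (hm : m ≤ n + 1)
    (hk : ContDiffOn ℝ m k U) :
    ContDiffOn ℝ m (fun y => shiftFst (G y) (ξ y) (η y) (k y)) (U ∩ {x | η x ≠ 0}) ∧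
    ContDiffOn ℝ m (fun y => shiftSnd (G y) (ξ y) (η y) (k y)) (U ∩ {x | η x ≠ 0}) :=
  _root_.contDiffOn_shift ((A.metric_class.of_le (by exact_mod_cast hm)).mono inter_subset_left)
    ((A.xi_class.of_le (by exact_mod_cast hm)).mono inter_subset_left)
    ((A.eta_class.of_le (by exact_mod_cast hm)).mono inter_subset_left)
    (hk.mono inter_subset_left) fun _ h => A.gramDet_ne h.1 h.2

/-- Gauge fields are smooth off the axis. -/
theorem contDiffOn_gauge_off_axis (A : AxialGeometry n U G ξ η) {m : ℕ} (hm : m ≤ n)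
    (hk : ContDiffOn ℝ m k U) {X : E → E} (hX : ∀ x ∈ U, η x ≠ 0 → IsGaugeAt G ξ η k X x) :
    ContDiffOn ℝ (m + 1 : ℕ) X (U ∩ {x | η x ≠ 0}) := by
  obtain ⟨w1, w2⟩ := A.contDiffOn_shift (by omega) hk
  have prim : ∀ {S : E → ℝ} {W : E → E →L[ℝ] ℝ}, ContDiffOn ℝ m W (U ∩ {x | η x ≠ 0}) →
      (∀ x ∈ U ∩ {x | η x ≠ 0}, HasFDerivAt S (- W x) x) →
      ContDiffOn ℝ (m + 1 : ℕ) S (U ∩ {x | η x ≠ 0}) := by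
    intro S W hW hS
    push_cast
    rw [contDiffOn_succ_iff_fderiv_of_isOpen A.isOpen_off_axis]
    exact ⟨fun x hx => (hS x hx).differentiableAt.differentiableWithinAt, by simp,
      hW.neg.congr fun x hx => (hS x hx).fderiv⟩
  have hle : ((m + 1 : ℕ) : WithTop ℕ∞) ≤ (n + 1 : ℕ) := by norm_cast; omega
  have s1 := prim w1 fun x hx => (hX x hx.1 hx.2).fst
  have s2 := prim w2 fun x hx => (hX x hx.1 hx.2).snd
  exact ((s1.smul ((A.xi_class.of_le hle).mono inter_subset_left)).add
    (s2.smul ((A.eta_class.of_le hle).mono inter_subset_left))).congr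
    fun x hx => (hX x hx.1 hx.2).decomp

/-- Poincaré lemma on a ball that avoids the axis. -/
theorem exists_gauge_off_axis [CompleteSpace E] (A : AxialGeometry n U G ξ η)
    (hk : ContDiffOn ℝ 1 k U) (hc : HasClosedShift U G ξ η k) {p : E} (hp : p ∈ U) (hη : η p ≠ 0) :
    ∃ X : E → E, ∀ᶠ x in 𝓝 p, IsGaugeAt G ξ η k X x := by
  obtain ⟨r, hr, hball⟩ := Metric.isOpen_iff.1 A.isOpen_off_axis p ⟨hp, hη⟩
  obtain ⟨w1, w2⟩ := A.contDiffOn_shift (m := 1) (by omega) (by exact_mod_cast hk)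
  have hd1 : DifferentiableOn ℝ (fun y => shiftFst (G y) (ξ y) (η y) (k y)) (Metric.ball p r) :=
    (w1.mono hball).differentiableOn (by norm_cast)
  have hd2 : DifferentiableOn ℝ (fun y => shiftSnd (G y) (ξ y) (η y) (k y)) (Metric.ball p r) :=
    (w2.mono hball).differentiableOn (by norm_cast)
  obtain ⟨f₁, hf₁⟩ := (convex_ball p r).exists_forall_hasFDerivAt_of_fderiv_symmetric
    Metric.isOpen_ball hd1 fun x hx X Y => hc.fst x (hball hx).1 (hball hx).2 X Y
  obtain ⟨f₂, hf₂⟩ := (convex_ball p r).exists_forall_hasFDerivAt_of_fderiv_symmetric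
    Metric.isOpen_ball hd2 fun x hx X Y => hc.snd x (hball hx).1 (hball hx).2 X Y
  refine ⟨fun y => (- f₁ y) • ξ y + (- f₂ y) • η y, ?_⟩
  filter_upwards [Metric.ball_mem_nhds p hr] with x hx
  exact A.isGaugeAt_of_eventuallyEq (hball hx).1 (hball hx).2 (hf₁ x hx).neg (hf₂ x hx).neg
    (Eventually.of_forall fun _ => rfl)

theorem eq_zero_of_orbit_combination (A : AxialGeometry n U G ξ η) {p : E} (hp : p ∈ U) {a b : ℝ}
    (h : ∀ᶠ x in 𝓝 p, a • ξ x + b • η x = 0) : a = 0 ∧ b = 0 := by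
  have := A.axis_thin p hp
  obtain ⟨x, hx1, hx2⟩ := (Eventually.and (eventually_nhdsWithin_of_eventually_nhds
    (h.and (A.isOpen.eventually_mem hp))) (eventually_mem_nhdsWithin (s := {x | η x ≠ 0}))).exists
  have := A.coframe_apply hx1.2 hx2 a b
  rw [hx1.1, map_zero, map_zero] at this
  exact ⟨this.1.symm, this.2.symm⟩

/-- Identities between continuous functions extend from the complement of the axis. -/
theorem eq_of_eq_off_axis (A : AxialGeometry n U G ξ η) {F : Type*} [TopologicalSpace F] [T2Space F]
    {f g : E → F} (hf : ContinuousOn f U) (hg : ContinuousOn g U)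
    (h : ∀ x ∈ U, η x ≠ 0 → f x = g x) {x : E} (hx : x ∈ U) : f x = g x := by
  have := A.axis_thin x hx
  have hUx := A.isOpen.mem_nhds hx
  refine tendsto_nhds_unique_of_eventuallyEq
    ((hf.continuousAt hUx).tendsto.mono_left (nhdsWithin_le_nhds (s := {x | η x ≠ 0})))
    ((hg.continuousAt hUx).tendsto.mono_left nhdsWithin_le_nhds) ?_
  filter_upwards [nhdsWithin_le_nhds hUx, self_mem_nhdsWithin] with y hy1 hy2 using h y hy1 hy2

theorem continuousOn_lieForm (A : AxialGeometry n U G ξ η) {X : E → E} (hX : ContDiffOn ℝ 1 X U) :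
    ContinuousOn (lieForm X G) U :=
  ((A.metric_two.continuousOn_fderiv_of_isOpen A.isOpen (by norm_num)).clm_apply
    hX.continuousOn).add (((formAction E).der.continuous.comp_continuousOn
      (hX.continuousOn_fderiv_of_isOpen A.isOpen le_rfl)).clm_apply A.metric_class.continuousOn)

/-- Gauge fields are unique up to constant combinations of the Killing vectors. -/
theorem exists_gauge_sub_eq [FiniteDimensional ℝ E] (A : AxialGeometry n U G ξ η)
    (hk : ∀ x ∈ U, ∀ Y Z, k x Y Z = k x Z Y) {X X' : E → E}
    (hXc : ContDiffOn ℝ 2 X U) (hXc' : ContDiffOn ℝ 2 X' U)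
    (hX : ∀ x ∈ U, η x ≠ 0 → IsGaugeAt G ξ η k X x)
    (hX' : ∀ x ∈ U, η x ≠ 0 → IsGaugeAt G ξ η k X' x) {p : E} (hp : p ∈ U) :
    ∃ a b : ℝ, ∀ᶠ x in 𝓝 p, X x - X' x = a • ξ x + b • η x := by
  obtain ⟨r, hr, hball, huniq⟩ := A.exists_ball_killing_eq_zero hp
  have := A.axis_thin p hp
  obtain ⟨q, hq1, hq2⟩ := (Eventually.and (eventually_nhdsWithin_of_eventually_nhds
    (Metric.isOpen_ball.eventually_mem (Metric.mem_ball_self (x := p) hr)))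
    (eventually_mem_nhdsWithin (s := {x | η x ≠ 0}))).exists
  have hqU := hball hq1
  obtain ⟨s, hs, hsball⟩ := Metric.isOpen_iff.1 A.isOpen_off_axis q ⟨hqU, hq2⟩
  have hconst : ∀ f : E → ℝ, (∀ x ∈ Metric.ball q s, HasFDerivAt f (0 : E →L[ℝ] ℝ) x) →
      ∀ x ∈ Metric.ball q s, f x = f q := fun f hf x hx =>
    (convex_ball q s).is_const_of_fderivWithin_eq_zero
      (fun y hy => (hf y hy).differentiableAt.differentiableWithinAt)
      (fun y hy => ((hf y hy).hasFDerivWithinAt.fderivWithin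
        (Metric.isOpen_ball.uniqueDiffWithinAt hy))) hx (Metric.mem_ball_self hs)
  have hg : ∀ x ∈ Metric.ball q s, IsGaugeAt G ξ η k X x ∧ IsGaugeAt G ξ η k X' x := fun x hx =>
    ⟨hX x (hsball hx).1 (hsball hx).2, hX' x (hsball hx).1 (hsball hx).2⟩
  -- Both fields have coefficients with the same differentials, so near `q` the coefficients differ
  -- by constants.
  have c1 := hconst _ fun x hx => ((hg x hx).1.fst.sub (hg x hx).2.fst).congr_fderiv (sub_self _)
  have c2 := hconst _ fun x hx => ((hg x hx).1.snd.sub (hg x hx).2.snd).congr_fderiv (sub_self _)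
  set a := coFst (G q) (ξ q) (η q) (X q) - coFst (G q) (ξ q) (η q) (X' q) with ha
  set b := coSnd (G q) (ξ q) (η q) (X q) - coSnd (G q) (ξ q) (η q) (X' q) with hb
  refine ⟨a, b, ?_⟩
  set ζ : E → E := fun x => (X x - X' x) - (a • ξ x + b • η x) with hζ
  have hζc : ContDiffOn ℝ 2 ζ U := (hXc.sub hXc').sub
    ((A.xi_two.const_smul a).add (A.eta_two.const_smul b))
  have dX : ∀ {Y : E → E}, ContDiffOn ℝ 2 Y U → ∀ x ∈ U, DifferentiableAt ℝ Y x := fun hY x hx =>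
    (hY.contDiffAt (A.isOpen.mem_nhds hx)).differentiableAt two_ne_zero
  -- Off the axis both gauge fields have the same Lie derivative of the metric and ξ, η are Killing;
  -- continuity covers the axis. A Killing field that vanishes near `q` then vanishes on the ball
  -- around `p`.
  have hkill : ∀ x ∈ U, lieForm ζ G x = 0 := by
    intro x hx
    refine A.eq_of_eq_off_axis (f := lieForm ζ G) (g := fun _ => 0)
      (A.continuousOn_lieForm (hζc.of_le (by norm_num))) continuousOn_const (fun y hy hη => ?_) hx
    have hev : ∀ᶠ z in 𝓝 y, IsGaugeAt G ξ η k X z ∧ IsGaugeAt G ξ η k X' z := by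
      filter_upwards [A.isOpen_off_axis.mem_nhds ⟨hy, hη⟩] with z hz
        using ⟨hX z hz.1 hz.2, hX' z hz.1 hz.2⟩
    have e1 := A.lieForm_gauge_metric hy hη (hev.mono fun _ h => h.1) (hk y hy)
    have e2 := A.lieForm_gauge_metric hy hη (hev.mono fun _ h => h.2) (hk y hy)
    have d1 := dX A.xi_two y hy
    have d2 := dX A.eta_two y hy
    have l1 := lieForm_sub (T := G) (X := fun x => X x - X' x) (Y := fun x => a • ξ x + b • η x)
      ((dX hXc y hy).fun_sub (dX hXc' y hy)) ((d1.fun_const_smul a).fun_add (d2.fun_const_smul b))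
    have l2 := lieForm_add (T := G) (X := fun x => a • ξ x) (Y := fun x => b • η x)
      (d1.fun_const_smul a) (d2.fun_const_smul b)
    rw [hζ, l1, l2, lieForm_sub (dX hXc y hy) (dX hXc' y hy),
      lieForm_const_smul d1, lieForm_const_smul d2, A.lieForm_xi hy, A.lieForm_eta hy, e1, e2]
    simp
  have hq0 : ζ =ᶠ[𝓝 q] 0 := by
    filter_upwards [Metric.ball_mem_nhds q hs] with x hx
    have e1 : coFst (G x) (ξ x) (η x) (X x) - coFst (G x) (ξ x) (η x) (X' x) = a := c1 x hx
    have e2 : coSnd (G x) (ξ x) (η x) (X x) - coSnd (G x) (ξ x) (η x) (X' x) = b := c2 x hx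
    have d1 := (hg x hx).1.decomp
    have d2 := (hg x hx).2.decomp
    rw [Pi.zero_apply, hζ]
    simp only [← e1, ← e2]
    rw [sub_smul, sub_smul, sub_eq_zero]
    calc X x - X' x = _ - _ := congrArg₂ (· - ·) d1 d2
      _ = _ := by abel
  filter_upwards [Metric.ball_mem_nhds p hr] with x hx
  exact sub_eq_zero.1 (huniq ζ (hζc.mono hball) (fun y hy => hkill y (hball hy)) q hq1 hq0 x hx)

/-- A gauge field of class `C^1` across a removable axis is smooth. -/
theorem contDiffOn_gauge [FiniteDimensional ℝ E] (A : AxialGeometry n U G ξ η)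
    (hrem : IsC1Removable U {x | η x = 0}) {m : ℕ} (hm : m + 1 ≤ n)
    (hk : ContDiffOn ℝ (m + 1 : ℕ) k U) (hks : ∀ x ∈ U, ∀ Y Z, k x Y Z = k x Z Y)
    {f : E → E →L[ℝ] E →L[ℝ] ℝ} (hf : ContDiffOn ℝ (m + 1 : ℕ) f U)
    (hfk : ∀ x ∈ U, η x ≠ 0 → f x = (formAction E).pull (orbitRefl (G x) (ξ x) (η x)) (k x))
    {X : E → E} (hXc : ContDiffOn ℝ 1 X U) (hX : ∀ x ∈ U, η x ≠ 0 → IsGaugeAt G ξ η k X x) :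
    ContDiffOn ℝ (m + 2 : ℕ) X U := by
  set c : E → E →L[ℝ] E →L[ℝ] ℝ := fun x => (1 / 2 : ℝ) • (f x - k x) with hc
  have hcc : ContDiffOn ℝ (m + 1 : ℕ) c U := (hf.sub hk).const_smul (1 / 2 : ℝ)
  have hb : ContDiffOn ℝ m (fun x => koszul (G x) (fderiv ℝ c x)) U :=
    (A.contDiffOn_koszul.of_le (by norm_cast; omega)).clm_apply
      (hcc.fderiv_of_isOpen A.isOpen (by norm_cast))
  have hoff := A.contDiffOn_gauge_off_axis hm hk hX
  have hDX : ContinuousOn (fderiv ℝ X) U := hXc.continuousOn_fderiv_of_isOpen A.isOpen le_rfl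
  refine A.contDiffOn_of_jet A.isOpen subset_rfl hm hb hXc ?_
  -- The second order system is known off the axis only. Its right side is continuous on all of `U`,
  -- so removability makes the first derivative of `X` differentiable across the axis.
  refine hrem _ (fderiv ℝ X) _ hDX (hb.continuousOn.add
    (A.contDiffOn_jetCoeff.continuousOn.clm_apply (hXc.continuousOn.prodMk hDX))) ?_
  rintro x ⟨hx, hη⟩
  have hXx : ContDiffAt ℝ 2 X x := (hoff.contDiffAt (A.isOpen_off_axis.mem_nhds ⟨hx, hη⟩)).of_le
    (by norm_cast; omega)
  have e := A.fderiv_fderiv_eq (c := c) hx hXx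
    ((hcc.contDiffAt (A.isOpen.mem_nhds hx)).differentiableAt (by norm_cast)) (by
      filter_upwards [A.isOpen_off_axis.mem_nhds ⟨hx, hη⟩] with y hy
      rw [A.lieForm_gauge_metric hy.1 hy.2 ?_ (hks y hy.1), ← hfk y hy.1 hy.2]
      filter_upwards [A.isOpen_off_axis.mem_nhds hy] with z hz using hX z hz.1 hz.2)
  rw [← e]
  exact ((hXx.fderiv_right (m := 1) (by norm_num)).differentiableAt one_ne_zero).hasFDerivAt

end AxialGeometry

/-! ### Primitives on the complement of a subspace of codimension two. -/

section CodimTwo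

variable {E : Type} [NormedAddCommGroup E] [NormedSpace ℝ E]

/-- A closed form with values in `P` on the complement of a subspace of codimension two has a
primitive if a jet of the local primitives is Lipschitz and determines them at the subspace; the jet
then extends continuously across the subspace. -/
theorem exists_primitive_off_codim_two {P Y : Type} [NormedAddCommGroup P] [NormedSpace ℝ P]
    [CompleteSpace P] [NormedAddCommGroup Y] [NormedSpace ℝ Y] [FiniteDimensional ℝ Y] {r : ℝ}
    (hr : 0 < r) {l₁ l₂ : E →L[ℝ] ℝ} {e f : E} (h11 : l₁ e = 1) (h21 : l₂ e = 0) (h12 : l₁ f = 0)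
    (h22 : l₂ f = 1) {W : E → E →L[ℝ] P}
    (hW : ∀ z ∈ Metric.ball (0 : E) r, (l₁ z ≠ 0 ∨ l₂ z ≠ 0) → DifferentiableAt ℝ W z ∧
      ∀ X Y, fderiv ℝ W z X Y = fderiv ℝ W z Y X)
    {Θ : E → P →L[ℝ] Y} (hΘ : ContinuousOn Θ (Metric.ball 0 r)) (hinj : ∀ a, Θ 0 a = 0 → a = 0)
    {β : E → Y}
    (hLip : ∀ H ⊆ Metric.ball (0 : E) r, IsOpen H → Convex ℝ H → (∀ z ∈ H, l₁ z ≠ 0 ∨ l₂ z ≠ 0) →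
      ∀ S : E → P, (∀ z ∈ H, HasFDerivAt S (W z) z) →
      ∃ C, LipschitzOnWith C (fun z => Θ z (S z) + β z) H) :
    ∃ (S : E → P) (y : E → Y), ContinuousOn y (Metric.ball 0 r) ∧
      ∀ z ∈ Metric.ball (0 : E) r, (l₁ z ≠ 0 ∨ l₂ z ≠ 0) →
        HasFDerivAt S (W z) z ∧ y z = Θ z (S z) + β z := by
  classical
  set B := Metric.ball (0 : E) r with hB
  have h0B : (0 : E) ∈ B := Metric.mem_ball_self hr
  -- Four open half-spaces, in cyclic order, cover the complement; `v a` points into the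
  -- intersection of the half-spaces `a` and `a + 1`. Opposite half-spaces are disjoint.
  let m : Fin 4 → E →L[ℝ] ℝ := ![l₁, l₂, -l₁, -l₂]
  let v : Fin 4 → E := ![e + f, f - e, -e - f, e - f]
  have hmv : ∀ a, m a (v a) = 1 ∧ m (a + 1) (v a) = 1 := by
    intro a; fin_cases a <;> simp [m, v, h11, h21, h12, h22]
  have hm0 : ∀ z, l₁ z = 0 → l₂ z = 0 → ∀ a, m a z = 0 := by
    intro z h1 h2 a; fin_cases a <;> simp [m, h1, h2]
  have hmpos : ∀ a z, 0 < m a z → l₁ z ≠ 0 ∨ l₂ z ≠ 0 := by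
    intro a z h
    by_contra! hc
    rw [hm0 z hc.1 hc.2 a] at h
    exact h.false
  have hcover : ∀ z, (l₁ z ≠ 0 ∨ l₂ z ≠ 0) → ∃ a, 0 < m a z := by
    rintro z (h | h)
    · rcases h.lt_or_gt with h | h
      · exact ⟨2, by simpa [m] using h⟩
      · exact ⟨0, by simpa [m] using h⟩
    · rcases h.lt_or_gt with h | h
      · exact ⟨3, by simpa [m] using h⟩
      · exact ⟨1, by simpa [m] using h⟩
  have hopp : ∀ a b z, 0 < m a z → 0 < m b z → b = a ∨ b = a + 1 ∨ a = b + 1 := by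
    intro a b z h1 h2
    fin_cases a <;> fin_cases b <;> simp [m] at h1 h2 ⊢ <;> linarith
  let H : Fin 4 → Set E := fun a => B ∩ {z | 0 < m a z}
  have hHo : ∀ a, IsOpen (H a) := fun a =>
    Metric.isOpen_ball.inter (isOpen_lt continuous_const (m a).continuous)
  have hHc : ∀ a, Convex ℝ (H a) := fun a =>
    (convex_ball 0 r).inter (convex_halfSpace_gt (m a).isLinear 0)
  have hHoff : ∀ a, ∀ z ∈ H a, l₁ z ≠ 0 ∨ l₂ z ≠ 0 := fun a z hz => hmpos a z hz.2
  have hprim : ∀ a, ∃ S : E → P, ∀ z ∈ H a, HasFDerivAt S (W z) z := fun a =>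
    (hHc a).exists_forall_hasFDerivAt_of_fderiv_symmetric (hHo a)
      (fun z hz => (hW z hz.1 (hHoff a z hz)).1.differentiableWithinAt)
      fun z hz => (hW z hz.1 (hHoff a z hz)).2
  choose S hS using hprim
  -- A Lipschitz map into a finite-dimensional space extends to the whole space; this supplies
  -- values on the subspace.
  have hext : ∀ a, ∃ y : E → Y, Continuous y ∧ EqOn (fun z => Θ z (S a z) + β z) y (H a) := by
    intro a
    obtain ⟨C, hC⟩ := hLip (H a) inter_subset_left (hHo a) (hHc a) (hHoff a) (S a) (hS a)
    obtain ⟨g, hg, hg2⟩ := hC.extend_finite_dimension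
    exact ⟨g, hg.continuous, hg2⟩
  choose y hyc hyeq using hext
  have hconst : ∀ a, ∃ κ : P, ∀ z ∈ H a ∩ H (a + 1), S (a + 1) z = S a z + κ := by
    intro a
    have hO : IsOpen (H a ∩ H (a + 1)) := (hHo a).inter (hHo (a + 1))
    rcases (H a ∩ H (a + 1)).eq_empty_or_nonempty with h | ⟨q, hq⟩
    · exact ⟨0, fun z hz => by simp [h] at hz⟩
    refine ⟨S (a + 1) q - S a q, fun z hz => ?_⟩
    have hd : ∀ z ∈ H a ∩ H (a + 1), HasFDerivAt (fun z => S (a + 1) z - S a z)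
        (0 : E →L[ℝ] P) z := fun z hz =>
      ((hS (a + 1) z hz.2).sub (hS a z hz.1)).congr_fderiv (sub_self _)
    have := hO.is_const_of_fderiv_eq_zero ((hHc a).inter (hHc (a + 1))).isPreconnected
      (fun z hz => (hd z hz).differentiableAt.differentiableWithinAt)
      (fun z hz => (hd z hz).fderiv) hz hq
    rw [← this]; abel
  choose κ hκ using hconst
  -- the values of the extensions on the subspace
  have haxis : ∀ a, ∀ z ∈ B, l₁ z = 0 → l₂ z = 0 → y (a + 1) z = y a z + Θ z (κ a) := by
    intro a z hz h1 h2
    have hzB : B ∈ 𝓝 z := Metric.isOpen_ball.mem_nhds hz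
    -- The point on the subspace is approached from inside the overlap of two half-spaces, where the
    -- primitives differ by the constant `κ a`.
    have hline : Tendsto (fun t : ℝ => z + t • v a) (𝓝[>] 0) (𝓝 z) := by
      have : Tendsto (fun t : ℝ => z + t • v a) (𝓝 0) (𝓝 (z + (0 : ℝ) • v a)) :=
        (continuous_const.add (continuous_id.smul continuous_const)).tendsto 0
      rw [zero_smul, add_zero] at this
      exact this.mono_left nhdsWithin_le_nhds
    have t1 := ((hyc (a + 1)).tendsto z).comp hline
    have t2 := (((hyc a).continuousAt (x := z)).add
      ((hΘ.continuousAt hzB).clm_apply (continuousAt_const (y := κ a)))).tendsto.comp hline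
    refine tendsto_nhds_unique_of_eventuallyEq t1 t2 ?_
    filter_upwards [hline.eventually hzB, self_mem_nhdsWithin] with t ht ht0
    have hmem : ∀ b, (b = a ∨ b = a + 1) → z + t • v a ∈ H b := by
      rintro b (rfl | rfl)
      · refine ⟨ht, ?_⟩
        simp only [mem_ofPred_eq, map_add, map_smul, hm0 z h1 h2, (hmv b).1]
        simpa using ht0
      · refine ⟨ht, ?_⟩
        simp only [mem_ofPred_eq, map_add, map_smul, hm0 z h1 h2, (hmv a).2]
        simpa using ht0
    have m1 := hmem a (Or.inl rfl)
    have m2 := hmem (a + 1) (Or.inr rfl)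
    have e1 := hyeq a m1
    have e2 := hyeq (a + 1) m2
    simp only [Function.comp_apply, Pi.add_apply]
    rw [← e2, ← e1]
    simp only [hκ a _ ⟨m1, m2⟩, map_add]
    abel
  -- One turn around the subspace returns to the same extended value, so `Θ 0` annihilates the total
  -- period, and it is injective.
  have hsum : κ 0 + κ 1 + κ 2 + κ 3 = 0 := by
    refine hinj _ ?_
    have a0 := haxis 0 0 h0B (map_zero _) (map_zero _)
    have a1 := haxis 1 0 h0B (map_zero _) (map_zero _)
    have a2 := haxis 2 0 h0B (map_zero _) (map_zero _)
    have a3 := haxis 3 0 h0B (map_zero _) (map_zero _)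
    rw [show (0 : Fin 4) + 1 = 1 from rfl] at a0
    rw [show (1 : Fin 4) + 1 = 2 from rfl, a0] at a1
    rw [show (2 : Fin 4) + 1 = 3 from rfl, a1] at a2
    rw [show (3 : Fin 4) + 1 = 0 from rfl, a2] at a3
    simp only [map_add]
    have : y 0 0 = y 0 0 + (Θ 0 (κ 0) + Θ 0 (κ 1) + Θ 0 (κ 2) + Θ 0 (κ 3)) := by
      conv_lhs => rw [a3]
      abel
    simpa using this
  -- Since the total period vanishes, the partial sums close up cyclically; subtracting them makes
  -- the four primitives agree.
  obtain ⟨d, hd⟩ : ∃ d : Fin 4 → P, ∀ a, d (a + 1) = d a + κ a := by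
    refine ⟨![0, κ 0, κ 0 + κ 1, κ 0 + κ 1 + κ 2], fun a => ?_⟩
    fin_cases a <;> simp [← hsum]
  have hagree : ∀ a b z, z ∈ H a → z ∈ H b → S a z - d a = S b z - d b := by
    intro a b z ha hb
    rcases hopp a b z ha.2 hb.2 with rfl | rfl | rfl
    · rfl
    · rw [hκ a z ⟨ha, hb⟩, hd]; abel
    · rw [hκ b z ⟨hb, ha⟩, hd]; abel
  have hT : ∃ T : E → P, ∀ a, ∀ z ∈ H a, T z = S a z - d a := by
    refine ⟨fun z => if h : ∃ a, z ∈ H a then S h.choose z - d h.choose else 0, fun a z hz => ?_⟩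
    have h : ∃ a, z ∈ H a := ⟨a, hz⟩
    simp only [dif_pos h]
    exact hagree _ _ z h.choose_spec hz
  obtain ⟨T, hT⟩ := hT
  let y' : Fin 4 → E → Y := fun a z => y a z - Θ z (d a)
  have hy'c : ∀ a, ContinuousOn (y' a) B := fun a =>
    (hyc a).continuousOn.sub (hΘ.clm_apply continuousOn_const)
  let Z : E → Y := fun z => if ∃ a, z ∈ H a then Θ z (T z) + β z else y' 0 z
  have hZH : ∀ a, ∀ z ∈ H a, Z z = Θ z (T z) + β z := fun a z hz => if_pos ⟨a, hz⟩
  have hZ : ∀ a, ∀ z ∈ H a, Z z = y' a z := by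
    intro a z hz
    rw [hZH a z hz, hT a z hz]
    have := hyeq a hz
    simp only [y', ← this, map_sub]
    abel
  refine ⟨T, Z, fun z hz => ContinuousAt.continuousWithinAt ?_, fun z hz hoff => ?_⟩
  · by_cases hoff : l₁ z ≠ 0 ∨ l₂ z ≠ 0
    · obtain ⟨a, ha⟩ := hcover z hoff
      refine ((hy'c a).continuousAt (Metric.isOpen_ball.mem_nhds hz)).congr ?_
      filter_upwards [(hHo a).mem_nhds ⟨hz, ha⟩] with w hw using (hZ a w hw).symm
    · push Not at hoff
      have hnot : ¬ ∃ a, z ∈ H a := by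
        rintro ⟨a, ha⟩
        have := ha.2
        simp only [mem_ofPred_eq, hm0 z hoff.1 hoff.2 a, lt_self_iff_false] at this
      have hstep : ∀ a, y' (a + 1) z = y' a z := by
        intro a
        simp only [y', haxis a z hz hoff.1 hoff.2, hd, map_add]; abel
      have hval : ∀ a, y' a z = Z z := by
        have e0 : Z z = y' 0 z := if_neg hnot
        have s0 := hstep 0
        have s1 := hstep 1
        have s2 := hstep 2
        rw [show (0 : Fin 4) + 1 = 1 from rfl] at s0
        rw [show (1 : Fin 4) + 1 = 2 from rfl, s0] at s1
        rw [show (2 : Fin 4) + 1 = 3 from rfl, s1] at s2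
        intro a
        fin_cases a
        · exact e0.symm
        · exact s0.trans e0.symm
        · exact s1.trans e0.symm
        · exact s2.trans e0.symm
      rw [Metric.continuousAt_iff']
      intro ε hε
      have hall : ∀ᶠ w in 𝓝 z, ∀ a, dist (y' a w) (Z z) < ε := by
        rw [eventually_all]
        intro a
        have := Metric.continuousAt_iff'.1
          ((hy'c a).continuousAt (Metric.isOpen_ball.mem_nhds hz)) ε hε
        rwa [hval] at this
      filter_upwards [hall] with w hw
      by_cases h : ∃ a, w ∈ H a
      · obtain ⟨a, ha⟩ := h
        rw [hZ a w ha]; exact hw a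
      · have : Z w = y' 0 w := if_neg h
        rw [this]; exact hw 0
  · obtain ⟨a, ha⟩ := hcover z hoff
    refine ⟨?_, hZH a z ⟨hz, ha⟩⟩
    refine ((hS a z ⟨hz, ha⟩).sub_const (d a)).congr_of_eventuallyEq ?_
    filter_upwards [(hHo a).mem_nhds ⟨hz, ha⟩] with w hw using hT a w hw

/-- Removability of sets that are flattened into a hyperplane by a `C^1` chart. -/
theorem isC1Removable_of_chart (φ : OpenPartialHomeomorph E E) (hφ : ContDiffOn ℝ 1 φ φ.source)
    (hψ : ContDiffOn ℝ 1 φ.symm φ.target) {l : E →L[ℝ] ℝ} (hl : l ≠ 0) {N O : Set E}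
    (hO : IsOpen O) (hOs : O ⊆ φ.source) (hN : ∀ x ∈ O, x ∈ N → l (φ x) = 0) :
    IsC1Removable O N := by
  intro F _ _ f g hf hg hfg x hx
  have hO' : IsOpen (φ.target ∩ φ.symm ⁻¹' O) := φ.symm.isOpen_inter_preimage hO
  have hmaps : MapsTo φ.symm (φ.target ∩ φ.symm ⁻¹' O) O := fun z hz => hz.2
  have hdψ : ∀ z ∈ φ.target, HasFDerivAt φ.symm (fderiv ℝ φ.symm z) z := fun z hz =>
    ((hψ.contDiffAt (φ.open_target.mem_nhds hz)).differentiableAt one_ne_zero).hasFDerivAt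
  have hdφ : ∀ z ∈ φ.source, HasFDerivAt φ (fderiv ℝ φ z) z := fun z hz =>
    ((hφ.contDiffAt (φ.open_source.mem_nhds hz)).differentiableAt one_ne_zero).hasFDerivAt
  have hcψ : ContinuousOn φ.symm (φ.target ∩ φ.symm ⁻¹' O) :=
    φ.continuousOn_symm.mono inter_subset_left
  have key := hasFDerivAt_of_off_hyperplane hO' l hl (f := fun z => f (φ.symm z))
    (g := fun z => g (φ.symm z) ∘L fderiv ℝ φ.symm z) (hf.comp hcψ hmaps)
    ((hg.comp hcψ hmaps).clm_comp ((hψ.continuousOn_fderiv_of_isOpen φ.open_target le_rfl).mono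
      inter_subset_left)) (fun z hz hlz => (hfg _ ⟨hz.2, fun h => hlz (by
        rw [← φ.right_inv hz.1]; exact hN _ hz.2 h)⟩).comp z (hdψ z hz.1))
    (x := φ x) ⟨φ.map_source (hOs hx), by rw [mem_preimage, φ.left_inv (hOs hx)]; exact hx⟩
  have hd := hdφ x (hOs hx)
  have h1 := key.comp x hd
  have hid : (fderiv ℝ φ.symm (φ x)) ∘L (fderiv ℝ φ x) = ContinuousLinearMap.id ℝ E := by
    refine HasFDerivAt.unique ((hdψ (φ x) (φ.map_source (hOs hx))).comp x hd) ?_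
    refine (hasFDerivAt_id x).congr_of_eventuallyEq ?_
    filter_upwards [φ.open_source.mem_nhds (hOs hx)] with w hw using φ.left_inv hw
  rw [ContinuousLinearMap.comp_assoc, hid, ContinuousLinearMap.comp_id, φ.left_inv (hOs hx)] at h1
  refine h1.congr_of_eventuallyEq ?_
  filter_upwards [φ.open_source.mem_nhds (hOs hx)] with w hw
  rw [Function.comp_apply, φ.left_inv hw]

end CodimTwo

/-! ### Flattening the axis. -/

namespace AxialGeometry

variable {E : Type} [NormedAddCommGroup E] [NormedSpace ℝ E] [FiniteDimensional ℝ E] {n : ℕ}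
  {U : Set E} {G : E → E →L[ℝ] E →L[ℝ] ℝ} {ξ η : E → E}

/-- The axis is flattened, near each of its points, by a `C^2` chart. -/
theorem exists_flattening (A : AxialGeometry n U G ξ η) {p : E} (hp : p ∈ U) (h0 : η p = 0) :
    ∃ (φ : OpenPartialHomeomorph E E) (l₁ l₂ : E →L[ℝ] ℝ) (e f : E), p ∈ φ.source ∧
      φ.source ⊆ U ∧ φ p = 0 ∧ ContDiffOn ℝ 2 φ φ.source ∧ ContDiffOn ℝ 2 φ.symm φ.target ∧
      l₁ e = 1 ∧ l₂ e = 0 ∧ l₁ f = 0 ∧ l₂ f = 1 ∧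
      ∀ x ∈ φ.source, η x = 0 → l₁ (φ x) = 0 ∧ l₂ (φ x) = 0 := by
  have := A.axis_thin p hp
  obtain ⟨e, he, -⟩ := A.exists_tendsto_orbitRefl hp h0 (Ultrafilter.of (𝓝[{x | η x ≠ 0}] p))
    (Ultrafilter.of_le _)
  set D := fderiv ℝ η p with hD
  have hs := A.symm p hp
  have hanti := A.fderiv_eta_antisymm hp h0
  rw [← hD] at hanti
  have hDξ : D (ξ p) = 0 := A.fderiv_eta_xi_eq_zero hp h0
  have hef : G p e (D e) = 0 := by
    have := hanti e e; rw [hs (D e)] at this; linarith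
  have hf0 : D e ≠ 0 := by
    intro h
    refine A.axis_deriv p hp h0 (ContinuousLinearMap.ext fun X => ?_)
    rw [← hD, he.plane X, h]; simp
  have hξf : G p (ξ p) (D e) = 0 := by
    have := hanti (ξ p) e; rw [hDξ, map_zero] at this; simpa using this.symm
  have hpos := A.spatial p hp _ hξf hf0
  set lam := G p (D e) (D e) with hlam
  have hD2 : D (D e) = (-lam) • e := by
    rw [he.plane (D e), hef, ← hlam]; simp
  have hplane := he.plane
  have hDz : ∀ w, D w = 0 → G p e w = 0 ∧ G p (D e) w = 0 := by
    intro w hw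
    have h1 := hanti e w
    have h2 := hanti (D e) w
    rw [hw, map_zero, neg_zero] at h1 h2
    rw [hD2] at h2
    simp only [map_smul, smul_apply, smul_eq_mul, neg_mul, neg_eq_zero, mul_eq_zero] at h2
    exact ⟨h2.resolve_left hpos.ne', h1⟩
  have hD3 : ∀ w, D (D (D w)) = (-lam) • D w := by
    intro w
    rw [hplane w]
    simp only [map_sub, map_smul, hD2, smul_sub, smul_comm lam]
    rw [smul_comm (-lam) (G p e w), smul_comm (-lam) (G p (D e) w)]
  -- Its derivative at `p` is the identity. Where `η` vanishes it equals the projection (1 + D²/λ)(x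
  -- - p), which takes values in the kernel of D because D³ = -λ D. Hence the axis is mapped into a
  -- subspace of codimension two.
  let F : E → E := fun x => (x - p) - (lam⁻¹ • D) (η x - D (x - p))
  have hFc : ∀ x ∈ U, ContDiffAt ℝ 2 F x := fun x hx =>
    (contDiffAt_id.sub contDiffAt_const).sub ((lam⁻¹ • D).contDiff.contDiffAt.comp x
      ((A.eta_two.contDiffAt (A.isOpen.mem_nhds hx)).sub
        (D.contDiff.contDiffAt.comp x (contDiffAt_id.sub contDiffAt_const))))
  have hFp : F p = 0 := by simp [F, h0]
  have hFd : HasFDerivAt F ((ContinuousLinearEquiv.refl ℝ E : E ≃L[ℝ] E) : E →L[ℝ] E) p := by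
    have h1 : HasFDerivAt (fun x => x - p) (ContinuousLinearMap.id ℝ E) p :=
      (hasFDerivAt_id p).sub_const p
    have h2 : HasFDerivAt η D p := A.hasFDerivAt_eta hp
    have h3 := h1.sub ((lam⁻¹ • D).hasFDerivAt.comp p (h2.sub (D.hasFDerivAt.comp p h1)))
    refine h3.congr_fderiv ?_
    ext w; simp
  have hF0 : ∀ x, η x = 0 → D (F x) = 0 := by
    intro x hx
    have e1 : F x = (x - p) + lam⁻¹ • D (D (x - p)) := by
      simp only [F, hx, zero_sub, map_neg, smul_apply]
      module
    rw [e1, map_add, map_smul, hD3, smul_smul, mul_neg, inv_mul_cancel₀ hpos.ne']; simp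
  let φ := (hFc p hp).toOpenPartialHomeomorph F hFd two_ne_zero
  have hφF : (φ : E → E) = F := (hFc p hp).toOpenPartialHomeomorph_coe hFd two_ne_zero
  have hpφ : p ∈ φ.source := (hFc p hp).mem_toOpenPartialHomeomorph_source hFd two_ne_zero
  have hsymm : ContDiffAt ℝ 2 φ.symm (F p) := (hFc p hp).to_localInverse hFd two_ne_zero
  obtain ⟨T, hT, hTo, hFT⟩ := eventually_nhds_iff.1 (hsymm.eventually (by norm_cast))
  have hO : IsOpen (U ∩ (φ.source ∩ φ ⁻¹' T)) := A.isOpen.inter (φ.isOpen_inter_preimage hTo)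
  refine ⟨φ.restrOpen _ hO, G p e, lam⁻¹ • G p (D e), e, D e, ?_, ?_, ?_, ?_, ?_, he.unit, ?_,
    hef, ?_, ?_⟩
  · rw [OpenPartialHomeomorph.restrOpen_source]
    exact ⟨hpφ, hp, hpφ, by rw [mem_preimage, hφF]; exact hFT⟩
  · rw [OpenPartialHomeomorph.restrOpen_source]
    exact fun x hx => hx.2.1
  · change φ p = 0; rw [hφF, hFp]
  · rw [OpenPartialHomeomorph.restrOpen_source]
    intro x hx
    change ContDiffWithinAt ℝ 2 φ _ x
    rw [hφF]
    exact (hFc x hx.2.1).contDiffWithinAt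
  · intro z hz
    have hz1 := (φ.restrOpen _ hO).map_target hz
    rw [OpenPartialHomeomorph.restrOpen_source] at hz1
    have hz2 : (φ.restrOpen _ hO) ((φ.restrOpen _ hO).symm z) = z :=
      (φ.restrOpen _ hO).right_inv hz
    have hz3 : φ ((φ.restrOpen _ hO).symm z) ∈ T := hz1.2.2.2
    have hz4 : φ ((φ.restrOpen _ hO).symm z) = z := hz2
    rw [hz4] at hz3
    exact (hT z hz3).contDiffWithinAt
  · rw [smul_apply, hs, hef, smul_zero]
  · rw [smul_apply, ← hlam, smul_eq_mul, inv_mul_cancel₀ hpos.ne']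
  · intro x _ hx
    change G p e (φ x) = 0 ∧ (lam⁻¹ • G p (D e)) (φ x) = 0
    rw [hφF]
    obtain ⟨h1, h2⟩ := hDz _ (hF0 x hx)
    exact ⟨h1, by rw [smul_apply, h2, smul_zero]⟩

end AxialGeometry

/-! ### Gauge fields across the axis. -/

section Pullback

variable {E F : Type*} [NormedAddCommGroup E] [NormedSpace ℝ E] [NormedAddCommGroup F]
  [NormedSpace ℝ F]

/-- Pullbacks of closed forms are closed. -/
theorem fderiv_symm_pullback {E' : Type*} [NormedAddCommGroup E'] [NormedSpace ℝ E']
    {α : E → E →L[ℝ] F} {ψ : E' → E} {z : E'}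
    (hω : DifferentiableAt ℝ α (ψ z))
    (hs : ∀ X Y, fderiv ℝ α (ψ z) X Y = fderiv ℝ α (ψ z) Y X) (hψ : ContDiffAt ℝ 2 ψ z) :
    DifferentiableAt ℝ (fun z => α (ψ z) ∘L fderiv ℝ ψ z) z ∧
    ∀ X Y, fderiv ℝ (fun z => α (ψ z) ∘L fderiv ℝ ψ z) z X Y =
      fderiv ℝ (fun z => α (ψ z) ∘L fderiv ℝ ψ z) z Y X := by
  have hd : HasFDerivAt ψ (fderiv ℝ ψ z) z := (hψ.differentiableAt two_ne_zero).hasFDerivAt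
  have hd2 : HasFDerivAt (fderiv ℝ ψ) (fderiv ℝ (fderiv ℝ ψ) z) z :=
    ((hψ.fderiv_right (m := 1) (by norm_num)).differentiableAt one_ne_zero).hasFDerivAt
  have hsym := hψ.isSymmSndFDerivAt (by simp)
  have h1 : HasFDerivAt (fun z => α (ψ z)) (fderiv ℝ α (ψ z) ∘L fderiv ℝ ψ z) z :=
    hω.hasFDerivAt.comp z hd
  have h2 := h1.clm_comp hd2
  refine ⟨h2.differentiableAt, fun X Y => ?_⟩
  rw [h2.fderiv]
  simp only [add_apply, ContinuousLinearMap.comp_apply, ContinuousLinearMap.compL_apply,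
    ContinuousLinearMap.flip_apply]
  rw [hs, hsym X Y]

theorem hasFDerivAt_clm_prod {E' F' : Type*} [NormedAddCommGroup E'] [NormedSpace ℝ E']
    [NormedAddCommGroup F'] [NormedSpace ℝ F'] {f : E' → E →L[ℝ] F} {g : E' → E →L[ℝ] F'}
    {f' : E' →L[ℝ] E →L[ℝ] F} {g' : E' →L[ℝ] E →L[ℝ] F'} {x : E'} (hf : HasFDerivAt f f' x)
    (hg : HasFDerivAt g g' x) :
    HasFDerivAt (fun x => (f x).prod (g x)) ((((ContinuousLinearMap.prodₗᵢ ℝ :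
      ((E →L[ℝ] F) × (E →L[ℝ] F')) ≃ₗᵢ[ℝ] (E →L[ℝ] F × F')).toContinuousLinearEquiv :
      ((E →L[ℝ] F) × (E →L[ℝ] F')) ≃L[ℝ] (E →L[ℝ] F × F')) :
      ((E →L[ℝ] F) × (E →L[ℝ] F')) →L[ℝ] (E →L[ℝ] F × F')) ∘L (f'.prod g')) x := by
  have h := ((((ContinuousLinearMap.prodₗᵢ ℝ :
      ((E →L[ℝ] F) × (E →L[ℝ] F')) ≃ₗᵢ[ℝ] (E →L[ℝ] F × F')).toContinuousLinearEquiv :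
      ((E →L[ℝ] F) × (E →L[ℝ] F')) ≃L[ℝ] (E →L[ℝ] F × F')) :
      ((E →L[ℝ] F) × (E →L[ℝ] F')) →L[ℝ] (E →L[ℝ] F × F')).hasFDerivAt (x := (f x, g x)))
  exact h.comp x (hf.prodMk hg)

theorem OpenPartialHomeomorph.fderiv_symm_comp_fderiv (φ : OpenPartialHomeomorph E F)
    {x : E} (hx : x ∈ φ.source) (hφ : DifferentiableAt ℝ φ x)
    (hψ : DifferentiableAt ℝ φ.symm (φ x)) :
    fderiv ℝ φ.symm (φ x) ∘L fderiv ℝ φ x = ContinuousLinearMap.id ℝ E := by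
  refine HasFDerivAt.unique (hψ.hasFDerivAt.comp x hφ.hasFDerivAt) ?_
  refine (hasFDerivAt_id x).congr_of_eventuallyEq ?_
  filter_upwards [φ.open_source.mem_nhds hx] with w hw using φ.left_inv hw

end Pullback

/-- The first jet of the combination of `ξ`, `η` with constant coefficients. -/
noncomputable def orbitJet {E : Type} [NormedAddCommGroup E] [NormedSpace ℝ E] (ξ η : E → E)
    (x : E) : (ℝ × ℝ) →L[ℝ] E × (E →L[ℝ] E) :=
  ((ContinuousLinearMap.fst ℝ ℝ ℝ).smulRight (ξ x) + (ContinuousLinearMap.snd ℝ ℝ ℝ).smulRight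
    (η x)).prod ((ContinuousLinearMap.fst ℝ ℝ ℝ).smulRight (fderiv ℝ ξ x) +
      (ContinuousLinearMap.snd ℝ ℝ ℝ).smulRight (fderiv ℝ η x))

theorem orbitJet_apply {E : Type} [NormedAddCommGroup E] [NormedSpace ℝ E] (ξ η : E → E) (x : E)
    (a b : ℝ) : orbitJet ξ η x (a, b) =
      (a • ξ x + b • η x, a • fderiv ℝ ξ x + b • fderiv ℝ η x) := rfl

namespace AxialGeometry

variable {E : Type} [NormedAddCommGroup E] [NormedSpace ℝ E] [FiniteDimensional ℝ E] {n : ℕ}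
  {U : Set E} {G : E → E →L[ℝ] E →L[ℝ] ℝ} {ξ η : E → E} {k : E → E →L[ℝ] E →L[ℝ] ℝ}

theorem continuousOn_orbitJet (A : AxialGeometry n U G ξ η) : ContinuousOn (orbitJet ξ η) U := by
  have h1 := A.xi_two.continuousOn_fderiv_of_isOpen A.isOpen (by norm_num)
  have h2 := A.eta_two.continuousOn_fderiv_of_isOpen A.isOpen (by norm_num)
  have key : ∀ {F : Type} [NormedAddCommGroup F] [NormedSpace ℝ F] (l : (ℝ × ℝ) →L[ℝ] ℝ)
      {f : E → F}, ContinuousOn f U → ContinuousOn (fun x => l.smulRight (f x)) U :=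
    fun l f hf => ((ContinuousLinearMap.smulRightL ℝ (ℝ × ℝ) _ l).continuous.comp_continuousOn hf)
  exact (ContinuousLinearMap.prodₗᵢ ℝ).continuous.comp_continuousOn
    (((key _ A.xi_class.continuousOn).add (key _ A.eta_class.continuousOn)).prodMk
      ((key _ h1).add (key _ h2)))

/-- At the axis the values of ξ and η are dependent, but their 1-jets are not: ξ ≠ 0, while η = 0
and Dη ≠ 0. This is why periods are detected on 1-jets. -/
theorem orbitJet_injective (A : AxialGeometry n U G ξ η) {p : E} (hp : p ∈ U) (h0 : η p = 0)
    (a : ℝ × ℝ) (ha : orbitJet ξ η p a = 0) : a = 0 := by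
  obtain ⟨a, b⟩ := a
  obtain ⟨h1, h2⟩ := Prod.ext_iff.1 ha
  have h1 : a • ξ p + b • η p = 0 := h1
  have h2 : a • fderiv ℝ ξ p + b • fderiv ℝ η p = 0 := h2
  have hξ : ξ p ≠ 0 := by
    intro h
    have := A.timelike p hp
    rw [h, map_zero] at this
    exact this.false
  rw [h0, smul_zero, add_zero] at h1
  obtain rfl : a = 0 := (smul_eq_zero.1 h1).resolve_right hξ
  rw [zero_smul, zero_add] at h2
  obtain rfl : b = 0 := (smul_eq_zero.1 h2).resolve_right (A.axis_deriv p hp h0)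
  rfl

/-- The first jet of a gauge field with coefficients `S`. -/
theorem gauge_jet_eq (A : AxialGeometry n U G ξ η) {x : E} (hx : x ∈ U) (hη : η x ≠ 0) {X : E → E}
    (hX : ∀ᶠ y in 𝓝 x, IsGaugeAt G ξ η k X y) {a b : ℝ} (hab : X x = a • ξ x + b • η x) :
    HasFDerivAt X (fderiv ℝ X x) x ∧ (X x, fderiv ℝ X x) = orbitJet ξ η x (a, b) +
      (0, (- shiftFst (G x) (ξ x) (η x) (k x)).smulRight (ξ x)
        + (- shiftSnd (G x) (ξ x) (η x) (k x)).smulRight (η x)) := by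
  have h := A.hasFDerivAt_gauge hx hX
  refine ⟨h.differentiableAt.hasFDerivAt, ?_⟩
  rw [h.fderiv]
  obtain ⟨e1, e2⟩ := A.coframe_apply hx hη a b
  rw [hab, e1, e2]
  rw [orbitJet_apply, Prod.mk_add_mk, add_zero]
  congr 1
  abel

/-- Near the axis there are gauge fields. -/
theorem exists_gauge_near_axis (A : AxialGeometry n U G ξ η) {m : ℕ} (hm : m + 1 ≤ n)
    (hk : ContDiffOn ℝ (m + 1 : ℕ) k U) (hks : ∀ x ∈ U, ∀ Y Z, k x Y Z = k x Z Y)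
    (hkξ : (formAction E).Invariant U ξ k) (hkη : (formAction E).Invariant U η k)
    (hc : HasClosedShift U G ξ η k) {p : E} (hp : p ∈ U) (h0 : η p = 0) :
    ∃ V, IsOpen V ∧ p ∈ V ∧ V ⊆ U ∧ ∃ X : E → E, ContDiffOn ℝ (m + 2 : ℕ) X V ∧
      ∀ x ∈ V, η x ≠ 0 → IsGaugeAt G ξ η k X x := by
  obtain ⟨φ, l₁, l₂, e, f, hpφ, hsub, hφp, hφ, hψ, h11, h21, h12, h22, haxis⟩ :=
    A.exists_flattening hp h0
  have hl₁ : l₁ ≠ 0 := by rintro rfl; simp at h11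
  have hφ1 := hφ.of_le (show (1 : WithTop ℕ∞) ≤ 2 by norm_num)
  have hψ1 := hψ.of_le (show (1 : WithTop ℕ∞) ≤ 2 by norm_num)
  have hremN : ∀ O, IsOpen O → O ⊆ φ.source → ∀ N : Set E, (∀ x ∈ O, x ∈ N → l₁ (φ x) = 0) →
      IsC1Removable O N := fun O hO hOs N hN => isC1Removable_of_chart φ hφ1 hψ1 hl₁ hO hOs hN
  have hrem : ∀ O, IsOpen O → O ⊆ φ.source → IsC1Removable O {x | η x = 0} := fun O hO hOs =>
    hremN O hO hOs _ fun x hx hη => (haxis x (hOs hx) hη).1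
  have hoff : ∀ x ∈ φ.source, (l₁ (φ x) ≠ 0 ∨ l₂ (φ x) ≠ 0) → η x ≠ 0 := by
    intro x hx h hη
    have := haxis x hx hη
    tauto
  have AV := A.mono φ.open_source hsub
  -- The extension of the reflected source across the axis makes the prescribed Lie derivative `c`
  -- of the metric regular on the whole chart.
  obtain ⟨F, hF, hFk⟩ := (AV.reflectionGeometry (hrem _ φ.open_source subset_rfl)).exists_contDiffOn_extension
    (m + 1) (formAction E) (AV.contDiffOn_leviCivita.of_le (by exact_mod_cast hm)) (hk.mono hsub)
    (fun _ => ⟨fun x hx => hkξ x (hsub hx), fun x hx => hkη x (hsub hx)⟩) (fun q hq hq0 => by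
      have := hkη q (hsub hq)
      rwa [hq0, map_zero, zero_add] at this)
  set c : E → E →L[ℝ] E →L[ℝ] ℝ := fun x => (1 / 2 : ℝ) • (F x - k x) with hcdef
  have hcc : ContDiffOn ℝ (m + 1 : ℕ) c φ.source := (hF.sub (hk.mono hsub)).const_smul (1 / 2 : ℝ)
  have hpt : (0 : E) ∈ φ.target := hφp ▸ φ.map_source hpφ
  obtain ⟨r, hr, hball⟩ := Metric.nhds_basis_closedBall.mem_iff.1 (φ.open_target.mem_nhds hpt)
  have hbt : Metric.ball (0 : E) r ⊆ φ.target := Metric.ball_subset_closedBall.trans hball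
  have hmaps : MapsTo φ.symm (Metric.closedBall (0 : E) r) φ.source := fun z hz =>
    φ.map_target (hball hz)
  have hψc : ContinuousOn φ.symm (Metric.closedBall (0 : E) r) := φ.continuousOn_symm.mono hball
  have hcomp : IsCompact (Metric.closedBall (0 : E) r) := isCompact_closedBall 0 r
  obtain ⟨C₁, hC₁⟩ := hcomp.exists_bound_of_continuousOn (f := fun z => koszul (G (φ.symm z)) (fderiv ℝ c (φ.symm z)))
    ((AV.contDiffOn_koszul.continuousOn.clm_apply
      (hcc.continuousOn_fderiv_of_isOpen φ.open_source (by norm_cast; omega))).comp hψc hmaps)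
  obtain ⟨C₂, hC₂⟩ := hcomp.exists_bound_of_continuousOn (f := fun z => jetCoeff G (φ.symm z))
    (AV.contDiffOn_jetCoeff.continuousOn.comp hψc hmaps)
  obtain ⟨C₃, hC₃⟩ := hcomp.exists_bound_of_continuousOn (f := fderiv ℝ φ.symm)
    ((hψ1.continuousOn_fderiv_of_isOpen φ.open_target le_rfl).mono hball)
  have h0c : (0 : E) ∈ Metric.closedBall (0 : E) r := Metric.mem_closedBall_self hr.le
  have hC₁0 := (norm_nonneg _).trans (hC₁ 0 h0c)
  have hC₂0 := (norm_nonneg _).trans (hC₂ 0 h0c)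
  have hC₃0 := (norm_nonneg _).trans (hC₃ 0 h0c)
  have hdψ : ∀ z ∈ φ.target, ContDiffAt ℝ 2 φ.symm z := fun z hz =>
    hψ.contDiffAt (φ.open_target.mem_nhds hz)
  have hdφ : ∀ x ∈ φ.source, HasFDerivAt φ (fderiv ℝ φ x) x := fun x hx =>
    ((hφ1.contDiffAt (φ.open_source.mem_nhds hx)).differentiableAt one_ne_zero).hasFDerivAt
  have hid : ∀ x ∈ φ.source, fderiv ℝ φ.symm (φ x) ∘L fderiv ℝ φ x = ContinuousLinearMap.id ℝ E :=
    fun x hx => φ.fderiv_symm_comp_fderiv hx (hdφ x hx).differentiableAt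
      ((hdψ _ (φ.map_source hx)).differentiableAt two_ne_zero)
  set α : E → E →L[ℝ] (ℝ × ℝ) := fun x => (- shiftFst (G x) (ξ x) (η x) (k x)).prod
    (- shiftSnd (G x) (ξ x) (η x) (k x)) with hα
  obtain ⟨w1, w2⟩ := A.contDiffOn_shift (m := m + 1) (by omega) hk
  have hαd : ∀ x ∈ U, η x ≠ 0 → DifferentiableAt ℝ α x ∧
      ∀ X Y, fderiv ℝ α x X Y = fderiv ℝ α x Y X := by
    intro x hx hη
    have hnh := A.isOpen_off_axis.mem_nhds ⟨hx, hη⟩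
    have d1 := ((w1.contDiffAt hnh).differentiableAt (by norm_cast)).hasFDerivAt.fun_neg
    have d2 := ((w2.contDiffAt hnh).differentiableAt (by norm_cast)).hasFDerivAt.fun_neg
    have d := hasFDerivAt_clm_prod d1 d2
    rw [← hα] at d
    refine ⟨d.differentiableAt, fun X Y => ?_⟩
    rw [d.fderiv]
    exact Prod.ext (congrArg Neg.neg (hc.fst x hx hη X Y)) (congrArg Neg.neg (hc.snd x hx hη X Y))
  -- combinations with primitives as coefficients are gauge fields
  have hgauge : ∀ (O : Set E), IsOpen O → (∀ z ∈ O, z ∈ φ.target ∧ (l₁ z ≠ 0 ∨ l₂ z ≠ 0)) →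
      ∀ S : E → ℝ × ℝ, (∀ z ∈ O, HasFDerivAt S (α (φ.symm z) ∘L fderiv ℝ φ.symm z) z) →
      ∀ X : E → E, (∀ z ∈ O, X (φ.symm z) = (S z).1 • ξ (φ.symm z) + (S z).2 • η (φ.symm z)) →
      ∀ z ∈ O, η (φ.symm z) ≠ 0 ∧ IsGaugeAt G ξ η k X (φ.symm z) := by
    intro O hO hOt S hS X hX z hz
    have hx := φ.map_target (hOt z hz).1
    have hzz := φ.right_inv (hOt z hz).1
    have hη : η (φ.symm z) ≠ 0 := hoff _ hx (by rw [hzz]; exact (hOt z hz).2)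
    have hS' : HasFDerivAt (fun x => S (φ x)) (α (φ.symm z)) (φ.symm z) := by
      have h1 : HasFDerivAt S (α (φ.symm z) ∘L fderiv ℝ φ.symm (φ (φ.symm z))) (φ (φ.symm z)) := by
        rw [hzz]; exact hS z hz
      have := h1.comp _ (hdφ _ hx)
      rwa [ContinuousLinearMap.comp_assoc, hid _ hx, ContinuousLinearMap.comp_id] at this
    refine ⟨hη, A.isGaugeAt_of_eventuallyEq (hsub hx) hη (S₁ := fun x => (S (φ x)).1)
      (S₂ := fun x => (S (φ x)).2) ?_ ?_ ?_⟩
    · exact hS'.fst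
    · exact hS'.snd
    · filter_upwards [(φ.isOpen_inter_preimage hO).mem_nhds ⟨hx, by rw [mem_preimage, hzz]; exact hz⟩]
        with y hy
      have := hX (φ y) hy.2
      rwa [φ.left_inv hy.1] at this
  -- In flattened coordinates, Θ and β are chosen so that Θ S + β is the 1-jet of the gauge field
  -- with coefficients S. The lemma removes the period and extends this jet continuously to the axis
  -- as `y`.
  obtain ⟨S, y, hyc, hSy⟩ := exists_primitive_off_codim_two (r := r) hr h11 h21 h12 h22
    (W := fun z => α (φ.symm z) ∘L fderiv ℝ φ.symm z)
    (fun z hz hz' => by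
      have hx := φ.map_target (hbt hz)
      obtain ⟨d1, d2⟩ := hαd _ (hsub hx) (hoff _ hx (by rwa [φ.right_inv (hbt hz)]))
      exact fderiv_symm_pullback d1 d2 (hdψ z (hbt hz)))
    (Θ := fun z => orbitJet ξ η (φ.symm z))
    (AV.continuousOn_orbitJet.comp (hψc.mono Metric.ball_subset_closedBall)
      (hmaps.mono Metric.ball_subset_closedBall subset_rfl))
    (fun a ha => A.orbitJet_injective hp h0 a (by
      have : φ.symm 0 = p := by rw [← hφp, φ.left_inv hpφ]
      rwa [← this]))
    (β := fun z => (0, (- shiftFst (G (φ.symm z)) (ξ (φ.symm z)) (η (φ.symm z)) (k (φ.symm z))).smulRight (ξ (φ.symm z))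
        + (- shiftSnd (G (φ.symm z)) (ξ (φ.symm z)) (η (φ.symm z)) (k (φ.symm z))).smulRight (η (φ.symm z))))
    (by
      intro H hHB hHo hHc hHoff S hS
      set X : E → E := fun x => (S (φ x)).1 • ξ x + (S (φ x)).2 • η x with hX
      have hXz : ∀ z ∈ H, X (φ.symm z) = (S z).1 • ξ (φ.symm z) + (S z).2 • η (φ.symm z) := by
        intro z hz
        rw [hX]; simp only [φ.right_inv (hbt (hHB hz))]
      have hg := hgauge H hHo (fun z hz => ⟨hbt (hHB hz), hHoff z hz⟩) S hS X hXz
      have hO : IsOpen (φ.source ∩ φ ⁻¹' H) := φ.isOpen_inter_preimage hHo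
      have hgO : ∀ x ∈ φ.source ∩ φ ⁻¹' H, η x ≠ 0 ∧ IsGaugeAt G ξ η k X x := by
        intro x hx
        have := hg (φ x) hx.2
        rwa [φ.left_inv hx.1] at this
      have hOU : φ.source ∩ φ ⁻¹' H ⊆ U := fun x hx => hsub hx.1
      have hXc := (A.mono hO hOU).contDiffOn_gauge_off_axis hm (hk.mono hOU)
        fun x hx _ => (hgO x hx).2
      have hmem : ∀ z ∈ H, φ.symm z ∈ φ.source ∩ φ ⁻¹' H := fun z hz =>
        ⟨φ.map_target (hbt (hHB hz)), by rw [mem_preimage, φ.right_inv (hbt (hHB hz))]; exact hz⟩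
      have hev : ∀ x ∈ φ.source ∩ φ ⁻¹' H, ∀ᶠ w in 𝓝 x, IsGaugeAt G ξ η k X w := fun x hx => by
        filter_upwards [hO.mem_nhds hx] with w hw using (hgO w hw).2
      have hX2 : ∀ x ∈ φ.source ∩ φ ⁻¹' H, ContDiffAt ℝ 2 X x := fun x hx =>
        (hXc.contDiffAt ((A.mono hO hOU).isOpen_off_axis.mem_nhds ⟨hx, (hgO x hx).1⟩)).of_le
          (by norm_cast; omega)
      -- The shifts may be singular at the axis, but the 1-jet satisfies an affine bound: C₁ bounds
      -- the source, C₂ the coefficients of the system, and C₃ the change of coordinates.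
      have hLip := exists_lipschitzOnWith_of_norm_fderiv_le hHc (Metric.isBounded_ball.subset hHB)
        (y := fun z => (X (φ.symm z), fderiv ℝ X (φ.symm z)))
        (y' := fun z => ((fderiv ℝ X (φ.symm z)).prod (fderiv ℝ (fderiv ℝ X) (φ.symm z))) ∘L fderiv ℝ φ.symm z)
        (K := (1 + C₁ + C₂) * C₃) (fun z hz => by
          have hx := hX2 _ (hmem z hz)
          have d1 := (hx.differentiableAt two_ne_zero).hasFDerivAt
          have d2 := ((hx.fderiv_right (m := 1) (by norm_num)).differentiableAt one_ne_zero).hasFDerivAt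
          exact (d1.prodMk d2).comp z
            ((hdψ z (hbt (hHB hz))).differentiableAt two_ne_zero).hasFDerivAt) (by positivity)
        (fun z hz => by
          have hx := hmem z hz
          have hzc := Metric.ball_subset_closedBall (hHB hz)
          have e := A.fderiv_fderiv_eq (c := c) (hsub hx.1) (hX2 _ hx)
            ((hcc.contDiffAt (φ.open_source.mem_nhds hx.1)).differentiableAt (by norm_cast)) (by
              filter_upwards [hO.mem_nhds hx] with w hw
              rw [A.lieForm_gauge_metric (hsub hw.1) (hgO w hw).1 (hev w hw) (hks w (hsub hw.1)),
                ← hFk w hw.1 (hgO w hw).1])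
          have hy1 : ‖fderiv ℝ X (φ.symm z)‖ ≤ ‖(X (φ.symm z), fderiv ℝ X (φ.symm z))‖ :=
            norm_snd_le (X (φ.symm z), fderiv ℝ X (φ.symm z))
          set N := ‖(X (φ.symm z), fderiv ℝ X (φ.symm z))‖ with hN
          have hN0 : 0 ≤ N := norm_nonneg _
          have hb2 : ‖fderiv ℝ (fderiv ℝ X) (φ.symm z)‖ ≤ C₁ + C₂ * N := by
            rw [e]
            exact (norm_add_le _ _).trans (add_le_add (hC₁ z hzc)
              ((ContinuousLinearMap.le_opNorm _ _).trans (by gcongr; exact hC₂ z hzc)))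
          have hb3 : ‖(fderiv ℝ X (φ.symm z)).prod (fderiv ℝ (fderiv ℝ X) (φ.symm z))‖
              ≤ C₁ + (1 + C₂) * N := norm_prod_le (by positivity) (by nlinarith) (by nlinarith)
          refine (ContinuousLinearMap.opNorm_comp_le _ _).trans ?_
          calc _ ≤ (C₁ + (1 + C₂) * N) * C₃ := by gcongr; exact hC₃ z hzc
            _ ≤ _ := by nlinarith [mul_nonneg hC₃0 hN0, mul_nonneg (mul_nonneg hC₃0 hN0) hC₁0, mul_nonneg hC₃0 hC₂0])
      obtain ⟨C, hC⟩ := hLip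
      refine ⟨C, fun z hz w hw => ?_⟩
      have hz' : ∀ z ∈ H, _ := fun z hz => (A.gauge_jet_eq (hsub (hmem z hz).1) (hg z hz).1 (hev _ (hmem z hz))
        (hXz z hz)).2
      simp only [Prod.mk.eta] at hz'
      have h3 : edist (X (φ.symm z), fderiv ℝ X (φ.symm z)) (X (φ.symm w), fderiv ℝ X (φ.symm w))
        ≤ C * edist z w := hC hz hw
      rw [hz' z hz, hz' w hw] at h3
      exact h3)
  have hVo : IsOpen (φ.source ∩ φ ⁻¹' Metric.ball 0 r) := φ.isOpen_inter_preimage Metric.isOpen_ball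
  have hVU : φ.source ∩ φ ⁻¹' Metric.ball 0 r ⊆ U := fun x hx => hsub hx.1
  have hVs : φ.source ∩ φ ⁻¹' Metric.ball 0 r ⊆ φ.source := inter_subset_left
  set X : E → E := fun x => (y (φ x)).1 with hX
  have hyφ : ContinuousOn (fun x => y (φ x)) (φ.source ∩ φ ⁻¹' Metric.ball 0 r) :=
    hyc.comp (φ.continuousOn.mono hVs) fun x hx => hx.2
  have hXcont : ContinuousOn X (φ.source ∩ φ ⁻¹' Metric.ball 0 r) := hyφ.fst
  set O : Set E := Metric.ball 0 r ∩ {z | l₁ z ≠ 0 ∨ l₂ z ≠ 0} with hOdef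
  have hOo : IsOpen O := Metric.isOpen_ball.inter ((isOpen_ne_fun l₁.continuous continuous_const).union
    (isOpen_ne_fun l₂.continuous continuous_const))
  have hXz : ∀ z ∈ O, X (φ.symm z) = (S z).1 • ξ (φ.symm z) + (S z).2 • η (φ.symm z) := by
    intro z hz
    rw [hX]
    simp only [φ.right_inv (hbt hz.1), (hSy z hz.1 hz.2).2]
    exact add_zero _
  have hg := hgauge O hOo (fun z hz => ⟨hbt hz.1, hz.2⟩) S (fun z hz => (hSy z hz.1 hz.2).1) X hXz
  have hgO : ∀ x ∈ φ.source ∩ φ ⁻¹' O, η x ≠ 0 ∧ IsGaugeAt G ξ η k X x := by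
    intro x hx
    have := hg (φ x) hx.2
    rwa [φ.left_inv hx.1] at this
  have hev : ∀ x ∈ φ.source ∩ φ ⁻¹' O, ∀ᶠ w in 𝓝 x, IsGaugeAt G ξ η k X w := fun x hx => by
    filter_upwards [(φ.isOpen_inter_preimage hOo).mem_nhds hx] with w hw using (hgO w hw).2
  have hN1 : ∀ x ∈ φ.source ∩ φ ⁻¹' Metric.ball 0 r, x ∈ φ ⁻¹' Oᶜ → l₁ (φ x) = 0 := by
    intro x hx hxN
    by_contra h
    exact hxN ⟨hx.2, Or.inl h⟩
  have hremV := hremN _ hVo hVs _ hN1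
  -- The second component of the extended jet is the derivative of the first off the flattened
  -- subspace, hence everywhere by removability.
  have hXd : ∀ x ∈ φ.source ∩ φ ⁻¹' Metric.ball 0 r, HasFDerivAt X (y (φ x)).2 x := by
    refine hremV _ X (fun x => (y (φ x)).2) hXcont hyφ.snd fun x hx => ?_
    have hxO : x ∈ φ.source ∩ φ ⁻¹' O := ⟨hx.1.1, not_not.1 hx.2⟩
    have hab := hXz (φ x) hxO.2
    rw [φ.left_inv hxO.1] at hab
    obtain ⟨d1, d2⟩ := A.gauge_jet_eq (hsub hxO.1) (hgO x hxO).1 (hev x hxO) hab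
    have e := (hSy (φ x) hxO.2.1 hxO.2.2).2
    simp only [Prod.mk.eta] at d2
    rw [φ.left_inv hxO.1, ← d2] at e
    rw [e]; exact d1
  have hXc : ContDiffOn ℝ 1 X (φ.source ∩ φ ⁻¹' Metric.ball 0 r) := by
    rw [← zero_add (1 : WithTop ℕ∞), contDiffOn_succ_iff_fderiv_of_isOpen hVo]
    refine ⟨fun x hx => (hXd x hx).differentiableAt.differentiableWithinAt, by simp, ?_⟩
    rw [contDiffOn_zero]
    exact hyφ.snd.congr fun x hx => (hXd x hx).fderiv
  have hcoF := A.contDiffOn_coFst.continuousOn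
  have hcoS := A.contDiffOn_coSnd.continuousOn
  have hVoff : IsOpen (φ.source ∩ φ ⁻¹' Metric.ball 0 r ∩ {x | η x ≠ 0}) :=
    (A.mono hVo hVU).isOpen_off_axis
  have hVoffU : φ.source ∩ φ ⁻¹' Metric.ball 0 r ∩ {x | η x ≠ 0} ⊆ U ∩ {x | η x ≠ 0} :=
    fun x hx => ⟨hVU hx.1, hx.2⟩
  have cF : ContinuousOn (fun x => coFst (G x) (ξ x) (η x) (X x))
      (φ.source ∩ φ ⁻¹' Metric.ball 0 r ∩ {x | η x ≠ 0}) :=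
    (hcoF.mono hVoffU).clm_apply (hXcont.mono inter_subset_left)
  have cS : ContinuousOn (fun x => coSnd (G x) (ξ x) (η x) (X x))
      (φ.source ∩ φ ⁻¹' Metric.ball 0 r ∩ {x | η x ≠ 0}) :=
    (hcoS.mono hVoffU).clm_apply (hXcont.mono inter_subset_left)
  have hremoff := hremN _ hVoff (inter_subset_left.trans hVs) _ fun x hx => hN1 x hx.1
  have hO' : ∀ x ∈ (φ.source ∩ φ ⁻¹' Metric.ball 0 r ∩ {x | η x ≠ 0}) \ φ ⁻¹' Oᶜ,
      IsGaugeAt G ξ η k X x := fun x hx => (hgO x ⟨hx.1.1.1, not_not.1 hx.2⟩).2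
  -- The axis is only known to be contained in the flattened subspace. At points of the subspace
  -- with `η ≠ 0` the differentials of the coefficients are recovered by removability, and the
  -- decomposition by a limit.
  have hGauge : ∀ x ∈ φ.source ∩ φ ⁻¹' Metric.ball 0 r, η x ≠ 0 → IsGaugeAt G ξ η k X x := by
    intro x hx hη
    refine ⟨?_, hremoff _ _ _ cF (w1.continuousOn.mono hVoffU).neg (fun x hx => (hO' x hx).fst) x ⟨hx, hη⟩,
      hremoff _ _ _ cS (w2.continuousOn.mono hVoffU).neg (fun x hx => (hO' x hx).snd) x ⟨hx, hη⟩⟩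
    have hnh := hVoff.mem_nhds ⟨hx, hη⟩
    -- Since `l₁ e = 1`, small nonzero displacements along `e` lie off the subspace.
    have hline : Tendsto (fun t : ℝ => φ.symm (φ x + t • e)) (𝓝[≠] 0) (𝓝 x) := by
      have h1 : Tendsto (fun t : ℝ => φ x + t • e) (𝓝 0) (𝓝 (φ x + (0 : ℝ) • e)) :=
        (continuous_const.add (continuous_id.smul continuous_const)).tendsto 0
      rw [zero_smul, add_zero] at h1
      have h2 := (φ.continuousAt_symm (φ.map_source hx.1)).tendsto
      rw [φ.left_inv hx.1] at h2
      exact (h2.comp h1).mono_left nhdsWithin_le_nhds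
    have hline2 : Tendsto (fun t : ℝ => φ x + t • e) (𝓝[≠] 0) (𝓝 (φ x)) := by
      have h1 : Tendsto (fun t : ℝ => φ x + t • e) (𝓝 0) (𝓝 (φ x + (0 : ℝ) • e)) :=
        (continuous_const.add (continuous_id.smul continuous_const)).tendsto 0
      rw [zero_smul, add_zero] at h1
      exact h1.mono_left nhdsWithin_le_nhds
    have hUx := A.isOpen.mem_nhds (hVU hx)
    have lhs := (hXcont.continuousAt (hVo.mem_nhds hx)).tendsto.comp hline
    have rhs := (((cF.continuousAt hnh).smul (A.xi_class.continuousOn.continuousAt hUx)).add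
      ((cS.continuousAt hnh).smul (A.eta_class.continuousOn.continuousAt hUx))).tendsto.comp hline
    refine tendsto_nhds_unique_of_eventuallyEq lhs rhs ?_
    have hl : ∀ᶠ t : ℝ in 𝓝[≠] 0, l₁ (φ x + t • e) ≠ 0 := by
      by_cases h : l₁ (φ x) = 0
      · filter_upwards [self_mem_nhdsWithin] with t ht
        rw [map_add, map_smul, h, h11]; simpa using ht
      · exact ((l₁.continuous.tendsto _).comp hline2).eventually_ne h
    filter_upwards [hl, hline2.eventually (Metric.isOpen_ball.mem_nhds hx.2)] with t ht1 ht2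
    exact (hg _ ⟨ht2, Or.inl ht1⟩).2.decomp
  refine ⟨_, hVo, ⟨hpφ, by rw [mem_preimage, hφp]; exact Metric.mem_ball_self hr⟩, hVU, X, ?_, hGauge⟩
  exact (A.mono hVo hVU).contDiffOn_gauge (hrem _ hVo hVs) hm (hk.mono hVU) (fun x hx => hks x (hVU hx))
    (hF.mono hVs) (fun x hx => hFk x (hVs hx)) hXc hGauge

/-- Around every point there are gauge fields. -/
theorem exists_gauge (A : AxialGeometry n U G ξ η) {m : ℕ} (hm : m + 1 ≤ n)
    (hk : ContDiffOn ℝ (m + 1 : ℕ) k U) (hks : ∀ x ∈ U, ∀ Y Z, k x Y Z = k x Z Y)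
    (hkξ : (formAction E).Invariant U ξ k) (hkη : (formAction E).Invariant U η k)
    (hc : HasClosedShift U G ξ η k) {p : E} (hp : p ∈ U) :
    ∃ V, IsOpen V ∧ p ∈ V ∧ V ⊆ U ∧ ∃ X : E → E, ContDiffOn ℝ (m + 2 : ℕ) X V ∧
      ∀ x ∈ V, η x ≠ 0 → IsGaugeAt G ξ η k X x := by
  by_cases h0 : η p = 0
  · exact A.exists_gauge_near_axis hm hk hks hkξ hkη hc hp h0
  obtain ⟨X, hX⟩ := A.exists_gauge_off_axis (hk.of_le (by norm_cast; omega)) hc hp h0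
  obtain ⟨V, hV, hVo, hpV⟩ := eventually_nhds_iff.1 (hX.and (A.isOpen_off_axis.mem_nhds ⟨hp, h0⟩))
  have hVU : V ⊆ U := fun x hx => (hV x hx).2.1
  refine ⟨V, hVo, hpV, hVU, X, ?_, fun x hx _ => (hV x hx).1⟩
  exact ((A.mono hVo hVU).contDiffOn_gauge_off_axis hm (hk.mono hVU) fun x hx _ => (hV x hx).1).mono
    fun x hx => ⟨hx, (hV x hx).2.2⟩

end AxialGeometry

/-! ### Tensor and vector fields in charts of the maximal atlas. -/

section ChartRepresentation

variable {k : ℕ} {M : Type u} [TopologicalSpace M] [ChartedSpace (ModelSp k) M]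

/-- The representation of a tensor field in a chart. -/
noncomputable def CovTensor.rep (e : OpenPartialHomeomorph M (ModelSp k)) (T : CovTensor k M) :
    ModelSp k → ModelForm k := CovTensor.pullback e.symm T

/-- The representation of a vector field in a chart. -/
noncomputable def VecField.rep (e : OpenPartialHomeomorph M (ModelSp k)) (V : VecField k M) :
    ModelSp k → ModelSp k := VectorField.mpullback (𝓡 k) (𝓡 k) e.symm V

/-- The coordinate frame of a chart. -/
noncomputable def chartFrame (e : OpenPartialHomeomorph M (ModelSp k)) (x : ModelSp k) :
    ModelSp k →L[ℝ] TangentSpace (𝓡 k) (e.symm x) := mfderiv (𝓡 k) (𝓡 k) e.symm x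

/-- The coordinate coframe of a chart. -/
noncomputable def chartCoframe (e : OpenPartialHomeomorph M (ModelSp k)) (x : ModelSp k) :
    TangentSpace (𝓡 k) (e.symm x) →L[ℝ] ModelSp k := mfderiv (𝓡 k) (𝓡 k) e (e.symm x)

theorem CovTensor.rep_apply (e : OpenPartialHomeomorph M (ModelSp k)) (T : CovTensor k M)
    (x u v : ModelSp k) : T.rep e x u v = T (e.symm x) (chartFrame e x u) (chartFrame e x v) := rfl

theorem CovTensor.rep_add (e : OpenPartialHomeomorph M (ModelSp k)) (T S : CovTensor k M)
    (x : ModelSp k) : CovTensor.rep e (fun p => T p + S p) x = T.rep e x + S.rep e x := rfl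

variable {N : WithTop ℕ∞} [IsManifold (𝓡 k) N M] {e : OpenPartialHomeomorph M (ModelSp k)}

theorem mdifferentiable_of_mem_maximalAtlas (hN : N ≠ 0)
    (he : e ∈ IsManifold.maximalAtlas (𝓡 k) N M) : e.MDifferentiable (𝓡 k) (𝓡 k) :=
  ⟨(contMDiffOn_of_mem_maximalAtlas he).mdifferentiableOn hN,
    (contMDiffOn_symm_of_mem_maximalAtlas he).mdifferentiableOn hN⟩

theorem chartFrame_chartCoframe (he : e.MDifferentiable (𝓡 k) (𝓡 k)) {x : ModelSp k}
    (hx : x ∈ e.target) (v : TangentSpace (𝓡 k) (e.symm x)) :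
    chartFrame e x (chartCoframe e x v) = v := by
  have h := he.symm_comp_deriv (e.map_target hx)
  rw [e.right_inv hx] at h
  exact congrArg (fun L : TangentSpace (𝓡 k) (e.symm x) →L[ℝ] TangentSpace (𝓡 k) (e.symm x) => L v) h

theorem chartCoframe_chartFrame (he : e.MDifferentiable (𝓡 k) (𝓡 k)) {x : ModelSp k}
    (hx : x ∈ e.target) (v : ModelSp k) : chartCoframe e x (chartFrame e x v) = v := by
  have h := he.comp_symm_deriv hx
  exact congrArg (fun L : ModelSp k →L[ℝ] ModelSp k => L v) h

theorem isInvertible_chartFrame (he : e.MDifferentiable (𝓡 k) (𝓡 k)) {x : ModelSp k}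
    (hx : x ∈ e.target) : (mfderiv (𝓡 k) (𝓡 k) e.symm x).IsInvertible :=
  ContinuousLinearMap.IsInvertible.of_inverse
    (ContinuousLinearMap.ext fun v => chartFrame_chartCoframe he hx v)
    (ContinuousLinearMap.ext fun v => chartCoframe_chartFrame he hx v)

theorem VecField.rep_eq (he : e.MDifferentiable (𝓡 k) (𝓡 k)) {x : ModelSp k} (hx : x ∈ e.target)
    (V : VecField k M) : V.rep e x = chartCoframe e x (V (e.symm x)) := by
  have h : (mfderiv (𝓡 k) (𝓡 k) e.symm x).inverse = chartCoframe e x :=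
    ContinuousLinearMap.inverse_eq
      (ContinuousLinearMap.ext fun v => chartFrame_chartCoframe he hx v)
      (ContinuousLinearMap.ext fun v => chartCoframe_chartFrame he hx v)
  exact congrArg (fun L : TangentSpace (𝓡 k) (e.symm x) →L[ℝ] ModelSp k => L (V (e.symm x))) h

theorem chartFrame_rep (he : e.MDifferentiable (𝓡 k) (𝓡 k)) {x : ModelSp k} (hx : x ∈ e.target)
    (V : VecField k M) : chartFrame e x (V.rep e x) = V (e.symm x) := by
  rw [VecField.rep_eq he hx, chartFrame_chartCoframe he hx]

theorem chartFrame_injective (he : e.MDifferentiable (𝓡 k) (𝓡 k)) {x : ModelSp k}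
    (hx : x ∈ e.target) {v w : ModelSp k} (h : chartFrame e x v = chartFrame e x w) : v = w := by
  rw [← chartCoframe_chartFrame he hx v, h, chartCoframe_chartFrame he hx]

theorem VecField.rep_eq_zero_iff (he : e.MDifferentiable (𝓡 k) (𝓡 k)) {x : ModelSp k}
    (hx : x ∈ e.target) (V : VecField k M) : V.rep e x = 0 ↔ V (e.symm x) = 0 := by
  rw [← chartFrame_rep he hx V]
  constructor
  · intro h; rw [h, map_zero]
  · intro h; exact chartFrame_injective he hx (h.trans (map_zero _).symm)

variable [IsManifold (𝓡 k) 1 M]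

/-- Components are evaluations on the coordinate frame, which is one order less regular than the
chart; hence `m + 1 ≤ N`. -/
theorem contDiffOn_rep_of_isOfClass {m : ℕ} (hmN : ((m + 1 : ℕ) : WithTop ℕ∞) ≤ N)
    {T : CovTensor k M} (hT : T.IsOfClass m) (he : e ∈ IsManifold.maximalAtlas (𝓡 k) N M) :
    ContDiffOn ℝ m (T.rep e) e.target := by
  have hsymm := contMDiffOn_symm_of_mem_maximalAtlas he
  have hframe : ∀ u : ModelSp k, ContMDiffOn (𝓡 k) (𝓡 k).tangent m
      (fun x => (TotalSpace.mk' (ModelSp k) (e.symm x) (chartFrame e x u) :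
        TangentBundle (𝓡 k) M)) e.target := by
    intro u
    have h1 := hsymm.contMDiffOn_tangentMapWithin (m := m) (by exact_mod_cast hmN)
      e.open_target.uniqueMDiffOn
    have h2 : ContMDiffOn (𝓡 k) (𝓡 k).tangent m
        (fun x : ModelSp k => (⟨x, u⟩ : TangentBundle (𝓡 k) (ModelSp k))) e.target :=
      (contMDiff_vectorSpace_iff_contDiff.2 contDiff_const).contMDiffOn
    refine (h1.comp h2 fun x hx => hx).congr fun x hx => ?_
    simp only [Function.comp_apply, tangentMapWithin]
    rw [mfderivWithin_of_isOpen e.open_target hx]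
    rfl
  have hsc : ∀ u v : ModelSp k, ContDiffOn ℝ m (fun x => T.rep e x u v) e.target := by
    intro u v
    have h1 : ContMDiffOn (𝓡 k) ((𝓡 k).prod 𝓘(ℝ, ℝ)) m
        (fun x => TotalSpace.mk' ℝ (E := Bundle.Trivial M ℝ) (e.symm x)
          (T (e.symm x) (chartFrame e x u) (chartFrame e x v))) e.target := by
      apply ContMDiffOn.clm_bundle_apply₂ (F₁ := ModelSp k) (F₂ := ModelSp k)
      · exact hT.comp_contMDiffOn (hsymm.of_le ((by norm_cast; omega : (m : WithTop ℕ∞) ≤ (m + 1 : ℕ)).trans hmN))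
      · exact hframe u
      · exact hframe v
    intro x hx
    have h2 := h1 x hx
    simp only [contMDiffWithinAt_totalSpace] at h2
    exact h2.2.contDiffWithinAt
  rw [contDiffOn_clm_apply]
  intro u
  rw [contDiffOn_clm_apply]
  intro v
  exact hsc u v

theorem isOfClass_of_contDiffOn_rep {m : ℕ} (hmN : (m : WithTop ℕ∞) ≤ N)
    {T : CovTensor k M}
    (hT : ∀ e ∈ IsManifold.maximalAtlas (𝓡 k) N M, ContDiffOn ℝ m (T.rep e) e.target) :
    T.IsOfClass m := by
  intro p
  have hc := hT _ (IsManifold.chart_mem_maximalAtlas (I := 𝓡 k) (n := N) p)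
  rw [contMDiffAt_hom_bundle]
  refine ⟨contMDiffAt_id, ?_⟩
  have h1 : ContMDiffAt (𝓡 k) 𝓘(ℝ, ModelForm k) m
      (fun q => T.rep (chartAt (ModelSp k) p) (chartAt (ModelSp k) p q)) p := by
    have h2 := (hc.contDiffAt ((chartAt (ModelSp k) p).open_target.mem_nhds
      (mem_chart_target (ModelSp k) p))).contMDiffAt
    exact h2.comp p (((contMDiffOn_of_mem_maximalAtlas
      (IsManifold.chart_mem_maximalAtlas (I := 𝓡 k) (n := N) p)).contMDiffAt
      ((chartAt (ModelSp k) p).open_source.mem_nhds (mem_chart_source (ModelSp k) p))).of_le hmN)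
  refine h1.congr_of_eventuallyEq ?_
  filter_upwards [(chartAt (ModelSp k) p).open_source.mem_nhds (mem_chart_source (ModelSp k) p)]
    with q hq
  have hT : (T ((chartAt (ModelSp k) p).symm (chartAt (ModelSp k) p q)) : ModelForm k) = T q := by
    rw [(chartAt (ModelSp k) p).left_inv hq]
  have hframe : ∀ u : ModelSp k, (trivializationAt (ModelSp k) (TangentSpace (𝓡 k)) p).symm q u =
      chartFrame (chartAt (ModelSp k) p) (chartAt (ModelSp k) p q) u := by
    intro u
    have h1 := TangentBundle.symmL_trivializationAt (I := 𝓡 k) hq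
    have h2 := congrArg (fun L : ModelSp k →L[ℝ] TangentSpace (𝓡 k) q => L u) h1
    simp only [mfld_simps, mfderivWithin_univ] at h2
    rw [← Trivialization.symmL_apply (R := ℝ) _ hq]
    exact h2
  ext u v
  have h3 : (T ((chartAt (ModelSp k) p).symm (chartAt (ModelSp k) p q)) : ModelForm k)
      (chartFrame (chartAt (ModelSp k) p) (chartAt (ModelSp k) p q) u)
      (chartFrame (chartAt (ModelSp k) p) (chartAt (ModelSp k) p q) v) =
      T q ((trivializationAt (ModelSp k) (TangentSpace (𝓡 k)) p).symm q u)
        ((trivializationAt (ModelSp k) (TangentSpace (𝓡 k)) p).symm q v) := by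
    rw [hT, hframe u, hframe v]; rfl
  refine Eq.trans ?_ h3.symm
  exact (inCoordinates_apply_eq₂ hq hq (mem_univ _)).trans (by simp)

theorem contDiffOn_vectorRep_of_isOfClass {m : ℕ} (hmN : ((m + 1 : ℕ) : WithTop ℕ∞) ≤ N)
    {V : VecField k M} (hV : V.IsOfClass m) (he : e ∈ IsManifold.maximalAtlas (𝓡 k) N M)
    (hN : N ≠ 0) : ContDiffOn ℝ m (V.rep e) e.target := by
  intro x hx
  have h := ContMDiffAt.mpullback_vectorField_preimage (hV (e.symm x))
    ((contMDiffOn_symm_of_mem_maximalAtlas he).contMDiffAt (e.open_target.mem_nhds hx))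
    (isInvertible_chartFrame (mdifferentiable_of_mem_maximalAtlas hN he) hx)
    (by exact_mod_cast hmN)
  exact (contMDiffAt_vectorSpace_iff_contDiffAt.1 h).contDiffWithinAt

theorem isInvertible_mfderiv_chart (he : e.MDifferentiable (𝓡 k) (𝓡 k)) {p : M}
    (hp : p ∈ e.source) : (mfderiv (𝓡 k) (𝓡 k) e p).IsInvertible := by
  have h1 := he.symm_comp_deriv hp
  have h2 := he.comp_symm_deriv (e.map_source hp)
  have h3 : (mfderiv (𝓡 k) (𝓡 k) e (e.symm (e p)) : ModelSp k →L[ℝ] ModelSp k) =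
      mfderiv (𝓡 k) (𝓡 k) e p := by rw [e.left_inv hp]
  refine ContinuousLinearMap.IsInvertible.of_inverse ?_ h1
  refine Eq.trans ?_ h2
  exact congrArg (fun L : ModelSp k →L[ℝ] ModelSp k =>
    L ∘L (mfderiv (𝓡 k) (𝓡 k) e.symm (e p) : ModelSp k →L[ℝ] ModelSp k)) h3.symm

/-- The vector field with a given chart representation. -/
noncomputable def VecField.ofRep (e : OpenPartialHomeomorph M (ModelSp k))
    (X : ModelSp k → ModelSp k) : VecField k M := VectorField.mpullback (𝓡 k) (𝓡 k) e X

theorem VecField.rep_ofRep (he : e.MDifferentiable (𝓡 k) (𝓡 k)) {x : ModelSp k} (hx : x ∈ e.target)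
    (X : ModelSp k → ModelSp k) : (VecField.ofRep e X).rep e x = X x := by
  rw [VecField.rep_eq he hx]
  have h := isInvertible_mfderiv_chart he (e.map_target hx)
  change (mfderiv (𝓡 k) (𝓡 k) e (e.symm x)) ((mfderiv (𝓡 k) (𝓡 k) e (e.symm x)).inverse
    (X (e (e.symm x)))) = X x
  rw [e.right_inv hx]
  exact ContinuousLinearMap.IsInvertible.self_apply_inverse h (X x)

theorem VecField.ofRep_rep (he : e.MDifferentiable (𝓡 k) (𝓡 k)) {p : M} (hp : p ∈ e.source)
    (V : VecField k M) : VecField.ofRep e (V.rep e) p = V p := by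
  have h1 := VecField.rep_eq he (e.map_source hp) V
  have h2 : (chartCoframe e (e p) (V (e.symm (e p))) : ModelSp k) =
      mfderiv (𝓡 k) (𝓡 k) e p (V p) := by
    change (mfderiv (𝓡 k) (𝓡 k) e (e.symm (e p)) : ModelSp k →L[ℝ] ModelSp k)
      (V (e.symm (e p))) = (mfderiv (𝓡 k) (𝓡 k) e p : ModelSp k →L[ℝ] ModelSp k) (V p)
    rw [e.left_inv hp]
  change (mfderiv (𝓡 k) (𝓡 k) e p).inverse (V.rep e (e p)) = V p
  rw [h1, h2]
  exact ContinuousLinearMap.IsInvertible.inverse_apply_self (isInvertible_mfderiv_chart he hp) _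

theorem VecField.contMDiffAt_ofRep {m : ℕ} (hmN : ((m + 1 : ℕ) : WithTop ℕ∞) ≤ N) (hN : N ≠ 0)
    (he : e ∈ IsManifold.maximalAtlas (𝓡 k) N M) {X : ModelSp k → ModelSp k} {p : M}
    (hp : p ∈ e.source) (hX : ContDiffAt ℝ m X (e p)) :
    ContMDiffAt (𝓡 k) (𝓡 k).tangent (m : WithTop ℕ∞)
      (fun p => (⟨p, VecField.ofRep e X p⟩ : TangentBundle (𝓡 k) M)) p :=
  ContMDiffAt.mpullback_vectorField_preimage (contMDiffAt_vectorSpace_iff_contDiffAt.2 hX)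
    ((contMDiffOn_of_mem_maximalAtlas he).contMDiffAt (e.open_source.mem_nhds hp))
    (isInvertible_mfderiv_chart (mdifferentiable_of_mem_maximalAtlas hN he) hp)
    (by exact_mod_cast hmN)

theorem isOfClass_of_contDiffAt_vectorRep {m : ℕ} (hmN : ((m + 1 : ℕ) : WithTop ℕ∞) ≤ N)
    (hN : N ≠ 0) {V : VecField k M}
    (hV : ∀ p, ∃ e ∈ IsManifold.maximalAtlas (𝓡 k) N M, p ∈ e.source ∧
      ContDiffAt ℝ m (V.rep e) (e p)) : V.IsOfClass m := by
  intro p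
  obtain ⟨e, he, hp, hc⟩ := hV p
  refine (VecField.contMDiffAt_ofRep hmN hN he hp hc).congr_of_eventuallyEq ?_
  filter_upwards [e.open_source.mem_nhds hp] with q hq
  rw [VecField.ofRep_rep (mdifferentiable_of_mem_maximalAtlas hN he) hq]

section Transition

variable {e' : OpenPartialHomeomorph M (ModelSp k)}

theorem contDiffAt_transition (he : e ∈ IsManifold.maximalAtlas (𝓡 k) N M)
    (he' : e' ∈ IsManifold.maximalAtlas (𝓡 k) N M) {x : ModelSp k} (hx : x ∈ e.target)
    (hx' : e.symm x ∈ e'.source) : ContDiffAt ℝ N (fun y => e' (e.symm y)) x := by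
  have h1 := (contMDiffOn_symm_of_mem_maximalAtlas he).contMDiffAt (e.open_target.mem_nhds hx)
  have h2 := (contMDiffOn_of_mem_maximalAtlas he').contMDiffAt (e'.open_source.mem_nhds hx')
  exact (h2.comp x h1).contDiffAt

theorem chartFrame_transition (he : e.MDifferentiable (𝓡 k) (𝓡 k))
    (he' : e'.MDifferentiable (𝓡 k) (𝓡 k)) {x : ModelSp k} (hx : x ∈ e.target)
    (hx' : e.symm x ∈ e'.source) (u : ModelSp k) :
    (chartFrame e' (e' (e.symm x)) (fderiv ℝ (fun y => e' (e.symm y)) x u) : ModelSp k) =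
      chartFrame e x u := by
  have h1 : mfderiv (𝓡 k) (𝓡 k) (e' ∘ e.symm) x =
      (mfderiv (𝓡 k) (𝓡 k) e' (e.symm x)).comp (mfderiv (𝓡 k) (𝓡 k) e.symm x) :=
    mfderiv_comp x (he'.mdifferentiableAt hx') (he.mdifferentiableAt_symm hx)
  rw [mfderiv_eq_fderiv] at h1
  have h2 := he'.symm_comp_deriv hx'
  have h3 := congrArg (fun L : ModelSp k →L[ℝ] ModelSp k => L u) h1
  have h4 := congrArg (fun L : ModelSp k →L[ℝ] ModelSp k => L (chartFrame e x u)) h2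
  refine Eq.trans ?_ h4
  exact congrArg (fun w : ModelSp k => (mfderiv (𝓡 k) (𝓡 k) e'.symm (e' (e.symm x)) :
    ModelSp k →L[ℝ] ModelSp k) w) h3

theorem CovTensor.rep_transition (he : e.MDifferentiable (𝓡 k) (𝓡 k))
    (he' : e'.MDifferentiable (𝓡 k) (𝓡 k)) {x : ModelSp k} (hx : x ∈ e.target)
    (hx' : e.symm x ∈ e'.source) (T : CovTensor k M) (u v : ModelSp k) :
    T.rep e' (e' (e.symm x)) (fderiv ℝ (fun y => e' (e.symm y)) x u)
      (fderiv ℝ (fun y => e' (e.symm y)) x v) = T.rep e x u v := by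
  have hT : (T (e'.symm (e' (e.symm x))) : ModelForm k) = T (e.symm x) := by
    rw [e'.left_inv hx']
  have h : (T (e'.symm (e' (e.symm x))) : ModelForm k)
      (chartFrame e' (e' (e.symm x)) (fderiv ℝ (fun y => e' (e.symm y)) x u))
      (chartFrame e' (e' (e.symm x)) (fderiv ℝ (fun y => e' (e.symm y)) x v)) =
      (T (e.symm x) : ModelForm k) (chartFrame e x u) (chartFrame e x v) := by
    rw [hT, chartFrame_transition he he' hx hx', chartFrame_transition he he' hx hx']; rfl
  exact h

theorem VecField.rep_transition (he : e.MDifferentiable (𝓡 k) (𝓡 k))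
    (he' : e'.MDifferentiable (𝓡 k) (𝓡 k)) {x : ModelSp k} (hx : x ∈ e.target)
    (hx' : e.symm x ∈ e'.source) (V : VecField k M) :
    fderiv ℝ (fun y => e' (e.symm y)) x (V.rep e x) = V.rep e' (e' (e.symm x)) := by
  refine chartFrame_injective he' (e'.map_source hx') ?_
  have h1 := chartFrame_transition he he' hx hx' (V.rep e x)
  have h2 := chartFrame_rep he hx V
  have h3 := chartFrame_rep he' (e'.map_source hx') V
  have h4 : (V (e'.symm (e' (e.symm x))) : ModelSp k) = V (e.symm x) := by rw [e'.left_inv hx']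
  exact h1.trans (h2.trans (h4.symm.trans h3.symm))

theorem fderiv_transition_injective (he : e.MDifferentiable (𝓡 k) (𝓡 k))
    (he' : e'.MDifferentiable (𝓡 k) (𝓡 k)) {x : ModelSp k} (hx : x ∈ e.target)
    (hx' : e.symm x ∈ e'.source) {u v : ModelSp k}
    (h : fderiv ℝ (fun y => e' (e.symm y)) x u = fderiv ℝ (fun y => e' (e.symm y)) x v) : u = v := by
  refine chartFrame_injective he hx ?_
  have h1 := chartFrame_transition he he' hx hx' u
  have h2 := chartFrame_transition he he' hx hx' v
  rw [h] at h1
  exact h1.symm.trans h2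

end Transition

end ChartRepresentation

/-! ### Naturality and commutation of Lie derivatives. -/

section LieFormNatural

variable {E : Type} [NormedAddCommGroup E] [NormedSpace ℝ E]

/-- Lie derivatives of bilinear forms are natural. -/
theorem lieForm_pullback {τ : E → E} {x : E} (hτ : ContDiffAt ℝ 2 τ x) {V V' : E → E}
    {T T' : E → E →L[ℝ] E →L[ℝ] ℝ} (hT : DifferentiableAt ℝ T (τ x))
    (hV : DifferentiableAt ℝ V (τ x)) (hT' : DifferentiableAt ℝ T' x)
    (hV' : DifferentiableAt ℝ V' x)
    (hTT : ∀ᶠ y in 𝓝 x, ∀ u v, T (τ y) (fderiv ℝ τ y u) (fderiv ℝ τ y v) = T' y u v)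
    (hVV : ∀ᶠ y in 𝓝 x, fderiv ℝ τ y (V' y) = V (τ y)) (u v : E) :
    lieForm V T (τ x) (fderiv ℝ τ x u) (fderiv ℝ τ x v) = lieForm V' T' x u v := by
  have d1 : HasFDerivAt τ (fderiv ℝ τ x) x := (hτ.differentiableAt two_ne_zero).hasFDerivAt
  have d2 : HasFDerivAt (fderiv ℝ τ) (fderiv ℝ (fderiv ℝ τ) x) x :=
    ((hτ.fderiv_right (m := 1) (by norm_num)).differentiableAt one_ne_zero).hasFDerivAt
  have hsym := hτ.isSymmSndFDerivAt (by simp)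
  have hVx := hVV.self_of_nhds
  have e1 : ∀ w, fderiv ℝ (fderiv ℝ τ) x w (V' x) + fderiv ℝ τ x (fderiv ℝ V' x w) =
      fderiv ℝ V (τ x) (fderiv ℝ τ x w) := by
    intro w
    have h1 := d2.clm_apply hV'.hasFDerivAt
    have h2 := (hV.hasFDerivAt.comp x d1).congr_of_eventuallyEq hVV
    have h3 := congrArg (fun L : E →L[ℝ] E => L w) (h1.unique h2)
    simp only [add_apply, ContinuousLinearMap.comp_apply, ContinuousLinearMap.flip_apply] at h3
    rw [← h3, add_comm]
  have e2 : fderiv ℝ T' x (V' x) u v = fderiv ℝ T (τ x) (V (τ x)) (fderiv ℝ τ x u) (fderiv ℝ τ x v)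
      + T (τ x) (fderiv ℝ (fderiv ℝ τ) x (V' x) u) (fderiv ℝ τ x v)
      + T (τ x) (fderiv ℝ τ x u) (fderiv ℝ (fderiv ℝ τ) x (V' x) v) := by
    have c := fun w : E => hasFDerivAt_const (𝕜 := ℝ) w x
    have h1 := (hT'.hasFDerivAt.clm_apply (c u)).clm_apply (c v)
    have h2 := ((hT.hasFDerivAt.comp x d1).clm_apply (d2.clm_apply (c u))).clm_apply
      (d2.clm_apply (c v))
    have h3 := congrArg (fun L : E →L[ℝ] ℝ => L (V' x))
      (h1.unique (h2.congr_of_eventuallyEq (hTT.mono fun y hy => (hy u v).symm)))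
    simp only [add_apply, ContinuousLinearMap.comp_apply, ContinuousLinearMap.flip_apply,
      map_zero, zero_add, Function.comp_apply,
      zero_apply, add_zero, hVx] at h3
    rw [h3]; ring
  have hTx := hTT.self_of_nhds
  rw [lieForm_apply, lieForm_apply, e2, ← e1 u, ← e1 v, hsym u (V' x), hsym v (V' x),
    ← hTx (fderiv ℝ V' x u) v, ← hTx u (fderiv ℝ V' x v)]
  simp only [map_add, add_apply]
  ring

theorem lieForm_symm {V : E → E} {T : E → E →L[ℝ] E →L[ℝ] ℝ} {x : E}
    (hT : DifferentiableAt ℝ T x) (hs : ∀ᶠ y in 𝓝 x, ∀ u v, T y u v = T y v u) (u v : E) :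
    lieForm V T x u v = lieForm V T x v u := by
  have c := fun w : E => hasFDerivAt_const (𝕜 := ℝ) w x
  have h1 := (hT.hasFDerivAt.clm_apply (c u)).clm_apply (c v)
  have h2 := (hT.hasFDerivAt.clm_apply (c v)).clm_apply (c u)
  have h3 := congrArg (fun L : E →L[ℝ] ℝ => L (V x))
    (h1.unique (h2.congr_of_eventuallyEq (hs.mono fun y hy => hy u v)))
  simp only [add_apply, ContinuousLinearMap.comp_apply, ContinuousLinearMap.flip_apply,
      map_zero, zero_apply, zero_add] at h3
  have hx := hs.self_of_nhds
  rw [lieForm_apply, lieForm_apply, h3, hx (fderiv ℝ V x u), hx u]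
  ring

theorem differentiableAt_lieForm {V : E → E} {T : E → E →L[ℝ] E →L[ℝ] ℝ} {x : E}
    (hV : ContDiffAt ℝ 2 V x) (hT : ContDiffAt ℝ 2 T x) (w u v : E) :
    DifferentiableAt ℝ (lieForm V T) x ∧
    fderiv ℝ (lieForm V T) x w u v = fderiv ℝ (fderiv ℝ T) x w (V x) u v
      + fderiv ℝ T x (fderiv ℝ V x w) u v
      + (T x (fderiv ℝ (fderiv ℝ V) x w u) v + fderiv ℝ T x w (fderiv ℝ V x u) v)
      + (T x u (fderiv ℝ (fderiv ℝ V) x w v) + fderiv ℝ T x w u (fderiv ℝ V x v)) := by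
  have dV := (hV.differentiableAt two_ne_zero).hasFDerivAt
  have dT := (hT.differentiableAt two_ne_zero).hasFDerivAt
  have dV2 : HasFDerivAt (fderiv ℝ V) (fderiv ℝ (fderiv ℝ V) x) x :=
    ((hV.fderiv_right (m := 1) (by norm_num)).differentiableAt one_ne_zero).hasFDerivAt
  have dT2 : HasFDerivAt (fderiv ℝ T) (fderiv ℝ (fderiv ℝ T) x) x :=
    ((hT.fderiv_right (m := 1) (by norm_num)).differentiableAt one_ne_zero).hasFDerivAt
  have h := (dT2.clm_apply dV).add
    (((formAction E).der.hasFDerivAt.comp x dV2).clm_apply dT)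
  have h' : HasFDerivAt (lieForm V T) _ x := h
  refine ⟨h'.differentiableAt, ?_⟩
  rw [h'.fderiv]
  simp only [add_apply, ContinuousLinearMap.comp_apply, ContinuousLinearMap.flip_apply,
    Function.comp_apply, formAction_der_apply]
  ring

/-- Lie derivatives along commuting vector fields commute. -/
theorem lieForm_comm {V W : E → E} {T : E → E →L[ℝ] E →L[ℝ] ℝ} {x : E} (hV : ContDiffAt ℝ 2 V x)
    (hW : ContDiffAt ℝ 2 W x) (hT : ContDiffAt ℝ 2 T x)
    (h : ∀ᶠ y in 𝓝 x, fderiv ℝ V y (W y) = fderiv ℝ W y (V y)) :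
    lieForm V (lieForm W T) x = lieForm W (lieForm V T) x := by
  have dV := (hV.differentiableAt two_ne_zero).hasFDerivAt
  have dW := (hW.differentiableAt two_ne_zero).hasFDerivAt
  have dV2 : HasFDerivAt (fderiv ℝ V) (fderiv ℝ (fderiv ℝ V) x) x :=
    ((hV.fderiv_right (m := 1) (by norm_num)).differentiableAt one_ne_zero).hasFDerivAt
  have dW2 : HasFDerivAt (fderiv ℝ W) (fderiv ℝ (fderiv ℝ W) x) x :=
    ((hW.fderiv_right (m := 1) (by norm_num)).differentiableAt one_ne_zero).hasFDerivAt
  have sT := (hT.isSymmSndFDerivAt (by simp)).eq (V x) (W x)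
  have sV := hV.isSymmSndFDerivAt (by simp)
  have sW := hW.isSymmSndFDerivAt (by simp)
  have hb : ∀ w, fderiv ℝ (fderiv ℝ V) x (W x) w + fderiv ℝ V x (fderiv ℝ W x w) =
      fderiv ℝ (fderiv ℝ W) x (V x) w + fderiv ℝ W x (fderiv ℝ V x w) := by
    intro w
    have h1 := (dV2.clm_apply dW).unique ((dW2.clm_apply dV).congr_of_eventuallyEq h)
    have h2 := congrArg (fun L : E →L[ℝ] E => L w) h1
    simp only [add_apply, ContinuousLinearMap.comp_apply, ContinuousLinearMap.flip_apply] at h2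
    rw [sV (W x) w, sW (V x) w, add_comm, h2, add_comm]
  ext u v
  have hx := h.self_of_nhds
  have b1 := congrArg (fun z => T x z v) (hb u)
  have b2 := congrArg (fun z => T x u z) (hb v)
  have b3 := congrArg (fun L : E →L[ℝ] E →L[ℝ] ℝ => L u v) sT
  have b4 := congrArg (fun z => fderiv ℝ T x z u v) hx
  simp only [map_add, add_apply] at b1 b2 b3 b4
  rw [lieForm_apply V (lieForm W T), lieForm_apply W (lieForm V T),
    (differentiableAt_lieForm hW hT (V x) u v).2, (differentiableAt_lieForm hV hT (W x) u v).2]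
  simp only [lieForm_apply]
  linear_combination b3 - b4 - b1 - b2

end LieFormNatural

section GaugeNatural

variable {E : Type} [NormedAddCommGroup E] [NormedSpace ℝ E]

theorem coframe_pullback {G G' : E →L[ℝ] E →L[ℝ] ℝ} {u v u' v' : E} {B : E →L[ℝ] E}
    (hG : ∀ X Y, G (B X) (B Y) = G' X Y) (hu : B u' = u) (hv : B v' = v) (X : E) :
    coFst G u v (B X) = coFst G' u' v' X ∧ coSnd G u v (B X) = coSnd G' u' v' X := by
  subst hu hv
  simp only [coFst_apply, coSnd_apply, gramDet, hG, and_self]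

theorem shift_pullback {G G' k k' : E →L[ℝ] E →L[ℝ] ℝ} {u v u' v' : E} {B : E →L[ℝ] E}
    (hG : ∀ X Y, G (B X) (B Y) = G' X Y) (hk : ∀ X Y, k (B X) (B Y) = k' X Y) (hu : B u' = u)
    (hv : B v' = v) (X : E) :
    shiftFst G u v k (B X) = shiftFst G' u' v' k' X ∧
    shiftSnd G u v k (B X) = shiftSnd G' u' v' k' X := by
  have h1 := coframe_pullback hG hu hv X
  have h2 : B X - orbitProj G u v (B X) = B (X - orbitProj G' u' v' X) := by
    rw [orbitProj_apply, orbitProj_apply, h1.1, h1.2, map_sub, map_add, map_smul, map_smul, hu, hv]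
  rw [shiftFst_apply, shiftFst_apply, shiftSnd_apply, shiftSnd_apply, h2]
  subst hu hv
  simp only [gramDet, hG, hk, and_self]

/-- Coframe and shifts are built from the metric, the two fields and the source alone, so the
coefficients of the field and their differentials are carried along by τ. -/
theorem IsGaugeAt.pullback {τ : E → E} {x : E} (hτ : DifferentiableAt ℝ τ x)
    {G G' k k' : E → E →L[ℝ] E →L[ℝ] ℝ} {ξ ξ' η η' X X' : E → E}
    (hG : ∀ᶠ y in 𝓝 x, ∀ u v, G (τ y) (fderiv ℝ τ y u) (fderiv ℝ τ y v) = G' y u v)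
    (hk : ∀ u v, k (τ x) (fderiv ℝ τ x u) (fderiv ℝ τ x v) = k' x u v)
    (hξ : ∀ᶠ y in 𝓝 x, fderiv ℝ τ y (ξ' y) = ξ (τ y))
    (hη : ∀ᶠ y in 𝓝 x, fderiv ℝ τ y (η' y) = η (τ y))
    (hX : ∀ᶠ y in 𝓝 x, fderiv ℝ τ y (X' y) = X (τ y))
    (hinj : ∀ u v, fderiv ℝ τ x u = fderiv ℝ τ x v → u = v) (h : IsGaugeAt G ξ η k X (τ x)) :
    IsGaugeAt G' ξ' η' k' X' x := by
  have hev : ∀ᶠ y in 𝓝 x, coFst (G (τ y)) (ξ (τ y)) (η (τ y)) (X (τ y)) =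
      coFst (G' y) (ξ' y) (η' y) (X' y) ∧ coSnd (G (τ y)) (ξ (τ y)) (η (τ y)) (X (τ y)) =
      coSnd (G' y) (ξ' y) (η' y) (X' y) := by
    filter_upwards [hG, hξ, hη, hX] with y h1 h2 h3 h4
    rw [← h4]
    exact coframe_pullback h1 h2 h3 _
  have hs := shift_pullback hG.self_of_nhds hk hξ.self_of_nhds hη.self_of_nhds
  refine ⟨hinj _ _ ?_, ?_, ?_⟩
  · rw [map_add, map_smul, map_smul, hX.self_of_nhds, hξ.self_of_nhds, hη.self_of_nhds,
      ← hev.self_of_nhds.1, ← hev.self_of_nhds.2]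
    exact h.decomp
  · refine ((h.fst.comp x hτ.hasFDerivAt).congr_of_eventuallyEq
      (hev.mono fun y hy => hy.1.symm)).congr_fderiv ?_
    ext u
    exact congrArg Neg.neg (hs u).1
  · refine ((h.snd.comp x hτ.hasFDerivAt).congr_of_eventuallyEq
      (hev.mono fun y hy => hy.2.symm)).congr_fderiv ?_
    ext u
    exact congrArg Neg.neg (hs u).2

end GaugeNatural

section ChartLie

variable {k : ℕ} {M : Type u} [TopologicalSpace M] [ChartedSpace (ModelSp k) M]

theorem lieDerivModel_eq_lieForm (V : ModelSp k → ModelSp k) (T : ModelSp k → ModelForm k)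
    (x : ModelSp k) : lieDerivModel V T x = lieForm V T x := by
  ext u v
  rw [lieForm_apply]
  rfl

variable [IsManifold (𝓡 k) 1 M] {N : WithTop ℕ∞} [IsManifold (𝓡 k) N M]
  {e : OpenPartialHomeomorph M (ModelSp k)}

/-- The Lie derivative in an arbitrary chart. -/
theorem rep_lieDeriv (hN : 2 ≤ N) {V : VecField k M} {T : CovTensor k M}
    (hV : ∀ e ∈ IsManifold.maximalAtlas (𝓡 k) N M, DifferentiableOn ℝ (V.rep e) e.target)
    (hT : ∀ e ∈ IsManifold.maximalAtlas (𝓡 k) N M, DifferentiableOn ℝ (T.rep e) e.target)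
    (he : e ∈ IsManifold.maximalAtlas (𝓡 k) N M) {x : ModelSp k} (hx : x ∈ e.target) :
    (lieDeriv V T).rep e x = lieForm (V.rep e) (T.rep e) x := by
  have hN0 : N ≠ 0 := by rintro rfl; simp at hN
  -- The Lie derivative is defined in the preferred chart at the point; the transition map from `e`
  -- to that chart carries the computation over.
  set c := chartAt (ModelSp k) (e.symm x) with hc
  have hca : c ∈ IsManifold.maximalAtlas (𝓡 k) N M := IsManifold.chart_mem_maximalAtlas _
  have hcs : e.symm x ∈ c.source := mem_chart_source _ _
  have me := mdifferentiable_of_mem_maximalAtlas hN0 he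
  have mc := mdifferentiable_of_mem_maximalAtlas hN0 hca
  have hτ := contDiffAt_transition he hca hx hcs
  have hev : ∀ᶠ y in 𝓝 x, y ∈ e.target ∧ e.symm y ∈ c.source :=
    (e.symm.isOpen_inter_preimage c.open_source).mem_nhds ⟨hx, hcs⟩
  have hd : ∀ {F : Type} [NormedAddCommGroup F] [NormedSpace ℝ F] {f : ModelSp k → F}
      {e : OpenPartialHomeomorph M (ModelSp k)} {x : ModelSp k}, DifferentiableOn ℝ f e.target →
      x ∈ e.target → DifferentiableAt ℝ f x := fun {F _ _ f e x} hf hx =>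
    hf.differentiableAt (e.open_target.mem_nhds hx)
  ext u v
  rw [← lieForm_pullback (τ := fun y => c (e.symm y)) (hτ.of_le hN) (V := V.rep c) (T := T.rep c)
    (hd (hT c hca) (c.map_source hcs)) (hd (hV c hca) (c.map_source hcs)) (hd (hT e he) hx)
    (hd (hV e he) hx)
    (hev.mono fun y hy u v => CovTensor.rep_transition me mc hy.1 hy.2 T u v)
    (hev.mono fun y hy => VecField.rep_transition me mc hy.1 hy.2 V), ← lieDerivModel_eq_lieForm]
  have h1 : mfderiv (𝓡 k) (𝓡 k) (c ∘ e.symm) x =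
      (mfderiv (𝓡 k) (𝓡 k) c (e.symm x)).comp (mfderiv (𝓡 k) (𝓡 k) e.symm x) :=
    mfderiv_comp x (mc.mdifferentiableAt hcs) (me.mdifferentiableAt_symm hx)
  rw [mfderiv_eq_fderiv] at h1
  have h2 : ∀ w, fderiv ℝ (fun y => c (e.symm y)) x w =
      (mfderiv (𝓡 k) (𝓡 k) c (e.symm x)) (chartFrame e x w) := fun w =>
    congrArg (fun L : ModelSp k →L[ℝ] ModelSp k => L w) h1
  rw [h2, h2]
  rfl

end ChartLie

/-! ### Lorentzian forms and forms vanishing along a submanifold. -/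

section LorentzAlgebra

/-- The orthogonal complement of every timelike vector of a Lorentzian form is spacelike. -/
theorem pos_of_orthogonal_timelike {E : Type*} [NormedAddCommGroup E] [NormedSpace ℝ E]
    {B : E →L[ℝ] E →L[ℝ] ℝ} (hs : ∀ u v, B u v = B v u) {u v w : E}
    (hv : ∀ w, B v w = 0 → w ≠ 0 → 0 < B w w) (hu : B u u < 0) (huw : B u w = 0) (hw : w ≠ 0) :
    0 < B w w := by
  by_contra! hle
  have hu0 : u ≠ 0 := by rintro rfl; simp at hu
  have h1 : B u v ≠ 0 := fun h => (hv u (by rw [hs, h]) hu0).not_ge hu.le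
  -- The combination of u and w orthogonal to the given timelike v. It would be spacelike, but u and
  -- w are orthogonal with nonpositive squares.
  set z := B w v • u - B u v • w with hz
  have hvz : B v z = 0 := by
    rw [hz, map_sub, map_smul, map_smul, hs v u, hs v w, smul_eq_mul, smul_eq_mul]; ring
  have hBz : B z z = B w v ^ 2 * B u u + B u v ^ 2 * B w w := by
    rw [hz]
    simp only [map_sub, map_smul, sub_apply, smul_apply, smul_eq_mul, huw, hs w u]
    ring
  have hz0 : z ≠ 0 := by
    intro h0
    have h2 : B u z = 0 := by rw [h0, map_zero]
    rw [hz, map_sub, map_smul, map_smul, huw, smul_zero, sub_zero, smul_eq_mul] at h2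
    have h3 : B w v = 0 := (mul_eq_zero.1 h2).resolve_right hu.ne
    rw [hz, h3, zero_smul, zero_sub, neg_eq_zero] at h0
    exact (smul_eq_zero.1 h0).elim h1 hw
  have := hv z hvz hz0
  nlinarith [sq_nonneg (B w v), sq_nonneg (B u v)]

/-- A one-form that vanishes along a `C²` map has symmetric derivative on its tangent space. -/
theorem fderiv_symm_of_vanish_along {E F : Type*} [NormedAddCommGroup E] [NormedSpace ℝ E]
    [NormedAddCommGroup F] [NormedSpace ℝ F] {φ : F → E} {z : F} {α : E → E →L[ℝ] ℝ}
    (hφ : ContDiffAt ℝ 2 φ z) (hα : DifferentiableAt ℝ α (φ z))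
    (h : ∀ᶠ x in 𝓝 z, ∀ w, α (φ x) (fderiv ℝ φ x w) = 0) (w w' : F) :
    fderiv ℝ α (φ z) (fderiv ℝ φ z w) (fderiv ℝ φ z w') =
      fderiv ℝ α (φ z) (fderiv ℝ φ z w') (fderiv ℝ φ z w) := by
  have d1 := (hφ.differentiableAt two_ne_zero).hasFDerivAt
  have d2 : HasFDerivAt (fderiv ℝ φ) (fderiv ℝ (fderiv ℝ φ) z) z :=
    ((hφ.fderiv_right (m := 1) (by norm_num)).differentiableAt one_ne_zero).hasFDerivAt
  -- Differentiating the vanishing condition leaves a second derivative of φ, which is symmetric.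
  have key : ∀ a b, fderiv ℝ α (φ z) (fderiv ℝ φ z a) (fderiv ℝ φ z b)
      = - α (φ z) (fderiv ℝ (fderiv ℝ φ) z a b) := by
    intro a b
    have h1 := (hα.hasFDerivAt.comp z d1).clm_apply (d2.clm_apply (hasFDerivAt_const b z))
    have h2 := h1.unique ((hasFDerivAt_const (0 : ℝ) z).congr_of_eventuallyEq
      (h.mono fun x hx => hx b))
    have h3 := congrArg (fun L : F →L[ℝ] ℝ => L a) h2
    simp only [add_apply, ContinuousLinearMap.comp_apply, ContinuousLinearMap.flip_apply,
      Function.comp_apply, map_zero, zero_apply, zero_add] at h3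
    linarith
  rw [key, key, (hφ.isSymmSndFDerivAt (by simp)).eq w w']

end LorentzAlgebra

/-! ### The Frobenius condition: from leaves at a dense set to all points off the axis. -/

section OrthogonalTransitivity

variable {E : Type} [NormedAddCommGroup E] [NormedSpace ℝ E]

/-- Integrability of the orthogonal distribution extends from a dense set of points. -/
theorem fderiv_symm_of_dense {V : Set E} (hV : IsOpen V) {S : Set E}
    (hS : ∀ W, IsOpen W → W ⊆ V → W.Nonempty → (W ∩ S).Nonempty)
    {G : E → E →L[ℝ] E →L[ℝ] ℝ} {ξ η : E → E} (hG : ContDiffOn ℝ 1 G V) (hξ : ContDiffOn ℝ 1 ξ V)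
    (hη : ContDiffOn ℝ 1 η V) (hs : ∀ x ∈ V, ∀ X Y, G x X Y = G x Y X)
    (hd : ∀ x ∈ V, gramDet (G x) (ξ x) (η x) ≠ 0) {α : E → E →L[ℝ] ℝ} (hα : ContDiffOn ℝ 1 α V)
    (h : ∀ x ∈ V ∩ S, ∀ X Y, G x (ξ x) X = 0 → G x (η x) X = 0 → G x (ξ x) Y = 0 →
      G x (η x) Y = 0 → fderiv ℝ α x X Y = fderiv ℝ α x Y X) :
    ∀ x ∈ V, ∀ X Y, G x (ξ x) X = 0 → G x (η x) X = 0 → G x (ξ x) Y = 0 →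
      G x (η x) Y = 0 → fderiv ℝ α x X Y = fderiv ℝ α x Y X := by
  intro x hx X Y hX1 hX2 hY1 hY2
  have hP : ContinuousOn (fun x => orbitProj (G x) (ξ x) (η x)) V :=
    (contDiffOn_orbitProj hG hξ hη hd).continuousOn
  have hD : ContinuousOn (fderiv ℝ α) V := hα.continuousOn_fderiv_of_isOpen hV le_rfl
  -- The test vectors are projected to the complement at each nearby point, so that the condition
  -- can be compared on the dense set and passed to the limit.
  set f : E → ℝ := fun y =>
    fderiv ℝ α y (X - orbitProj (G y) (ξ y) (η y) X) (Y - orbitProj (G y) (ξ y) (η y) Y)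
      - fderiv ℝ α y (Y - orbitProj (G y) (ξ y) (η y) Y) (X - orbitProj (G y) (ξ y) (η y) X) with hf
  have hp : ∀ Z : E, ContinuousOn (fun y => Z - orbitProj (G y) (ξ y) (η y) Z) V := fun Z =>
    continuousOn_const.sub (hP.clm_apply continuousOn_const)
  have hfc : ContinuousOn f V :=
    ((hD.clm_apply (hp X)).clm_apply (hp Y)).sub ((hD.clm_apply (hp Y)).clm_apply (hp X))
  have horth : ∀ y ∈ V, ∀ Z, G y (ξ y) (Z - orbitProj (G y) (ξ y) (η y) Z) = 0 ∧
      G y (η y) (Z - orbitProj (G y) (ξ y) (η y) Z) = 0 := by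
    intro y hy Z
    have e1 := metric_fst_eq (G := G y) (u := ξ y) (v := η y) (hd y hy) Z
    have e2 := metric_snd_eq (G := G y) (u := ξ y) (v := η y) (hd y hy) Z
    rw [map_sub, map_sub, orbitProj_apply, map_add, map_add, map_smul, map_smul, map_smul, map_smul,
      hs y hy (η y) (ξ y), smul_eq_mul, smul_eq_mul, smul_eq_mul, smul_eq_mul]
    constructor <;> linarith
  have hzero : f x = 0 := by
    by_contra hne
    obtain ⟨y, ⟨hyV, hy⟩, hyS⟩ := hS _ (hfc.isOpen_inter_preimage hV isOpen_compl_singleton)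
      inter_subset_left ⟨x, hx, hne⟩
    exact hy (sub_eq_zero.2 (h y ⟨hyV, hyS⟩ _ _ (horth y hyV X).1 (horth y hyV X).2
      (horth y hyV Y).1 (horth y hyV Y).2))
  have := sub_eq_zero.1 hzero
  rwa [orbitProj_eq_zero hX1 hX2, orbitProj_eq_zero hY1 hY2, sub_zero, sub_zero] at this

end OrthogonalTransitivity

section ChartGeometry

variable {k n : ℕ} {M : Type u} [TopologicalSpace M] [ChartedSpace (ModelSp k) M]
  [IsManifold (𝓡 k) 1 M] [IsManifold (𝓡 k) ((n + 2 : ℕ) : WithTop ℕ∞) M]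
  {e : OpenPartialHomeomorph M (ModelSp k)} {g : CovTensor k M} {ξ η : VecField k M}

/-- A leaf through a point of a chart domain, in coordinates. -/
theorem fderiv_symm_of_leaf
    (he : e ∈ IsManifold.maximalAtlas (𝓡 k) ((n + 2 : ℕ) : WithTop ℕ∞) M) {x : ModelSp k}
    (hx : x ∈ e.target) (hl : HasOrthogonalLeafThrough g ξ η (e.symm x))
    {α : ModelSp k → ModelSp k →L[ℝ] ℝ} (hα : DifferentiableAt ℝ α x)
    (h : ∀ y ∈ e.target, ∀ X, g.rep e y (ξ.rep e y) X = 0 → g.rep e y (η.rep e y) X = 0 → α y X = 0)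
    {X Y : ModelSp k} (hX1 : g.rep e x (ξ.rep e x) X = 0) (hX2 : g.rep e x (η.rep e x) X = 0)
    (hY1 : g.rep e x (ξ.rep e x) Y = 0) (hY2 : g.rep e x (η.rep e x) Y = 0) :
    fderiv ℝ α x X Y = fderiv ℝ α x Y X := by
  obtain ⟨m, U, f, hU, h0, hf0, hf, hleaf⟩ := hl
  have me := mdifferentiable_of_mem_maximalAtlas (by simp) he
  have hfs : f 0 ∈ e.source := hf0 ▸ e.map_target hx
  have hφ0 : e (f 0) = x := by rw [hf0, e.right_inv hx]
  have hev : ∀ᶠ z in 𝓝 (0 : ModelSp m), z ∈ U ∧ f z ∈ e.source :=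
    (hU.mem_nhds h0 |> Filter.eventually_mem_set.2).and
      ((hf.continuousOn.continuousAt (hU.mem_nhds h0)).eventually_mem (e.open_source.mem_nhds hfs))
  have hφ : ContDiffAt ℝ 2 (fun z => e (f z)) 0 := by
    have h2 : (2 : WithTop ℕ∞) ≤ ((n + 2 : ℕ) : WithTop ℕ∞) := by norm_cast; omega
    have h1 := ((contMDiffOn_of_mem_maximalAtlas he).contMDiffAt
      (e.open_source.mem_nhds hfs)).of_le h2
    exact (h1.comp 0 (hf.contMDiffAt (hU.mem_nhds h0))).contDiffAt
  have hD : ∀ z ∈ U, f z ∈ e.source → ∀ w, (chartFrame e (e (f z))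
      (fderiv ℝ (fun z => e (f z)) z w) : ModelSp k) = mfderiv (𝓡 m) (𝓡 k) f z w := by
    intro z hz hzs w
    have h1 : mfderiv (𝓡 m) (𝓡 k) (e ∘ f) z =
        (mfderiv (𝓡 k) (𝓡 k) e (f z)).comp (mfderiv (𝓡 m) (𝓡 k) f z) :=
      mfderiv_comp z (me.mdifferentiableAt hzs)
        ((hf.contMDiffAt (hU.mem_nhds hz)).mdifferentiableAt two_ne_zero)
    rw [mfderiv_eq_fderiv] at h1
    have h2 := congrArg (fun L : ModelSp m →L[ℝ] ModelSp k => L w) h1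
    have h3 := chartFrame_chartCoframe me (e.map_source hzs)
    have h4 : fderiv ℝ (fun z => e (f z)) z w =
      mfderiv (𝓡 k) (𝓡 k) e (f z) (mfderiv (𝓡 m) (𝓡 k) f z w) := h2
    rw [h4]
    have h5 := congrArg (fun L : ModelSp k →L[ℝ] ModelSp k => L (mfderiv (𝓡 m) (𝓡 k) f z w))
      (me.symm_comp_deriv hzs)
    exact h5
  have hperp : ∀ z ∈ U, f z ∈ e.source → ∀ v : ModelSp k,
      ((g.rep e (e (f z)) (ξ.rep e (e (f z))) v = 0 ∧ g.rep e (e (f z)) (η.rep e (e (f z))) v = 0) ↔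
        (chartFrame e (e (f z)) v : ModelSp k) ∈ Set.range (mfderiv (𝓡 m) (𝓡 k) f z)) := by
    intro z hz hzs v
    rw [CovTensor.rep_apply, CovTensor.rep_apply, chartFrame_rep me (e.map_source hzs),
      chartFrame_rep me (e.map_source hzs)]
    have h1 := (hleaf z hz).2 (chartFrame e (e (f z)) v : ModelSp k)
    refine Iff.trans ?_ h1.symm
    have h2 : e.symm (e (f z)) = f z := e.left_inv hzs
    have h3 : ∀ q : M, q = f z → ∀ v : ModelSp k,
        ((g q (ξ q) v = 0 ∧ g q (η q) v = 0) ↔ (g (f z) (ξ (f z)) v = 0 ∧ g (f z) (η (f z)) v = 0)) := by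
      rintro q rfl v; rfl
    exact h3 _ h2 _
  have hrange : ∀ v, g.rep e x (ξ.rep e x) v = 0 → g.rep e x (η.rep e x) v = 0 →
      ∃ w, fderiv ℝ (fun z => e (f z)) 0 w = v := by
    intro v hv1 hv2
    have h1 := (hperp 0 h0 hfs v).1 (by rw [hφ0]; exact ⟨hv1, hv2⟩)
    obtain ⟨w, hw⟩ := h1
    refine ⟨w, chartFrame_injective me (e.map_source hfs) ?_⟩
    exact (hD 0 h0 hfs w).trans hw
  obtain ⟨w, rfl⟩ := hrange X hX1 hX2
  obtain ⟨w', rfl⟩ := hrange Y hY1 hY2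
  have hα' : DifferentiableAt ℝ α ((fun z => e (f z)) 0) := by
    change DifferentiableAt ℝ α (e (f 0)); rwa [hφ0]
  have := fderiv_symm_of_vanish_along hφ hα' (hev.mono fun z hz w => by
    refine h _ (e.map_source hz.2) _ ?_ ?_
    · exact ((hperp z hz.1 hz.2 _).2 ⟨w, (hD z hz.1 hz.2 w).symm⟩).1
    · exact ((hperp z hz.1 hz.2 _).2 ⟨w, (hD z hz.1 hz.2 w).symm⟩).2) w w'
  simpa only [hφ0] using this

/-- The coordinate representation of a stationary and axisymmetric, orthogonally transitive
geometry. -/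
theorem axialGeometry_of_mem_maximalAtlas (hn : 2 ≤ n) (hL : IsLorentzian g)
    (hg : g.IsOfClass (n + 1)) (h : IsStationaryAxisymmetricOT n g ξ η)
    (he : e ∈ IsManifold.maximalAtlas (𝓡 k) ((n + 2 : ℕ) : WithTop ℕ∞) M) :
    AxialGeometry n e.target (g.rep e) (ξ.rep e) (η.rep e) := by
  have hN0 : ((n + 2 : ℕ) : WithTop ℕ∞) ≠ 0 := by simp
  have hN2 : (2 : WithTop ℕ∞) ≤ ((n + 2 : ℕ) : WithTop ℕ∞) := by norm_cast; omega
  have h1n : (1 : WithTop ℕ∞) ≤ ((n + 1 : ℕ) : WithTop ℕ∞) := by norm_cast; omega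
  have h2n : (2 : WithTop ℕ∞) ≤ ((n + 1 : ℕ) : WithTop ℕ∞) := by norm_cast; omega
  have me := mdifferentiable_of_mem_maximalAtlas hN0 he
  have cG : ∀ e ∈ IsManifold.maximalAtlas (𝓡 k) ((n + 2 : ℕ) : WithTop ℕ∞) M,
      ContDiffOn ℝ (n + 1 : ℕ) (g.rep e) e.target := fun e he =>
    contDiffOn_rep_of_isOfClass le_rfl hg he
  have cξ : ∀ e ∈ IsManifold.maximalAtlas (𝓡 k) ((n + 2 : ℕ) : WithTop ℕ∞) M,
      ContDiffOn ℝ (n + 1 : ℕ) (ξ.rep e) e.target := fun e he =>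
    contDiffOn_vectorRep_of_isOfClass le_rfl h.class_xi he hN0
  have cη : ∀ e ∈ IsManifold.maximalAtlas (𝓡 k) ((n + 2 : ℕ) : WithTop ℕ∞) M,
      ContDiffOn ℝ (n + 1 : ℕ) (η.rep e) e.target := fun e he =>
    contDiffOn_vectorRep_of_isOfClass le_rfl h.class_eta he hN0
  have hd : ∀ {F : Type} [NormedAddCommGroup F] [NormedSpace ℝ F] {f : ModelSp k → F}
      {e : OpenPartialHomeomorph M (ModelSp k)}, ContDiffOn ℝ (n + 1 : ℕ) f e.target →
      DifferentiableOn ℝ f e.target := fun {F _ _ f e} hf => hf.differentiableOn (by simp)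
  have hsymm : ∀ x ∈ e.target, ∀ X Y, g.rep e x X Y = g.rep e x Y X := fun x _ X Y =>
    (hL (e.symm x)).1 _ _
  have htime : ∀ x ∈ e.target, g.rep e x (ξ.rep e x) (ξ.rep e x) < 0 := by
    intro x hx
    rw [CovTensor.rep_apply, chartFrame_rep me hx]
    exact h.timelike _
  have hspace : ∀ x ∈ e.target, η.rep e x ≠ 0 → 0 < g.rep e x (η.rep e x) (η.rep e x) := by
    intro x hx hne
    rw [CovTensor.rep_apply, chartFrame_rep me hx]
    exact h.spacelike _ fun h0 => hne ((VecField.rep_eq_zero_iff me hx η).2 h0)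
  have hspatial : ∀ x ∈ e.target, ∀ w, g.rep e x (ξ.rep e x) w = 0 → w ≠ 0 →
      0 < g.rep e x w w := by
    -- The Lorentzian condition supplies some timelike vector with positive complement; the property
    -- is transferred to ξ.
    intro x hx w hw hw0
    obtain ⟨hs, v, -, hv⟩ := hL (e.symm x)
    rw [CovTensor.rep_apply, chartFrame_rep me hx] at hw
    exact pos_of_orthogonal_timelike (E := ModelSp k) (B := (g (e.symm x) : ModelForm k)) hs hv
      (h.timelike (e.symm x)) hw fun h0 => hw0 (chartFrame_injective me hx (h0.trans (map_zero _).symm))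
  have hkill : ∀ ζ : VecField k M, IsKilling g ζ →
      (∀ e ∈ IsManifold.maximalAtlas (𝓡 k) ((n + 2 : ℕ) : WithTop ℕ∞) M,
        ContDiffOn ℝ (n + 1 : ℕ) (ζ.rep e) e.target) → ∀ x ∈ e.target, ∀ X Y,
      fderiv ℝ (g.rep e) x (ζ.rep e x) X Y + g.rep e x (fderiv ℝ (ζ.rep e) x X) Y
        + g.rep e x X (fderiv ℝ (ζ.rep e) x Y) = 0 := by
    intro ζ hζ cζ x hx X Y
    rw [← lieForm_apply, ← rep_lieDeriv hN2 (fun e he => hd (cζ e he)) (fun e he => hd (cG e he))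
      he hx]
    exact congrArg (fun L : ModelForm k => L (chartFrame e x X) (chartFrame e x Y)) (hζ (e.symm x))
  obtain ⟨S, hS, hOT⟩ := h.orthogonallyTransitive
  -- The exceptional set of orthogonal transitivity has empty interior, so every open part of the
  -- chart domain contains regular points.
  have hdense : ∀ W, IsOpen W → W ⊆ e.target → W.Nonempty →
      (W ∩ {x | e.symm x ∉ S}).Nonempty := by
    intro W hW hWt hWne
    by_contra hemp
    have h1 : e.source ∩ e ⁻¹' W ⊆ interior S := by
      refine interior_maximal ?_ (e.isOpen_inter_preimage hW)
      rintro q ⟨hq, hqW⟩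
      by_contra hqS
      exact hemp ⟨e q, hqW, by rw [mem_ofPred_eq, e.left_inv hq]; exact hqS⟩
    obtain ⟨x, hx⟩ := hWne
    have h2 : e.symm x ∈ e.source ∩ e ⁻¹' W :=
      ⟨e.map_target (hWt hx), by rw [mem_preimage, e.right_inv (hWt hx)]; exact hx⟩
    simpa only [hS, mem_empty_iff_false] using h1 h2
  have hgram : ∀ x ∈ e.target, η.rep e x ≠ 0 →
      gramDet (g.rep e x) (ξ.rep e x) (η.rep e x) ≠ 0 := by
    intro x hx hne
    have h1 := htime x hx
    have h2 := hspace x hx hne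
    have : gramDet (g.rep e x) (ξ.rep e x) (η.rep e x) < 0 := by
      unfold gramDet
      nlinarith [mul_neg_of_neg_of_pos h1 h2, sq_nonneg (g.rep e x (ξ.rep e x) (η.rep e x))]
    exact this.ne
  have hoff : IsOpen (e.target ∩ {x | η.rep e x ≠ 0}) :=
    (cη e he).continuousOn.isOpen_inter_preimage e.open_target isOpen_compl_singleton
  have hint : ∀ α : ModelSp k → ModelSp k →L[ℝ] ℝ, ContDiffOn ℝ (n + 1 : ℕ) α e.target →
      (∀ y ∈ e.target, ∀ X, g.rep e y (ξ.rep e y) X = 0 → g.rep e y (η.rep e y) X = 0 →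
        α y X = 0) → ∀ x ∈ e.target, η.rep e x ≠ 0 → ∀ X Y, g.rep e x (ξ.rep e x) X = 0 →
      g.rep e x (η.rep e x) X = 0 → g.rep e x (ξ.rep e x) Y = 0 → g.rep e x (η.rep e x) Y = 0 →
      fderiv ℝ α x X Y = fderiv ℝ α x Y X := by
    intro α cα hα x hx hne
    refine fderiv_symm_of_dense hoff (S := {x | e.symm x ∉ S})
      (fun W hW hWV => hdense W hW (hWV.trans inter_subset_left))
      (((cG e he).of_le h1n).mono inter_subset_left) (((cξ e he).of_le h1n).mono inter_subset_left)
      (((cη e he).of_le h1n).mono inter_subset_left) (fun x hx => hsymm x hx.1)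
      (fun x hx => hgram x hx.1 hx.2) ((cα.of_le h1n).mono inter_subset_left) ?_ x ⟨hx, hne⟩
    rintro y ⟨⟨hy, -⟩, hyS⟩ X Y hX1 hX2 hY1 hY2
    exact fderiv_symm_of_leaf he hy (hOT _ hyS).2.2
      ((hd cα).differentiableAt (e.open_target.mem_nhds hy)) hα hX1 hX2 hY1 hY2
  refine ⟨hn, e.open_target, cG e he, cξ e he, cη e he, hsymm, hspatial, htime, hspace,
    hkill ξ h.killing_xi cξ, hkill η h.killing_eta cη, ?_,
    hint _ ((cG e he).clm_apply (cξ e he)) fun y _ X h1 _ => h1,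
    hint _ ((cG e he).clm_apply (cη e he)) fun y _ X _ h2 => h2, ?_⟩
  · intro x hx
    have : IsManifold (𝓡 k) 2 M := IsManifold.of_le hN2
    have : IsManifold (𝓡 k) (minSmoothness ℝ 2) M := by
      rwa [minSmoothness_of_isRCLikeNormedField]
    have h1 : VectorField.mpullback (𝓡 k) (𝓡 k) e.symm (VectorField.mlieBracket (𝓡 k) ξ η) x =
        VectorField.mlieBracket (𝓡 k) (VectorField.mpullback (𝓡 k) (𝓡 k) e.symm ξ)
          (VectorField.mpullback (𝓡 k) (𝓡 k) e.symm η) x :=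
      VectorField.mpullback_mlieBracket ((h.class_xi _).mdifferentiableAt (by simp))
        ((h.class_eta _).mdifferentiableAt (by simp))
        ((contMDiffOn_symm_of_mem_maximalAtlas he).contMDiffAt (e.open_target.mem_nhds hx))
        (by rwa [minSmoothness_of_isRCLikeNormedField])
    rw [VectorField.mpullback_apply, h.commute, map_zero, ← VectorField.mlieBracketWithin_univ,
      VectorField.mlieBracketWithin_eq_lieBracketWithin] at h1
    have h2 : 0 = VectorField.lieBracketWithin ℝ (ξ.rep e) (η.rep e) univ x := h1
    rw [VectorField.lieBracketWithin_univ] at h2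
    exact (sub_eq_zero.1 h2.symm).symm
  · intro p hp
    rw [← mem_closure_iff_nhdsWithin_neBot, mem_closure_iff]
    intro W hW hpW
    obtain ⟨y, hy, hyS⟩ := hdense (e.target ∩ W) (e.open_target.inter hW) inter_subset_left
      ⟨p, hp, hpW⟩
    -- At a regular point ξ and η are independent, so `η` is nonzero there; hence the axis has no
    -- interior.
    refine ⟨y, hy.2, fun h0 => ?_⟩
    have h1 := (hOT _ hyS).1.ne_zero 1
    exact h1 ((VecField.rep_eq_zero_iff me hy.1 η).1 h0)

end ChartGeometry

theorem AxialGeometry.congr {E : Type} [NormedAddCommGroup E] [NormedSpace ℝ E] {n : ℕ} {U : Set E}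
    {G G' : E → E →L[ℝ] E →L[ℝ] ℝ} {ξ ξ' η η' : E → E} (A : AxialGeometry n U G ξ η)
    (hG : ∀ x ∈ U, G' x = G x) (hξ : ∀ x ∈ U, ξ' x = ξ x) (hη : ∀ x ∈ U, η' x = η x) :
    AxialGeometry n U G' ξ' η' := by
  have ev : ∀ {F : Type} {f f' : E → F}, (∀ x ∈ U, f' x = f x) → ∀ x ∈ U, f' =ᶠ[𝓝 x] f :=
    fun {F f f'} h x hx => Filter.eventually_of_mem (A.isOpen.mem_nhds hx) h
  have fG := fun x hx => (ev hG x hx).fderiv_eq (𝕜 := ℝ)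
  have fξ := fun x hx => (ev hξ x hx).fderiv_eq (𝕜 := ℝ)
  have fη := fun x hx => (ev hη x hx).fderiv_eq (𝕜 := ℝ)
  have f1 := fun x hx => (ev (f' := fun y => G' y (ξ' y)) (f := fun y => G y (ξ y))
    (fun x hx => by rw [hG x hx, hξ x hx]) x hx).fderiv_eq (𝕜 := ℝ)
  have f2 := fun x hx => (ev (f' := fun y => G' y (η' y)) (f := fun y => G y (η y))
    (fun x hx => by rw [hG x hx, hη x hx]) x hx).fderiv_eq (𝕜 := ℝ)
  refine ⟨A.two_le, A.isOpen, A.metric_class.congr hG, A.xi_class.congr hξ, A.eta_class.congr hη,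
    ?_, ?_, ?_, ?_, ?_, ?_, ?_, ?_, ?_, ?_⟩
  · intro x hx; rw [hG x hx]; exact A.symm x hx
  · intro x hx; rw [hG x hx, hξ x hx]; exact A.spatial x hx
  · intro x hx; rw [hG x hx, hξ x hx]; exact A.timelike x hx
  · intro x hx; rw [hG x hx, hη x hx]; exact A.spacelike x hx
  · intro x hx; rw [fG x hx, fξ x hx, hG x hx, hξ x hx]; exact A.killing_xi x hx
  · intro x hx; rw [fG x hx, fη x hx, hG x hx, hη x hx]; exact A.killing_eta x hx
  · intro x hx; rw [fξ x hx, fη x hx, hξ x hx, hη x hx]; exact A.commute x hx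
  · intro x hx; rw [f1 x hx, hG x hx, hξ x hx, hη x hx]; exact A.ot_xi x hx
  · intro x hx; rw [f2 x hx, hG x hx, hξ x hx, hη x hx]; exact A.ot_eta x hx
  · intro p hp
    have h1 := A.axis_thin p hp
    have h2 : 𝓝[{x | η' x ≠ 0}] p = 𝓝[{x | η x ≠ 0}] p :=
      nhdsWithin_eq_iff_eventuallyEq.2 ((ev hη p hp).mono fun x hx => by
        change (η' x ≠ 0) = (η x ≠ 0); rw [hx])
    rwa [h2]

/-! ### Charts transported by the gauge diffeomorphisms. -/

section Transport

variable {k n : ℕ} {M M' : Type u} [TopologicalSpace M] [ChartedSpace (ModelSp k) M]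
  [IsManifold (𝓡 k) ((n + 2 : ℕ) : WithTop ℕ∞) M]
  [TopologicalSpace M'] [ChartedSpace (ModelSp k) M']
  [IsManifold (𝓡 k) ((n + 2 : ℕ) : WithTop ℕ∞) M']

/-- The chart transported by a diffeomorphism. -/
noncomputable def transportChart
    (φ : Diffeomorph (𝓡 k) (𝓡 k) M M' ((n + 2 : ℕ) : WithTop ℕ∞))
    (e : OpenPartialHomeomorph M (ModelSp k)) : OpenPartialHomeomorph M' (ModelSp k) :=
  φ.symm.toHomeomorph.toOpenPartialHomeomorph.trans e

variable (φ : Diffeomorph (𝓡 k) (𝓡 k) M M' ((n + 2 : ℕ) : WithTop ℕ∞))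
  {e : OpenPartialHomeomorph M (ModelSp k)}

theorem transportChart_target : (transportChart φ e).target = e.target := by
  simp [transportChart]

theorem transportChart_mem_maximalAtlas
    (he : e ∈ IsManifold.maximalAtlas (𝓡 k) ((n + 2 : ℕ) : WithTop ℕ∞) M) :
    transportChart φ e ∈ IsManifold.maximalAtlas (𝓡 k) ((n + 2 : ℕ) : WithTop ℕ∞) M' := by
  rw [IsManifold.mem_maximalAtlas_iff_contMDiffOn]
  constructor
  · refine (contMDiffOn_of_mem_maximalAtlas he).comp φ.symm.contMDiff.contMDiffOn ?_
    intro q hq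
    simpa [transportChart] using hq
  · rw [transportChart_target]
    exact φ.contMDiff.comp_contMDiffOn (contMDiffOn_symm_of_mem_maximalAtlas he)

theorem chartFrame_transportChart
    (he : e ∈ IsManifold.maximalAtlas (𝓡 k) ((n + 2 : ℕ) : WithTop ℕ∞) M) {x : ModelSp k}
    (hx : x ∈ e.target) (u : ModelSp k) :
    (chartFrame (transportChart φ e) x u : ModelSp k) =
      mfderiv (𝓡 k) (𝓡 k) φ (e.symm x) (chartFrame e x u) := by
  have me := mdifferentiable_of_mem_maximalAtlas (by simp) he
  have h1 : mfderiv (𝓡 k) (𝓡 k) (φ ∘ e.symm) x =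
      (mfderiv (𝓡 k) (𝓡 k) φ (e.symm x)).comp (mfderiv (𝓡 k) (𝓡 k) e.symm x) :=
    mfderiv_comp x ((φ.mdifferentiable (by simp)) _) (me.mdifferentiableAt_symm hx)
  exact congrArg (fun L : ModelSp k →L[ℝ] ModelSp k => L u) h1

theorem CovTensor.rep_transportChart
    (he : e ∈ IsManifold.maximalAtlas (𝓡 k) ((n + 2 : ℕ) : WithTop ℕ∞) M) {x : ModelSp k}
    (hx : x ∈ e.target) (T : CovTensor k M') :
    T.rep (transportChart φ e) x = CovTensor.rep e (CovTensor.pullback φ T) x := by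
  ext u v
  have hu := chartFrame_transportChart φ he hx u
  have hv := chartFrame_transportChart φ he hx v
  exact congrArg₂ (fun a b : ModelSp k => (T (φ (e.symm x)) : ModelForm k) a b) hu hv

/-- The push-forwarded Killing vectors have the same coordinate components for every ε, which places
the whole family on one coordinate domain with common fields. -/
theorem VecField.rep_transportChart
    (he : e ∈ IsManifold.maximalAtlas (𝓡 k) ((n + 2 : ℕ) : WithTop ℕ∞) M) {x : ModelSp k}
    (hx : x ∈ e.target) (V : VecField k M) :
    VecField.rep (transportChart φ e) (VectorField.mpullback (𝓡 k) (𝓡 k) φ.symm V) x =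
      V.rep e x := by
  have me := mdifferentiable_of_mem_maximalAtlas (by simp) he
  have me' := mdifferentiable_of_mem_maximalAtlas (by simp) (transportChart_mem_maximalAtlas φ he)
  have hx' : x ∈ (transportChart φ e).target := by rwa [transportChart_target]
  refine chartFrame_injective me' hx' ?_
  rw [chartFrame_rep me' hx']
  refine Eq.trans ?_ (chartFrame_transportChart φ he hx _).symm
  rw [chartFrame_rep me hx]
  have h1 : (mfderiv (𝓡 k) (𝓡 k) φ (e.symm x)).comp
      (mfderiv (𝓡 k) (𝓡 k) φ.symm (φ (e.symm x)) : ModelSp k →L[ℝ] ModelSp k) =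
      ContinuousLinearMap.id ℝ (ModelSp k) := by
    have h2 : mfderiv (𝓡 k) (𝓡 k) (φ ∘ φ.symm) (φ (e.symm x)) =
        (mfderiv (𝓡 k) (𝓡 k) φ (φ.symm (φ (e.symm x)))).comp
          (mfderiv (𝓡 k) (𝓡 k) φ.symm (φ (e.symm x))) :=
      mfderiv_comp _ ((φ.mdifferentiable (by simp)) _) ((φ.symm.mdifferentiable (by simp)) _)
    have h3 : (φ ∘ φ.symm : M' → M') = id := funext φ.apply_symm_apply
    have h4 : (mfderiv (𝓡 k) (𝓡 k) (φ ∘ φ.symm) (φ (e.symm x)) : ModelSp k →L[ℝ] ModelSp k) =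
        ContinuousLinearMap.id ℝ (ModelSp k) := by
      rw [h3]; exact mfderiv_id
    rw [← h4]
    refine Eq.trans ?_ h2.symm
    have h5 : ∀ q : M, q = e.symm x →
        (mfderiv (𝓡 k) (𝓡 k) φ q : ModelSp k →L[ℝ] ModelSp k) = mfderiv (𝓡 k) (𝓡 k) φ (e.symm x) := by
      rintro q rfl; rfl
    exact congrArg (fun L : ModelSp k →L[ℝ] ModelSp k => L.comp
      (mfderiv (𝓡 k) (𝓡 k) φ.symm (φ (e.symm x)) : ModelSp k →L[ℝ] ModelSp k))
      (h5 _ (φ.symm_apply_apply _)).symm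
  have h1' : (mfderiv (𝓡 k) (𝓡 k) φ.symm (φ (e.symm x)) : ModelSp k →L[ℝ] ModelSp k).comp
      (mfderiv (𝓡 k) (𝓡 k) φ (e.symm x) : ModelSp k →L[ℝ] ModelSp k) =
      ContinuousLinearMap.id ℝ (ModelSp k) := by
    have h2 : mfderiv (𝓡 k) (𝓡 k) (φ.symm ∘ φ) (e.symm x) =
        (mfderiv (𝓡 k) (𝓡 k) φ.symm (φ (e.symm x))).comp
          (mfderiv (𝓡 k) (𝓡 k) φ (e.symm x)) :=
      mfderiv_comp _ ((φ.symm.mdifferentiable (by simp)) _) ((φ.mdifferentiable (by simp)) _)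
    have h3 : (φ.symm ∘ φ : M → M) = id := funext φ.symm_apply_apply
    rw [h3] at h2
    exact h2.symm.trans mfderiv_id
  have h6 : (mfderiv (𝓡 k) (𝓡 k) φ.symm (φ (e.symm x)) : ModelSp k →L[ℝ] ModelSp k).inverse =
      (mfderiv (𝓡 k) (𝓡 k) φ (e.symm x) : ModelSp k →L[ℝ] ModelSp k) :=
    ContinuousLinearMap.inverse_eq h1' h1
  have h7 : ∀ q : M, q = e.symm x → (V q : ModelSp k) = V (e.symm x) := by rintro q rfl; rfl
  change (mfderiv (𝓡 k) (𝓡 k) φ.symm (φ (e.symm x)) : ModelSp k →L[ℝ] ModelSp k).inverse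
    (V (φ.symm (φ (e.symm x))) : ModelSp k) = _
  rw [h6]
  exact congrArg (mfderiv (𝓡 k) (𝓡 k) φ (e.symm x) : ModelSp k →L[ℝ] ModelSp k)
    (h7 _ (φ.symm_apply_apply _))

end Transport

/-! ### The perturbation scheme in a chart of the background. -/

section SchemeFamily

theorem iteratedDeriv_clm_comp {F F' : Type*} [NormedAddCommGroup F] [NormedSpace ℝ F]
    [NormedAddCommGroup F'] [NormedSpace ℝ F'] (L : F →L[ℝ] F') {f : ℝ → F} {t : ℝ} {j : ℕ}
    (hf : ContDiffAt ℝ j f t) :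
    iteratedDeriv j (fun s => L (f s)) t = L (iteratedDeriv j f t) := by
  have h := L.iteratedFDeriv_comp_left hf le_rfl
  rw [iteratedDeriv_eq_iteratedFDeriv, iteratedDeriv_eq_iteratedFDeriv]
  exact congrArg (fun T => T fun _ => 1) h

/-- The pullback of bilinear forms by a linear map, as a linear map. -/
noncomputable def ModelForm.compL {k : ℕ} (L : ModelSp k →L[ℝ] ModelSp k) :
    ModelForm k →L[ℝ] ModelForm k :=
  (ContinuousLinearMap.compL ℝ (ModelSp k) (ModelSp k →L[ℝ] ℝ) (ModelSp k →L[ℝ] ℝ)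
    ((ContinuousLinearMap.compL ℝ (ModelSp k) (ModelSp k) ℝ).flip L)).comp
  ((ContinuousLinearMap.compL ℝ (ModelSp k) (ModelSp k) (ModelSp k →L[ℝ] ℝ)).flip L)

/-- At a fixed point the passage to coordinates is a linear map independent of ε. -/
theorem rep_epsDeriv {k : ℕ} {M : Type u} [TopologicalSpace M] [ChartedSpace (ModelSp k) M]
    (e : OpenPartialHomeomorph M (ModelSp k)) {G : ℝ → CovTensor k M} {x : ModelSp k} {j : ℕ}
    (hG : ContDiffAt ℝ j (F := ModelForm k) (fun ε => G ε (e.symm x)) 0) :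
    (epsDeriv j G).rep e x = iteratedDeriv j (fun ε => (G ε).rep e x) 0 :=
  (iteratedDeriv_clm_comp (ModelForm.compL (mfderiv (𝓡 k) (𝓡 k) e.symm x)) hG).symm

variable {k n : ℕ} {M : ℝ → Type u} [∀ ε, TopologicalSpace (M ε)]
  [∀ ε, ChartedSpace (ModelSp k) (M ε)] [∀ ε, IsManifold (𝓡 k) 1 (M ε)]
  [∀ ε, IsManifold (𝓡 k) ((n + 2 : ℕ) : WithTop ℕ∞) (M ε)] {S : PerturbationScheme k n M}
  {ξ η : VecField k (M 0)}
  {ψ : ∀ ε, Diffeomorph (𝓡 k) (𝓡 k) (M 0) (M ε) ((n + 2 : ℕ) : WithTop ℕ∞)}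
  {e : OpenPartialHomeomorph (M 0) (ModelSp k)}

theorem PerturbationScheme.pulledMetric_zero (hψ : ψ ∈ S.gauges) :
    S.pulledMetric ψ 0 = S.metric 0 := by
  have h : (ψ 0 : M 0 → M 0) = id := funext (S.gauge_zero ψ hψ)
  funext p
  change CovTensor.pullback (ψ 0 : M 0 → M 0) (S.metric 0) p = _
  rw [h]
  ext u v
  have h2 : (mfderiv (𝓡 k) (𝓡 k) (id : M 0 → M 0) p : ModelSp k →L[ℝ] ModelSp k) =
      ContinuousLinearMap.id ℝ (ModelSp k) := mfderiv_id
  exact congrArg (fun L : ModelSp k →L[ℝ] ModelSp k => (S.metric 0 p : ModelForm k) (L u) (L v)) h2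

/-- An inherited symmetry, in a chart of the background. -/
theorem PerturbationScheme.axialFamily (hn : 2 ≤ n) (hS : S.InheritsStationaryAxisymmetricOT ξ η)
    (hψ : ψ ∈ S.gauges)
    (he : e ∈ IsManifold.maximalAtlas (𝓡 k) ((n + 2 : ℕ) : WithTop ℕ∞) (M 0)) :
    AxialFamily n S.I₀ e.target (fun ε => (S.pulledMetric ψ ε).rep e) (ξ.rep e) (η.rep e) where
  isOpen_param := S.isOpen_I₀
  zero_mem := S.zero_mem_I₀
  geometry ε hε := by
    have h := axialGeometry_of_mem_maximalAtlas hn (S.lorentzian ε hε) (S.class_metric ε hε)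
      (hS.2 ψ hψ ε hε) (transportChart_mem_maximalAtlas (ψ ε) he)
    rw [transportChart_target] at h
    exact h.congr (fun x hx => (CovTensor.rep_transportChart (ψ ε) he hx _).symm)
      (fun x hx => (VecField.rep_transportChart (ψ ε) he hx _).symm)
      (fun x hx => (VecField.rep_transportChart (ψ ε) he hx _).symm)
  contDiff_param x _ :=
    (S.contDiff_eps ψ hψ (e.symm x)).continuousLinearMap_comp
      (ModelForm.compL (mfderiv (𝓡 k) (𝓡 k) e.symm x))

theorem PerturbationScheme.rep_epsDeriv_eq (hψ : ψ ∈ S.gauges) (x : ModelSp k) :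
    (epsDeriv 1 (S.pulledMetric ψ)).rep e x =
      deriv (fun ε => (S.pulledMetric ψ ε).rep e x) 0 ∧
    (epsDeriv 2 (S.pulledMetric ψ)).rep e x =
      deriv (deriv (fun ε => (S.pulledMetric ψ ε).rep e x)) 0 := by
  have h : ContDiffAt ℝ 2 (F := ModelForm k) (fun ε => S.pulledMetric ψ ε (e.symm x)) 0 :=
    (S.contDiff_eps ψ hψ (e.symm x)).contDiffAt (S.isOpen_I₀.mem_nhds S.zero_mem_I₀)
  constructor
  · rw [rep_epsDeriv e (h.of_le (by norm_num)), iteratedDeriv_one]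
  · rw [rep_epsDeriv e h, iteratedDeriv_succ, iteratedDeriv_one]

end SchemeFamily

/-- Constant multiples of ξ and η add constants to the coefficients and do not change their
differentials. -/
theorem AxialGeometry.isGaugeAt_add_orbit {E : Type} [NormedAddCommGroup E] [NormedSpace ℝ E]
    {n : ℕ} {U : Set E} {G k : E → E →L[ℝ] E →L[ℝ] ℝ} {ξ η : E → E} (A : AxialGeometry n U G ξ η)
    {x : E} (hx : x ∈ U) (hη : η x ≠ 0) {X X' : E → E} {a b : ℝ} (h : IsGaugeAt G ξ η k X x)
    (hX : ∀ᶠ y in 𝓝 x, X' y = X y + (a • ξ y + b • η y)) : IsGaugeAt G ξ η k X' x := by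
  have hev : ∀ᶠ y in 𝓝 x, coFst (G y) (ξ y) (η y) (X' y) = coFst (G y) (ξ y) (η y) (X y) + a ∧
      coSnd (G y) (ξ y) (η y) (X' y) = coSnd (G y) (ξ y) (η y) (X y) + b := by
    filter_upwards [A.isOpen_off_axis.mem_nhds ⟨hx, hη⟩, hX] with y hy hy2
    have h1 := A.coframe_apply hy.1 hy.2 a b
    rw [hy2, (coFst _ _ _).map_add, (coSnd _ _ _).map_add, h1.1, h1.2]
    exact ⟨rfl, rfl⟩
  refine ⟨?_, (h.fst.add_const a).congr_of_eventuallyEq (hev.mono fun _ h => h.1),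
    (h.snd.add_const b).congr_of_eventuallyEq (hev.mono fun _ h => h.2)⟩
  rw [hev.self_of_nhds.1, hev.self_of_nhds.2, hX.self_of_nhds, add_smul, add_smul]
  nth_rewrite 1 [h.decomp]
  abel

/-! ### Gluing local gauge fields on a simply connected manifold. -/

section Gluing

variable {k : ℕ} {M : Type u} [TopologicalSpace M] [ChartedSpace (ModelSp k) M]
  {e : OpenPartialHomeomorph M (ModelSp k)}

theorem VecField.rep_sub_eq_iff (he : e.MDifferentiable (𝓡 k) (𝓡 k)) {x : ModelSp k}
    (hx : x ∈ e.target) {V W ξ η : VecField k M} {a b : ℝ} :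
    V.rep e x - W.rep e x = a • ξ.rep e x + b • η.rep e x ↔
      V (e.symm x) - W (e.symm x) = a • ξ (e.symm x) + b • η (e.symm x) := by
  rw [← chartFrame_rep he hx V, ← chartFrame_rep he hx W, ← chartFrame_rep he hx ξ,
    ← chartFrame_rep he hx η, ← map_sub, ← map_smul, ← map_smul, ← map_add]
  exact ⟨fun h => congrArg _ h, fun h => chartFrame_injective he hx h⟩

variable [IsManifold (𝓡 k) 1 M] {N : WithTop ℕ∞} [IsManifold (𝓡 k) N M]

theorem contDiffAt_vectorRep {m : ℕ} (hmN : ((m + 1 : ℕ) : WithTop ℕ∞) ≤ N) (hN : N ≠ 0)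
    {V : VecField k M} (he : e ∈ IsManifold.maximalAtlas (𝓡 k) N M) {x : ModelSp k}
    (hx : x ∈ e.target) (hV : ContMDiffAt (𝓡 k) (𝓡 k).tangent (m : WithTop ℕ∞)
      (fun p => (⟨p, V p⟩ : TangentBundle (𝓡 k) M)) (e.symm x)) :
    ContDiffAt ℝ m (V.rep e) x := by
  have h := ContMDiffAt.mpullback_vectorField_preimage hV
    ((contMDiffOn_symm_of_mem_maximalAtlas he).contMDiffAt (e.open_target.mem_nhds hx))
    (isInvertible_chartFrame (mdifferentiable_of_mem_maximalAtlas hN he) hx)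
    (by exact_mod_cast hmN)
  exact contMDiffAt_vectorSpace_iff_contDiffAt.1 h

variable {n : ℕ} [IsManifold (𝓡 k) ((n + 2 : ℕ) : WithTop ℕ∞) M] {g K : CovTensor k M}
  {ξ η : VecField k M}

/-- The gauge condition does not depend on the chart. -/
theorem isGaugeAt_transition {e' : OpenPartialHomeomorph M (ModelSp k)}
    (he : e ∈ IsManifold.maximalAtlas (𝓡 k) ((n + 2 : ℕ) : WithTop ℕ∞) M)
    (he' : e' ∈ IsManifold.maximalAtlas (𝓡 k) ((n + 2 : ℕ) : WithTop ℕ∞) M) {x : ModelSp k}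
    (hx : x ∈ e.target) (hx' : e.symm x ∈ e'.source) {V : VecField k M}
    (h : IsGaugeAt (g.rep e') (ξ.rep e') (η.rep e') (K.rep e') (V.rep e') (e' (e.symm x))) :
    IsGaugeAt (g.rep e) (ξ.rep e) (η.rep e) (K.rep e) (V.rep e) x := by
  have hN0 : ((n + 2 : ℕ) : WithTop ℕ∞) ≠ 0 := by simp
  have me := mdifferentiable_of_mem_maximalAtlas hN0 he
  have me' := mdifferentiable_of_mem_maximalAtlas hN0 he'
  have hev : ∀ᶠ y in 𝓝 x, y ∈ e.target ∧ e.symm y ∈ e'.source :=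
    (e.symm.isOpen_inter_preimage e'.open_source).mem_nhds ⟨hx, hx'⟩
  exact IsGaugeAt.pullback (τ := fun y => e' (e.symm y))
    ((contDiffAt_transition he he' hx hx').differentiableAt hN0)
    (hev.mono fun y hy u v => CovTensor.rep_transition me me' hy.1 hy.2 g u v)
    (fun u v => CovTensor.rep_transition me me' hx hx' K u v)
    (hev.mono fun y hy => VecField.rep_transition me me' hy.1 hy.2 ξ)
    (hev.mono fun y hy => VecField.rep_transition me me' hy.1 hy.2 η)
    (hev.mono fun y hy => VecField.rep_transition me me' hy.1 hy.2 V)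
    (fun u v huv => fderiv_transition_injective me me' hx hx' huv) h

/-- Gauge fields exist globally on a simply connected manifold. -/
theorem exists_global_gauge [SimplyConnectedSpace M]
    (hA : ∀ e ∈ IsManifold.maximalAtlas (𝓡 k) ((n + 2 : ℕ) : WithTop ℕ∞) M,
      AxialGeometry n e.target (g.rep e) (ξ.rep e) (η.rep e)) {m : ℕ} (hm : m + 1 ≤ n)
    (hK : ∀ e ∈ IsManifold.maximalAtlas (𝓡 k) ((n + 2 : ℕ) : WithTop ℕ∞) M,
      ContDiffOn ℝ (m + 1 : ℕ) (K.rep e) e.target ∧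
      (∀ x ∈ e.target, ∀ Y Z, K.rep e x Y Z = K.rep e x Z Y) ∧
      (formAction (ModelSp k)).Invariant e.target (ξ.rep e) (K.rep e) ∧
      (formAction (ModelSp k)).Invariant e.target (η.rep e) (K.rep e) ∧
      HasClosedShift e.target (g.rep e) (ξ.rep e) (η.rep e) (K.rep e)) :
    ∃ V : VecField k M, V.IsOfClass (m + 2) ∧
      ∀ e ∈ IsManifold.maximalAtlas (𝓡 k) ((n + 2 : ℕ) : WithTop ℕ∞) M,
      ∀ x ∈ e.target, η.rep e x ≠ 0 →
        IsGaugeAt (g.rep e) (ξ.rep e) (η.rep e) (K.rep e) (V.rep e) x := by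
  have hN0 : ((n + 2 : ℕ) : WithTop ℕ∞) ≠ 0 := by simp
  have hmN : ((m + 2 + 1 : ℕ) : WithTop ℕ∞) ≤ ((n + 2 : ℕ) : WithTop ℕ∞) := by norm_cast; omega
  have hchart : ∀ p : M, chartAt (ModelSp k) p ∈
      IsManifold.maximalAtlas (𝓡 k) ((n + 2 : ℕ) : WithTop ℕ∞) M := fun p =>
    IsManifold.chart_mem_maximalAtlas p
  have md : ∀ {e : OpenPartialHomeomorph M (ModelSp k)},
      e ∈ IsManifold.maximalAtlas (𝓡 k) ((n + 2 : ℕ) : WithTop ℕ∞) M →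
      e.MDifferentiable (𝓡 k) (𝓡 k) := fun he => mdifferentiable_of_mem_maximalAtlas hN0 he
  have : LocallyPathConnectedSpace M := ChartedSpace.locallyPathConnectedSpace (ModelSp k) M
  have local_gauge : ∀ p : M, ∃ (U : Set M) (W : VecField k M), IsOpen U ∧ p ∈ U ∧
      ∀ e ∈ IsManifold.maximalAtlas (𝓡 k) ((n + 2 : ℕ) : WithTop ℕ∞) M,
      ∀ x ∈ e.target, e.symm x ∈ U → ContDiffAt ℝ (m + 2 : ℕ) (W.rep e) x ∧ (η.rep e x ≠ 0 →
        IsGaugeAt (g.rep e) (ξ.rep e) (η.rep e) (K.rep e) (W.rep e) x) := by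
    intro p
    have hc := hchart p
    obtain ⟨k1, k2, k3, k4, k5⟩ := hK _ hc
    obtain ⟨V, hV, hpV, hVt, X, hX, hXg⟩ :=
      (hA _ hc).exists_gauge hm k1 k2 k3 k4 k5 (mem_chart_target (ModelSp k) p)
    set c := chartAt (ModelSp k) p with hcdef
    refine ⟨c.source ∩ c ⁻¹' V, VecField.ofRep c X, c.isOpen_inter_preimage hV,
      ⟨mem_chart_source _ p, hpV⟩, ?_⟩
    rintro e he x hx ⟨hx1, hx2⟩
    refine ⟨contDiffAt_vectorRep hmN hN0 he hx (VecField.contMDiffAt_ofRep hmN hN0 hc hx1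
      (hX.contDiffAt (hV.mem_nhds hx2))), fun hη => ?_⟩
    refine isGaugeAt_transition he hc hx hx1 ?_
    have hη' : η.rep c (c (e.symm x)) ≠ 0 := by
      rw [← VecField.rep_transition (md he) (md hc) hx hx1]
      exact fun h0 => hη (fderiv_transition_injective (md he) (md hc) hx hx1 (h0.trans (map_zero _).symm))
    have hev : ∀ᶠ y in 𝓝 (c (e.symm x)), (VecField.ofRep c X).rep c y = X y :=
      Filter.eventually_of_mem (hV.mem_nhds hx2) fun y hy => VecField.rep_ofRep (md hc) (hVt hy) X
    -- With both constants zero this transfers the condition between fields that agree near the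
    -- point.
    refine (hA c hc).isGaugeAt_add_orbit (hVt hx2) hη' (hXg _ hx2 hη') (a := 0) (b := 0)
      (hev.mono fun y hy => ?_)
    rw [hy, zero_smul, zero_smul, add_zero, add_zero]
  choose U W hUo hpU hW using local_gauge
  -- The coefficients of a constant combination are determined by its germ, even at an axis point;
  -- this yields both the cocycle identity and local constancy.
  have huniq : ∀ (r : M) (a b : ℝ × ℝ), (∀ᶠ q in 𝓝 r, a.1 • ξ q + a.2 • η q = b.1 • ξ q + b.2 • η q) →
      a = b := by
    intro r a b h
    have hr := mem_chart_target (ModelSp k) r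
    have h0 := (hA _ (hchart r)).eq_zero_of_orbit_combination hr (a := a.1 - b.1) (b := a.2 - b.2) (by
      rw [(chartAt (ModelSp k) r).eventually_nhds _ (mem_chart_source _ r)]
      filter_upwards [h, (chartAt (ModelSp k) r).open_source.mem_nhds (mem_chart_source _ r)]
        with q hq hqs
      have h1 := (VecField.rep_sub_eq_iff (V := 0) (W := 0) (ξ := ξ) (η := η) (a := a.1 - b.1)
        (b := a.2 - b.2) (md (hchart r)) ((chartAt (ModelSp k) r).map_source hqs)).2 (by
          rw [(chartAt (ModelSp k) r).left_inv hqs, sub_smul, sub_smul, sub_self]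
          rw [← sub_eq_zero] at hq
          rw [← hq]; abel)
      rw [← h1, sub_self])
    exact Prod.ext (sub_eq_zero.1 h0.1) (sub_eq_zero.1 h0.2)
  have hdiff : ∀ p q r, r ∈ U p → r ∈ U q → ∃ c : ℝ × ℝ,
      ∀ᶠ y in 𝓝 r, W p y - W q y = c.1 • ξ y + c.2 • η y := by
    intro p q r hp hq
    set c := chartAt (ModelSp k) r with hc
    have hcA : c ∈ IsManifold.maximalAtlas (𝓡 k) ((n + 2 : ℕ) : WithTop ℕ∞) M := hchart r
    have hrs : r ∈ c.source := mem_chart_source _ r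
    have hO : IsOpen (c.target ∩ c.symm ⁻¹' (U p ∩ U q)) :=
      c.symm.isOpen_inter_preimage ((hUo p).inter (hUo q))
    have h2 : (2 : WithTop ℕ∞) ≤ ((m + 2 : ℕ) : WithTop ℕ∞) := by norm_cast; omega
    obtain ⟨a, b, hab⟩ := ((hA c hcA).mono hO inter_subset_left).exists_gauge_sub_eq
      (k := K.rep c) (X := (W p).rep c) (X' := (W q).rep c)
      (fun x hx => (hK c hcA).2.1 x hx.1)
      (fun x hx => ((hW p c hcA x hx.1 hx.2.1).1.of_le h2).contDiffWithinAt)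
      (fun x hx => ((hW q c hcA x hx.1 hx.2.2).1.of_le h2).contDiffWithinAt)
      (fun x hx => (hW p c hcA x hx.1 hx.2.1).2) (fun x hx => (hW q c hcA x hx.1 hx.2.2).2)
      (p := c r) ⟨c.map_source hrs, by rw [mem_preimage, c.left_inv hrs]; exact ⟨hp, hq⟩⟩
    refine ⟨(a, b), ?_⟩
    rw [c.eventually_nhds _ hrs] at hab
    filter_upwards [hab, c.open_source.mem_nhds hrs] with y hy hys
    have := (VecField.rep_sub_eq_iff (md hcA) (c.map_source hys)).1 hy
    rwa [c.left_inv hys] at this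
  classical
  -- The value 0 is a default outside the overlaps; on an overlap the difference of two local fields
  -- is a constant combination by uniqueness.
  set a : M → M → M → ℝ × ℝ := fun p q r =>
    if h : ∃ c : ℝ × ℝ, ∀ᶠ y in 𝓝 r, W p y - W q y = c.1 • ξ y + c.2 • η y then h.choose else 0
    with hadef
  have ha : ∀ p q r, r ∈ U p → r ∈ U q →
      ∀ᶠ y in 𝓝 r, W p y - W q y = (a p q r).1 • ξ y + (a p q r).2 • η y := by
    intro p q r hp hq
    have h := hdiff p q r hp hq
    rw [show a p q r = h.choose from dif_pos h]
    exact h.choose_spec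
  obtain ⟨s, hs, hsa⟩ := exists_locally_constant_coboundary U hUo (fun p => ⟨p, hpU p⟩) a
    (fun p q l r hp hq hl => huniq r _ _ (by
      filter_upwards [ha p q r hp hq, ha q l r hq hl, ha p l r hp hl] with y h1 h2 h3
      rw [← h3, Prod.fst_add, Prod.snd_add, add_smul, add_smul, add_add_add_comm, ← h1, ← h2]
      abel))
    (fun p q r hp hq => by
      filter_upwards [(ha p q r hp hq).eventually_nhds, (hUo p).mem_nhds hp, (hUo q).mem_nhds hq]
        with y h1 h2 h3
      refine huniq y _ _ ?_
      filter_upwards [h1, ha p q y h2 h3] with z h4 h5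
      rw [← h4, ← h5])
  -- Each point uses the patch indexed by itself. By the coboundary relation the result agrees near
  -- `p` with the field of the single patch `p`, corrected by fixed constants.
  set V : VecField k M := fun r => W r r + ((s r r).1 • ξ r + (s r r).2 • η r) with hVdef
  have hVW : ∀ p, ∀ᶠ y in 𝓝 p, V y = W p y + ((s p p).1 • ξ y + (s p p).2 • η y) := by
    intro p
    filter_upwards [(hUo p).mem_nhds (hpU p), hs p p (hpU p)] with y hy h1
    have h2 := (ha p y y hy (hpU y)).self_of_nhds
    have h3 := hsa p y y hy (hpU y)
    rw [h1] at h3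
    change W y y + ((s y y).1 • ξ y + (s y y).2 • η y) = _
    rw [h3, Prod.fst_add, Prod.snd_add, add_smul, add_smul, add_add_add_comm, ← h2]
    abel
  have hrep : ∀ e ∈ IsManifold.maximalAtlas (𝓡 k) ((n + 2 : ℕ) : WithTop ℕ∞) M,
      ∀ x ∈ e.target, ∀ᶠ y in 𝓝 x, V.rep e y = (W (e.symm x)).rep e y +
        ((s (e.symm x) (e.symm x)).1 • ξ.rep e y + (s (e.symm x) (e.symm x)).2 • η.rep e y) := by
    intro e he x hx
    filter_upwards [(e.symm.continuousAt hx).tendsto.eventually (hVW (e.symm x)),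
      e.open_target.mem_nhds hx] with y h1 hy
    rw [← sub_eq_iff_eq_add', VecField.rep_sub_eq_iff (md he) hy, sub_eq_iff_eq_add', h1]
  refine ⟨V, isOfClass_of_contDiffAt_vectorRep hmN hN0 fun p =>
    ⟨chartAt (ModelSp k) p, hchart p, mem_chart_source _ p, ?_⟩, fun e he x hx hη => ?_⟩
  · have hp := mem_chart_target (ModelSp k) p
    have hle : ((m + 2 : ℕ) : WithTop ℕ∞) ≤ ((n + 1 : ℕ) : WithTop ℕ∞) := by norm_cast; omega
    have hO := (chartAt (ModelSp k) p).open_target.mem_nhds hp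
    refine ContDiffAt.congr_of_eventuallyEq ?_ (hrep _ (hchart p) _ hp)
    exact (hW _ _ (hchart p) _ hp (hpU _)).1.add
      (((((hA _ (hchart p)).xi_class.contDiffAt hO).of_le hle).const_smul _).add
        ((((hA _ (hchart p)).eta_class.contDiffAt hO).of_le hle).const_smul _))
  · exact (hA e he).isGaugeAt_add_orbit hx hη ((hW _ e he x hx (hpU _)).2 hη) (hrep e he x hx)

end Gluing

/-! ### Lie derivatives of invariant tensors along gauge fields. -/

section LieFormCalculus

variable {E : Type} [NormedAddCommGroup E] [NormedSpace ℝ E] {U : Set E} {V : E → E}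
  {T S : E → E →L[ℝ] E →L[ℝ] ℝ} {x : E}

theorem contDiffOn_lieForm (hU : IsOpen U) {m : ℕ} (hV : ContDiffOn ℝ (m + 1 : ℕ) V U)
    (hT : ContDiffOn ℝ (m + 1 : ℕ) T U) : ContDiffOn ℝ m (lieForm V T) U := by
  have hle : (m : WithTop ℕ∞) ≤ (m + 1 : ℕ) := by norm_cast; omega
  exact ((hT.fderiv_of_isOpen hU (by norm_cast)).clm_apply (hV.of_le hle)).add
    (((hV.fderiv_of_isOpen hU (by norm_cast)).continuousLinearMap_comp (formAction E).der).clm_apply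
      (hT.of_le hle))

theorem lieForm_add_tensor (hT : DifferentiableAt ℝ T x) (hS : DifferentiableAt ℝ S x) :
    lieForm V (fun y => T y + S y) x = lieForm V T x + lieForm V S x := by
  rw [lieForm, lieForm, lieForm, fderiv_fun_add hT hS, map_add, add_apply]
  abel

theorem lieForm_sub_tensor (hT : DifferentiableAt ℝ T x) (hS : DifferentiableAt ℝ S x) :
    lieForm V (fun y => T y - S y) x = lieForm V T x - lieForm V S x := by
  rw [lieForm, lieForm, lieForm, fderiv_fun_sub hT hS, map_sub, sub_apply]
  abel

theorem lieForm_smul_tensor (c : ℝ) (hT : DifferentiableAt ℝ T x) :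
    lieForm V (fun y => c • T y) x = c • lieForm V T x := by
  rw [lieForm, lieForm, fderiv_fun_const_smul hT, map_smul, smul_apply, smul_add]

theorem lieForm_congr_tensor (h : T =ᶠ[𝓝 x] S) : lieForm V T x = lieForm V S x := by
  rw [lieForm, lieForm, h.fderiv_eq, h.self_of_nhds]

/-- The Lie derivative of an invariant tensor along a commuting field is invariant. -/
theorem lieForm_lieForm_eq_zero (hU : IsOpen U) {ζ : E → E} (hζ : ContDiffOn ℝ 2 ζ U)
    (hV : ContDiffOn ℝ 2 V U) (hT : ContDiffOn ℝ 2 T U)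
    (hc : ∀ x ∈ U, fderiv ℝ ζ x (V x) = fderiv ℝ V x (ζ x)) (h0 : ∀ x ∈ U, lieForm ζ T x = 0) :
    ∀ x ∈ U, lieForm ζ (lieForm V T) x = 0 := by
  intro x hx
  have hn := hU.mem_nhds hx
  rw [lieForm_comm (hζ.contDiffAt hn) (hV.contDiffAt hn) (hT.contDiffAt hn)
    (Filter.eventually_of_mem hn hc),
    lieForm_congr_tensor (S := fun _ => 0) (Filter.eventually_of_mem hn h0)]
  simp [lieForm]

/-- Constancy along segments in the span of two directions of vanishing derivative. -/
theorem eq_of_segment_subset {F : Type*} [NormedAddCommGroup F] [NormedSpace ℝ F] {f : E → F}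
    {u v : E} (hf : ∀ z ∈ U, DifferentiableAt ℝ f z) (hu : ∀ z ∈ U, fderiv ℝ f z u = 0)
    (hv : ∀ z ∈ U, fderiv ℝ f z v = 0) {y : E} (hxy : segment ℝ x y ⊆ U) {a b : ℝ}
    (hab : y - x = a • u + b • v) : f x = f y := by
  have hmem : ∀ t ∈ Icc (0 : ℝ) 1, x + t • (y - x) ∈ U := fun t ht => by
    refine hxy ?_
    rw [segment_eq_image']
    exact ⟨t, ht, rfl⟩
  have hd : ∀ t ∈ Icc (0 : ℝ) 1, HasDerivAt (fun t : ℝ => f (x + t • (y - x))) 0 t := by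
    intro t ht
    have h1 : HasDerivAt (fun t : ℝ => x + t • (y - x)) (y - x) t := by
      simpa using ((hasDerivAt_id t).smul_const (y - x)).const_add x
    have h2 := (hf _ (hmem t ht)).hasFDerivAt.comp_hasDerivAt t h1
    rwa [hab, map_add, map_smul, map_smul, hu _ (hab ▸ hmem t ht), hv _ (hab ▸ hmem t ht), smul_zero,
      smul_zero, add_zero, ← hab] at h2
  have h3 := constant_of_has_deriv_right_zero
    (fun t ht => (hd t ht).continuousAt.continuousWithinAt)
    (fun t ht => (hd t ⟨ht.1, ht.2.le⟩).hasDerivWithinAt) 1 (right_mem_Icc.2 zero_le_one)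
  simpa using h3.symm

end LieFormCalculus

namespace AxialGeometry

variable {E : Type} [NormedAddCommGroup E] [NormedSpace ℝ E] {n : ℕ} {U : Set E}
  {G k : E → E →L[ℝ] E →L[ℝ] ℝ} {ξ η X : E → E}

/-- Gauge fields commute with the Killing vectors. -/
theorem commute_gauge (A : AxialGeometry n U G ξ η) (hXc : ContDiffOn ℝ 1 X U)
    (hX : ∀ x ∈ U, η x ≠ 0 → IsGaugeAt G ξ η k X x) {x : E} (hx : x ∈ U) :
    fderiv ℝ ξ x (X x) = fderiv ℝ X x (ξ x) ∧ fderiv ℝ η x (X x) = fderiv ℝ X x (η x) := by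
  have cD : ∀ {ζ : E → E}, ContDiffOn ℝ 1 ζ U → ContinuousOn (fderiv ℝ ζ) U := fun h =>
    h.continuousOn_fderiv_of_isOpen A.isOpen le_rfl
  have cξ := A.xi_two.of_le one_le_two
  have cη := A.eta_two.of_le one_le_two
  constructor
  · refine A.eq_of_eq_off_axis ((cD cξ).clm_apply hXc.continuousOn)
      ((cD hXc).clm_apply cξ.continuousOn) (fun y hy hη => ?_) hx
    have hev : ∀ᶠ z in 𝓝 y, IsGaugeAt G ξ η k X z := by
      filter_upwards [A.isOpen_off_axis.mem_nhds ⟨hy, hη⟩] with z hz using hX z hz.1 hz.2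
    -- The shifts vanish on the orbit vectors, so the coefficients of a gauge field are constant
    -- along the orbits.
    have hs := shift_fst (k := k y) (A.symm y hy) (A.gramDet_ne hy hη)
    rw [(A.hasFDerivAt_gauge hy hev).fderiv]
    simp only [add_apply, smul_apply, ContinuousLinearMap.smulRight_apply, neg_apply, hs.1, hs.2,
      neg_zero, zero_smul, add_zero]
    rw [← A.commute y hy, ← map_smul, ← map_smul, ← map_add, ← (hX y hy hη).decomp]
  · refine A.eq_of_eq_off_axis ((cD cη).clm_apply hXc.continuousOn)
      ((cD hXc).clm_apply cη.continuousOn) (fun y hy hη => ?_) hx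
    have hev : ∀ᶠ z in 𝓝 y, IsGaugeAt G ξ η k X z := by
      filter_upwards [A.isOpen_off_axis.mem_nhds ⟨hy, hη⟩] with z hz using hX z hz.1 hz.2
    have hs := shift_snd (k := k y) (A.gramDet_ne hy hη)
    rw [(A.hasFDerivAt_gauge hy hev).fderiv]
    simp only [add_apply, smul_apply, ContinuousLinearMap.smulRight_apply, neg_apply, hs.1, hs.2,
      neg_zero, zero_smul, add_zero]
    rw [A.commute y hy, ← map_smul, ← map_smul, ← map_add, ← (hX y hy hη).decomp]

theorem lieForm_gauge_invariant (A : AxialGeometry n U G ξ η) (hXc : ContDiffOn ℝ 2 X U)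
    (hX : ∀ x ∈ U, η x ≠ 0 → IsGaugeAt G ξ η k X x) {T : E → E →L[ℝ] E →L[ℝ] ℝ}
    (hT : ContDiffOn ℝ 2 T U) (hξ : ∀ x ∈ U, lieForm ξ T x = 0) (hη : ∀ x ∈ U, lieForm η T x = 0) :
    ∀ x ∈ U, lieForm ξ (lieForm X T) x = 0 ∧ lieForm η (lieForm X T) x = 0 := fun x hx =>
  ⟨lieForm_lieForm_eq_zero A.isOpen A.xi_two hXc hT
    (fun _ h => (A.commute_gauge (hXc.of_le one_le_two) hX h).1) hξ x hx,
  lieForm_lieForm_eq_zero A.isOpen A.eta_two hXc hT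
    (fun _ h => (A.commute_gauge (hXc.of_le one_le_two) hX h).2) hη x hx⟩

/-- The gauge transformed tensor has no cross components. -/
theorem gauge_cross_eq_zero (A : AxialGeometry n U G ξ η) {x : E} (hx : x ∈ U)
    (hη : η x ≠ 0) (hX : ∀ᶠ y in 𝓝 x, IsGaugeAt G ξ η k X y) (hk : ∀ Y Z, k x Y Z = k x Z Y)
    {Z : E} (h1 : G x (ξ x) Z = 0) (h2 : G x (η x) Z = 0) :
    (k x (ξ x) Z + lieForm X G x (ξ x) Z = 0 ∧ k x (η x) Z + lieForm X G x (η x) Z = 0) ∧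
    (k x Z (ξ x) + lieForm X G x Z (ξ x) = 0 ∧ k x Z (η x) + lieForm X G x Z (η x) = 0) := by
  have hs := A.symm x hx
  have hd := A.gramDet_ne hx hη
  have hZ := (orbitRefl_eq_self_iff (G := G x) (u := ξ x) (v := η x) hs hd (X := Z)).2 ⟨h1, h2⟩
  rw [A.lieForm_gauge_metric hx hη hX hk]
  simp only [smul_apply, sub_apply, formAction_pull_apply, smul_eq_mul, hZ, orbitRefl_fst hs hd,
    orbitRefl_snd hs hd, map_neg, neg_apply, hk Z]
  refine ⟨⟨?_, ?_⟩, ?_, ?_⟩ <;> ring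

end AxialGeometry

/-! ### The source of the second gauge field. -/

namespace AxialFamily

variable {E : Type} [NormedAddCommGroup E] [NormedSpace ℝ E] [CompleteSpace E] {m n : ℕ}
  {I : Set ℝ} {U : Set E} {G : ℝ → E → E →L[ℝ] E →L[ℝ] ℝ} {ξ η X : E → E}
  {K₁ K₂ : E → E →L[ℝ] E →L[ℝ] ℝ}

theorem deriv_symm (A : AxialFamily n I U G ξ η) {x : E} (hx : x ∈ U) (Y Z : E) :
    deriv (fun ε => G ε x) 0 Y Z = deriv (fun ε => G ε x) 0 Z Y ∧
    deriv (deriv (fun ε => G ε x)) 0 Y Z = deriv (deriv (fun ε => G ε x)) 0 Z Y := by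
  have hflip : ∀ j : ℕ, j ≤ 2 →
      flipForm (iteratedDeriv j (fun ε => G ε x) 0) = iteratedDeriv j (fun ε => G ε x) 0 := by
    intro j hj
    rw [← iteratedDeriv_clm_comp flipForm ((A.contDiffAt_param hx).of_le (by exact_mod_cast hj))]
    refine Filter.EventuallyEq.iteratedDeriv_eq j ?_
    filter_upwards [A.isOpen_param.mem_nhds A.zero_mem] with ε hε
    ext u v
    exact (A.geometry ε hε).symm x hx v u
  have h1 := hflip 1 (by norm_num)
  have h2 := hflip 2 le_rfl
  rw [iteratedDeriv_one] at h1
  rw [iteratedDeriv_succ, iteratedDeriv_one] at h2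
  exact ⟨congrArg (fun T : E →L[ℝ] E →L[ℝ] ℝ => T Z Y) h1,
    congrArg (fun T : E →L[ℝ] E →L[ℝ] ℝ => T Z Y) h2⟩

theorem invariant_deriv (A : AxialFamily n I U G ξ η)
    (hK₁ : ContDiffOn ℝ 1 (fun x => deriv (fun ε => G ε x) 0) U)
    (hK₂ : ContDiffOn ℝ 1 (fun x => deriv (deriv (fun ε => G ε x)) 0) U) :
    ((formAction E).Invariant U ξ (fun x => deriv (fun ε => G ε x) 0) ∧
      (formAction E).Invariant U η (fun x => deriv (fun ε => G ε x) 0)) ∧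
    ((formAction E).Invariant U ξ (fun x => deriv (deriv (fun ε => G ε x)) 0) ∧
      (formAction E).Invariant U η (fun x => deriv (deriv (fun ε => G ε x)) 0)) := by
  have h1 := A.invariant_of_killing (A.background.xi_two.of_le one_le_two)
    fun ε hε => (A.geometry ε hε).killing_xi
  have h2 := A.invariant_of_killing (A.background.eta_two.of_le one_le_two)
    fun ε hε => (A.geometry ε hε).killing_eta
  exact ⟨⟨h1.1 hK₁, h2.1 hK₁⟩, ⟨h1.2 hK₂, h2.2 hK₂⟩⟩

/-- The source of the second gauge field satisfies the conditions for its existence. -/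
theorem second_source (A : AxialFamily n I U G ξ η) (hn : n = m + 2)
    (h₁ : K₁ = fun x => deriv (fun ε => G ε x) 0)
    (h₂ : K₂ = fun x => deriv (deriv (fun ε => G ε x)) 0)
    (hK₁ : ContDiffOn ℝ n K₁ U) (hK₂ : ContDiffOn ℝ (m + 1 : ℕ) K₂ U)
    (hXc : ContDiffOn ℝ (n + 1 : ℕ) X U)
    (hX : ∀ x ∈ U, η x ≠ 0 → IsGaugeAt (G 0) ξ η K₁ X x) {T L k₂ : E → E →L[ℝ] E →L[ℝ] ℝ}
    (hL : ∀ x ∈ U, L x = lieForm X (G 0) x) (hT : ∀ x ∈ U, T x = K₁ x + L x)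
    (hk₂ : ∀ x ∈ U, k₂ x = K₂ x + (2 : ℝ) • lieForm X T x - lieForm X L x) :
    (ContDiffOn ℝ n T U ∧ (∀ x ∈ U, lieForm ξ T x = 0) ∧ (∀ x ∈ U, lieForm η T x = 0)) ∧
    ContDiffOn ℝ (m + 1 : ℕ) k₂ U ∧
      (∀ x ∈ U, ∀ Y Z, k₂ x Y Z = k₂ x Z Y) ∧
      (formAction E).Invariant U ξ k₂ ∧ (formAction E).Invariant U η k₂ ∧
      HasClosedShift U (G 0) ξ η k₂ := by
  have B := A.background
  have h2n : (2 : WithTop ℕ∞) ≤ n := by subst hn; norm_cast; omega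
  have h12 : (2 : WithTop ℕ∞) ≤ (n + 1 : ℕ) := by subst hn; norm_cast; omega
  have hm1 : (1 : WithTop ℕ∞) ≤ (m + 1 : ℕ) := by norm_cast; omega
  have hmn : ((m + 1 + 1 : ℕ) : WithTop ℕ∞) ≤ n := by subst hn; norm_cast
  have hmn' : ((m + 1 + 1 : ℕ) : WithTop ℕ∞) ≤ (n + 1 : ℕ) := by subst hn; norm_cast; omega
  have cL : ContDiffOn ℝ n L U := (contDiffOn_lieForm B.isOpen hXc B.metric_class).congr hL
  have cT : ContDiffOn ℝ n T U := (hK₁.add cL).congr hT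
  have cLT : ∀ S : E → E →L[ℝ] E →L[ℝ] ℝ, ContDiffOn ℝ n S U →
      ContDiffOn ℝ (m + 1 : ℕ) (lieForm X S) U := fun S hS =>
    contDiffOn_lieForm B.isOpen (hXc.of_le hmn') (hS.of_le hmn)
  have ck₂ : ContDiffOn ℝ (m + 1 : ℕ) k₂ U :=
    ((hK₂.add ((cLT T cT).const_smul (2 : ℝ))).sub (cLT L cL)).congr hk₂
  have hd : ∀ {S : E → E →L[ℝ] E →L[ℝ] ℝ}, ContDiffOn ℝ (m + 1 : ℕ) S U → ∀ x ∈ U,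
      DifferentiableAt ℝ S x := fun hS x hx =>
    (hS.differentiableOn (by simp)).differentiableAt (B.isOpen.mem_nhds hx)
  have hdn : ∀ {S : E → E →L[ℝ] E →L[ℝ] ℝ}, ContDiffOn ℝ n S U → ∀ x ∈ U,
      DifferentiableAt ℝ S x := fun hS x hx =>
    ((hS.of_le h2n).differentiableOn two_ne_zero).differentiableAt (B.isOpen.mem_nhds hx)
  have inv := A.invariant_deriv (h₁ ▸ hK₁.of_le (one_le_two.trans h2n)) (h₂ ▸ hK₂.of_le hm1)
  rw [← h₁, ← h₂] at inv
  obtain ⟨⟨i1, i2⟩, i3, i4⟩ := inv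
  have hev : ∀ {S S' : E → E →L[ℝ] E →L[ℝ] ℝ}, (∀ x ∈ U, S x = S' x) → ∀ x ∈ U, S =ᶠ[𝓝 x] S' :=
    fun h x hx => Filter.eventually_of_mem (B.isOpen.mem_nhds hx) h
  have iG := B.lieForm_gauge_invariant (hXc.of_le h12) hX B.metric_two
    (fun _ h => B.lieForm_xi h) (fun _ h => B.lieForm_eta h)
  have iL : ∀ x ∈ U, lieForm ξ L x = 0 ∧ lieForm η L x = 0 := fun x hx => by
    rw [lieForm_congr_tensor (hev hL x hx), lieForm_congr_tensor (hev hL x hx)]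
    exact iG x hx
  have iT : ∀ x ∈ U, lieForm ξ T x = 0 ∧ lieForm η T x = 0 := fun x hx => by
    rw [lieForm_congr_tensor (hev hT x hx), lieForm_congr_tensor (hev hT x hx),
      lieForm_add_tensor (hdn hK₁ x hx) (hdn cL x hx), lieForm_add_tensor (hdn hK₁ x hx) (hdn cL x hx),
      (iL x hx).1, (iL x hx).2, add_zero, add_zero]
    exact ⟨i1 x hx, i2 x hx⟩
  have iLT := B.lieForm_gauge_invariant (hXc.of_le h12) hX (cT.of_le h2n) (fun x h => (iT x h).1)
    fun x h => (iT x h).2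
  have iLL := B.lieForm_gauge_invariant (hXc.of_le h12) hX (cL.of_le h2n) (fun x h => (iL x h).1)
    fun x h => (iL x h).2
  have split : ∀ ζ : E → E, ∀ x ∈ U, lieForm ζ k₂ x = lieForm ζ K₂ x
      + (2 : ℝ) • lieForm ζ (lieForm X T) x - lieForm ζ (lieForm X L) x := fun ζ x hx => by
    have d1 := hd (cLT T cT) x hx
    have d2 : DifferentiableAt ℝ (fun y => (2 : ℝ) • lieForm X T y) x := d1.const_smul (2 : ℝ)
    have d3 : DifferentiableAt ℝ (fun y => K₂ y + (2 : ℝ) • lieForm X T y) x :=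
      (hd hK₂ x hx).add d2
    rw [lieForm_congr_tensor (hev hk₂ x hx), lieForm_sub_tensor d3 (hd (cLT L cL) x hx),
      lieForm_add_tensor (hd hK₂ x hx) d2, lieForm_smul_tensor _ d1]
  have sK : ∀ x ∈ U, ∀ Y Z, K₁ x Y Z = K₁ x Z Y := fun x hx Y Z => by
    rw [h₁]; exact (A.deriv_symm hx Y Z).1
  have sL : ∀ x ∈ U, ∀ Y Z, L x Y Z = L x Z Y := fun x hx Y Z => by
    rw [hL x hx]
    exact lieForm_symm (B.hasFDerivAt_metric hx).differentiableAt
      (Filter.eventually_of_mem (B.isOpen.mem_nhds hx) B.symm) Y Z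
  have sT : ∀ x ∈ U, ∀ Y Z, T x Y Z = T x Z Y := fun x hx Y Z => by
    rw [hT x hx, add_apply, add_apply, add_apply, add_apply, sK x hx, sL x hx]
  refine ⟨⟨cT, fun x h => (iT x h).1, fun x h => (iT x h).2⟩, ck₂, ?_, ?_, ?_, ?_⟩
  · intro x hx Y Z
    have hn := B.isOpen.mem_nhds hx
    rw [hk₂ x hx]
    simp only [sub_apply, add_apply, smul_apply]
    rw [lieForm_symm (hdn cT x hx) (Filter.eventually_of_mem hn sT) Y Z,
      lieForm_symm (hdn cL x hx) (Filter.eventually_of_mem hn sL) Y Z]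
    have : K₂ x Y Z = K₂ x Z Y := by rw [h₂]; exact (A.deriv_symm hx Y Z).2
    rw [this]
  · intro x hx
    refine (split ξ x hx).trans ?_
    rw [(iLT x hx).1, (iLL x hx).1, smul_zero, add_zero, sub_zero]
    exact i3 x hx
  · intro x hx
    refine (split η x hx).trans ?_
    rw [(iLT x hx).2, (iLL x hx).2, smul_zero, add_zero, sub_zero]
    exact i4 x hx
  -- The shifts see a tensor only through its contractions with ξ and η in the first slot, and these
  -- are compared with those of `secondSource`.
  · have key : ∀ x ∈ U, η x ≠ 0 →
        shiftFst (G 0 x) (ξ x) (η x) (k₂ x) = shiftFst (G 0 x) (ξ x) (η x) (secondSource G ξ η x) ∧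
        shiftSnd (G 0 x) (ξ x) (η x) (k₂ x) = shiftSnd (G 0 x) (ξ x) (η x) (secondSource G ξ η x) := by
      intro x hx hη
      have hs := B.symm x hx
      have hdet := B.gramDet_ne hx hη
      have hXev : ∀ᶠ y in 𝓝 x, IsGaugeAt (G 0) ξ η K₁ X y := by
        filter_upwards [B.isOpen_off_axis.mem_nhds ⟨hx, hη⟩] with y hy using hX y hy.1 hy.2
      have z1 := shift_fst (k := K₁ x) hs hdet
      have z2 := shift_snd (G := G 0 x) (u := ξ x) (k := K₁ x) hdet
      have eL : L x (ξ x) (ξ x) = 0 ∧ L x (ξ x) (η x) = 0 ∧ L x (η x) (ξ x) = 0 ∧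
          L x (η x) (η x) = 0 := by
        rw [hL x hx]
        simp only [B.lieForm_gauge hx hXev (B.lieForm_xi hx) (B.lieForm_eta hx), z1.1, z1.2, z2.1,
          z2.2, zero_mul, add_zero, neg_zero, and_self]
      -- For Y tangent to the orbits `L` vanishes on orbit pairs, so its own Lie derivative
      -- contributes nothing at (Y, Z); in the doubled Lie derivative of T = K₁ + L only K₁
      -- survives, giving minus twice the quadratic correction.
      have main : ∀ Y, (Y = ξ x ∨ Y = η x) → ∀ Z, k₂ x Y Z = secondSource G ξ η x Y Z := by
        intro Y hY Z
        have y1 : shiftFst (G 0 x) (ξ x) (η x) (K₁ x) Y = 0 := by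
          rcases hY with rfl | rfl
          exacts [z1.1, z2.1]
        have y2 : shiftSnd (G 0 x) (ξ x) (η x) (K₁ x) Y = 0 := by
          rcases hY with rfl | rfl
          exacts [z1.2, z2.2]
        have y3 : L x Y (ξ x) = 0 := by
          rcases hY with rfl | rfl
          exacts [eL.1, eL.2.2.1]
        have y4 : L x Y (η x) = 0 := by
          rcases hY with rfl | rfl
          exacts [eL.2.1, eL.2.2.2]
        have e1 : secondSource G ξ η x = K₂ x - (2 : ℝ) • shiftCorrection (K₁ x) (ξ x) (η x)
            (shiftFst (G 0 x) (ξ x) (η x) (K₁ x)) (shiftSnd (G 0 x) (ξ x) (η x) (K₁ x)) := by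
          rw [h₁, h₂]; rfl
        rw [e1, hk₂ x hx]
        simp only [sub_apply, add_apply, smul_apply, shiftCorrection_apply, smul_eq_mul,
          B.lieForm_gauge hx hXev (iT x hx).1 (iT x hx).2,
          B.lieForm_gauge hx hXev (iL x hx).1 (iL x hx).2, hT x hx, y1, y2, y3, y4]
        ring
      have m1 := main (ξ x) (Or.inl rfl)
      have m2 := main (η x) (Or.inr rfl)
      constructor
      · ext Z; rw [shiftFst_apply, shiftFst_apply, m1, m2]
      · ext Z; rw [shiftSnd_apply, shiftSnd_apply, m1, m2]
    have sym := fun {x : E} (hx : x ∈ U) (hη : η x ≠ 0) (Y Z : E) => A.fderiv_symm_shift_second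
      (h₁ ▸ hK₁.of_le (one_le_two.trans h2n)) (h₂ ▸ hK₂.of_le hm1) hx hη Y Z
    have ev := fun {x : E} (hx : x ∈ U) (hη : η x ≠ 0) =>
      Filter.eventually_of_mem (B.isOpen_off_axis.mem_nhds ⟨hx, hη⟩) fun y hy => key y hy.1 hy.2
    refine ⟨fun x hx hη Y Z => ?_, fun x hx hη Y Z => ?_⟩
    · have e1 : (fun y => shiftFst (G 0 y) (ξ y) (η y) (k₂ y)) =ᶠ[𝓝 x]
          fun y => shiftFst (G 0 y) (ξ y) (η y) (secondSource G ξ η y) := (ev hx hη).mono fun _ h => h.1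
      rw [e1.fderiv_eq]
      exact (sym hx hη Y Z).1
    · have e1 : (fun y => shiftSnd (G 0 y) (ξ y) (η y) (k₂ y)) =ᶠ[𝓝 x]
          fun y => shiftSnd (G 0 y) (ξ y) (η y) (secondSource G ξ η y) := (ev hx hη).mono fun _ h => h.2
      rw [e1.fderiv_eq]
      exact (sym hx hη Y Z).2

end AxialFamily

/-! ### Block form in adapted charts. -/

section BlockForm

variable {k n : ℕ} {M : Type u} [TopologicalSpace M] [ChartedSpace (ModelSp k) M]
  {g T : CovTensor k M} {ξ η : VecField k M} {e : OpenPartialHomeomorph M (ModelSp k)} {a b : Fin k}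

theorem fderiv_eq_zero_of_lieForm_const {E : Type} [NormedAddCommGroup E] [NormedSpace ℝ E]
    {U : Set E} (hU : IsOpen U) {ζ : E → E} {u : E} (hζ : ∀ x ∈ U, ζ x = u)
    {T : E → E →L[ℝ] E →L[ℝ] ℝ} (h : ∀ x ∈ U, lieForm ζ T x = 0) :
    ∀ x ∈ U, fderiv ℝ T x u = 0 := by
  intro x hx
  have h1 := h x hx
  rw [lieForm_congr (Y := fun _ => u) (Filter.eventually_of_mem (hU.mem_nhds hx) hζ)] at h1
  simpa [lieForm] using h1

/-- Gauge transformed invariant tensors are block diagonal in adapted charts. -/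
theorem hasBlockForm_of_gauge [IsManifold (𝓡 k) ((n + 2 : ℕ) : WithTop ℕ∞) M]
    (he : IsAdaptedChart n g ξ η e a b)
    (A : AxialGeometry n e.target (g.rep e) (ξ.rep e) (η.rep e)) {K : ModelSp k → ModelForm k}
    {X : ModelSp k → ModelSp k} (hX : ∀ x ∈ e.target, η.rep e x ≠ 0 →
      IsGaugeAt (g.rep e) (ξ.rep e) (η.rep e) K X x)
    (hK : ∀ x ∈ e.target, ∀ Y Z, K x Y Z = K x Z Y)
    (hT : ∀ x ∈ e.target, T.rep e x = K x + lieForm X (g.rep e) x)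
    (hTd : ContDiffOn ℝ 1 (T.rep e) e.target)
    (hTξ : ∀ x ∈ e.target, lieForm (ξ.rep e) (T.rep e) x = 0)
    (hTη : ∀ x ∈ e.target, lieForm (η.rep e) (T.rep e) x = 0) : HasBlockForm e a b T := by
  have me := mdifferentiable_of_mem_maximalAtlas (by simp) he.mem_atlas
  have hξ : ∀ x ∈ e.target, ξ.rep e x = EuclideanSpace.single a (1 : ℝ) := fun x hx =>
    chartFrame_injective me hx ((chartFrame_rep me hx ξ).trans (he.xi_eq x hx))
  have hη : ∀ x ∈ e.target, η.rep e x = EuclideanSpace.single b (1 : ℝ) := fun x hx =>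
    chartFrame_injective me hx ((chartFrame_rep me hx η).trans (he.eta_eq x hx))
  have hη0 : ∀ x ∈ e.target, η.rep e x ≠ 0 := fun x hx h0 => by
    have := congrArg (fun v : ModelSp k => v b) ((hη x hx).symm.trans h0)
    simp at this
  constructor
  -- The block form of the metric makes the transversal coordinate vectors orthogonal to the orbits,
  -- where the transformed tensor has no cross components.
  · intro x hx i c hi hca hcb
    have h1 : g.rep e x (ξ.rep e x) (EuclideanSpace.single c (1 : ℝ)) = 0 := by
      rw [hξ x hx]; exact (he.metric_block.cross x hx a c (Or.inl rfl) hca hcb).1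
    have h2 : g.rep e x (η.rep e x) (EuclideanSpace.single c (1 : ℝ)) = 0 := by
      rw [hη x hx]; exact (he.metric_block.cross x hx b c (Or.inr rfl) hca hcb).1
    have h3 := A.gauge_cross_eq_zero (k := K) (X := X) hx (hη0 x hx)
      (Filter.eventually_of_mem (e.open_target.mem_nhds hx) fun y hy => hX y hy (hη0 y hy))
      (hK x hx) h1 h2
    have h4 : T.rep e x (EuclideanSpace.single i (1 : ℝ)) (EuclideanSpace.single c (1 : ℝ)) = 0 ∧
        T.rep e x (EuclideanSpace.single c (1 : ℝ)) (EuclideanSpace.single i (1 : ℝ)) = 0 := by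
      rw [hξ x hx, hη x hx] at h3
      rw [hT x hx]
      rcases hi with rfl | rfl
      · exact ⟨h3.1.1, h3.2.1⟩
      · exact ⟨h3.1.2, h3.2.2⟩
    exact h4
  · intro x y hxy hc α β
    have hab : y - x = (y a - x a) • EuclideanSpace.single a (1 : ℝ)
        + (y b - x b) • EuclideanSpace.single b (1 : ℝ) := by
      ext c
      simp only [PiLp.sub_apply, PiLp.add_apply, PiLp.smul_apply, PiLp.single_apply,
        smul_eq_mul]
      by_cases hca : c = a
      · subst hca; simp [he.ne]
      by_cases hcb : c = b
      · subst hcb; simp [hca]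
      simp [hca, hcb, hc c hca hcb]
    have := eq_of_segment_subset
      (fun z hz => (hTd.differentiableOn one_ne_zero).differentiableAt (e.open_target.mem_nhds hz))
      (fderiv_eq_zero_of_lieForm_const e.open_target hξ hTξ)
      (fderiv_eq_zero_of_lieForm_const e.open_target hη hTη) hxy hab
    exact congrArg (fun B : ModelForm k =>
      B (EuclideanSpace.single α (1 : ℝ)) (EuclideanSpace.single β (1 : ℝ))) this

end BlockForm

end

/-! ### Assembly of the two gauge vectors. -/

set_option maxSynthPendingDepth 3

theorem proposition4p2 {k n : ℕ} (hn : 2 ≤ n) {M : ℝ → Type u}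
    [∀ ε, TopologicalSpace (M ε)] [∀ ε, T2Space (M ε)] [∀ ε, SecondCountableTopology (M ε)]
    [∀ ε, ChartedSpace (ModelSp k) (M ε)] [∀ ε, IsManifold (𝓡 k) 1 (M ε)]
    [∀ ε, IsManifold (𝓡 k) ((n + 2 : ℕ) : WithTop ℕ∞) (M ε)]
    (S : PerturbationScheme k n M) (ξ η : VecField k (M 0))
    (hS : S.InheritsStationaryAxisymmetricOT ξ η)
    (hM : SimplyConnectedSpace (M 0))
    (ψ : ∀ ε, Diffeomorph (𝓡 k) (𝓡 k) (M 0) (M ε) ((n + 2 : ℕ) : WithTop ℕ∞))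
    (hψ : ψ ∈ S.gauges) (K₁ K₂ : CovTensor k (M 0))
    (hK₁ : K₁ = epsDeriv 1 (S.pulledMetric ψ)) (hK₂ : K₂ = epsDeriv 2 (S.pulledMetric ψ)) :
    ∃ V₁ V₂ : VecField k (M 0),
      V₁.IsOfClass (n + 1) ∧ V₂.IsOfClass n ∧
      (gaugeFirst (S.metric 0) K₁ V₁).IsOfClass n ∧
      (gaugeSecond (S.metric 0) K₁ K₂ V₁ V₂).IsOfClass (n - 1) ∧
      ∀ (e : OpenPartialHomeomorph (M 0) (ModelSp k)) (a b : Fin k),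
        IsAdaptedChart n (S.metric 0) ξ η e a b →
          HasBlockForm e a b (gaugeFirst (S.metric 0) K₁ V₁) ∧
          HasBlockForm e a b (gaugeSecond (S.metric 0) K₁ K₂ V₁ V₂) := by
  -- With this substitution the class `n - 1` becomes `m + 1`, without truncated subtraction.
  obtain ⟨m, rfl⟩ : ∃ m, n = m + 2 := ⟨n - 2, by omega⟩
  set Atl := IsManifold.maximalAtlas (𝓡 k) ((m + 2 + 2 : ℕ) : WithTop ℕ∞) (M 0) with hAtl
  have hN0 : ((m + 2 + 2 : ℕ) : WithTop ℕ∞) ≠ 0 := by simp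
  have hN2 : (2 : WithTop ℕ∞) ≤ ((m + 2 + 2 : ℕ) : WithTop ℕ∞) := by norm_cast; omega
  have fam := fun e (he : e ∈ Atl) => S.axialFamily hn hS hψ he
  have hg0 : S.pulledMetric ψ 0 = S.metric 0 := S.pulledMetric_zero hψ
  have geo : ∀ e ∈ Atl, AxialGeometry (m + 2) e.target ((S.metric 0).rep e) (ξ.rep e) (η.rep e) :=
    fun e he => hg0 ▸ (fam e he).background
  have rK₁ : ∀ e : OpenPartialHomeomorph (M 0) (ModelSp k), K₁.rep e =
      fun x => deriv (fun ε => (S.pulledMetric ψ ε).rep e x) 0 := fun e =>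
    funext fun x => hK₁ ▸ (S.rep_epsDeriv_eq hψ x).1
  have rK₂ : ∀ e : OpenPartialHomeomorph (M 0) (ModelSp k), K₂.rep e =
      fun x => deriv (deriv (fun ε => (S.pulledMetric ψ ε).rep e x)) 0 := fun e =>
    funext fun x => hK₂ ▸ (S.rep_epsDeriv_eq hψ x).2
  have cK₁ : ∀ e ∈ Atl, ContDiffOn ℝ (m + 2 : ℕ) (K₁.rep e) e.target := fun e he =>
    contDiffOn_rep_of_isOfClass (m := m + 2) (by norm_cast; omega)
      (by rw [hK₁]; exact S.class_first ψ hψ) he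
  have cK₂ : ∀ e ∈ Atl, ContDiffOn ℝ (m + 1 : ℕ) (K₂.rep e) e.target := fun e he =>
    contDiffOn_rep_of_isOfClass (m := m + 1) (by norm_cast; omega)
      (by rw [hK₂]; exact S.class_second ψ hψ) he
  have one_le : (1 : WithTop ℕ∞) ≤ ((m + 1 : ℕ) : WithTop ℕ∞) := by norm_cast; omega
  have one_le' : (1 : WithTop ℕ∞) ≤ ((m + 2 : ℕ) : WithTop ℕ∞) := by norm_cast; omega
  have two_le : (2 : WithTop ℕ∞) ≤ ((m + 2 : ℕ) : WithTop ℕ∞) := by norm_cast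
  have inv : ∀ e ∈ Atl, _ := fun e he => (fam e he).invariant_deriv
    (rK₁ e ▸ (cK₁ e he).of_le one_le') (rK₂ e ▸ (cK₂ e he).of_le one_le)
  have sK₁ : ∀ e ∈ Atl, ∀ x ∈ e.target, ∀ Y Z, K₁.rep e x Y Z = K₁.rep e x Z Y :=
    fun e he x hx Y Z => by rw [rK₁]; exact ((fam e he).deriv_symm hx Y Z).1
  -- A source of class `m + 2` yields a field of class `m + 3 = n + 1`.
  obtain ⟨V₁, hV₁, hV₁g⟩ := exists_global_gauge (K := K₁) geo (m := m + 1) le_rfl fun e he =>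
    ⟨cK₁ e he, sK₁ e he, rK₁ e ▸ (inv e he).1.1, rK₁ e ▸ (inv e he).1.2, by
      have h := fun {x} hx hη Y Z => (fam e he).fderiv_symm_shift_first
        (rK₁ e ▸ (cK₁ e he).of_le one_le') (x := x) hx hη Y Z
      rw [rK₁ e, ← hg0]
      exact ⟨fun x hx hη Y Z => (h hx hη Y Z).1, fun x hx hη Y Z => (h hx hη Y Z).2⟩⟩
  have cV₁ : ∀ e ∈ Atl, ContDiffOn ℝ (m + 2 + 1 : ℕ) (V₁.rep e) e.target := fun e he =>
    contDiffOn_vectorRep_of_isOfClass (m := m + 2 + 1) le_rfl hV₁ he hN0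
  have hd : ∀ {F : Type} [NormedAddCommGroup F] [NormedSpace ℝ F] {l : ℕ} {f : ModelSp k → F}
      {s : Set (ModelSp k)}, ContDiffOn ℝ (l + 1 : ℕ) f s → DifferentiableOn ℝ f s :=
    fun {F _ _ l f s} hf => hf.differentiableOn (by simp)
  have cg : ∀ e ∈ Atl, ContDiffOn ℝ (m + 2 + 1 : ℕ) ((S.metric 0).rep e) e.target := fun e he =>
    (geo e he).metric_class
  have rL : ∀ e ∈ Atl, ∀ x ∈ e.target, (lieDeriv V₁ (S.metric 0)).rep e x =
      lieForm (V₁.rep e) ((S.metric 0).rep e) x := fun e he x hx =>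
    rep_lieDeriv hN2 (fun e he => hd (cV₁ e he)) (fun e he => hd (cg e he)) he hx
  set K₁g := gaugeFirst (S.metric 0) K₁ V₁ with hK₁g
  have rT : ∀ e ∈ Atl, ∀ x ∈ e.target, K₁g.rep e x =
      K₁.rep e x + (lieDeriv V₁ (S.metric 0)).rep e x := fun e he x hx => rfl
  have cL : ∀ e ∈ Atl, ContDiffOn ℝ (m + 2 : ℕ) ((lieDeriv V₁ (S.metric 0)).rep e) e.target :=
    fun e he => (contDiffOn_lieForm e.open_target (cV₁ e he) (cg e he)).congr (rL e he)
  have cT : ∀ e ∈ Atl, ContDiffOn ℝ (m + 2 : ℕ) (K₁g.rep e) e.target :=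
    fun e he => ((cK₁ e he).add (cL e he)).congr (rT e he)
  -- The second order tensor without the contribution of `V₂`. Adding that contribution is again a
  -- transformation of first order type, with `k₂` as source.
  set k₂ : CovTensor k (M 0) := fun p => K₂ p + (2 : ℝ) • lieDeriv V₁ K₁g p -
    lieDeriv V₁ (lieDeriv V₁ (S.metric 0)) p with hk₂
  have rk₂ : ∀ e ∈ Atl, ∀ x ∈ e.target, k₂.rep e x = K₂.rep e x +
      (2 : ℝ) • lieForm (V₁.rep e) (K₁g.rep e) x -
      lieForm (V₁.rep e) ((lieDeriv V₁ (S.metric 0)).rep e) x := fun e he x hx => by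
    rw [← rep_lieDeriv hN2 (fun e he => hd (cV₁ e he)) (fun e he => hd (cT e he)) he hx,
      ← rep_lieDeriv hN2 (fun e he => hd (cV₁ e he)) (fun e he => hd (cL e he)) he hx]
    rfl
  have second := fun e (he : e ∈ Atl) => (fam e he).second_source (m := m) rfl (rK₁ e) (rK₂ e)
    (cK₁ e he) (cK₂ e he) (cV₁ e he) (by rw [hg0]; exact hV₁g e he) (by rw [hg0]; exact rL e he)
    (rT e he) (rk₂ e he)
  simp only [hg0] at second
  -- The source is one order less regular than at first order, so the field has class `m + 2 = n`.
  obtain ⟨V₂, hV₂, hV₂g⟩ := exists_global_gauge (K := k₂) geo (m := m) (by omega) fun e he =>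
    (second e he).2
  have cV₂ : ∀ e ∈ Atl, ContDiffOn ℝ (m + 1 + 1 : ℕ) (V₂.rep e) e.target := fun e he =>
    contDiffOn_vectorRep_of_isOfClass (m := m + 1 + 1) (by norm_cast; omega) hV₂ he hN0
  set K₂g := gaugeSecond (S.metric 0) K₁ K₂ V₁ V₂ with hK₂g
  have rT₂ : ∀ e ∈ Atl, ∀ x ∈ e.target, K₂g.rep e x =
      k₂.rep e x + lieForm (V₂.rep e) ((S.metric 0).rep e) x := fun e he x hx => by
    rw [← rep_lieDeriv hN2 (fun e he => hd (cV₂ e he)) (fun e he => hd (cg e he)) he hx,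
      ← CovTensor.rep_add]
    have h : K₂g = fun p => k₂ p + lieDeriv V₂ (S.metric 0) p := by
      funext p
      change K₂ p + lieDeriv V₂ (S.metric 0) p + (2 : ℝ) • lieDeriv V₁ K₁g p -
        lieDeriv V₁ (lieDeriv V₁ (S.metric 0)) p = K₂ p + (2 : ℝ) • lieDeriv V₁ K₁g p -
        lieDeriv V₁ (lieDeriv V₁ (S.metric 0)) p + lieDeriv V₂ (S.metric 0) p
      abel
    rw [h]
  have cLV₂ : ∀ e ∈ Atl, ContDiffOn ℝ (m + 1 : ℕ) (lieForm (V₂.rep e) ((S.metric 0).rep e))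
      e.target := fun e he => contDiffOn_lieForm e.open_target (cV₂ e he)
    ((cg e he).of_le (by norm_cast; omega))
  have cT₂ : ∀ e ∈ Atl, ContDiffOn ℝ (m + 1 : ℕ) (K₂g.rep e) e.target := fun e he =>
    ((second e he).2.1.add (cLV₂ e he)).congr (rT₂ e he)
  refine ⟨V₁, V₂, hV₁, hV₂, isOfClass_of_contDiffOn_rep (by norm_cast; omega) cT,
    isOfClass_of_contDiffOn_rep (m := m + 1) (by norm_cast; omega) cT₂, fun e a b hab => ?_⟩
  have he : e ∈ Atl := hab.mem_atlas
  have G := geo e he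
  obtain ⟨⟨-, iT⟩, ck₂, sk₂, i1, i2, -⟩ := second e he
  refine ⟨hasBlockForm_of_gauge hab G (hV₁g e he) (sK₁ e he)
    (fun x hx => by rw [rT e he x hx, rL e he x hx]) ((cT e he).of_le one_le') iT.1 iT.2,
    hasBlockForm_of_gauge hab G (hV₂g e he) sk₂ (rT₂ e he) ((cT₂ e he).of_le one_le) ?_ ?_⟩
  all_goals
    intro x hx
    have hn := e.open_target.mem_nhds hx
    -- Invariance of the transformed second tensor is checked separately on `k₂` and on the Lie
    -- derivative of the metric along `V₂`, which commutes with both Killing vectors.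
    have hi := G.lieForm_gauge_invariant ((cV₂ e he).of_le two_le) (hV₂g e he) G.metric_two
      (fun _ h => G.lieForm_xi h) (fun _ h => G.lieForm_eta h) x hx
    rw [lieForm_congr_tensor (Filter.eventually_of_mem hn (rT₂ e he)),
      lieForm_add_tensor ((hd ck₂).differentiableAt hn) ((hd (cLV₂ e he)).differentiableAt hn)]
  · rw [hi.1, add_zero]; exact i1 x hx
  · rw [hi.2, add_zero]; exact i2 x hx
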